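/- **Setting.** Let $G=\langle r_0,\dots,r_{n-1}\rangle$ be a crystallographic linear Coxeter group with string diagram and basic system $b_0,\dots,b_{n-1}$ (a basis of real $n$-space $V$ consisting of roots), so that $r_i(b_k)=b_k+m_{ik}b_i$ with integers $m_{ik}$, $m_{ii}=-2$, $m_{ik}=0$ for $|i-k|\ge2$. Node $i$ of the diagram is labelled $b_i\cdot b_i>0$; for consecutive nodes with labels $a$ (node $i$) and $c$ (node $k$), in one of the two orders, $(m_{ik},m_{ki})$ is $(0,0)$ (no branch), or $(1,1)$ with $c=a$, $(2,1)$ with $c=2a$, $(3,1)$ with $c=3a$, $(4,1)$ with $c=4a$ (single branch), or $(2,2)$ with $c=a$ (double branch). The invariant form satisfies $b_i\cdot b_k=-\tfrac12 m_{ik}\,(b_i\cdot b_i)$. Put $m_{0,-1}=m_{n-1,n}=0$; node $i$ is *o-o*, *o-e* or *e-e* according as none, exactly one, or both of $m_{i,i-1},m_{i,i+1}$ are even. Writing $G$ in $GL_n(\mathbb Z)$ with respect to the basis $(b_i)$ and reducing modulo $s\ge2$ gives a group $G^s\le GL_n(\mathbb Z_s)$; the image of $K\le G$ is denoted $K^s$.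 Let $j\ge 0$, $m\ge1$, $j+m\le n-1$, $E=\langle r_j,\dots,r_{j+m}\rangle$ and $H=\langle r_{j+1},\dots,r_{j+m}\rangle$. Let $W$ be the real span of $b_j,\dots,b_{j+m}$, and let $T\le E$ be the group of translations in $E$, i.e. of those $g\in E$ with $g x-x\in\operatorname{rad}W$ for all $x\in W$. Assume that the labels of nodes $j,\dots,j+m$ (joined by single branches unless otherwise said; $a>0$), $s$, $m$ and the nodes $j,j+m$ are as in one of the following entries, where $\mathbf q=(q^k,0^{m-k})$ denotes the type vector of the entry: 1. $2a,a,\dots,a,2a$ ($m\ge2$): $s\ge3$ odd, $\mathbf q=(s,0,\dots,0)$; $s\ge4$ even, $m$ odd, at least one of $j,j+m$ o-o, $\mathbf q=(s,0,\dots,0)$; $s\ge4$ even, $m$ odd, both o-e, $\mathbf q=(\frac s2,\dots,\frac s2)$; $s\ge4$ even, $m$ even, $\mathbf q=(\frac s2,\dots,\frac s2)$; $s=2$, $m$ odd, both o-o, $\mathbf q=(2,0,\dots,0)$. 2. $a,2a,\dots,2a,a$ ($m\ge2$): $s\ge3$ odd, $\mathbf q=(s,0,\dots,0)$; $s\ge4$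 even, at least one of $j,j+m$ o-e, $\mathbf q=(s,0,\dots,0)$; $s\ge4$ even, both e-e, $\mathbf q=(\frac s2,0,\dots,0)$; $s=2$, both o-e, $\mathbf q=(2,0,\dots,0)$. 3. $4a,2a,\dots,2a,a$ ($m\ge2$): $s\ge3$ odd, $\mathbf q=(s,0,\dots,0)$; $s\ge4$ even, $j+m$ e-e, $\mathbf q=(s,0,\dots,0)$; $s\ge2$ even, $j+m$ o-e, $\mathbf q=(s,s,0,\dots,0)$. 4. $a,a,a,2a,2a$ ($m=4$): $s\ge3$ odd, $\mathbf q=(s,0,0,0)$; $s\ge4$ even, $j$ o-o, $\mathbf q=(s,0,0,0)$; $s\ge4$ even, $j$ o-e, $\mathbf q=(\frac s2,\frac s2,0,0)$. 5. $2a,2a,2a,a,a$ ($m=4$): $s\ge3$, $\mathbf q=(s,0,0,0)$. 6. $a,a,3a$ ($m=2$): $s>2$, $3\nmid s$, $\mathbf q=(s,0)$; $3\mid s$, $3\nmid m_{j,j-1}$, $\mathbf q=(s,0)$; $3\mid s$, $3\mid m_{j,j-1}$, $\mathbf q=(\frac s3,\frac s3)$. 7. $3a,3a,a$ ($m=2$):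 $s\ge3$, $\mathbf q=(s,0)$. 8. $a,a$ with a double branch ($m=1$): $s\ge3$ odd, $\mathbf q=(s)$; $s\ge4$ even, some node o-e, $\mathbf q=(s)$; $s\ge4$ even, both nodes e-e, $\mathbf q=(\frac s2)$; $s=2$, both nodes o-e, $\mathbf q=(2)$. 9. $4a,a$ ($m=1$): $s\ge3$ odd, $\mathbf q=(s)$; $s\ge4$ even, $j+1$ e-e, $\mathbf q=(s)$; $s\ge2$ even, $j+1$ o-e, $\mathbf q=(2s)$. Let $L_{\mathbf q}$ be the normal subgroup of $E$ generated by $t_1^q\cdots t_k^q$, where $t_1,t_2,\dots$ are the standard translations of $E$: $t_1=r_j r'$, with $r'\in H$ the reflection whose mirror is parallel to that of $r_j$, and the further $t_i$ are conjugates of $t_1$ under $H$, with $t_1,\dots,t_m$ mutually orthogonal in cases 1–5 and 8–9 and $t_1,t_2$ at an angle of $60^\circ$ in cases 6–7. Let $\mathcal T$ be the regular tessellation with group $E$, whose faces of rank $i$ ($-1\le i\le m+1$) are the left cosets in $E$ of $\langle r_{j+k}\mid 0\le k\le m,\ k\ne i\rangle$, two faces being incident when the cosets meet; $\mathcal T/L_{\mathbf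 q}$ is the poset of $L_{\mathbf q}$-orbits of faces, the regular toroid of rank $m+1$ with type vector $\mathbf q$. **Lemma.** Then $E=T\rtimes H$, reduction modulo $s$ is injective on $H$ (so $H\simeq H^s$), and, for the natural epimorphism $\varphi:E\to E^s$: (a) $\ker\varphi\subseteq T$. (b) $E^s$ is a string C-group with respect to the images of $r_j,\dots,r_{j+m}$: they are involutions, non-consecutive ones commute, and $\langle\varphi(r_i)\mid i\in I\rangle\cap\langle\varphi(r_i)\mid i\in J\rangle=\langle\varphi(r_i)\mid i\in I\cap J\rangle$ for all $I,J\subseteq\{j,\dots,j+m\}$. Moreover $\ker\varphi=L_{\mathbf q}$, which is a non-trivial group of translations, and $E^s$ is the automorphism group of the regular toroid $\mathcal T/L_{\mathbf q}$, with $\varphi(g)$ acting as $g$ does on orbits. (c) If $T^s$ acts faithfully on the $\mathbb Z_s$-submodule spanned by $b_j,\dots,b_{j+m}$, then $$T^s\cap\langle r_{j+1},\dots,r_{j+l}\rangle^s=\{e\}$$ for every $l\ge m$ with $j+l\le n-1$. -/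

import Mathlib

open scoped Matrix

noncomputable section

/-! ### Crystallographic linear Coxeter groups with string diagram -/

/-- The admissible subdiagrams on two nodes `i` (label `a`) and `j` (label `c`), together with
the Cartan integers `p = m i j` and `q = m j i`: period `2, 3, 4, 6, ∞, ∞` of `r i * r j`. -/
def AdmissiblePair (a c : ℝ) (p q : ℤ) : Prop :=
  (p = 0 ∧ q = 0) ∨
  (c = a ∧ p = 1 ∧ q = 1) ∨
  (c = 2 * a ∧ p = 2 ∧ q = 1) ∨
  (c = 3 * a ∧ p = 3 ∧ q = 1) ∨
  (c = 4 * a ∧ p = 4 ∧ q = 1) ∨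
  (c = a ∧ p = 2 ∧ q = 2)

/-- A basic system `b 0, …, b (n - 1)` of a crystallographic linear Coxeter group with string
diagram, encoded by its diagram: `label i = b i ⬝ b i`, and the Cartan integers, for which
`r i (b k) = b k + cartan i k • b i`. -/
structure StringBasicSystem (n : ℕ) where
  label : Fin n → ℝ
  label_pos : ∀ i, 0 < label i
  cartan : Fin n → Fin n → ℤ
  cartan_self : ∀ i, cartan i i = -2
  cartan_far : ∀ i k : Fin n, (i : ℕ) + 2 ≤ k → cartan i k = 0 ∧ cartan k i = 0
  cartan_near : ∀ i k : Fin n, (k : ℕ) = i + 1 →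
    AdmissiblePair (label i) (label k) (cartan i k) (cartan k i) ∨
    AdmissiblePair (label k) (label i) (cartan k i) (cartan i k)

/-- Extension of scalars of integral matrices along `ℤ → R`. For `R = ZMod s` this is reduction
modulo `s`. -/
def changeRing (n : ℕ) (R : Type) [CommRing R] :
    Matrix.GeneralLinearGroup (Fin n) ℤ →* Matrix.GeneralLinearGroup (Fin n) R :=
  Matrix.GeneralLinearGroup.map (Int.castRingHom R)

/-- The `R`-submodule of `R ^ n` spanned by the basis vectors `b i`, `a ≤ i ≤ b`. -/
def rootSpan (n : ℕ) (R : Type) [CommRing R] (a b : ℕ) : Submodule R (Fin n → R) :=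
  Submodule.span R {v | ∃ i : Fin n, a ≤ (i : ℕ) ∧ (i : ℕ) ≤ b ∧ v = Pi.single i 1}

namespace StringBasicSystem

variable {n : ℕ} (D : StringBasicSystem n)

/-- The matrix of `r i` with respect to the basis `b`: column `k` is `b k + cartan i k • b i`. -/
def reflMatrix (i : Fin n) : Matrix (Fin n) (Fin n) ℤ :=
  1 + Matrix.vecMulVec (Pi.single i 1) (D.cartan i)

theorem reflMatrix_mul_self (i : Fin n) : D.reflMatrix i * D.reflMatrix i = 1 := by
  have h : Matrix.vecMulVec (Pi.single i 1) (D.cartan i) *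
      Matrix.vecMulVec (Pi.single i 1) (D.cartan i) =
      (-2 : ℤ) • Matrix.vecMulVec (Pi.single i 1) (D.cartan i) := by
    rw [Matrix.vecMulVec_mul_vecMulVec, dotProduct_single, D.cartan_self, mul_one]
    ext a b
    simp only [Matrix.vecMulVec_apply, Matrix.smul_apply, Pi.smul_apply, smul_eq_mul]
    ring
  unfold reflMatrix
  rw [add_mul, mul_add, mul_add, h]
  simp only [mul_one, one_mul]
  module

/-- The reflection `r i`, as an element of `GL_n(ℤ)`. -/
def r (i : Fin n) : Matrix.GeneralLinearGroup (Fin n) ℤ :=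
  ⟨D.reflMatrix i, D.reflMatrix i, D.reflMatrix_mul_self i, D.reflMatrix_mul_self i⟩

/-- The subgroup `⟨r a, …, r b⟩`. -/
def parabolic (a b : ℕ) : Subgroup (Matrix.GeneralLinearGroup (Fin n) ℤ) :=
  Subgroup.closure {g | ∃ i : Fin n, a ≤ (i : ℕ) ∧ (i : ℕ) ≤ b ∧ g = D.r i}

/-- The invariant symmetric bilinear form on `ℝ ^ n`, with `b i ⬝ b i = label i` and
`b i ⬝ b k = - cartan i k * label i / 2`. -/
def form : LinearMap.BilinForm ℝ (Fin n → ℝ) :=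
  Matrix.toBilin' (Matrix.of fun i k => -(D.cartan i k : ℝ) * D.label i / 2)

/-- The radical of the form restricted to the span of `b a, …, b b`. -/
def radical (a b : ℕ) : Submodule ℝ (Fin n → ℝ) where
  carrier := {x | x ∈ rootSpan n ℝ a b ∧ ∀ y ∈ rootSpan n ℝ a b, D.form x y = 0}
  zero_mem' := ⟨zero_mem _, fun y _ => by simp⟩
  add_mem' := by
    rintro x y ⟨hx, hx'⟩ ⟨hy, hy'⟩
    exact ⟨add_mem hx hy, fun z hz => by simp [hx' z hz, hy' z hz]⟩
  smul_mem' := by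
    rintro c x ⟨hx, hx'⟩
    exact ⟨Submodule.smul_mem _ c hx, fun z hz => by simp [hx' z hz]⟩

theorem parabolic_mulVec_mem {a b : ℕ} {g : Matrix.GeneralLinearGroup (Fin n) ℤ}
    (hg : g ∈ D.parabolic a b) :
    ∀ x ∈ rootSpan n ℝ a b, (changeRing n ℝ g).val *ᵥ x ∈ rootSpan n ℝ a b := by
  have hr : ∀ i : Fin n, a ≤ (i : ℕ) → (i : ℕ) ≤ b → ∀ x ∈ rootSpan n ℝ a b,
      (changeRing n ℝ (D.r i)).val *ᵥ x ∈ rootSpan n ℝ a b := by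
    intro i hi hi' x hx
    have e : (changeRing n ℝ (D.r i)).val =
        1 + Matrix.vecMulVec (Pi.single i 1) (fun k => (D.cartan i k : ℝ)) := by
      ext p q
      simp [changeRing, r, reflMatrix, Matrix.vecMulVec_apply, Matrix.one_apply, Pi.single_apply]
    rw [e, Matrix.add_mulVec, Matrix.one_mulVec, Matrix.vecMulVec_mulVec]
    refine add_mem hx ?_
    have : (Pi.single i 1 : Fin n → ℝ) ∈ rootSpan n ℝ a b :=
      Submodule.subset_span ⟨i, hi, hi', rfl⟩
    simpa using Submodule.smul_mem _ _ this
  induction hg using Subgroup.closure_induction'' with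
  | mem g hg =>
    obtain ⟨i, hi, hi', rfl⟩ := hg
    exact hr i hi hi'
  | inv_mem g hg =>
    obtain ⟨i, hi, hi', rfl⟩ := hg
    have : (D.r i)⁻¹ = D.r i := by
      apply inv_eq_of_mul_eq_one_right
      ext1
      exact D.reflMatrix_mul_self i
    rw [this]
    exact hr i hi hi'
  | one => intro x hx; simpa using hx
  | mul g h _ _ ihg ihh =>
    intro x hx
    rw [map_mul, Units.val_mul, ← Matrix.mulVec_mulVec]
    exact ihg _ (ihh x hx)

/-- The translations in `E = ⟨r a, …, r b⟩`. Let `W` be the span of `b a, …, b b`. If `rad W` is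
a line `ℝ c`, then `E` acts on the Euclidean space `{μ ∈ W* | μ c = 1}`, and `g` acts there as
a translation if and only if it acts on `W` as a transvection `x ↦ x - τ x • c`, that is, if and
only if it moves each vector of `W` by an element of `rad W`. -/
def translations (a b : ℕ) : Subgroup (Matrix.GeneralLinearGroup (Fin n) ℤ) where
  carrier := {g | g ∈ D.parabolic a b ∧
    ∀ x ∈ rootSpan n ℝ a b, (changeRing n ℝ g).val *ᵥ x - x ∈ D.radical a b}
  one_mem' := ⟨one_mem _, fun x _ => by simp⟩
  mul_mem' := by
    rintro g h ⟨hg, hg'⟩ ⟨hh, hh'⟩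
    refine ⟨mul_mem hg hh, fun x hx => ?_⟩
    rw [map_mul, Units.val_mul, ← Matrix.mulVec_mulVec]
    have := add_mem (hg' _ (D.parabolic_mulVec_mem hh x hx)) (hh' x hx)
    simpa using this
  inv_mem' := by
    rintro g ⟨hg, hg'⟩
    refine ⟨inv_mem hg, fun x hx => ?_⟩
    have h1 := hg' _ (D.parabolic_mulVec_mem (inv_mem hg) x hx)
    rw [Matrix.mulVec_mulVec, ← Units.val_mul, ← map_mul, mul_inv_cancel, map_one,
      Units.val_one, Matrix.one_mulVec] at h1
    simpa using neg_mem h1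

/-! ### Diagrams of Euclidean subgroups -/

/-- The Cartan integer `m_{i, i-1}`, which is `0` by convention at the left end. -/
def cartanLeft (i : ℕ) : ℤ :=
  if h : 1 ≤ i ∧ i < n then D.cartan ⟨i, h.2⟩ ⟨i - 1, by omega⟩ else 0

/-- The Cartan integer `m_{i, i+1}`, which is `0` by convention at the right end. -/
def cartanRight (i : ℕ) : ℤ :=
  if h : i + 1 < n then D.cartan ⟨i, by omega⟩ ⟨i + 1, h⟩ else 0

/-- Node `i` is o-o. -/
def NodeOO (i : ℕ) : Prop := Odd (D.cartanLeft i) ∧ Odd (D.cartanRight i)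

/-- Node `i` is o-e: exactly one of the two Cartan integers is even. -/
def NodeOE (i : ℕ) : Prop :=
  (Odd (D.cartanLeft i) ∧ Even (D.cartanRight i)) ∨
  (Even (D.cartanLeft i) ∧ Odd (D.cartanRight i))

/-- Node `i` is e-e. -/
def NodeEE (i : ℕ) : Prop := Even (D.cartanLeft i) ∧ Even (D.cartanRight i)

/-- The nodes `j, …, j + m` carry the labels `f 0, …, f m`, and consecutive nodes among them are
joined by a single branch. -/
def SingleString (j m : ℕ) (f : ℕ → ℝ) : Prop :=
  (∀ i : Fin n, j ≤ (i : ℕ) → (i : ℕ) ≤ j + m → D.label i = f ((i : ℕ) - j)) ∧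
  ∀ i : ℕ, j ≤ i → i < j + m → D.cartanRight i = 1 ∨ D.cartanLeft (i + 1) = 1

/-- The nodes `j` and `j + 1` have the same label and are joined by a double branch. -/
def DoubleBranch (j : ℕ) : Prop :=
  ∃ a : ℝ, (∀ i : Fin n, (i : ℕ) = j ∨ (i : ℕ) = j + 1 → D.label i = a) ∧
    D.cartanRight j = 2 ∧ D.cartanLeft (j + 1) = 2

end StringBasicSystem

/-- The labels `x, y, …, y, z` on nodes `0, …, m`. -/
def endLabels (m : ℕ) (x y z : ℝ) (i : ℕ) : ℝ :=
  if i = 0 then x else if i = m then z else y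

/-- The families of Euclidean groups: `[4, 3^(m-2), 4]`, `[3,3,4,3]`, `[3,6]` and `[∞]`. -/
inductive EuclideanFamily
  | cubic
  | f4
  | hexagonal
  | dihedral

open StringBasicSystem EuclideanFamily in
/-- `ToroidEntry D s j m X q k`: the subdiagram on nodes `j, …, j + m` is one of the diagrams for
a group of family `X`, the modulus `s`, the dimension `m` and the nodes `j`, `j + m` satisfy the
constraints of one of its entries, and the type vector of that entry is
`(q, …, q, 0, …, 0)` with `k` entries `q` and `m - k` entries `0`. -/
inductive ToroidEntry {n : ℕ} (D : StringBasicSystem n) (s j m : ℕ) :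
    EuclideanFamily → ℕ → ℕ → Prop
  -- labels 2a, a, …, a, 2a
  | cubicA_odd (a : ℝ) (hm : 2 ≤ m) (hD : D.SingleString j m (endLabels m (2 * a) a (2 * a)))
      (hs : 3 ≤ s) (ho : Odd s) : ToroidEntry D s j m cubic s 1
  | cubicA_even_oo (a : ℝ) (hm : 2 ≤ m) (hD : D.SingleString j m (endLabels m (2 * a) a (2 * a)))
      (hs : 4 ≤ s) (he : Even s) (hmo : Odd m) (hN : D.NodeOO j ∨ D.NodeOO (j + m)) :
      ToroidEntry D s j m cubic s 1
  | cubicA_even_oe (a : ℝ) (hm : 2 ≤ m) (hD : D.SingleString j m (endLabels m (2 * a) a (2 * a)))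
      (hs : 4 ≤ s) (he : Even s) (hmo : Odd m) (hN : D.NodeOE j ∧ D.NodeOE (j + m)) :
      ToroidEntry D s j m cubic (s / 2) m
  | cubicA_even_even (a : ℝ) (hm : 2 ≤ m)
      (hD : D.SingleString j m (endLabels m (2 * a) a (2 * a)))
      (hs : 4 ≤ s) (he : Even s) (hme : Even m) : ToroidEntry D s j m cubic (s / 2) m
  | cubicA_two (a : ℝ) (hm : 2 ≤ m) (hD : D.SingleString j m (endLabels m (2 * a) a (2 * a)))
      (hs : s = 2) (hmo : Odd m) (hN : D.NodeOO j ∧ D.NodeOO (j + m)) :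
      ToroidEntry D s j m cubic 2 1
  -- labels a, 2a, …, 2a, a
  | cubicB_odd (a : ℝ) (hm : 2 ≤ m) (hD : D.SingleString j m (endLabels m a (2 * a) a))
      (hs : 3 ≤ s) (ho : Odd s) : ToroidEntry D s j m cubic s 1
  | cubicB_even_oe (a : ℝ) (hm : 2 ≤ m) (hD : D.SingleString j m (endLabels m a (2 * a) a))
      (hs : 4 ≤ s) (he : Even s) (hN : D.NodeOE j ∨ D.NodeOE (j + m)) :
      ToroidEntry D s j m cubic s 1
  | cubicB_even_ee (a : ℝ) (hm : 2 ≤ m) (hD : D.SingleString j m (endLabels m a (2 * a) a))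
      (hs : 4 ≤ s) (he : Even s) (hN : D.NodeEE j ∧ D.NodeEE (j + m)) :
      ToroidEntry D s j m cubic (s / 2) 1
  | cubicB_two (a : ℝ) (hm : 2 ≤ m) (hD : D.SingleString j m (endLabels m a (2 * a) a))
      (hs : s = 2) (hN : D.NodeOE j ∧ D.NodeOE (j + m)) : ToroidEntry D s j m cubic 2 1
  -- labels 4a, 2a, …, 2a, a
  | cubicC_odd (a : ℝ) (hm : 2 ≤ m) (hD : D.SingleString j m (endLabels m (4 * a) (2 * a) a))
      (hs : 3 ≤ s) (ho : Odd s) : ToroidEntry D s j m cubic s 1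
  | cubicC_even_ee (a : ℝ) (hm : 2 ≤ m) (hD : D.SingleString j m (endLabels m (4 * a) (2 * a) a))
      (hs : 4 ≤ s) (he : Even s) (hN : D.NodeEE (j + m)) : ToroidEntry D s j m cubic s 1
  | cubicC_even_oe (a : ℝ) (hm : 2 ≤ m) (hD : D.SingleString j m (endLabels m (4 * a) (2 * a) a))
      (hs : 2 ≤ s) (he : Even s) (hN : D.NodeOE (j + m)) : ToroidEntry D s j m cubic s 2
  -- labels a, a, a, 2a, 2a
  | f4A_odd (a : ℝ) (hm : m = 4) (hD : D.SingleString j m fun i => if i ≤ 2 then a else 2 * a)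
      (hs : 3 ≤ s) (ho : Odd s) : ToroidEntry D s j m f4 s 1
  | f4A_even_oo (a : ℝ) (hm : m = 4) (hD : D.SingleString j m fun i => if i ≤ 2 then a else 2 * a)
      (hs : 4 ≤ s) (he : Even s) (hN : D.NodeOO j) : ToroidEntry D s j m f4 s 1
  | f4A_even_oe (a : ℝ) (hm : m = 4) (hD : D.SingleString j m fun i => if i ≤ 2 then a else 2 * a)
      (hs : 4 ≤ s) (he : Even s) (hN : D.NodeOE j) : ToroidEntry D s j m f4 (s / 2) 2
  -- labels 2a, 2a, 2a, a, a
  | f4B (a : ℝ) (hm : m = 4) (hD : D.SingleString j m fun i => if i ≤ 2 then 2 * a else a)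
      (hs : 3 ≤ s) : ToroidEntry D s j m f4 s 1
  -- labels a, a, 3a
  | hexA_coprime (a : ℝ) (hm : m = 2) (hD : D.SingleString j m (endLabels m a a (3 * a)))
      (hs : 2 < s) (h3 : ¬ 3 ∣ s) : ToroidEntry D s j m hexagonal s 1
  | hexA_unit (a : ℝ) (hm : m = 2) (hD : D.SingleString j m (endLabels m a a (3 * a)))
      (hs : 2 < s) (h3 : 3 ∣ s) (hN : ¬ (3 : ℤ) ∣ D.cartanLeft j) :
      ToroidEntry D s j m hexagonal s 1
  | hexA_zero (a : ℝ) (hm : m = 2) (hD : D.SingleString j m (endLabels m a a (3 * a)))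
      (hs : 2 < s) (h3 : 3 ∣ s) (hN : (3 : ℤ) ∣ D.cartanLeft j) :
      ToroidEntry D s j m hexagonal (s / 3) 2
  -- labels 3a, 3a, a
  | hexB (a : ℝ) (hm : m = 2) (hD : D.SingleString j m (endLabels m (3 * a) (3 * a) a))
      (hs : 3 ≤ s) : ToroidEntry D s j m hexagonal s 1
  -- labels a, a with a double branch
  | dihA_odd (hm : m = 1) (hD : D.DoubleBranch j) (hs : 3 ≤ s) (ho : Odd s) :
      ToroidEntry D s j m dihedral s 1
  | dihA_even_oe (hm : m = 1) (hD : D.DoubleBranch j) (hs : 4 ≤ s) (he : Even s)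
      (hN : D.NodeOE j ∨ D.NodeOE (j + 1)) : ToroidEntry D s j m dihedral s 1
  | dihA_even_ee (hm : m = 1) (hD : D.DoubleBranch j) (hs : 4 ≤ s) (he : Even s)
      (hN : D.NodeEE j ∧ D.NodeEE (j + 1)) : ToroidEntry D s j m dihedral (s / 2) 1
  | dihA_two (hm : m = 1) (hD : D.DoubleBranch j) (hs : s = 2)
      (hN : D.NodeOE j ∧ D.NodeOE (j + 1)) : ToroidEntry D s j m dihedral 2 1
  -- labels 4a, a
  | dihB_odd (a : ℝ) (hm : m = 1) (hD : D.SingleString j m (endLabels m (4 * a) a a))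
      (hs : 3 ≤ s) (ho : Odd s) : ToroidEntry D s j m dihedral s 1
  | dihB_even_ee (a : ℝ) (hm : m = 1) (hD : D.SingleString j m (endLabels m (4 * a) a a))
      (hs : 4 ≤ s) (he : Even s) (hN : D.NodeEE (j + 1)) : ToroidEntry D s j m dihedral s 1
  | dihB_even_oe (a : ℝ) (hm : m = 1) (hD : D.SingleString j m (endLabels m (4 * a) a a))
      (hs : 2 ≤ s) (he : Even s) (hN : D.NodeOE (j + 1)) :
      ToroidEntry D s j m dihedral (2 * s) 1

/-! ### String C-groups, regular polytopes and regular toroids -/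

/-- `Γ` is a string C-group with respect to the generators `ρ 0, …, ρ (d - 1)`. -/
structure IsStringCGroup {Γ : Type} [Group Γ] {d : ℕ} (ρ : Fin d → Γ) : Prop where
  generates : Subgroup.closure (Set.range ρ) = ⊤
  involution : ∀ i, orderOf (ρ i) = 2
  string : ∀ i k : Fin d, (i : ℕ) + 2 ≤ k → (ρ i * ρ k) ^ 2 = 1
  intersection : ∀ I J : Set (Fin d),
    Subgroup.closure (ρ '' I) ⊓ Subgroup.closure (ρ '' J) = Subgroup.closure (ρ '' (I ∩ J))

/-- The stabilizer of the base face of rank `i - 1`, for `0 ≤ i ≤ d + 1`: it is generated by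
the `ρ k` with `k ≠ i - 1`. For the two improper faces, of ranks `-1` and `d`, this is the whole
group generated by `ρ`. -/
def faceStabilizer {Γ : Type} [Group Γ] {d : ℕ} (ρ : Fin d → Γ) (i : Fin (d + 2)) : Subgroup Γ :=
  Subgroup.closure {g | ∃ k : Fin d, (k : ℕ) + 1 ≠ i ∧ g = ρ k}

/-- The faces of the regular `d`-polytope `P(Γ)` of a string C-group `Γ` with generators `ρ`: the
faces of rank `i - 1` are the left cosets of the stabilizer of the base face of that rank. When `Γ`
is a Euclidean Coxeter group, `P(Γ)` is the corresponding regular tessellation. -/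
abbrev Face {Γ : Type} [Group Γ] {d : ℕ} (ρ : Fin d → Γ) : Type :=
  Σ i : Fin (d + 2), Γ ⧸ faceStabilizer ρ i

/-- The partial order of `P(Γ)`: two faces are comparable when the cosets meet. -/
def faceLE {Γ : Type} [Group Γ] {d : ℕ} (ρ : Fin d → Γ) (F F' : Face ρ) : Prop :=
  F.1 ≤ F'.1 ∧ ∃ g : Γ,
    (g : Γ ⧸ faceStabilizer ρ F.1) = F.2 ∧ (g : Γ ⧸ faceStabilizer ρ F'.1) = F'.2

/-- The faces of the quotient `P(Γ) / L`: orbits of faces of `P(Γ)` under `L`. -/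
abbrev QuotientFace {Γ : Type} [Group Γ] {d : ℕ} (ρ : Fin d → Γ) (L : Subgroup Γ) : Type :=
  MulAction.orbitRel.Quotient L (Face ρ)

/-- The orbit of a face. -/
def QuotientFace.mk {Γ : Type} [Group Γ] {d : ℕ} (ρ : Fin d → Γ) (L : Subgroup Γ) (F : Face ρ) :
    QuotientFace ρ L :=
  Quotient.mk (MulAction.orbitRel L (Face ρ)) F

/-- The induced partial order on `P(Γ) / L`. -/
def quotientLE {Γ : Type} [Group Γ] {d : ℕ} (ρ : Fin d → Γ) (L : Subgroup Γ)
    (x y : QuotientFace ρ L) : Prop :=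
  ∃ F F' : Face ρ, QuotientFace.mk ρ L F = x ∧ QuotientFace.mk ρ L F' = y ∧ faceLE ρ F F'

/-- The automorphism group of `P(Γ) / L`. -/
abbrev QuotientAut {Γ : Type} [Group Γ] {d : ℕ} (ρ : Fin d → Γ) (L : Subgroup Γ) : Type :=
  quotientLE ρ L ≃r quotientLE ρ L

/-- `ρ 1 * ρ 2 * ⋯ * ρ (m - 1)`. -/
def prefixProduct {Γ : Type} [Group Γ] {m : ℕ} (ρ : Fin (m + 1) → Γ) : Γ :=
  ((List.range (m - 1)).map fun i => ρ (Fin.ofNat (m + 1) (i + 1))).prod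

/-- For the generators `ρ 0, …, ρ m` of `[4, 3^(m-2), 4]` (or of `[∞]` when `m = 1`),
`cubicTranslation ρ i` is the translation `t_{i+1}`. With
`ρ 0 : ξ ↦ (1 - ξ₁, ξ₂, …)`, `ρ i` the interchange of `ξᵢ` and `ξᵢ₊₁` and `ρ m` the change of sign
of the last coordinate, it is the translation by the `(i + 1)`-st unit vector. -/
def cubicTranslation {Γ : Type} [Group Γ] {m : ℕ} (ρ : Fin (m + 1) → Γ) : ℕ → Γ
  | 0 => ρ 0 * (prefixProduct ρ * ρ (Fin.last m) * (prefixProduct ρ)⁻¹)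
  | i + 1 => ρ (Fin.ofNat (m + 1) (i + 1)) * cubicTranslation ρ i *
      (ρ (Fin.ofNat (m + 1) (i + 1)))⁻¹

/-- For the generators `ρ 0, …, ρ 4` of `[3,3,4,3]`: translations `t_1, …, t_4` by four mutually
orthogonal vectors of minimal length in the translation lattice (edge vectors of the tessellation).
The conjugate of `ρ 1` in `t_1` is the reflection of the point group whose mirror is parallel to
that of `ρ 0`. -/
def f4Translation {Γ : Type} [Group Γ] {m : ℕ} (ρ : Fin (m + 1) → Γ) (i : ℕ) : Γ :=
  let x : ℕ → Γ := fun k => ρ (Fin.ofNat (m + 1) k)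
  let w : Γ := x 1 * x 2 * x 3 * x 4 * x 2 * x 3 * x 2
  let u : Γ := x 1 * x 2 * x 3 * x 2 * x 1
  let t : Γ := x 0 * (w * x 1 * w⁻¹)
  match i with
  | 0 => t
  | 1 => u * t * u⁻¹
  | 2 => (x 4 * u) * t * (x 4 * u)⁻¹
  | 3 => (x 3 * x 4 * u) * t * (x 3 * x 4 * u)⁻¹
  | _ => 1

/-- For the generators `ρ 0, ρ 1, ρ 2` of `[3,6]`: translations `t_1, t_2` by two vectors of minimal
length in the translation lattice, at an angle of `60` degrees. -/
def hexagonalTranslation {Γ : Type} [Group Γ] {m : ℕ} (ρ : Fin (m + 1) → Γ) (i : ℕ) : Γ :=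
  let x : ℕ → Γ := fun k => ρ (Fin.ofNat (m + 1) k)
  let t : Γ := x 0 * (x 1 * x 2 * x 1 * (x 1 * x 2)⁻¹)
  match i with
  | 0 => t
  | 1 => (x 1 * x 2) * t * (x 1 * x 2)⁻¹
  | _ => 1

/-- The standard translation `t_{i+1}`. -/
def standardTranslation {Γ : Type} [Group Γ] {m : ℕ} (X : EuclideanFamily)
    (ρ : Fin (m + 1) → Γ) (i : ℕ) : Γ :=
  match X with
  | .cubic => cubicTranslation ρ i
  | .f4 => f4Translation ρ i
  | .hexagonal => hexagonalTranslation ρ i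
  | .dihedral => cubicTranslation ρ i

/-- The normal subgroup generated by `t_1 ^ q * ⋯ * t_k ^ q`, by which the tessellation is divided
to give the regular toroid with type vector `(q^k, 0^(m-k))`. -/
def toroidKernel {Γ : Type} [Group Γ] {m : ℕ} (X : EuclideanFamily) (ρ : Fin (m + 1) → Γ)
    (q k : ℕ) : Subgroup Γ :=
  Subgroup.normalClosure {((List.range k).map fun i => standardTranslation X ρ i ^ q).prod}

namespace StringBasicSystem

variable {n : ℕ} (D : StringBasicSystem n)

/-- The generators `r j, …, r (j + m)` of `E`, as elements of `E`. -/
def gens (j m : ℕ) (h : j + m < n) (i : Fin (m + 1)) : D.parabolic j (j + m) :=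
  ⟨D.r ⟨j + i, by omega⟩, Subgroup.subset_closure ⟨_, by simp, by simp; omega, rfl⟩⟩

/-- The natural epimorphism `φ : E → E^s`. -/
def modReduction (j m s : ℕ) :
    D.parabolic j (j + m) →* (D.parabolic j (j + m)).map (changeRing n (ZMod s)) :=
  (changeRing n (ZMod s)).subgroupMap (D.parabolic j (j + m))

end StringBasicSystem

end

noncomputable section

/-! ### Words, lengths and the positivity of columns -/

namespace StringBasicSystem

variable {n : ℕ} (D : StringBasicSystem n)

/-! The group `E` is a Euclidean reflection group that acts on all of `ℝ ^ n`, not only on the span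
`W` of its roots. The radical of the form on `W` is a line spanned by a null vector `c`, normalized
to have coordinate `1` at node `j`, and `E` fixes `c`. The roots `b_j` and `c - b_j` have parallel
mirrors, and the product of their reflections is the Eichler transformation of `c` and `c - b_j`
(`reflection_mul_reflection`). Eichler transformations are additive in the translation vector `z`,
and an isometry `g` fixing `c` conjugates the one of `z` into the one of `g z`. Hence each element
of `E` is uniquely an Eichler transformation composed with an element of `H`, where `z` runs over
the lattice spanned by the `H`-orbit of `c - b_j` (`IsNullRoot.exists_decomposition`). This is `E =
T ⋊ H`, and the normal closure of a translation corresponds to the lattice spanned by the `H`-orbit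
of its vector (`IsNullRoot.normalClosure_eq`).

A translation is trivial modulo `s` when `z` satisfies finitely many congruences: its products with
the roots of `H` are divisible by `s`, and each of the nodes `j - 1` and `j + m + 1` contributes one
condition on the vector `z` and one involving its norm (`IsNullRoot.eichler_congruence_iff`). The
types of the end nodes enter through these neighbours. In coordinates adapted to each family the
solutions form exactly the lattice of the type vector. An element of the kernel has trivial
component in `H`: for `s ≥ 3` because signed permutations, or more generally short vectors of a
definite lattice, are separated modulo `s`; for `s = 2` because the neighbouring nodes detect the
remaining sign changes. So the kernel is `L_q` (`IsNullRoot.ker_modReduction_eq`).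

For the intersection property, recall that in `E` itself standard parabolic subgroups intersect as
they should. This follows from the positivity of roots (`column_nonneg`) and its consequence for
stabilizers of dominant functionals (`closure_inf_closure`). Now let `g ∈ ⟨I⟩` and `h ∈ ⟨J⟩` have
the same image, where `I` omits `i` and `J` omits `k`. They differ by a translation by some `z` from
the kernel, while `g` preserves the coordinate at `i` and `h` the one at `k`. The functionals `x ↦ x
i / c i` are the vertices of the base chamber, so the product of `z` with `x` is the change, under
an element of `H`, of the difference of `x / c` between two vertices. On suitable vectors this is
too small for a nonzero `z` of the kernel lattice. So `z = 0` and `g = h`, and the property descends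
from `E` to `E^s`.

The quotient of the coset polytope of `E` by the kernel is the coset polytope of `E^s`. For a string
C-group, automorphisms of the coset polytope preserve rank, carry flags to flags, and are determined
by one flag, so they come from the group. Finally, for (c), products of the generators after node
`j` do not change the coordinate at `j`, where `c` has coordinate `1`; a translation congruent to
such a product therefore acts trivially on `W` modulo `s`. -/

theorem r_mul_self (i : Fin n) : D.r i * D.r i = 1 :=
  Units.ext (D.reflMatrix_mul_self i)

theorem r_inv (i : Fin n) : (D.r i)⁻¹ = D.r i :=
  inv_eq_of_mul_eq_one_right (D.r_mul_self i)

theorem r_mulVec (i : Fin n) (x : Fin n → ℤ) :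
    (D.r i).val *ᵥ x = x + (D.cartan i ⬝ᵥ x) • Pi.single i 1 := by
  change D.reflMatrix i *ᵥ x = _
  rw [reflMatrix, Matrix.add_mulVec, Matrix.one_mulVec, Matrix.vecMulVec_mulVec]
  simp

/-- The matrix determinant lemma with `cartan i i = -2`. The sign separates words of different
parity and shows that no `r i` is trivial. -/
theorem det_r (i : Fin n) : (D.r i).val.det = -1 := by
  change (D.reflMatrix i).det = _
  rw [reflMatrix, Matrix.vecMulVec_eq Unit, Matrix.det_one_add_replicateCol_mul_replicateRow]
  simp [D.cartan_self]

/-- The product of the generators named by the letters of a word. -/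
def wordProd (L : List (Fin n)) : Matrix.GeneralLinearGroup (Fin n) ℤ :=
  (L.map D.r).prod

@[simp] theorem wordProd_nil : D.wordProd [] = 1 := rfl

@[simp] theorem wordProd_cons (i : Fin n) (L : List (Fin n)) :
    D.wordProd (i :: L) = D.r i * D.wordProd L := by
  simp [wordProd]

@[simp] theorem wordProd_append (L L' : List (Fin n)) :
    D.wordProd (L ++ L') = D.wordProd L * D.wordProd L' := by
  simp [wordProd]

theorem det_wordProd (L : List (Fin n)) : (D.wordProd L).val.det = (-1) ^ L.length := by
  induction L with
  | nil => simp
  | cons i L ih => rw [wordProd_cons, Units.val_mul, Matrix.det_mul, ih, det_r]; simp [pow_succ]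

theorem exists_wordProd_eq {I : Set (Fin n)} {g : Matrix.GeneralLinearGroup (Fin n) ℤ}
    (hg : g ∈ Subgroup.closure (D.r '' I)) : ∃ L, D.wordProd L = g := by
  induction hg using Subgroup.closure_induction'' with
  | mem g hg => obtain ⟨i, _, rfl⟩ := hg; exact ⟨[i], by simp⟩
  | inv_mem g hg => obtain ⟨i, _, rfl⟩ := hg; exact ⟨[i], by simp [r_inv]⟩
  | one => exact ⟨[], rfl⟩
  | mul g h _ _ ihg ihh =>
    obtain ⟨L, rfl⟩ := ihg
    obtain ⟨L', rfl⟩ := ihh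
    exact ⟨L ++ L', by simp⟩

/-- The least length of a word representing `g`. -/
def wordLength (g : Matrix.GeneralLinearGroup (Fin n) ℤ) : ℕ :=
  sInf {k | ∃ L, L.length = k ∧ D.wordProd L = g}

/-- The infimum of the empty set is `0`, so `wordLength` is meaningful only on products of words;
the lemmas about it are stated for `wordProd L`. -/
theorem wordLength_le (L : List (Fin n)) : D.wordLength (D.wordProd L) ≤ L.length :=
  Nat.sInf_le ⟨L, rfl, rfl⟩

theorem exists_reduced (L : List (Fin n)) :
    ∃ L', L'.length = D.wordLength (D.wordProd L) ∧ D.wordProd L' = D.wordProd L :=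
  Nat.sInf_mem (s := {k | ∃ L' : List (Fin n), L'.length = k ∧ D.wordProd L' = D.wordProd L})
    ⟨_, L, rfl, rfl⟩

theorem wordLength_mul_le (L : List (Fin n)) (L' : List (Fin n)) :
    D.wordLength (D.wordProd L * D.wordProd L') ≤ D.wordLength (D.wordProd L) + L'.length := by
  obtain ⟨M, hM, hM'⟩ := D.exists_reduced L
  rw [← hM, ← hM', ← wordProd_append]
  exact (D.wordLength_le _).trans (by simp)

/-- Multiplication by a reflection changes the sign of the determinant, which is `-1` to the power
of the length. -/
theorem wordLength_mul_r_ne (L : List (Fin n)) (i : Fin n) :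
    D.wordLength (D.wordProd L * D.r i) ≠ D.wordLength (D.wordProd L) := by
  intro h
  obtain ⟨M, hM, hM'⟩ := D.exists_reduced L
  obtain ⟨N, hN, hN'⟩ := D.exists_reduced (L ++ [i])
  have h1 : D.wordProd (L ++ [i]) = D.wordProd L * D.r i := by simp
  rw [h1] at hN hN'
  have h2 := congrArg (fun g => g.val.det) hN'
  simp only [Units.val_mul, Matrix.det_mul, ← hM', det_wordProd, det_r] at h2
  rw [hN, h, ← hM] at h2
  rcases neg_one_pow_eq_or ℤ M.length with h3 | h3 <;> rw [h3] at h2 <;> norm_num at h2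

/-- The alternating word `…, k, i, k` of length `l`. -/
def altWord (i k : Fin n) : ℕ → List (Fin n)
  | 0 => []
  | l + 1 => (if Even l then k else i) :: altWord i k l

/-- With equal neighbours and a final `i` excluded, the parity of the distance to the right end
decides each letter. -/
theorem eq_altWord {i k : Fin n} (u : List (Fin n)) (hu : u.IsChain (· ≠ ·))
    (hl : ∀ x ∈ u, x = i ∨ x = k) (hlast : u.getLast? ≠ some i) : u = altWord i k u.length := by
  induction u with
  | nil => rfl
  | cons x u ih =>
    cases u with
    | nil =>
      have hx : x = k := (hl x (by simp)).resolve_left fun h => hlast (by simp [h])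
      simp [altWord, hx]
    | cons y u =>
      rw [List.isChain_cons_cons] at hu
      have h := ih hu.2 (fun z hz => hl z (by simp [hz])) (by simpa using hlast)
      have hx := hl x (by simp)
      simp only [List.length_cons, altWord, List.cons.injEq] at h ⊢
      have hne := hu.1
      refine ⟨?_, h⟩
      rw [h.1] at hne
      by_cases he : Even u.length
      · simp only [he, if_true] at hne
        have : ¬ Even (u.length + 1) := by simpa [Nat.even_add_one] using he
        simp only [this, if_false]
        tauto
      · simp only [he, if_false] at hne
        have : Even (u.length + 1) := by simpa [Nat.even_add_one] using he
        simp only [this, if_true]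
        tauto

/-- `altWord` grows on the left, so a shorter alternating word is a suffix of a longer one. -/
theorem exists_append_altWord (i k : Fin n) (a b : ℕ) :
    ∃ v : List (Fin n), v.length = a ∧ altWord i k (a + b) = v ++ altWord i k b ∧
      ∀ x ∈ v, x = i ∨ x = k := by
  induction a with
  | zero => exact ⟨[], rfl, by simp, by simp⟩
  | succ a ih =>
    obtain ⟨v, hv, hv', hv''⟩ := ih
    refine ⟨(if Even (a + b) then k else i) :: v, by simp [hv], ?_, ?_⟩
    · rw [Nat.add_right_comm, altWord, hv', List.cons_append]
    · intro x hx
      rcases List.mem_cons.1 hx with rfl | hx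
      · split_ifs <;> simp
      · exact hv'' x hx

theorem r_mulVec_left (i k : Fin n) (x : Fin n → ℤ) (a b : ℤ) :
    (D.r i).val *ᵥ (x + a • Pi.single i 1 + b • Pi.single k 1) =
      x + ((D.cartan i ⬝ᵥ x) - a + D.cartan i k * b) • Pi.single i 1 + b • Pi.single k 1 := by
  rw [r_mulVec]
  simp only [dotProduct_add, dotProduct_smul, dotProduct_single, D.cartan_self, smul_eq_mul]
  module

theorem r_mulVec_right (i k : Fin n) (x : Fin n → ℤ) (a b : ℤ) :
    (D.r k).val *ᵥ (x + a • Pi.single i 1 + b • Pi.single k 1) =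
      x + a • Pi.single i 1 + ((D.cartan k ⬝ᵥ x) - b + D.cartan k i * a) • Pi.single k 1 := by
  rw [r_mulVec]
  simp only [dotProduct_add, dotProduct_smul, dotProduct_single, D.cartan_self, smul_eq_mul]
  module

theorem GL_ext_mulVec {g h : Matrix.GeneralLinearGroup (Fin n) ℤ}
    (H : ∀ x : Fin n → ℤ, g.val *ᵥ x = h.val *ᵥ x) : g = h :=
  Units.ext (Matrix.ext_of_mulVec_single fun _ => H _)

/-- The coefficients of `b i` and `b k` in the image of `b i` under an alternating word. -/
def altCoeff (p q : ℤ) : ℕ → ℤ × ℤ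
  | 0 => (1, 0)
  | l + 1 =>
    if Even l then ((altCoeff p q l).1, q * (altCoeff p q l).1 - (altCoeff p q l).2)
    else (p * (altCoeff p q l).2 - (altCoeff p q l).1, (altCoeff p q l).2)

theorem altWord_mulVec (i k : Fin n) (l : ℕ) :
    (D.wordProd (altWord i k l)).val *ᵥ Pi.single i 1 =
      (altCoeff (D.cartan i k) (D.cartan k i) l).1 • (Pi.single i 1 : Fin n → ℤ) +
      (altCoeff (D.cartan i k) (D.cartan k i) l).2 • (Pi.single k 1 : Fin n → ℤ) := by
  induction l with
  | zero => simp only [altWord, altCoeff, wordProd_nil, Units.val_one, Matrix.one_mulVec]; simp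
  | succ l ih =>
    rw [altWord, wordProd_cons, Units.val_mul, ← Matrix.mulVec_mulVec, ih, altCoeff]
    generalize altCoeff (D.cartan i k) (D.cartan k i) l = c
    split_ifs
    · have := D.r_mulVec_right i k 0 c.1 c.2
      simp only [dotProduct_zero, zero_add] at this
      rw [this]
      congr 2
      ring
    · have := D.r_mulVec_left i k 0 c.1 c.2
      simp only [dotProduct_zero, zero_add] at this
      rw [this]
      congr 2
      ring

/-- Both orientations of every kind of branch in one finite list, so that the analysis of rank two
is a check of nine cases. -/
theorem cartan_pair {i k : Fin n} (hik : i ≠ k) :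
    (D.cartan i k, D.cartan k i) ∈ [((0 : ℤ), (0 : ℤ)), (1, 1), (2, 1), (1, 2), (3, 1), (1, 3),
      (4, 1), (1, 4), (2, 2)] := by
  have key : ∀ i k : Fin n, (i : ℕ) < k →
      (D.cartan i k, D.cartan k i) ∈ [((0 : ℤ), (0 : ℤ)), (1, 1), (2, 1), (1, 2), (3, 1), (1, 3),
      (4, 1), (1, 4), (2, 2)] := by
    intro i k h
    by_cases h2 : (i : ℕ) + 2 ≤ k
    · obtain ⟨h, h'⟩ := D.cartan_far i k h2
      simp [h, h']
    · have := D.cartan_near i k (by omega)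
      simp only [AdmissiblePair] at this
      rcases this with (h | h | h | h | h | h) | (h | h | h | h | h | h) <;> simp [h]
  rcases lt_or_gt_of_ne (fun h => hik (Fin.ext h) : (i : ℕ) ≠ k) with h | h
  · exact key i k h
  · have := key k i h
    simp only [List.mem_cons, Prod.mk.injEq, List.not_mem_nil, or_false] at this ⊢
    tauto

/-- The product `4` is the case of infinite period: the coefficients grow linearly along the word,
so they stay nonnegative when `0 ≤ q`. -/
theorem altCoeff_infinite {p q : ℤ} (h : p * q = 4) (t : ℕ) :
    altCoeff p q (2 * t) = (2 * (t : ℤ) + 1, (t : ℤ) * q) ∧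
    altCoeff p q (2 * t + 1) = (2 * (t : ℤ) + 1, ((t : ℤ) + 1) * q) := by
  have step : ∀ t : ℕ, altCoeff p q (2 * t) = (2 * (t : ℤ) + 1, (t : ℤ) * q) →
      altCoeff p q (2 * t + 1) = (2 * (t : ℤ) + 1, ((t : ℤ) + 1) * q) := by
    intro t h
    rw [altCoeff, h]
    simp only [even_two, Even.mul_right, if_true, Prod.mk.injEq, true_and]
    ring
  have key : altCoeff p q (2 * t) = (2 * (t : ℤ) + 1, (t : ℤ) * q) := by
    induction t with
    | zero => simp [altCoeff]
    | succ t ih =>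
      have h1 := step t ih
      rw [show 2 * (t + 1) = (2 * t + 1) + 1 by ring, altCoeff, h1]
      have : ¬ Even (2 * t + 1) := by simp
      simp only [this, if_false, Prod.mk.injEq]
      push_cast
      constructor
      · linear_combination (t + 1) * h
      · ring
  exact ⟨key, step t key⟩

/-- Either every alternating word sends `b i` to a nonnegative combination, or this holds up to a
length at which a braid relation shortens the word. -/
theorem altWord_nonneg_or_shorten {i k : Fin n} (hik : i ≠ k) (l : ℕ) :
    (0 ≤ (altCoeff (D.cartan i k) (D.cartan k i) l).1 ∧
      0 ≤ (altCoeff (D.cartan i k) (D.cartan k i) l).2) ∨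
    ∃ M ≤ l, ∃ u : List (Fin n), u.length < M ∧ (∀ x ∈ u, x = i ∨ x = k) ∧
      D.wordProd (altWord i k M) * D.r i = D.wordProd u := by
  -- Infinite period: there is no braid relation, but no negative coefficient either.
  have inf : D.cartan i k * D.cartan k i = 4 → 0 ≤ D.cartan k i →
      (0 ≤ (altCoeff (D.cartan i k) (D.cartan k i) l).1 ∧
      0 ≤ (altCoeff (D.cartan i k) (D.cartan k i) l).2) := by
    intro h h'
    obtain ⟨t, rfl | rfl⟩ := Nat.even_or_odd' l
    · rw [(altCoeff_infinite h t).1]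
      exact ⟨by positivity, by positivity⟩
    · rw [(altCoeff_infinite h t).2]
      exact ⟨by positivity, by positivity⟩
  have start : ∀ x : Fin n → ℤ, x = x + (0 : ℤ) • Pi.single i 1 + (0 : ℤ) • Pi.single k 1 := by
    simp
  -- Finite period `M`: below length `M` the coefficients are nonnegative by inspection. From `M`
  -- on, the braid relation rewrites the alternating word of length `M` followed by `i` as a word of
  -- length `M - 1`.
  have fin : ∀ (M : ℕ) (u : List (Fin n)), u.length < M → (∀ x ∈ u, x = i ∨ x = k) →
      D.wordProd (altWord i k M) * D.r i = D.wordProd u →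
      (l < M → 0 ≤ (altCoeff (D.cartan i k) (D.cartan k i) l).1 ∧
      0 ≤ (altCoeff (D.cartan i k) (D.cartan k i) l).2) →
      (0 ≤ (altCoeff (D.cartan i k) (D.cartan k i) l).1 ∧
      0 ≤ (altCoeff (D.cartan i k) (D.cartan k i) l).2) ∨
    ∃ M ≤ l, ∃ u : List (Fin n), u.length < M ∧ (∀ x ∈ u, x = i ∨ x = k) ∧
      D.wordProd (altWord i k M) * D.r i = D.wordProd u := by
    intro M u h1 h2 h3 h4
    rcases lt_or_ge l M with h | h
    · exact Or.inl (h4 h)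
    · exact Or.inr ⟨M, h, u, h1, h2, h3⟩
  have e1 : ¬ Even 1 := by decide
  have e2 : Even 2 := by decide
  have e3 : ¬ Even 3 := by decide
  have e4 : Even 4 := by decide
  have e5 : ¬ Even 5 := by decide
  have hp := D.cartan_pair hik
  simp only [List.mem_cons, Prod.mk.injEq, List.not_mem_nil, or_false] at hp
  rcases hp with ⟨hp, hq⟩ | ⟨hp, hq⟩ | ⟨hp, hq⟩ | ⟨hp, hq⟩ | ⟨hp, hq⟩ | ⟨hp, hq⟩ | ⟨hp, hq⟩ |
    ⟨hp, hq⟩ | ⟨hp, hq⟩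
  · refine fin 2 [k] (by simp) (by simp) (GL_ext_mulVec fun x => ?_) (fun h => ?_)
    · simp only [altWord, wordProd_cons, wordProd_nil, mul_one, Units.val_mul,
        ← Matrix.mulVec_mulVec, e1, Even.zero, if_true, if_false]
      rw [start x]
      simp only [r_mulVec_left D i k, r_mulVec_right D i k, hp, hq]
      congr 2 <;> ring_nf
    · rw [hp, hq]; interval_cases l <;> decide
  · refine fin 3 [i, k] (by simp) (by simp) (GL_ext_mulVec fun x => ?_) (fun h => ?_)
    · simp only [altWord, wordProd_cons, wordProd_nil, mul_one, Units.val_mul,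
        ← Matrix.mulVec_mulVec, e1, e2, Even.zero, if_true, if_false]
      rw [start x]
      simp only [r_mulVec_left D i k, r_mulVec_right D i k, hp, hq]
      congr 2 <;> ring_nf
    · rw [hp, hq]; interval_cases l <;> decide
  iterate 2
    · refine fin 4 [k, i, k] (by simp) (by simp) (GL_ext_mulVec fun x => ?_) (fun h => ?_)
      · simp only [altWord, wordProd_cons, wordProd_nil, mul_one, Units.val_mul,
          ← Matrix.mulVec_mulVec, e1, e2, e3, Even.zero, if_true, if_false]
        rw [start x]
        simp only [r_mulVec_left D i k, r_mulVec_right D i k, hp, hq]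
        congr 2 <;> ring_nf
      · rw [hp, hq]; interval_cases l <;> decide
  iterate 2
    · refine fin 6 [k, i, k, i, k] (by simp) (by simp) (GL_ext_mulVec fun x => ?_) (fun h => ?_)
      · simp only [altWord, wordProd_cons, wordProd_nil, mul_one, Units.val_mul,
          ← Matrix.mulVec_mulVec, e1, e2, e3, e4, e5, Even.zero, if_true, if_false]
        rw [start x]
        simp only [r_mulVec_left D i k, r_mulVec_right D i k, hp, hq]
        congr 2 <;> ring_nf
      · rw [hp, hq]; interval_cases l <;> decide
  all_goals exact Or.inl (inf (by rw [hp, hq]; norm_num) (by rw [hq]; norm_num))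

/-- If multiplication by `r i` on the right lengthens `w`, then `w` sends `b i` to a nonnegative
combination of the basis. -/
theorem column_nonneg (L : List (Fin n)) (i : Fin n)
    (h : D.wordLength (D.wordProd L) < D.wordLength (D.wordProd L * D.r i)) :
    0 ≤ (D.wordProd L).val *ᵥ Pi.single i 1 := by
  induction hN : D.wordLength (D.wordProd L) using Nat.strong_induction_on generalizing L i with
  | _ N ih =>
  obtain ⟨L₀, hL₀, hL₀'⟩ := D.exists_reduced L
  rcases List.eq_nil_or_concat L₀ with rfl | ⟨L₁, k, rfl⟩
  · rw [← hL₀', wordProd_nil, Units.val_one, Matrix.one_mulVec]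
    exact Pi.single_nonneg.2 zero_le_one
  have hk : D.wordProd L * D.r k = D.wordProd L₁ := by
    rw [← hL₀']
    simp [mul_assoc, r_mul_self]
  have hik : i ≠ k := by
    rintro rfl
    rw [hk] at h
    have := D.wordLength_le L₁
    simp at hL₀
    omega
  -- decompositions `w = v * u` with `u` a word in `i, k` and additive lengths
  let P : ℕ → Prop := fun a => ∃ v u : List (Fin n), u.length = a ∧ (∀ x ∈ u, x = i ∨ x = k) ∧
    D.wordProd L = D.wordProd v * D.wordProd u ∧ D.wordLength (D.wordProd v) + a = N
  have hP : P 1 := by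
    refine ⟨L₁, [k], rfl, by simp, by rw [← hL₀']; simp, ?_⟩
    have h1 := D.wordLength_le L₁
    have h2 := D.wordLength_mul_le L₁ [k]
    rw [show D.wordProd L₁ * D.wordProd [k] = D.wordProd L by rw [← hL₀']; simp] at h2
    simp at hL₀ h2
    omega
  have hbd : ∀ a, P a → a ≤ N := by
    rintro a ⟨v, u, -, -, -, h⟩
    omega
  classical
  obtain ⟨a, ha, hmax⟩ : ∃ a, P a ∧ ∀ b, P b → b ≤ a :=
    ⟨Nat.findGreatest P N, Nat.findGreatest_spec (hbd 1 hP) hP,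
      fun b hb => Nat.le_findGreatest (hbd b hb) hb⟩
  have ha1 := hmax 1 hP
  obtain ⟨v, u, hu, hul, hw, hlen⟩ := ha
  -- As `a` is maximal, no letter can be moved from `v` to `u`: a letter in `{i, k}` that did not
  -- lengthen `v` would give a decomposition with a longer second factor.
  have grow : ∀ x, (x = i ∨ x = k) →
      D.wordLength (D.wordProd v) < D.wordLength (D.wordProd v * D.r x) := by
    intro x hx
    by_contra hlt
    have hne := D.wordLength_mul_r_ne v x
    have h1 : D.wordProd (v ++ [x]) = D.wordProd v * D.r x := by simp
    have h2 := D.wordLength_mul_le (v ++ [x]) (x :: u)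
    have h3 : D.wordProd (v ++ [x]) * D.wordProd (x :: u) = D.wordProd L := by
      rw [hw]
      simp [mul_assoc, ← mul_assoc (D.r x) (D.r x), r_mul_self]
    rw [h3, h1, hN] at h2
    simp only [List.length_cons, hu] at h2
    have := hmax (a + 1) ⟨v ++ [x], x :: u, by simp [hu], ?_, h3.symm, ?_⟩
    · omega
    · intro y hy
      rcases List.mem_cons.1 hy with rfl | hy
      · exact hx
      · exact hul y hy
    · rw [h1]
      omega
  have hvi := ih _ (by omega) v i (grow i (Or.inl rfl)) rfl
  have hvk := ih _ (by omega) v k (grow k (Or.inr rfl)) rfl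
  -- no word in `i, k` for `u` or `u * r i` is too short
  have red : ∀ u' : List (Fin n), D.wordProd u' = D.wordProd u → a ≤ u'.length := by
    intro u' h'
    have := D.wordLength_mul_le v u'
    rw [h', ← hw, hN] at this
    omega
  have red' : ∀ u' : List (Fin n), D.wordProd u' = D.wordProd u * D.r i → a < u'.length := by
    intro u' h'
    have := D.wordLength_mul_le v u'
    rw [h', ← mul_assoc, ← hw] at this
    omega
  -- Equal neighbours would cancel and leave a shorter word for `u`.
  have hchain : u.IsChain (· ≠ ·) := by
    refine List.isChain_iff_forall_rel_of_append_cons_cons.2 fun x y l₁ l₂ hl hxy => ?_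
    have := red (l₁ ++ l₂) (by rw [hl, hxy]; simp [← mul_assoc (D.r _) (D.r _), r_mul_self])
    rw [hl] at hu
    simp at hu this
    omega
  -- A final `i` would cancel against `r i`, although `w * r i` is longer than `w`.
  have hlast : u.getLast? ≠ some i := by
    intro hl
    obtain ⟨u', rfl⟩ := List.getLast?_eq_some_iff.1 hl
    have := red' u' (by simp [mul_assoc, r_mul_self])
    simp at hu
    omega
  have hualt := eq_altWord u hchain hul hlast
  rw [hu] at hualt
  -- Either `u` takes `b i` to a nonnegative combination of `b i` and `b k`, on both of which `v` is
  -- nonnegative by induction, or the braid relation yields a word for `u * r i` that is too short.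
  rcases D.altWord_nonneg_or_shorten hik a with ⟨h1, h2⟩ | ⟨M, hM, u', hu', -, hu''⟩
  · rw [hw, Units.val_mul, ← Matrix.mulVec_mulVec, hualt, D.altWord_mulVec, Matrix.mulVec_add,
      Matrix.mulVec_smul, Matrix.mulVec_smul]
    exact add_nonneg (smul_nonneg h1 hvi) (smul_nonneg h2 hvk)
  · obtain ⟨x, hx, hx', -⟩ := exists_append_altWord i k (a - M) M
    rw [Nat.sub_add_cancel hM] at hx'
    have := red' (x ++ u') (by rw [hualt, hx', wordProd_append, wordProd_append, mul_assoc, hu''])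
    simp at this
    omega

/-- An element fixing a dominant functional is a product of simple reflections fixing it. -/
theorem mem_closure_of_vecMul_eq (f : Fin n → ℤ) (hf : 0 ≤ f) (L : List (Fin n))
    (hL : f ᵥ* (D.wordProd L).val = f) :
    D.wordProd L ∈ Subgroup.closure (D.r '' {i | f i = 0}) := by
  induction hN : D.wordLength (D.wordProd L) using Nat.strong_induction_on generalizing L with
  | _ N ih =>
  obtain ⟨L₀, hL₀, hL₀'⟩ := D.exists_reduced L
  rcases List.eq_nil_or_concat L₀ with rfl | ⟨L₁, k, rfl⟩
  · rw [← hL₀']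
    simp
  have hk : D.wordProd L = D.wordProd L₁ * D.r k := by
    rw [← hL₀']
    simp
  have hlt : D.wordLength (D.wordProd L₁) < D.wordLength (D.wordProd L₁ * D.r k) := by
    rw [← hk]
    have := D.wordLength_le L₁
    simp at hL₀
    omega
  have hpos := D.column_nonneg L₁ k hlt
  have hneg : (D.wordProd L).val *ᵥ Pi.single k 1 = -((D.wordProd L₁).val *ᵥ Pi.single k 1) := by
    rw [hk, Units.val_mul, ← Matrix.mulVec_mulVec, r_mulVec, ← Matrix.mulVec_neg]
    congr 1
    simp only [dotProduct_single, cartan_self]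
    module
  -- With `w = w₁ r_k` reduced, `f k = f (w b_k) = -f (w₁ b_k) ≤ 0 ≤ f k`. So the last letter fixes
  -- `f` and can be split off.
  have hfk : f k = 0 := by
    have h1 : f ⬝ᵥ ((D.wordProd L).val *ᵥ Pi.single k 1) = f k := by
      rw [Matrix.dotProduct_mulVec, hL]
      simp
    rw [hneg, dotProduct_neg] at h1
    have h2 : 0 ≤ f ⬝ᵥ ((D.wordProd L₁).val *ᵥ Pi.single k 1) :=
      dotProduct_nonneg_of_nonneg hf hpos
    have h3 := hf k
    simp at h3
    omega
  have hrk : f ᵥ* (D.r k).val = f := by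
    change f ᵥ* D.reflMatrix k = f
    rw [reflMatrix, Matrix.vecMul_add, Matrix.vecMul_one, Matrix.vecMul_vecMulVec]
    simp [hfk]
  rw [hk] at hL ⊢
  refine mul_mem (ih _ (by rw [← hN, hk]; exact hlt) L₁ ?_ rfl)
    (Subgroup.subset_closure ⟨k, hfk, rfl⟩)
  have := congrArg (· ᵥ* (D.r k).val) hL
  simp only [Matrix.vecMul_vecMul, ← Units.val_mul, mul_assoc, r_mul_self, mul_one] at this
  rw [this, hrk]

theorem vecMul_eq_of_mem_closure {I : Set (Fin n)} (f : Fin n → ℤ) (hf : ∀ i ∈ I, f i = 0)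
    {g : Matrix.GeneralLinearGroup (Fin n) ℤ} (hg : g ∈ Subgroup.closure (D.r '' I)) :
    f ᵥ* g.val = f := by
  have hr : ∀ i ∈ I, f ᵥ* (D.r i).val = f := by
    intro i hi
    change f ᵥ* D.reflMatrix i = f
    rw [reflMatrix, Matrix.vecMul_add, Matrix.vecMul_one, Matrix.vecMul_vecMulVec]
    simp [hf i hi]
  induction hg using Subgroup.closure_induction'' with
  | mem g hg => obtain ⟨i, hi, rfl⟩ := hg; exact hr i hi
  | inv_mem g hg => obtain ⟨i, hi, rfl⟩ := hg; rw [r_inv]; exact hr i hi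
  | one => simp
  | mul g h _ _ ihg ihh => rw [Units.val_mul, ← Matrix.vecMul_vecMul, ihg, ihh]

/-- Standard parabolic subgroups intersect in standard parabolic subgroups. -/
theorem closure_inf_closure (I J : Set (Fin n)) :
    Subgroup.closure (D.r '' I) ⊓ Subgroup.closure (D.r '' J) =
      Subgroup.closure (D.r '' (I ∩ J)) := by
  classical
  apply le_antisymm
  · rintro g ⟨hI, hJ⟩
    obtain ⟨L, rfl⟩ := D.exists_wordProd_eq hI
    -- The indicator functional of the complement of `I` is fixed by `⟨I⟩`, likewise for `J`. Their
    -- sum is dominant and vanishes exactly on `I ∩ J`.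
    let fI : Fin n → ℤ := fun i => if i ∈ I then 0 else 1
    let fJ : Fin n → ℤ := fun i => if i ∈ J then 0 else 1
    have h1 := D.vecMul_eq_of_mem_closure fI (fun i hi => by simp [fI, hi]) hI
    have h2 := D.vecMul_eq_of_mem_closure fJ (fun i hi => by simp [fJ, hi]) hJ
    have h3 := D.mem_closure_of_vecMul_eq (fI + fJ)
      (fun i => by simp only [fI, fJ, Pi.add_apply, Pi.zero_apply]; split_ifs <;> simp) L
      (by rw [Matrix.add_vecMul, h1, h2])
    convert h3 using 3
    ext i
    by_cases hi : i ∈ I <;> by_cases hj : i ∈ J <;> simp [fI, fJ, hi, hj]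
  · exact le_inf (Subgroup.closure_mono (Set.image_mono Set.inter_subset_left))
      (Subgroup.closure_mono (Set.image_mono Set.inter_subset_right))

end StringBasicSystem
end

noncomputable section

/-! ### The automorphism group of the polytope of a string C-group -/

section StringCGroup

variable {Γ : Type} [Group Γ] {d : ℕ} {ρ : Fin d → Γ}

theorem face_eq_iff {i : Fin (d + 2)} {g h : Γ} :
    (⟨i, (g : Γ ⧸ faceStabilizer ρ i)⟩ : Face ρ) = ⟨i, (h : Γ ⧸ faceStabilizer ρ i)⟩ ↔
      g⁻¹ * h ∈ faceStabilizer ρ i := by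
  simp [QuotientGroup.eq]

theorem faceLE_mk {i k : Fin (d + 2)} (hik : i ≤ k) (g : Γ) :
    faceLE ρ ⟨i, (g : Γ ⧸ faceStabilizer ρ i)⟩ ⟨k, (g : Γ ⧸ faceStabilizer ρ k)⟩ :=
  ⟨hik, g, rfl, rfl⟩

theorem faceLE_eq_of_rank_eq {F F' : Face ρ} (h : faceLE ρ F F') (hr : F.1 = F'.1) : F = F' := by
  obtain ⟨i, x⟩ := F
  obtain ⟨k, y⟩ := F'
  obtain ⟨-, g, h1, h2⟩ := h
  dsimp only at hr h1 h2
  subst hr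
  rw [← h1, ← h2]

theorem face_exists_rep (F : Face ρ) :
    ∃ g : Γ, F = ⟨F.1, (g : Γ ⧸ faceStabilizer ρ F.1)⟩ := by
  obtain ⟨i, x⟩ := F
  obtain ⟨g, rfl⟩ := QuotientGroup.mk_surjective x
  exact ⟨g, rfl⟩

/-- A flag through the face goes to a chain with strictly increasing ranks, and a strictly
increasing self-map of `Fin (d + 2)` is the identity. -/
theorem rank_relIso (α : faceLE ρ ≃r faceLE ρ) (F : Face ρ) : (α F).1 = F.1 := by
  obtain ⟨g, hg⟩ := face_exists_rep F
  let f : Fin (d + 2) → Fin (d + 2) := fun i => (α ⟨i, (g : Γ ⧸ faceStabilizer ρ i)⟩).1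
  have hf : StrictMono f := by
    intro i k hik
    have h := α.map_rel_iff.2 (faceLE_mk (ρ := ρ) hik.le g)
    refine lt_of_le_of_ne h.1 fun he => ?_
    have := α.injective (faceLE_eq_of_rank_eq h he)
    exact hik.ne (congrArg Sigma.fst this)
  have h : f F.1 = F.1 := le_antisymm hf.apply_le hf.le_apply
  rw [hg]
  exact h

theorem IsStringCGroup.mul_self (hC : IsStringCGroup ρ) (i : Fin d) : ρ i * ρ i = 1 := by
  rw [← pow_two, ← hC.involution i, pow_orderOf_eq_one]

theorem IsStringCGroup.commute (hC : IsStringCGroup ρ) {i k : Fin d} (h : (i : ℕ) + 2 ≤ k) :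
    Commute (ρ i) (ρ k) := by
  have h1 := hC.string i k h
  have hi := inv_eq_of_mul_eq_one_right (hC.mul_self i)
  have hk := inv_eq_of_mul_eq_one_right (hC.mul_self k)
  rw [pow_two] at h1
  have h2 := inv_eq_of_mul_eq_one_right h1
  rw [mul_inv_rev, hi, hk] at h2
  exact h2.symm

/-- The stabilizer of a base face is the product of two commuting subgroups. -/
theorem IsStringCGroup.faceStabilizer_decompose (hC : IsStringCGroup ρ) {i : Fin (d + 2)} {g : Γ}
    (hg : g ∈ faceStabilizer ρ i) :
    ∃ y ∈ Subgroup.closure {g | ∃ k : Fin d, (i : ℕ) < (k : ℕ) + 1 ∧ g = ρ k},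
    ∃ x ∈ Subgroup.closure {g | ∃ k : Fin d, (k : ℕ) + 1 < i ∧ g = ρ k}, g = y * x := by
  -- The two sets of generators lie on opposite sides of the omitted index, so their members are
  -- never consecutive.
  have hcomm : ∀ y ∈ {g | ∃ k : Fin d, (i : ℕ) < (k : ℕ) + 1 ∧ g = ρ k},
      ∀ x ∈ Subgroup.closure {g | ∃ k : Fin d, (k : ℕ) + 1 < i ∧ g = ρ k}, x * y = y * x := by
    rintro _ ⟨k, hk, rfl⟩ x hx
    induction hx using Subgroup.closure_induction with
    | mem x hx => obtain ⟨l, hl, rfl⟩ := hx; exact hC.commute (by omega)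
    | one => simp
    | mul a b _ _ ha hb => exact Commute.mul_left ha hb
    | inv a _ ha => exact Commute.inv_left ha
  have step : ∀ k : Fin d, (k : ℕ) + 1 ≠ i → ∀ g : Γ,
      (∃ y ∈ Subgroup.closure {g | ∃ k : Fin d, (i : ℕ) < (k : ℕ) + 1 ∧ g = ρ k},
      ∃ x ∈ Subgroup.closure {g | ∃ k : Fin d, (k : ℕ) + 1 < i ∧ g = ρ k}, g = y * x) →
      ∃ y ∈ Subgroup.closure {g | ∃ k : Fin d, (i : ℕ) < (k : ℕ) + 1 ∧ g = ρ k},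
      ∃ x ∈ Subgroup.closure {g | ∃ k : Fin d, (k : ℕ) + 1 < i ∧ g = ρ k}, g * ρ k = y * x := by
    rintro k hk g ⟨y, hy, x, hx, rfl⟩
    rcases lt_or_gt_of_ne hk with hk | hk
    · exact ⟨y, hy, x * ρ k, mul_mem hx (Subgroup.subset_closure ⟨k, hk, rfl⟩), mul_assoc _ _ _⟩
    · refine ⟨y * ρ k, mul_mem hy (Subgroup.subset_closure ⟨k, hk, rfl⟩), x, hx, ?_⟩
      rw [mul_assoc, hcomm _ ⟨k, hk, rfl⟩ x hx, mul_assoc]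
  induction hg using Subgroup.closure_induction_right with
  | one => exact ⟨1, one_mem _, 1, one_mem _, by simp⟩
  | mul_right x hx y hy ih => obtain ⟨k, hk, rfl⟩ := hy; exact step k hk _ ih
  | mul_inv_cancel x hx y hy ih =>
    obtain ⟨k, hk, rfl⟩ := hy
    rw [inv_eq_of_mul_eq_one_right (hC.mul_self k)]
    exact step k hk _ ih

/-- Faces of all ranks, each incident with the next, have a common representative. -/
theorem IsStringCGroup.exists_common_rep (hC : IsStringCGroup ρ) (h : Fin (d + 2) → Γ)
    (hh : ∀ i k : Fin (d + 2), (k : ℕ) = i + 1 →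
      faceLE ρ ⟨i, (h i : Γ ⧸ faceStabilizer ρ i)⟩ ⟨k, (h k : Γ ⧸ faceStabilizer ρ k)⟩) :
    ∃ g : Γ, ∀ i, (⟨i, (g : Γ ⧸ faceStabilizer ρ i)⟩ : Face ρ) =
      ⟨i, (h i : Γ ⧸ faceStabilizer ρ i)⟩ := by
  suffices H : ∀ a : ℕ, a < d + 2 → ∃ g : Γ, ∀ i : Fin (d + 2), (i : ℕ) ≤ a →
      (⟨i, (g : Γ ⧸ faceStabilizer ρ i)⟩ : Face ρ) = ⟨i, (h i : Γ ⧸ faceStabilizer ρ i)⟩ by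
    obtain ⟨g, hg⟩ := H (d + 1) (by omega)
    exact ⟨g, fun i => hg i (by omega)⟩
  intro a
  induction a with
  | zero =>
    intro _
    refine ⟨h 0, fun i hi => ?_⟩
    obtain rfl : i = 0 := Fin.ext (by simpa using hi)
    rfl
  | succ a ih =>
    intro ha
    obtain ⟨g, hg⟩ := ih (by omega)
    obtain ⟨-, g', h1, h2⟩ := hh ⟨a, by omega⟩ ⟨a + 1, ha⟩ rfl
    dsimp only at h1 h2
    have h3 := hg ⟨a, by omega⟩ le_rfl
    rw [← h1, face_eq_iff] at h3
    -- Here `g⁻¹ g' = y x`, where `y` fixes the base faces of index at most `a` and `x` the base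
    -- face of index `a + 1`. Hence `g y` still represents the earlier faces and agrees with `g'` on
    -- the next one.
    obtain ⟨y, hy, x, hx, hyx⟩ := hC.faceStabilizer_decompose h3
    refine ⟨g * y, fun i hi => ?_⟩
    rcases Nat.lt_or_ge a i with hai | hai
    · obtain rfl : i = ⟨a + 1, ha⟩ := Fin.ext (by simp; omega)
      rw [← h2, face_eq_iff]
      have : (g * y)⁻¹ * g' = x := by
        rw [mul_inv_rev, mul_assoc, hyx]
        group
      rw [this]
      refine Subgroup.closure_mono ?_ hx
      rintro _ ⟨k, hk, rfl⟩
      exact ⟨k, by simp at hk ⊢; omega, rfl⟩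
    · rw [← hg i hai, face_eq_iff]
      have : (g * y)⁻¹ * g = y⁻¹ := by group
      rw [this]
      refine inv_mem (Subgroup.closure_mono ?_ hy)
      rintro _ ⟨k, hk, rfl⟩
      exact ⟨k, by simp at hk ⊢; omega, rfl⟩

theorem faceStabilizer_eq_closure_image (i : Fin (d + 2)) :
    faceStabilizer ρ i = Subgroup.closure (ρ '' {k | (k : ℕ) + 1 ≠ i}) := by
  unfold faceStabilizer
  congr 1
  ext g
  simp [eq_comm]

/-- The intersection property, applied once for each face of a chain. -/
theorem IsStringCGroup.mem_closure_of_forall_mem (hC : IsStringCGroup ρ) (t : Finset (Fin (d + 2)))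
    {g : Γ} (hg : ∀ i ∈ t, g ∈ faceStabilizer ρ i) :
    g ∈ Subgroup.closure (ρ '' {k | ∀ i ∈ t, (k : ℕ) + 1 ≠ i}) := by
  classical
  induction t using Finset.induction_on with
  | empty => simp [hC.generates]
  | insert a t _ ih =>
    have h1 := ih fun i hi => hg i (by simp [hi])
    have h2 := hg a (by simp)
    rw [faceStabilizer_eq_closure_image] at h2
    have h3 := (hC.intersection _ _).le (Subgroup.mem_inf.2 ⟨h2, h1⟩)
    convert h3 using 3
    ext k
    simp

theorem IsStringCGroup.eq_one_of_forall_mem (hC : IsStringCGroup ρ) {g : Γ}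
    (hg : ∀ i, g ∈ faceStabilizer ρ i) : g = 1 := by
  have h := hC.mem_closure_of_forall_mem Finset.univ fun i _ => hg i
  have : {k : Fin d | ∀ i ∈ Finset.univ, (k : ℕ) + 1 ≠ ((i : Fin (d + 2)) : ℕ)} = ∅ := by
    ext k
    simp only [Finset.mem_univ, forall_const, Set.mem_ofPred_eq, Set.mem_empty_iff_false, iff_false]
    intro h
    exact h ⟨k + 1, by omega⟩ rfl
  rw [this] at h
  simpa using h

/-- The stabilizer of a flag with one face removed is generated by the single involution `ρ k`. This
makes it possible to follow an automorphism from a flag to an adjacent flag. -/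
theorem IsStringCGroup.eq_or_eq_of_forall_mem (hC : IsStringCGroup ρ) {g : Γ} (k : Fin d)
    (hg : ∀ i : Fin (d + 2), (k : ℕ) + 1 ≠ i → g ∈ faceStabilizer ρ i) : g = 1 ∨ g = ρ k := by
  have h := hC.mem_closure_of_forall_mem (Finset.univ.filter fun i => (k : ℕ) + 1 ≠ i)
    fun i hi => hg i (by simpa using hi)
  have : {l : Fin d | ∀ i ∈ Finset.univ.filter fun i : Fin (d + 2) => (k : ℕ) + 1 ≠ i,
      (l : ℕ) + 1 ≠ i} = {k} := by
    ext l
    simp only [Finset.mem_filter, Finset.mem_univ, true_and, Set.mem_ofPred_eq,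
      Set.mem_singleton_iff]
    constructor
    · intro h
      by_contra hne
      exact h ⟨l + 1, by omega⟩ (fun h => hne (Fin.ext (by simp at h; omega))) rfl
    · rintro rfl i hi
      exact hi
  rw [this, Set.image_singleton, Subgroup.mem_closure_singleton] at h
  obtain ⟨z, rfl⟩ := h
  have h2 : ρ k ^ (2 : ℤ) = 1 := by
    rw [zpow_two]
    exact hC.mul_self k
  obtain ⟨y, rfl | rfl⟩ := Int.even_or_odd' z
  · left; rw [zpow_mul, h2, one_zpow]
  · right; rw [zpow_add, zpow_mul, h2, one_zpow, zpow_one, one_mul]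

/-- Otherwise `ρ k` would lie in every face stabilizer and be trivial. -/
theorem IsStringCGroup.not_mem_faceStabilizer (hC : IsStringCGroup ρ) (k : Fin d) :
    ρ k ∉ faceStabilizer ρ ⟨(k : ℕ) + 1, by omega⟩ := by
  intro h
  have h1 : ρ k = 1 := by
    refine hC.eq_one_of_forall_mem fun i => ?_
    by_cases hi : (k : ℕ) + 1 = i
    · convert h
      exact hi.symm
    · exact Subgroup.subset_closure ⟨k, hi, rfl⟩
  have := hC.involution k
  rw [h1, orderOf_one] at this
  omega

/-- An automorphism preserves ranks and takes the flag of `w` to a chain of successively incident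
faces, which is again the flag of a group element. -/
theorem IsStringCGroup.exists_relIso_rep (hC : IsStringCGroup ρ) (α : faceLE ρ ≃r faceLE ρ)
    (w : Γ) : ∃ g : Γ, ∀ i, α ⟨i, (w : Γ ⧸ faceStabilizer ρ i)⟩ =
      ⟨i, (g : Γ ⧸ faceStabilizer ρ i)⟩ := by
  have h1 : ∀ i, ∃ g : Γ, α ⟨i, (w : Γ ⧸ faceStabilizer ρ i)⟩ =
      ⟨i, (g : Γ ⧸ faceStabilizer ρ i)⟩ := by
    intro i
    obtain ⟨g, hg⟩ := face_exists_rep (α ⟨i, (w : Γ ⧸ faceStabilizer ρ i)⟩)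
    have hr := rank_relIso α ⟨i, (w : Γ ⧸ faceStabilizer ρ i)⟩
    dsimp only at hr
    rw [hr] at hg
    exact ⟨g, hg⟩
  choose h hh using h1
  obtain ⟨g, hg⟩ := hC.exists_common_rep h fun i k hik => by
    rw [← hh, ← hh]
    exact α.map_rel_iff.2 (faceLE_mk (by rw [Fin.le_def]; omega) w)
  exact ⟨g, fun i => by rw [hh, hg]⟩

/-- Every automorphism of the polytope of a string C-group is induced by a group element. -/
theorem IsStringCGroup.exists_eq_smul (hC : IsStringCGroup ρ) (α : faceLE ρ ≃r faceLE ρ) :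
    ∃ g : Γ, ∀ F, α F = g • F := by
  obtain ⟨g, hg⟩ := hC.exists_relIso_rep α 1
  refine ⟨g, fun F => ?_⟩
  suffices H : ∀ w : Γ, ∀ i, α ⟨i, (w : Γ ⧸ faceStabilizer ρ i)⟩ =
      ⟨i, ((g * w : Γ) : Γ ⧸ faceStabilizer ρ i)⟩ by
    obtain ⟨w, hw⟩ := face_exists_rep F
    rw [hw, H]
    rfl
  -- The flags of `w` and `w * ρ k` differ in one face only. So the image of the second is the flag
  -- of `g w` or of `g w ρ_k`, and injectivity of `α` excludes the former.
  have step : ∀ (k : Fin d) (w : Γ), (∀ i, α ⟨i, (w : Γ ⧸ faceStabilizer ρ i)⟩ =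
      ⟨i, ((g * w : Γ) : Γ ⧸ faceStabilizer ρ i)⟩) →
      ∀ i, α ⟨i, ((w * ρ k : Γ) : Γ ⧸ faceStabilizer ρ i)⟩ =
      ⟨i, ((g * (w * ρ k) : Γ) : Γ ⧸ faceStabilizer ρ i)⟩ := by
    intro k w ih
    obtain ⟨y, hy⟩ := hC.exists_relIso_rep α (w * ρ k)
    have h1 := hC.eq_or_eq_of_forall_mem (g := (g * w)⁻¹ * y) k fun i hi => by
      rw [← face_eq_iff, ← ih, ← hy]
      congr 1
      rw [face_eq_iff, inv_mul_cancel_left]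
      exact Subgroup.subset_closure ⟨k, hi, rfl⟩
    rcases h1 with h1 | h1
    · exfalso
      have h2 := hy ⟨k + 1, by omega⟩
      rw [← eq_of_inv_mul_eq_one h1, ← ih] at h2
      have h3 := α.injective h2
      rw [face_eq_iff] at h3
      refine hC.not_mem_faceStabilizer k ?_
      have h4 : (w * ρ k)⁻¹ * w = (ρ k)⁻¹ := by group
      rw [h4] at h3
      exact inv_mem_iff.1 h3
    · intro i
      rw [hy, eq_mul_of_inv_mul_eq h1, mul_assoc]
  intro w
  have hw : w ∈ Subgroup.closure (Set.range ρ) := hC.generates ▸ Subgroup.mem_top w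
  induction hw using Subgroup.closure_induction_right with
  | one => simpa using hg
  | mul_right x hx y hy ih => obtain ⟨k, rfl⟩ := hy; exact step k x ih
  | mul_inv_cancel x hx y hy ih =>
    obtain ⟨k, rfl⟩ := hy
    rw [inv_eq_of_mul_eq_one_right (hC.mul_self k)]
    exact step k x ih

theorem faceLE_smul_iff (g : Γ) (F F' : Face ρ) : faceLE ρ (g • F) (g • F') ↔ faceLE ρ F F' := by
  have key : ∀ (g : Γ) (F F' : Face ρ), faceLE ρ F F' → faceLE ρ (g • F) (g • F') := by
    rintro g ⟨i, x⟩ ⟨k, y⟩ ⟨hik, h, h1, h2⟩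
    dsimp only at h1 h2
    subst h1 h2
    exact ⟨hik, g * h, rfl, rfl⟩
  refine ⟨fun h => ?_, key g F F'⟩
  simpa using key g⁻¹ _ _ h

/-- The action of a group on its coset polytope. -/
def faceAction (ρ : Fin d → Γ) : Γ →* (faceLE ρ ≃r faceLE ρ) where
  toFun g := ⟨MulAction.toPerm g, fun {F F'} => faceLE_smul_iff g F F'⟩
  map_one' := RelIso.ext fun F => one_smul Γ F
  map_mul' g h := RelIso.ext fun F => mul_smul g h F

theorem IsStringCGroup.faceAction_bijective (hC : IsStringCGroup ρ) :
    Function.Bijective (faceAction ρ) := by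
  constructor
  · rw [injective_iff_map_eq_one]
    intro g hg
    refine hC.eq_one_of_forall_mem fun i => ?_
    have h : g • (⟨i, ((1 : Γ) : Γ ⧸ faceStabilizer ρ i)⟩ : Face ρ) =
        ⟨i, ((1 : Γ) : Γ ⧸ faceStabilizer ρ i)⟩ := DFunLike.congr_fun hg _
    have h2 : (⟨i, ((g * 1 : Γ) : Γ ⧸ faceStabilizer ρ i)⟩ : Face ρ) =
        ⟨i, ((1 : Γ) : Γ ⧸ faceStabilizer ρ i)⟩ := h
    rw [face_eq_iff] at h2
    simpa using h2
  · intro α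
    obtain ⟨g, hg⟩ := hC.exists_eq_smul α
    exact ⟨g, RelIso.ext fun F => (hg F).symm⟩

variable {Γ' : Type} [Group Γ']

theorem faceStabilizer_comp (φ : Γ →* Γ') (i : Fin (d + 2)) :
    faceStabilizer (fun k => φ (ρ k)) i = (faceStabilizer ρ i).map φ := by
  rw [faceStabilizer, faceStabilizer, MonoidHom.map_closure]
  congr 1
  ext g
  constructor
  · rintro ⟨k, hk, rfl⟩
    exact ⟨_, ⟨k, hk, rfl⟩, rfl⟩
  · rintro ⟨_, ⟨k, hk, rfl⟩, rfl⟩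
    exact ⟨k, hk, rfl⟩

/-- The map of faces induced by a homomorphism. -/
def faceMap (φ : Γ →* Γ') (F : Face ρ) : Face (fun k => φ (ρ k)) :=
  ⟨F.1, Quotient.map' φ (fun a b h => by
    rw [QuotientGroup.leftRel_apply] at h ⊢
    rw [faceStabilizer_comp, ← map_inv, ← map_mul]
    exact Subgroup.mem_map_of_mem φ h) F.2⟩

theorem faceMap_mk (φ : Γ →* Γ') (i : Fin (d + 2)) (g : Γ) :
    faceMap φ (⟨i, (g : Γ ⧸ faceStabilizer ρ i)⟩ : Face ρ) =
      ⟨i, (φ g : Γ' ⧸ faceStabilizer (fun k => φ (ρ k)) i)⟩ := rfl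

theorem faceMap_smul (φ : Γ →* Γ') (g : Γ) (F : Face ρ) :
    faceMap φ (g • F) = φ g • faceMap φ F := by
  obtain ⟨h, hh⟩ := face_exists_rep F
  rw [hh, faceMap_mk]
  change faceMap φ (⟨F.1, ((g * h : Γ) : Γ ⧸ faceStabilizer ρ F.1)⟩ : Face ρ) = _
  rw [faceMap_mk, map_mul]
  rfl

/-- If the faces of `a` and `b` have the same image, then `φ(a)⁻¹ φ(b) = φ(c)` with `c` in the face
stabilizer, and `a c b⁻¹` is an element of the kernel that carries the one face to the other. -/
theorem faceMap_eq_iff (φ : Γ →* Γ') (F F' : Face ρ) :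
    faceMap φ F = faceMap φ F' ↔ QuotientFace.mk ρ φ.ker F = QuotientFace.mk ρ φ.ker F' := by
  constructor
  · intro h
    obtain ⟨a, ha⟩ := face_exists_rep F
    obtain ⟨b, hb⟩ := face_exists_rep F'
    have hr : F'.1 = F.1 := (congrArg Sigma.fst h).symm
    rw [hr] at hb
    rw [ha, hb, faceMap_mk, faceMap_mk, face_eq_iff, faceStabilizer_comp] at h
    obtain ⟨c, hc, hc'⟩ := h
    refine Quotient.sound ?_
    change F ∈ MulAction.orbit φ.ker F'
    refine ⟨⟨a * c * b⁻¹, ?_⟩, ?_⟩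
    · rw [MonoidHom.mem_ker, map_mul, map_mul, hc', map_inv]
      group
    · change (a * c * b⁻¹) • F' = F
      rw [ha, hb]
      change (⟨F.1, ((a * c * b⁻¹ * b : Γ) : Γ ⧸ faceStabilizer ρ F.1)⟩ : Face ρ) = _
      rw [face_eq_iff]
      have : (a * c * b⁻¹ * b)⁻¹ * a = c⁻¹ := by group
      rw [this]
      exact inv_mem hc
  · intro h
    obtain ⟨⟨l, hl⟩, rfl⟩ := Quotient.exact h
    change faceMap φ (l • F') = _
    rw [faceMap_smul, MonoidHom.mem_ker.1 hl, one_smul]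

/-- The quotient of a coset polytope by the kernel of an epimorphism is the coset polytope of the
image. -/
def quotientFaceIso (φ : Γ →* Γ') (hφ : Function.Surjective φ) (ρ : Fin d → Γ) :
    quotientLE ρ φ.ker ≃r faceLE (fun k => φ (ρ k)) where
  toEquiv := Equiv.ofBijective
    (Quotient.lift (faceMap φ) fun F F' h => (faceMap_eq_iff φ F F').2 (Quotient.sound h)) <| by
    constructor
    · rintro ⟨F⟩ ⟨F'⟩ h
      exact (faceMap_eq_iff φ F F').1 h
    · intro F
      obtain ⟨g, hg⟩ := face_exists_rep F
      obtain ⟨h, rfl⟩ := hφ g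
      exact ⟨QuotientFace.mk ρ φ.ker ⟨F.1, (h : Γ ⧸ faceStabilizer ρ F.1)⟩, hg.symm⟩
  map_rel_iff' := by
    rintro ⟨F⟩ ⟨F'⟩
    constructor
    · rintro ⟨hr, g, h1, h2⟩
      obtain ⟨g, rfl⟩ := hφ g
      refine ⟨⟨F.1, (g : Γ ⧸ faceStabilizer ρ F.1)⟩, ⟨F'.1, (g : Γ ⧸ faceStabilizer ρ F'.1)⟩,
        (faceMap_eq_iff φ _ _).1 ?_, (faceMap_eq_iff φ _ _).1 ?_, hr, g, rfl, rfl⟩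
      · rw [faceMap_mk]
        exact Sigma.ext rfl (heq_of_eq h1)
      · rw [faceMap_mk]
        exact Sigma.ext rfl (heq_of_eq h2)
    · rintro ⟨F₁, F₂, h1, h2, hr, g, h3, h4⟩
      have e1 : faceMap φ F = faceMap φ F₁ := (faceMap_eq_iff φ _ _).2 h1.symm
      have e2 : faceMap φ F' = faceMap φ F₂ := (faceMap_eq_iff φ _ _).2 h2.symm
      change faceLE _ (faceMap φ F) (faceMap φ F')
      rw [e1, e2]
      obtain ⟨i, x⟩ := F₁
      obtain ⟨k, y⟩ := F₂
      dsimp only at h3 h4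
      subst h3 h4
      exact ⟨hr, φ g, rfl, rfl⟩

/-- If the images of `ρ` under an epimorphism `φ` form a string C-group, then the automorphism
group of the quotient of the coset polytope by `ker φ` is the image of `φ`. -/
theorem exists_mulEquiv_quotientAut (φ : Γ →* Γ') (hφ : Function.Surjective φ)
    (hC : IsStringCGroup (fun k => φ (ρ k))) :
    ∃ Φ : Γ' ≃* QuotientAut ρ φ.ker, ∀ (g : Γ) (F : Face ρ),
      Φ (φ g) (QuotientFace.mk ρ φ.ker F) = QuotientFace.mk ρ φ.ker (g • F) := by
  let e := quotientFaceIso φ hφ ρ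
  -- Conjugation by the isomorphism between the quotient poset and the coset polytope of the image.
  let Ψ : (faceLE (fun k => φ (ρ k)) ≃r faceLE (fun k => φ (ρ k))) ≃* QuotientAut ρ φ.ker :=
    { toFun := fun α => (e.trans α).trans e.symm
      invFun := fun α => (e.symm.trans α).trans e
      left_inv := fun α => RelIso.ext fun F => by simp
      right_inv := fun α => RelIso.ext fun F => by simp
      map_mul' := fun α β => RelIso.ext fun F => by simp [RelIso.mul_apply] }
  refine ⟨(MulEquiv.ofBijective _ hC.faceAction_bijective).trans Ψ, fun g F => ?_⟩
  change e.symm (φ g • e (QuotientFace.mk ρ φ.ker F)) = _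
  rw [RelIso.symm_apply_eq]
  change φ g • faceMap φ F = faceMap φ (g • F)
  rw [faceMap_smul]

end StringCGroup
end

noncomputable section

/-! ### Eichler transformations -/

section Eichler

variable {V : Type*} [AddCommGroup V] [Module ℝ V] (B : LinearMap.BilinForm ℝ V) (c : V)

/-- The Eichler transformation of the isotropic vector `c` and of `z`. -/
def eichler (z x : V) : V := x + B c x • z - (B z x + B z z * B c x / 2) • c

variable {B c}

theorem eichler_zero (x : V) : eichler B c 0 x = x := by simp [eichler]

/-- The term `B z z / 2` is what makes this hold: its polarization absorbs the product of `z` and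
`w` that arises in the composition. -/
theorem eichler_add (hB : ∀ x y, B x y = B y x) (hc : B c c = 0) {z w : V} (hz : B c z = 0)
    (hw : B c w = 0) (x : V) : eichler B c (z + w) x = eichler B c z (eichler B c w x) := by
  have hz' : B z c = 0 := by rw [hB, hz]
  simp only [eichler, map_add, map_sub, map_smul, LinearMap.add_apply, hc, hw, hz', smul_eq_mul,
    hB w z]
  module

/-- The formula involves only the form, `c` and `z`. This is how the point group acts on translation
vectors. -/
theorem eichler_conj {B : LinearMap.BilinForm ℝ V} {g : V →ₗ[ℝ] V} {c : V}
    (hg : ∀ x y, B (g x) (g y) = B x y) (hgc : g c = c) (z x : V) :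
    g (eichler B c z x) = eichler B c (g z) (g x) := by
  have : B c (g x) = B c x := by rw [← hg c x, hgc]
  simp only [eichler, map_add, map_sub, map_smul, hg, this, hgc]

/-- The roots `b` and `c - b` add up to a null vector orthogonal to `b`, so their mirrors are
parallel and the product of the reflections is a translation. -/
theorem reflection_mul_reflection (hB : ∀ x y, B x y = B y x) (hc : B c c = 0) {b : V}
    (hcb : B c b = 0) (hb : B b b = 2) (x : V) :
    (x - B (c - b) x • (c - b)) - B b (x - B (c - b) x • (c - b)) • b =
      eichler B c (c - b) x := by
  have hbc : B b c = 0 := by rw [hB, hcb]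
  simp only [eichler, map_sub, map_smul, LinearMap.sub_apply, hc, hcb, hbc, hb, smul_eq_mul]
  module

/-- On the span `W`, which is orthogonal to `c`, a translation is a transvection; the other terms
are seen only by the neighbouring nodes. -/
theorem eichler_of_orthogonal (z : V) {x : V} (hx : B c x = 0) :
    eichler B c z x = x - B z x • c := by
  simp [eichler, hx]

end Eichler

/-! ### Integrality and reduction modulo `s` -/

/-- The vectors all of whose coordinates are integral multiples of `s`. -/
def multiples (n s : ℕ) : AddSubgroup (Fin n → ℝ) where
  carrier := {v | ∀ k, ∃ d : ℤ, v k = s * d}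
  zero_mem' k := ⟨0, by simp⟩
  add_mem' := by
    intro v w hv hw k
    obtain ⟨a, ha⟩ := hv k
    obtain ⟨b, hb⟩ := hw k
    exact ⟨a + b, by simp [ha, hb, mul_add]⟩
  neg_mem' := by
    intro v hv k
    obtain ⟨a, ha⟩ := hv k
    exact ⟨-a, by simp [ha]⟩

theorem mem_multiples {n s : ℕ} {v : Fin n → ℝ} :
    v ∈ multiples n s ↔ ∀ k, ∃ d : ℤ, v k = s * d := Iff.rfl

theorem smul_mem_multiples {n s : ℕ} {v : Fin n → ℝ} (hv : v ∈ multiples n 1) {a : ℝ}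
    (ha : ∃ d : ℤ, a = s * d) : a • v ∈ multiples n s := by
  intro k
  obtain ⟨d, rfl⟩ := ha
  obtain ⟨e, he⟩ := hv k
  exact ⟨d * e, by simp [he]; ring⟩

theorem int_smul_mem_multiples {n s : ℕ} {v : Fin n → ℝ} (hv : v ∈ multiples n s) {a : ℝ}
    (ha : ∃ d : ℤ, a = d) : a • v ∈ multiples n s := by
  intro k
  obtain ⟨d, rfl⟩ := ha
  obtain ⟨e, he⟩ := hv k
  exact ⟨d * e, by simp [he]; ring⟩

theorem single_mem_multiples {n : ℕ} (i : Fin n) :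
    (Pi.single i 1 : Fin n → ℝ) ∈ multiples n 1 := by
  intro k
  by_cases h : k = i
  · subst h; exact ⟨1, by simp⟩
  · exact ⟨0, by simp [h]⟩

/-- The action of an integral matrix on `ℝ ^ n`. -/
def realAct {n : ℕ} (g : Matrix.GeneralLinearGroup (Fin n) ℤ) : (Fin n → ℝ) →ₗ[ℝ] (Fin n → ℝ) :=
  (changeRing n ℝ g).val.mulVecLin

section RealAct

variable {n : ℕ}

theorem realAct_one (x : Fin n → ℝ) : realAct 1 x = x := by simp [realAct]

theorem realAct_mul (g h : Matrix.GeneralLinearGroup (Fin n) ℤ) (x : Fin n → ℝ) :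
    realAct (g * h) x = realAct g (realAct h x) := by
  simp [realAct]

theorem realAct_inv_self (g : Matrix.GeneralLinearGroup (Fin n) ℤ) (x : Fin n → ℝ) :
    realAct g⁻¹ (realAct g x) = x := by
  rw [← realAct_mul, inv_mul_cancel, realAct_one]

theorem realAct_self_inv (g : Matrix.GeneralLinearGroup (Fin n) ℤ) (x : Fin n → ℝ) :
    realAct g (realAct g⁻¹ x) = x := by
  rw [← realAct_mul, mul_inv_cancel, realAct_one]

theorem realAct_single_apply (g : Matrix.GeneralLinearGroup (Fin n) ℤ) (i k : Fin n) :
    realAct g (Pi.single i 1) k = g.val k i := by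
  simp [realAct, changeRing]

theorem realAct_injective {g h : Matrix.GeneralLinearGroup (Fin n) ℤ}
    (H : ∀ x, realAct g x = realAct h x) : g = h := by
  refine Units.ext (Matrix.ext fun k i => ?_)
  have := congrFun (H (Pi.single i 1)) k
  rw [realAct_single_apply, realAct_single_apply] at this
  exact_mod_cast this

/-- Reduction modulo `s` is expressed by real vectors with coordinates in `s ℤ`, so that the form,
which need not be integral, and the congruences live in the same space. -/
theorem changeRing_mulVec_single_eq_iff (s : ℕ) (g h : Matrix.GeneralLinearGroup (Fin n) ℤ)
    (i : Fin n) :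
    (changeRing n (ZMod s) g).val *ᵥ Pi.single i 1 =
      (changeRing n (ZMod s) h).val *ᵥ Pi.single i 1 ↔
      realAct g (Pi.single i 1) - realAct h (Pi.single i 1) ∈ multiples n s := by
  rw [mem_multiples, funext_iff]
  refine forall_congr' fun k => ?_
  rw [Pi.sub_apply, realAct_single_apply, realAct_single_apply]
  have h1 : ∀ g : Matrix.GeneralLinearGroup (Fin n) ℤ,
      ((changeRing n (ZMod s) g).val *ᵥ Pi.single i 1) k = ((g.val k i : ℤ) : ZMod s) := by
    intro g
    simp [changeRing]
  rw [h1, h1, eq_comm, ZMod.intCast_eq_intCast_iff_dvd_sub]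
  constructor
  · rintro ⟨d, hd⟩
    exact ⟨d, by exact_mod_cast hd⟩
  · rintro ⟨d, hd⟩
    exact ⟨d, by exact_mod_cast hd⟩

theorem changeRing_eq_iff (s : ℕ) (g h : Matrix.GeneralLinearGroup (Fin n) ℤ) :
    changeRing n (ZMod s) g = changeRing n (ZMod s) h ↔
      ∀ i, realAct g (Pi.single i 1) - realAct h (Pi.single i 1) ∈ multiples n s := by
  simp only [← changeRing_mulVec_single_eq_iff]
  exact ⟨fun h i => by rw [h], fun h => Units.ext (Matrix.ext_of_mulVec_single h)⟩

theorem changeRing_eq_one_iff (s : ℕ) (g : Matrix.GeneralLinearGroup (Fin n) ℤ) :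
    changeRing n (ZMod s) g = 1 ↔
      ∀ i, realAct g (Pi.single i 1) - Pi.single i 1 ∈ multiples n s := by
  rw [← map_one (changeRing n (ZMod s)), changeRing_eq_iff]
  simp only [realAct_one]

theorem mem_rootSpan_iff {R : Type} [CommRing R] {a b : ℕ} {x : Fin n → R} :
    x ∈ rootSpan n R a b ↔ ∀ k : Fin n, ¬ (a ≤ (k : ℕ) ∧ (k : ℕ) ≤ b) → x k = 0 := by
  constructor
  · intro hx
    induction hx using Submodule.span_induction with
    | mem x hx =>
      obtain ⟨i, h1, h2, rfl⟩ := hx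
      intro k hk
      rw [Pi.single_apply, if_neg]
      rintro rfl
      exact hk ⟨h1, h2⟩
    | zero => simp
    | add x y _ _ hx hy => intro k hk; simp [hx k hk, hy k hk]
    | smul r x _ hx => intro k hk; simp [hx k hk]
  · intro hx
    have : x = ∑ k, x k • (Pi.single k 1 : Fin n → R) := by
      ext l
      simp [Finset.sum_apply, Pi.single_apply]
    rw [this]
    refine Submodule.sum_mem _ fun k _ => ?_
    by_cases hk : a ≤ (k : ℕ) ∧ (k : ℕ) ≤ b
    · exact Submodule.smul_mem _ _ (Submodule.subset_span ⟨k, hk.1, hk.2, rfl⟩)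
    · simp [hx k hk]

theorem single_mem_rootSpan {R : Type} [CommRing R] {a b : ℕ} {i : Fin n} (h : a ≤ (i : ℕ))
    (h' : (i : ℕ) ≤ b) : (Pi.single i 1 : Fin n → R) ∈ rootSpan n R a b :=
  Submodule.subset_span ⟨i, h, h', rfl⟩

theorem rootSpan_mono {R : Type} [CommRing R] {a b a' b' : ℕ} (h : a' ≤ a) (h' : b ≤ b') :
    rootSpan n R a b ≤ rootSpan n R a' b' := by
  refine Submodule.span_mono ?_
  rintro _ ⟨i, h1, h2, rfl⟩
  exact ⟨i, h.trans h1, h2.trans h', rfl⟩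

theorem sum_single_eq (x : Fin n → ℝ) : x = ∑ k, x k • (Pi.single k 1 : Fin n → ℝ) := by
  ext l
  simp [Finset.sum_apply, Pi.single_apply]

end RealAct

/-! ### The invariant form -/

namespace StringBasicSystem

variable {n : ℕ} (D : StringBasicSystem n)

/-- The symmetry of the Gram matrix, checked for each kind of branch. -/
theorem cartan_mul_label (i k : Fin n) :
    (D.cartan i k : ℝ) * D.label i = D.cartan k i * D.label k := by
  have key : ∀ i k : Fin n, (i : ℕ) < k →
      (D.cartan i k : ℝ) * D.label i = D.cartan k i * D.label k := by
    intro i k h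
    by_cases h2 : (i : ℕ) + 2 ≤ k
    · obtain ⟨h, h'⟩ := D.cartan_far i k h2
      simp [h, h']
    · have := D.cartan_near i k (by omega)
      simp only [AdmissiblePair] at this
      rcases this with (⟨h, h'⟩ | ⟨h, h', h''⟩ | ⟨h, h', h''⟩ | ⟨h, h', h''⟩ | ⟨h, h', h''⟩ |
        ⟨h, h', h''⟩) | (⟨h, h'⟩ | ⟨h, h', h''⟩ | ⟨h, h', h''⟩ | ⟨h, h', h''⟩ | ⟨h, h', h''⟩ |
        ⟨h, h', h''⟩) <;> simp [*]
  rcases lt_trichotomy (i : ℕ) k with h | h | h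
  · exact key i k h
  · rw [Fin.ext h]
  · exact (key k i h).symm

/-- The invariant form, scaled so that `b o ⬝ b o = 2`. -/
def nform (o : Fin n) : LinearMap.BilinForm ℝ (Fin n → ℝ) := (2 / D.label o) • D.form

variable (o : Fin n)

theorem form_eq_nform (x y : Fin n → ℝ) : D.form x y = D.label o / 2 * D.nform o x y := by
  have := (D.label_pos o).ne'
  simp only [nform, LinearMap.smul_apply, smul_eq_mul]
  field_simp

theorem nform_single (i k : Fin n) : D.nform o (Pi.single i 1) (Pi.single k 1) =
    -(D.cartan i k : ℝ) * (D.label i / D.label o) := by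
  simp only [nform, LinearMap.smul_apply, form, Matrix.toBilin'_single, Matrix.of_apply,
    smul_eq_mul]
  ring

theorem nform_single_left (i : Fin n) (x : Fin n → ℝ) : D.nform o (Pi.single i 1) x =
    -(∑ k, (D.cartan i k : ℝ) * x k) * (D.label i / D.label o) := by
  conv_lhs => rw [sum_single_eq x]
  simp only [map_sum, map_smul, nform_single, smul_eq_mul]
  rw [← Finset.sum_neg_distrib, Finset.sum_mul]
  exact Finset.sum_congr rfl fun k _ => by ring

theorem nform_symm (x y : Fin n → ℝ) : D.nform o x y = D.nform o y x := by
  conv_lhs => rw [sum_single_eq x, sum_single_eq y]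
  conv_rhs => rw [sum_single_eq x, sum_single_eq y]
  simp only [map_sum, map_smul, LinearMap.sum_apply, LinearMap.smul_apply, nform_single,
    smul_eq_mul, Finset.mul_sum]
  rw [Finset.sum_comm]
  refine Finset.sum_congr rfl fun k _ => Finset.sum_congr rfl fun l _ => ?_
  have h1 : (D.cartan l k : ℝ) * (D.label l / D.label o) =
      D.cartan k l * (D.label k / D.label o) := by
    rw [← mul_div_assoc, D.cartan_mul_label, mul_div_assoc]
  linear_combination (y l * x k) * h1

theorem realAct_r (i : Fin n) (x : Fin n → ℝ) : realAct (D.r i) x =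
    x + (∑ k, (D.cartan i k : ℝ) * x k) • Pi.single i 1 := by
  have e : (changeRing n ℝ (D.r i)).val =
      1 + Matrix.vecMulVec (Pi.single i 1) (fun k => (D.cartan i k : ℝ)) := by
    ext p q
    simp [changeRing, r, reflMatrix, Matrix.vecMulVec_apply, Matrix.one_apply, Pi.single_apply]
  rw [realAct, Matrix.mulVecLin_apply, e, Matrix.add_mulVec, Matrix.one_mulVec,
    Matrix.vecMulVec_mulVec, op_smul_eq_smul]
  rfl

theorem realAct_r_eq_sub (i : Fin n) (x : Fin n → ℝ) : realAct (D.r i) x =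
    x - (D.label o / D.label i * D.nform o (Pi.single i 1) x) • Pi.single i 1 := by
  rw [realAct_r, nform_single_left]
  have h1 := (D.label_pos o).ne'
  have h2 := (D.label_pos i).ne'
  rw [sub_eq_add_neg, ← neg_smul]
  congr 2
  field_simp

theorem realAct_r_single (i k : Fin n) : realAct (D.r i) (Pi.single k 1) =
    Pi.single k 1 + (D.cartan i k : ℝ) • Pi.single i 1 := by
  rw [realAct_r]
  simp [Pi.single_apply]

theorem realAct_r_apply_of_ne {i k : Fin n} (h : k ≠ i) (x : Fin n → ℝ) :
    realAct (D.r i) x k = x k := by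
  rw [realAct_r]
  simp [h]

theorem nform_r (i : Fin n) (x y : Fin n → ℝ) :
    D.nform o (realAct (D.r i) x) (realAct (D.r i) y) = D.nform o x y := by
  have h1 := (D.label_pos o).ne'
  have h2 := (D.label_pos i).ne'
  have h3 : D.nform o (Pi.single i 1) (Pi.single i 1) = 2 * (D.label i / D.label o) := by
    rw [nform_single, cartan_self]; norm_num
  simp only [realAct_r_eq_sub D o, map_sub, map_smul, LinearMap.sub_apply, LinearMap.smul_apply,
    smul_eq_mul, h3, D.nform_symm o x (Pi.single i 1)]
  field_simp
  ring

theorem r_mem_parabolic {a b : ℕ} {i : Fin n} (h : a ≤ (i : ℕ)) (h' : (i : ℕ) ≤ b) :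
    D.r i ∈ D.parabolic a b :=
  Subgroup.subset_closure ⟨i, h, h', rfl⟩

/-- An induction principle for the subgroups `⟨r a, …, r b⟩`. -/
theorem parabolic_induction {a b : ℕ} {P : ∀ g, g ∈ D.parabolic a b → Prop}
    (one : P 1 (one_mem _)) (mul : ∀ (i : Fin n) (h : a ≤ (i : ℕ)) (h' : (i : ℕ) ≤ b) (g)
      (hg : g ∈ D.parabolic a b), P g hg →
      P (D.r i * g) (mul_mem (D.r_mem_parabolic h h') hg))
    {g : Matrix.GeneralLinearGroup (Fin n) ℤ} (hg : g ∈ D.parabolic a b) : P g hg := by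
  induction hg using Subgroup.closure_induction_left with
  | one => exact one
  | mul_left x hx y hy ih =>
    obtain ⟨i, h1, h2, rfl⟩ := hx
    exact mul i h1 h2 y hy ih
  | inv_mul_cancel x hx y hy ih =>
    obtain ⟨i, h1, h2, rfl⟩ := hx
    simp only [r_inv]
    exact mul i h1 h2 y hy ih

theorem parabolic_mono {a b a' b' : ℕ} (h : a' ≤ a) (h' : b ≤ b') :
    D.parabolic a b ≤ D.parabolic a' b' := by
  refine Subgroup.closure_mono ?_
  rintro _ ⟨i, h1, h2, rfl⟩
  exact ⟨i, h.trans h1, h2.trans h', rfl⟩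

theorem nform_parabolic {a b : ℕ} {g : Matrix.GeneralLinearGroup (Fin n) ℤ}
    (hg : g ∈ D.parabolic a b) (x y : Fin n → ℝ) :
    D.nform o (realAct g x) (realAct g y) = D.nform o x y := by
  induction hg using D.parabolic_induction with
  | one => simp [realAct_one]
  | mul i _ _ g _ ih => rw [realAct_mul, realAct_mul, nform_r, ih]

theorem realAct_apply_of_notMem {a b : ℕ} {g : Matrix.GeneralLinearGroup (Fin n) ℤ}
    (hg : g ∈ D.parabolic a b) {k : Fin n} (hk : ¬ (a ≤ (k : ℕ) ∧ (k : ℕ) ≤ b)) (x : Fin n → ℝ) :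
    realAct g x k = x k := by
  induction hg using D.parabolic_induction with
  | one => simp [realAct_one]
  | mul i h1 h2 g _ ih =>
    rw [realAct_mul, realAct_r_apply_of_ne, ih]
    rintro rfl
    exact hk ⟨h1, h2⟩

theorem realAct_mem_rootSpan {a b a' b' : ℕ} (ha : a' ≤ a) (hb : b ≤ b')
    {g : Matrix.GeneralLinearGroup (Fin n) ℤ}
    (hg : g ∈ D.parabolic a b) {x : Fin n → ℝ} (hx : x ∈ rootSpan n ℝ a' b') :
    realAct g x ∈ rootSpan n ℝ a' b' :=
  D.parabolic_mulVec_mem (D.parabolic_mono ha hb hg) x hx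

/-- A reflection `r i` changes only the coordinate at `i`. This separates parabolic subgroups in the
intersection property. -/
theorem realAct_apply_of_mem_closure {I : Set (Fin n)} {g : Matrix.GeneralLinearGroup (Fin n) ℤ}
    (hg : g ∈ Subgroup.closure (D.r '' I)) {k : Fin n} (hk : k ∉ I) (x : Fin n → ℝ) :
    realAct g x k = x k := by
  have step : ∀ i ∈ I, ∀ y, realAct (D.r i) y k = y k := by
    intro i hi y
    refine D.realAct_r_apply_of_ne ?_ y
    rintro rfl
    exact hk hi
  induction hg using Subgroup.closure_induction_left with
  | one => simp [realAct_one]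
  | mul_left g hg y _ ih => obtain ⟨i, hi, rfl⟩ := hg; rw [realAct_mul, step i hi, ih]
  | inv_mul_cancel g hg y _ ih =>
    obtain ⟨i, hi, rfl⟩ := hg; rw [r_inv, realAct_mul, step i hi, ih]

/-- The lattice spanned by the orbit of `z` under `⟨r a, …, r b⟩`. -/
def orbitLattice (a b : ℕ) (z : Fin n → ℝ) : AddSubgroup (Fin n → ℝ) :=
  AddSubgroup.closure {v | ∃ h ∈ D.parabolic a b, v = realAct h z}

variable {D}

theorem self_mem_orbitLattice (a b : ℕ) (z : Fin n → ℝ) : z ∈ D.orbitLattice a b z :=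
  AddSubgroup.subset_closure ⟨1, one_mem _, (realAct_one z).symm⟩

theorem realAct_mem_orbitLattice {a b : ℕ} {z v : Fin n → ℝ} (hv : v ∈ D.orbitLattice a b z)
    {g : Matrix.GeneralLinearGroup (Fin n) ℤ} (hg : g ∈ D.parabolic a b) :
    realAct g v ∈ D.orbitLattice a b z := by
  induction hv using AddSubgroup.closure_induction with
  | mem v hv =>
    obtain ⟨h, hh, rfl⟩ := hv
    exact AddSubgroup.subset_closure ⟨g * h, mul_mem hg hh, (realAct_mul _ _ _).symm⟩
  | zero => simp
  | add v w _ _ hv hw => rw [map_add]; exact add_mem hv hw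
  | neg v _ hv => rw [map_neg]; exact neg_mem hv

theorem orbitLattice_le {a b : ℕ} {z : Fin n → ℝ} {A : AddSubgroup (Fin n → ℝ)} (hz : z ∈ A)
    (hA : ∀ i : Fin n, a ≤ (i : ℕ) → (i : ℕ) ≤ b → ∀ v ∈ A, realAct (D.r i) v ∈ A) :
    D.orbitLattice a b z ≤ A := by
  rw [orbitLattice, AddSubgroup.closure_le]
  rintro _ ⟨h, hh, rfl⟩
  induction hh using D.parabolic_induction with
  | one => rwa [realAct_one]
  | mul i h1 h2 g _ ih => rw [realAct_mul]; exact hA i h1 h2 _ ih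

theorem mem_rootSpan_of_mem_orbitLattice {a b : ℕ} {z v : Fin n → ℝ}
    (hz : z ∈ rootSpan n ℝ a b) (hv : v ∈ D.orbitLattice a b z) : v ∈ rootSpan n ℝ a b := by
  refine orbitLattice_le (A := (rootSpan n ℝ a b).toAddSubgroup) hz ?_ hv
  intro i h1 h2 w hw
  exact D.realAct_mem_rootSpan le_rfl le_rfl (D.r_mem_parabolic h1 h2) hw

end StringBasicSystem
end

noncomputable section

/-! ### Euclidean subgroups: translations and point group -/

namespace StringBasicSystem

variable {n : ℕ}

theorem mem_rootSpan_of_succ_le {j b : ℕ} {x : Fin n → ℝ} (hx : x ∈ rootSpan n ℝ (j + 1) b) :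
    x ∈ rootSpan n ℝ j b := rootSpan_mono (by omega) le_rfl hx

theorem nform_self (D : StringBasicSystem n) (o : Fin n) :
    D.nform o (Pi.single o 1) (Pi.single o 1) = 2 := by
  have := (D.label_pos o).ne'
  rw [nform_single, cartan_self]
  field_simp
  norm_num

theorem parabolic_succ_le (D : StringBasicSystem n) {j b : ℕ} :
    D.parabolic (j + 1) b ≤ D.parabolic j b :=
  D.parabolic_mono (by omega) le_rfl

/-- `c` is the null vector of the Euclidean group `⟨r j, …, r (j + m)⟩`, normalized at node `j`,
and `r'` is the reflection in the point group `⟨r (j + 1), …, r (j + m)⟩` whose mirror is parallel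
to that of `r j`. -/
structure IsNullRoot (D : StringBasicSystem n) (j m : ℕ) (o : Fin n) (c : Fin n → ℝ)
    (r' : Matrix.GeneralLinearGroup (Fin n) ℤ) : Prop where
  val_o : (o : ℕ) = j
  lt : j + m < n
  mem : c ∈ rootSpan n ℝ j (j + m)
  coord : c o = 1
  integral : c ∈ multiples n 1
  ne_zero : ∀ i : Fin n, j ≤ (i : ℕ) → (i : ℕ) ≤ j + m → c i ≠ 0
  orth : ∀ i : Fin n, j ≤ (i : ℕ) → (i : ℕ) ≤ j + m → D.nform o c (Pi.single i 1) = 0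
  nondeg : ∀ x ∈ rootSpan n ℝ (j + 1) (j + m),
    (∀ i : Fin n, j + 1 ≤ (i : ℕ) → (i : ℕ) ≤ j + m → D.nform o x (Pi.single i 1) = 0) → x = 0
  refl_mem : r' ∈ D.parabolic (j + 1) (j + m)
  refl_act : ∀ x, realAct r' x = x - D.nform o (c - Pi.single o 1) x • (c - Pi.single o 1)

variable {D : StringBasicSystem n} {j m : ℕ} {o : Fin n} {c : Fin n → ℝ}
  {r' : Matrix.GeneralLinearGroup (Fin n) ℤ}

namespace IsNullRoot

theorem orth_mem (N : IsNullRoot D j m o c r')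
    {x : Fin n → ℝ} (hx : x ∈ rootSpan n ℝ j (j + m)) : D.nform o c x = 0 := by
  induction hx using Submodule.span_induction with
  | mem x hx => obtain ⟨i, h1, h2, rfl⟩ := hx; exact N.orth i h1 h2
  | zero => simp
  | add x y _ _ hx hy => simp [hx, hy]
  | smul a x _ hx => simp [hx]

theorem isotropic (N : IsNullRoot D j m o c r') : D.nform o c c = 0 := N.orth_mem N.mem

theorem single_mem (N : IsNullRoot D j m o c r')
    : (Pi.single o 1 : Fin n → ℝ) ∈ rootSpan n ℝ j (j + m) :=
  single_mem_rootSpan N.val_o.ge (by have := N.val_o; omega)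

theorem root_mem (N : IsNullRoot D j m o c r')
    : c - Pi.single o 1 ∈ rootSpan n ℝ (j + 1) (j + m) := by
  rw [mem_rootSpan_iff]
  intro k hk
  by_cases hko : k = o
  · subst hko
    simp [N.coord]
  · have h := mem_rootSpan_iff.1 N.mem k (fun h => hk ⟨?_, h.2⟩)
    · simp [hko, h]
    · have h1 := h.1
      have h2 := N.val_o
      have h3 : (k : ℕ) ≠ o := fun h => hko (Fin.ext h)
      omega

theorem apply_o (N : IsNullRoot D j m o c r')
    {x : Fin n → ℝ} (hx : x ∈ rootSpan n ℝ (j + 1) (j + m)) : x o = 0 :=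
  mem_rootSpan_iff.1 hx o (by have := N.val_o; omega)

theorem nondeg' (N : IsNullRoot D j m o c r')
    {x : Fin n → ℝ} (hx : x ∈ rootSpan n ℝ (j + 1) (j + m))
    (h : ∀ y ∈ rootSpan n ℝ (j + 1) (j + m), D.nform o x y = 0) : x = 0 :=
  N.nondeg x hx fun _ h1 h2 => h _ (single_mem_rootSpan h1 h2)

theorem fix (N : IsNullRoot D j m o c r')
    {g : Matrix.GeneralLinearGroup (Fin n) ℤ} (hg : g ∈ D.parabolic j (j + m)) :
    realAct g c = c := by
  induction hg using D.parabolic_induction with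
  | one => exact realAct_one c
  | mul i h1 h2 g _ ih =>
    rw [realAct_mul, ih, D.realAct_r_eq_sub o, D.nform_symm, N.orth i h1 h2]
    simp

theorem r_mem (N : IsNullRoot D j m o c r') : D.r o ∈ D.parabolic j (j + m) :=
  D.r_mem_parabolic N.val_o.ge (by have := N.val_o; omega)

/-- The first standard translation `t₁`, realized on all of `ℝ ^ n`. -/
theorem realAct_r_mul (N : IsNullRoot D j m o c r') (x : Fin n → ℝ) :
    realAct (D.r o * r') x = eichler (D.nform o) c (c - Pi.single o 1) x := by
  rw [realAct_mul, D.realAct_r_eq_sub o, div_self (D.label_pos o).ne', one_mul, N.refl_act]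
  exact reflection_mul_reflection (D.nform_symm o) N.isotropic (N.orth_mem N.single_mem)
    (D.nform_self o) x

theorem eichler_add' (N : IsNullRoot D j m o c r')
    {z w : Fin n → ℝ} (hz : z ∈ rootSpan n ℝ (j + 1) (j + m))
    (hw : w ∈ rootSpan n ℝ (j + 1) (j + m)) (x : Fin n → ℝ) :
    eichler (D.nform o) c (z + w) x = eichler (D.nform o) c z (eichler (D.nform o) c w x) :=
  eichler_add (D.nform_symm o) N.isotropic (N.orth_mem (mem_rootSpan_of_succ_le hz))
    (N.orth_mem (mem_rootSpan_of_succ_le hw)) x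

theorem eichler_conj' (N : IsNullRoot D j m o c r')
    {g : Matrix.GeneralLinearGroup (Fin n) ℤ} (hg : g ∈ D.parabolic j (j + m))
    (z x : Fin n → ℝ) : realAct g (eichler (D.nform o) c z x) =
      eichler (D.nform o) c (realAct g z) (realAct g x) :=
  eichler_conj (D.nform_parabolic o hg) (N.fix hg) z x

theorem eichler_eq (N : IsNullRoot D j m o c r')
    {z x : Fin n → ℝ} (hx : x ∈ rootSpan n ℝ j (j + m)) :
    eichler (D.nform o) c z x = x - D.nform o z x • c :=
  eichler_of_orthogonal z (N.orth_mem hx)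

theorem mem_rootSpan (N : IsNullRoot D j m o c r')
    {z₀ z : Fin n → ℝ} (hz₀ : z₀ ∈ D.orbitLattice (j + 1) (j + m)
    (c - Pi.single o 1)) (hz : z ∈ D.orbitLattice (j + 1) (j + m) z₀) :
    z ∈ rootSpan n ℝ (j + 1) (j + m) :=
  mem_rootSpan_of_mem_orbitLattice (mem_rootSpan_of_mem_orbitLattice N.root_mem hz₀) hz

/-- The coordinate at `o`, where `c` is `1`, reads off the product of `z` with a vector; on the span
of the roots of `H` the form is nondegenerate. -/
theorem eichler_injective (N : IsNullRoot D j m o c r')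
    {z w : Fin n → ℝ} (hz : z ∈ rootSpan n ℝ (j + 1) (j + m))
    (hw : w ∈ rootSpan n ℝ (j + 1) (j + m))
    (h : ∀ x, eichler (D.nform o) c z x = eichler (D.nform o) c w x) : z = w := by
  rw [← sub_eq_zero]
  refine N.nondeg' (sub_mem hz hw) fun y hy => ?_
  have h1 := congrFun (h y) o
  rw [N.eichler_eq (mem_rootSpan_of_succ_le hy), N.eichler_eq (mem_rootSpan_of_succ_le hy)] at h1
  simp only [Pi.sub_apply, Pi.smul_apply, N.coord, smul_eq_mul, mul_one] at h1
  rw [map_sub, LinearMap.sub_apply]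
  linarith

/-- Induction on a word: a generator in `H` conjugates the translation part, and `r o` is a
translation times an element of `H`. -/
theorem exists_decomposition (N : IsNullRoot D j m o c r') {g : Matrix.GeneralLinearGroup (Fin n) ℤ}
    (hg : g ∈ D.parabolic j (j + m)) :
    ∃ z ∈ D.orbitLattice (j + 1) (j + m) (c - Pi.single o 1),
    ∃ h ∈ D.parabolic (j + 1) (j + m),
      ∀ x, realAct g x = eichler (D.nform o) c z (realAct h x) := by
  induction hg using D.parabolic_induction with
  | one => exact ⟨0, zero_mem _, 1, one_mem _, fun x => by rw [eichler_zero, realAct_one]⟩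
  | mul i h1 h2 g _ ih =>
    obtain ⟨z, hz, h, hh, H⟩ := ih
    rcases Nat.eq_or_lt_of_le h1 with h1' | h1'
    -- Here `r o = (r o * r') * r'⁻¹`, whose first factor is the translation by `c - b o`; then
    -- `r'⁻¹` is moved past the translation by `z`.
    · have hio : i = o := Fin.ext (by rw [N.val_o]; omega)
      subst hio
      have hr' := inv_mem N.refl_mem
      refine ⟨(c - Pi.single i 1) + realAct r'⁻¹ z, add_mem (self_mem_orbitLattice _ _ _)
        (realAct_mem_orbitLattice hz hr'), r'⁻¹ * h, mul_mem hr' hh, fun x => ?_⟩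
      rw [N.eichler_add' N.root_mem (mem_rootSpan_of_mem_orbitLattice N.root_mem
        (realAct_mem_orbitLattice hz hr')), realAct_mul r'⁻¹,
        ← N.eichler_conj' (D.parabolic_succ_le hr'), ← H, ← N.realAct_r_mul, ← realAct_mul,
        ← realAct_mul]
      congr 2
      group
    · have hi := D.r_mem_parabolic (a := j + 1) h1' h2
      refine ⟨realAct (D.r i) z, realAct_mem_orbitLattice hz hi, D.r i * h, mul_mem hi hh,
        fun x => ?_⟩
      rw [realAct_mul, realAct_mul, H, N.eichler_conj' (D.parabolic_succ_le hi)]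

/-- For every `x`, also outside the span of the roots of `H`, the vector `h x - x` lies in this span
and is orthogonal to it, since `h` is an isometry fixing the span pointwise. -/
theorem eq_one_of_fix (N : IsNullRoot D j m o c r') {h : Matrix.GeneralLinearGroup (Fin n) ℤ}
    (hh : h ∈ D.parabolic (j + 1) (j + m))
    (H : ∀ x ∈ rootSpan n ℝ (j + 1) (j + m), realAct h x = x) : h = 1 := by
  refine realAct_injective fun x => ?_
  rw [realAct_one, ← sub_eq_zero]
  refine N.nondeg' ?_ fun y hy => ?_
  · rw [mem_rootSpan_iff]
    intro k hk
    rw [Pi.sub_apply, D.realAct_apply_of_notMem hh hk, sub_self]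
  · rw [map_sub, LinearMap.sub_apply]
    conv_lhs => rw [← H y hy]
    rw [D.nform_parabolic o hh, H y hy, sub_self]

/-- Subtracting `x o • c` from a radical vector leaves a vector in the span of the roots of `H` that
is orthogonal to this span. -/
theorem mem_radical_iff (N : IsNullRoot D j m o c r')
    {x : Fin n → ℝ} : x ∈ D.radical j (j + m) ↔ ∃ a : ℝ, x = a • c := by
  constructor
  · rintro ⟨hx, hx'⟩
    refine ⟨x o, ?_⟩
    rw [← sub_eq_zero]
    have hmem : x - x o • c ∈ rootSpan n ℝ j (j + m) := sub_mem hx (Submodule.smul_mem _ _ N.mem)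
    refine N.nondeg' ?_ fun y hy => ?_
    · rw [mem_rootSpan_iff]
      intro k hk
      by_cases hko : k = o
      · subst hko; simp [N.coord]
      · refine mem_rootSpan_iff.1 hmem k fun h => hk ⟨?_, h.2⟩
        have h1 := h.1
        have h2 := N.val_o
        have h3 : (k : ℕ) ≠ o := fun h => hko (Fin.ext h)
        omega
    · have h1 := hx' y (mem_rootSpan_of_succ_le hy)
      rw [D.form_eq_nform o] at h1
      have h2 : D.nform o x y = 0 := by
        have := (D.label_pos o).ne'
        simpa [this] using h1
      rw [map_sub, LinearMap.sub_apply, h2, map_smul, LinearMap.smul_apply,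
        N.orth_mem (mem_rootSpan_of_succ_le hy)]
      simp
  · rintro ⟨a, rfl⟩
    refine ⟨Submodule.smul_mem _ _ N.mem, fun y hy => ?_⟩
    rw [D.form_eq_nform o, map_smul, LinearMap.smul_apply, N.orth_mem hy]
    simp

/-- The translations of `E` by the vectors in the lattice spanned by the orbit of `z₀`. -/
def latticeTranslations (N : IsNullRoot D j m o c r') {z₀ : Fin n → ℝ}
    (hz₀ : z₀ ∈ D.orbitLattice (j + 1) (j + m) (c - Pi.single o 1)) :
    Subgroup (D.parabolic j (j + m)) where
  carrier := {t | ∃ z ∈ D.orbitLattice (j + 1) (j + m) z₀, ∀ x,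
    realAct (t : Matrix.GeneralLinearGroup (Fin n) ℤ) x = eichler (D.nform o) c z x}
  one_mem' := ⟨0, zero_mem _, fun x => by rw [eichler_zero]; exact realAct_one x⟩
  mul_mem' := by
    rintro t u ⟨z, hz, ht⟩ ⟨w, hw, hu⟩
    refine ⟨z + w, add_mem hz hw, fun x => ?_⟩
    rw [N.eichler_add' (N.mem_rootSpan hz₀ hz) (N.mem_rootSpan hz₀ hw), ← hu, ← ht]
    exact realAct_mul _ _ _
  inv_mem' := by
    rintro t ⟨z, hz, ht⟩
    refine ⟨-z, neg_mem hz, fun x => ?_⟩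
    have h1 : eichler (D.nform o) c (-z) (realAct t.1 (realAct t.1⁻¹ x)) =
        eichler (D.nform o) c (-z + z) (realAct t.1⁻¹ x) := by
      rw [ht, N.eichler_add' (N.mem_rootSpan hz₀ (neg_mem hz)) (N.mem_rootSpan hz₀ hz)]
    rw [realAct_self_inv, neg_add_cancel, eichler_zero] at h1
    exact h1.symm

/-- Translations commute, so conjugation by an element of `E` affects a translation only through the
`H`-component, and the lattice is invariant under `H`. -/
theorem latticeTranslations_normal (N : IsNullRoot D j m o c r') {z₀ : Fin n → ℝ}
    (hz₀ : z₀ ∈ D.orbitLattice (j + 1) (j + m) (c - Pi.single o 1)) :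
    (N.latticeTranslations hz₀).Normal := by
  constructor
  rintro t ⟨z, hz, ht⟩ ⟨g, hg⟩
  obtain ⟨w, hw, h, hh, H⟩ := N.exists_decomposition hg
  have hhz := realAct_mem_orbitLattice hz hh
  have hw' := mem_rootSpan_of_mem_orbitLattice N.root_mem hw
  refine ⟨realAct h z, hhz, fun x => ?_⟩
  change realAct (g * t.1 * g⁻¹) x = _
  rw [realAct_mul, realAct_mul, ht, H, N.eichler_conj' (D.parabolic_succ_le hh),
    ← N.eichler_add' hw' (N.mem_rootSpan hz₀ hhz), add_comm,
    N.eichler_add' (N.mem_rootSpan hz₀ hhz) hw', ← H, realAct_self_inv]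

/-- Conjugation by `H` realizes the orbit of `z₀`, and products realize sums. -/
theorem exists_mem_of_normal (N : IsNullRoot D j m o c r')
    {z₀ : Fin n → ℝ} (hz₀ : z₀ ∈ rootSpan n ℝ (j + 1) (j + m))
    (K : Subgroup (D.parabolic j (j + m))) (hK : K.Normal) {t₀ : D.parabolic j (j + m)}
    (hmem : t₀ ∈ K) (ht₀ : ∀ x, realAct t₀.1 x = eichler (D.nform o) c z₀ x)
    {z : Fin n → ℝ} (hz : z ∈ D.orbitLattice (j + 1) (j + m) z₀) :
    ∃ t ∈ K, ∀ x, realAct t.1 x = eichler (D.nform o) c z x := by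
  induction hz using AddSubgroup.closure_induction with
  | mem z hz =>
    obtain ⟨h, hh, rfl⟩ := hz
    refine ⟨⟨h, D.parabolic_succ_le hh⟩ * t₀ * ⟨h, D.parabolic_succ_le hh⟩⁻¹,
      hK.conj_mem _ hmem _, fun x => ?_⟩
    change realAct (h * t₀.1 * h⁻¹) x = _
    rw [realAct_mul, realAct_mul, ht₀, N.eichler_conj' (D.parabolic_succ_le hh), realAct_self_inv]
  | zero => exact ⟨1, one_mem _, fun x => by rw [eichler_zero]; exact realAct_one x⟩
  | add z w hz hw ihz ihw =>
    obtain ⟨t, ht, ht'⟩ := ihz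
    obtain ⟨u, hu, hu'⟩ := ihw
    refine ⟨t * u, mul_mem ht hu, fun x => ?_⟩
    rw [N.eichler_add' (mem_rootSpan_of_mem_orbitLattice hz₀ hz)
      (mem_rootSpan_of_mem_orbitLattice hz₀ hw), ← hu', ← ht']
    exact realAct_mul _ _ _
  | neg z hz ih =>
    obtain ⟨t, ht, ht'⟩ := ih
    refine ⟨t⁻¹, inv_mem ht, fun x => ?_⟩
    have hz' := mem_rootSpan_of_mem_orbitLattice hz₀ hz
    have h1 : eichler (D.nform o) c (-z) (realAct t.1 (realAct t.1⁻¹ x)) =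
        eichler (D.nform o) c (-z + z) (realAct t.1⁻¹ x) := by
      rw [ht', N.eichler_add' (neg_mem hz') hz']
    rw [realAct_self_inv, neg_add_cancel, eichler_zero] at h1
    exact h1.symm

/-- The normal subgroup generated by a translation. -/
theorem normalClosure_eq (N : IsNullRoot D j m o c r') {z₀ : Fin n → ℝ}
    (hz₀ : z₀ ∈ D.orbitLattice (j + 1) (j + m) (c - Pi.single o 1)) (t₀ : D.parabolic j (j + m))
    (ht₀ : ∀ x, realAct t₀.1 x = eichler (D.nform o) c z₀ x) :
    Subgroup.normalClosure {t₀} = N.latticeTranslations hz₀ := by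
  have hn := N.latticeTranslations_normal hz₀
  apply le_antisymm
  · refine Subgroup.normalClosure_le_normal ?_
    rintro _ rfl
    exact ⟨z₀, self_mem_orbitLattice _ _ _, ht₀⟩
  · rintro t ⟨z, hz, ht⟩
    obtain ⟨u, hu, hu'⟩ := N.exists_mem_of_normal
      (mem_rootSpan_of_mem_orbitLattice N.root_mem hz₀) (Subgroup.normalClosure {t₀})
      Subgroup.normalClosure_normal (Subgroup.subset_normalClosure (Set.mem_singleton t₀)) ht₀ hz
    have : t = u := Subtype.ext (realAct_injective fun x => by rw [ht, hu'])
    rwa [this]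

/-- The `H`-component `h` of a translation moves vectors of `W` by multiples of `c`; on the span of
the roots of `H` this forces `h x = x`, because `h x - x` has no component at `o`. -/
theorem translations_subgroupOf_eq (N : IsNullRoot D j m o c r') :
    (D.translations j (j + m)).subgroupOf (D.parabolic j (j + m)) =
      N.latticeTranslations (self_mem_orbitLattice _ _ _) := by
  ext ⟨t, ht⟩
  rw [Subgroup.mem_subgroupOf]
  constructor
  · rintro ⟨-, h1⟩
    obtain ⟨z, hz, h, hh, H⟩ := N.exists_decomposition ht
    have h2 : h = 1 := by
      refine N.eq_one_of_fix hh fun x hx => ?_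
      have hhx := D.realAct_mem_rootSpan le_rfl le_rfl hh hx
      obtain ⟨a, ha⟩ := N.mem_radical_iff.1 (h1 x (mem_rootSpan_of_succ_le hx))
      change realAct t x - x = _ at ha
      rw [H, N.eichler_eq (mem_rootSpan_of_succ_le hhx)] at ha
      -- Neither `h x` nor `x` has a component at `o`, so this coordinate determines `a`.
      have h3 := congrFun ha o
      simp only [Pi.sub_apply, Pi.smul_apply, N.coord, smul_eq_mul, mul_one, N.apply_o hx,
        N.apply_o hhx] at h3
      rw [show a = -D.nform o z (realAct h x) by linarith] at ha
      rw [← sub_eq_zero]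
      have h4 : realAct h x - x = (realAct h x - D.nform o z (realAct h x) • c - x) -
        (-D.nform o z (realAct h x)) • c := by module
      rw [h4, ha, sub_self]
    refine ⟨z, hz, fun x => ?_⟩
    change realAct t x = _
    rw [H, h2, realAct_one]
  · rintro ⟨z, hz, H⟩
    refine ⟨ht, fun x hx => ?_⟩
    change realAct t x - x ∈ _
    rw [H, N.eichler_eq hx, N.mem_radical_iff]
    exact ⟨-D.nform o z x, by module⟩

theorem isComplement' (N : IsNullRoot D j m o c r') : Subgroup.IsComplement'
    ((D.translations j (j + m)).subgroupOf (D.parabolic j (j + m)))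
    ((D.parabolic (j + 1) (j + m)).subgroupOf (D.parabolic j (j + m))) := by
  apply Subgroup.isComplement'_of_disjoint_and_mul_eq_univ
  · rw [Subgroup.disjoint_def]
    rintro ⟨g, hg⟩ h1 h2
    rw [N.translations_subgroupOf_eq] at h1
    obtain ⟨z, hz, H⟩ := h1
    rw [Subgroup.mem_subgroupOf] at h2
    refine Subtype.ext (N.eq_one_of_fix h2 fun x hx => ?_)
    have h3 := H x
    change realAct g x = _ at h3
    have hgx := D.realAct_mem_rootSpan le_rfl le_rfl h2 hx
    rw [N.eichler_eq (mem_rootSpan_of_succ_le hx)] at h3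
    have h4 := congrFun h3 o
    have h5 := N.apply_o hgx
    change realAct g x o = 0 at h5
    simp only [Pi.sub_apply, Pi.smul_apply, N.coord, smul_eq_mul, mul_one, N.apply_o hx, h5] at h4
    rw [show D.nform o z x = 0 by linarith] at h3
    simpa using h3
  · rw [Set.eq_univ_iff_forall]
    rintro ⟨g, hg⟩
    obtain ⟨z, hz, h, hh, H⟩ := N.exists_decomposition hg
    refine Set.mem_mul.2 ⟨⟨g, hg⟩ * ⟨h, D.parabolic_succ_le hh⟩⁻¹, ?_, ⟨h, D.parabolic_succ_le hh⟩,
      hh, by simp⟩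
    rw [N.translations_subgroupOf_eq]
    refine ⟨z, hz, fun x => ?_⟩
    change realAct (g * h⁻¹) x = _
    rw [realAct_mul, H, realAct_self_inv]

end IsNullRoot

/-- The conditions on the modulus `s` and on a translation vector `z₀` under which reduction modulo
`s` of `E` is the toroidal group of the lattice spanned by the orbit of `z₀`. -/
structure IsToroidModulus (D : StringBasicSystem n) (j m : ℕ) (o : Fin n) (c : Fin n → ℝ) (s : ℕ)
    (z₀ : Fin n → ℝ) : Prop where
  mem : z₀ ∈ D.orbitLattice (j + 1) (j + m) (c - Pi.single o 1)
  ne_zero : z₀ ≠ 0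
  fix_of_mem_ker : ∀ z ∈ D.orbitLattice (j + 1) (j + m) (c - Pi.single o 1),
    ∀ h ∈ D.parabolic (j + 1) (j + m),
    (∀ i, eichler (D.nform o) c z (realAct h (Pi.single i 1)) - Pi.single i 1 ∈ multiples n s) →
    ∀ x ∈ rootSpan n ℝ (j + 1) (j + m), realAct h x = x
  mem_ker : ∀ i, eichler (D.nform o) c z₀ (Pi.single i 1) - Pi.single i 1 ∈ multiples n s
  mem_lattice : ∀ z ∈ D.orbitLattice (j + 1) (j + m) (c - Pi.single o 1),
    (∀ i, eichler (D.nform o) c z (Pi.single i 1) - Pi.single i 1 ∈ multiples n s) →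
    z ∈ D.orbitLattice (j + 1) (j + m) z₀
  eq_zero_of_displacement : ∀ z ∈ D.orbitLattice (j + 1) (j + m) z₀,
    (∀ i, eichler (D.nform o) c z (Pi.single i 1) - Pi.single i 1 ∈ multiples n s) →
    ∀ i k : Fin n, j ≤ (i : ℕ) → (i : ℕ) ≤ j + m → j ≤ (k : ℕ) → (k : ℕ) ≤ j + m →
    ∀ h ∈ D.parabolic (j + 1) (j + m), (∀ x ∈ rootSpan n ℝ (j + 1) (j + m),
      D.nform o z x = (realAct h x k / c k - realAct h x i / c i) - (x k / c k - x i / c i)) →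
    z = 0

/-! ### Reduction modulo `s`: the kernel, the intersection property and the trivial intersection in
(c) -/

namespace IsNullRoot

variable {s : ℕ} {z₀ : Fin n → ℝ}

theorem mem_ker_modReduction_iff (g : D.parabolic j (j + m)) :
    g ∈ (D.modReduction j m s).ker ↔
      ∀ i, realAct g.1 (Pi.single i 1) - Pi.single i 1 ∈ multiples n s := by
  rw [MonoidHom.mem_ker, ← changeRing_eq_one_iff]
  exact Subtype.ext_iff

/-- A kernel element has trivial `H`-component by `fix_of_mem_ker`, and then its translation vector
lies in the lattice. Conversely the kernel is normal and contains the translation by `z₀`, hence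
also its normal closure. -/
theorem ker_modReduction_eq (N : IsNullRoot D j m o c r')
    (M : IsToroidModulus D j m o c s z₀) :
    (D.modReduction j m s).ker = N.latticeTranslations M.mem := by
  apply le_antisymm
  · rintro g hg
    rw [mem_ker_modReduction_iff] at hg
    obtain ⟨z, hz, h, hh, H⟩ := N.exists_decomposition g.2
    simp only [H] at hg
    have h1 := N.eq_one_of_fix hh (M.fix_of_mem_ker z hz h hh hg)
    subst h1
    simp only [realAct_one] at hg H
    exact ⟨z, M.mem_lattice z hz hg, H⟩
  · obtain ⟨t, -, ht⟩ := N.exists_mem_of_normal N.root_mem ⊤ inferInstance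
      (t₀ := ⟨D.r o * r', mul_mem N.r_mem (D.parabolic_succ_le N.refl_mem)⟩) (Subgroup.mem_top _)
      N.realAct_r_mul M.mem
    rw [← N.normalClosure_eq M.mem t ht]
    refine Subgroup.normalClosure_le_normal ?_
    rintro _ rfl
    rw [SetLike.mem_coe, mem_ker_modReduction_iff]
    simpa only [ht] using M.mem_ker

theorem latticeTranslations_le (N : IsNullRoot D j m o c r')
    (M : IsToroidModulus D j m o c s z₀) :
    N.latticeTranslations M.mem ≤
      (D.translations j (j + m)).subgroupOf (D.parabolic j (j + m)) := by
  rw [N.translations_subgroupOf_eq]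
  rintro t ⟨z, hz, ht⟩
  refine ⟨z, orbitLattice_le M.mem (fun i h1 h2 v hv => ?_) hz, ht⟩
  exact realAct_mem_orbitLattice hv (D.r_mem_parabolic h1 h2)

/-- The kernel consists of translations, and these meet `H` trivially. -/
theorem injOn_changeRing (N : IsNullRoot D j m o c r')
    (M : IsToroidModulus D j m o c s z₀)
    : Set.InjOn (changeRing n (ZMod s)) (D.parabolic (j + 1) (j + m)) := by
  intro g hg h hh hgh
  have hgh' : (⟨g⁻¹ * h, D.parabolic_succ_le (mul_mem (inv_mem hg) hh)⟩ : D.parabolic j (j + m)) ∈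
      (D.modReduction j m s).ker := by
    rw [MonoidHom.mem_ker]
    refine Subtype.ext ?_
    change changeRing n (ZMod s) (g⁻¹ * h) = 1
    rw [map_mul, map_inv, hgh, inv_mul_cancel]
  rw [N.ker_modReduction_eq M] at hgh'
  have h1 := N.latticeTranslations_le M hgh'
  have h2 := Subgroup.disjoint_def.1 N.isComplement'.disjoint h1
    (Subgroup.mem_subgroupOf.2 (mul_mem (inv_mem hg) hh))
  have h3 : g⁻¹ * h = 1 := congrArg Subtype.val h2
  exact eq_of_inv_mul_eq_one h3

/-- The group of translations has no torsion, so the kernel contains no involution. -/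
theorem eq_one_of_mul_self (N : IsNullRoot D j m o c r')
    (M : IsToroidModulus D j m o c s z₀)
    {t : D.parabolic j (j + m)} (ht : t ∈ N.latticeTranslations M.mem)
    (h : t * t = 1) : t = 1 := by
  obtain ⟨z, hz, hzt⟩ := ht
  have hz' := N.mem_rootSpan M.mem hz
  have h1 : z + z = 0 := by
    refine N.eichler_injective (add_mem hz' hz') (zero_mem _) fun x => ?_
    rw [N.eichler_add' hz' hz', ← hzt, ← hzt, ← realAct_mul, eichler_zero]
    have : t.1 * t.1 = 1 := congrArg Subtype.val h
    rw [this, realAct_one]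
  have h2 : z = 0 := by
    have : (2 : ℝ) • z = 0 := by rw [two_smul, h1]
    simpa using this
  refine Subtype.ext (realAct_injective fun x => ?_)
  rw [hzt, h2, eichler_zero]
  exact (realAct_one x).symm

theorem map_gens (N : IsNullRoot D j m o c r') (I : Set (Fin (m + 1))) :
    (Subgroup.closure (D.gens j m N.lt '' I)).map (D.parabolic j (j + m)).subtype =
      Subgroup.closure (D.r '' ((fun i : Fin (m + 1) =>
        (⟨j + i, by have := N.lt; omega⟩ : Fin n)) '' I)) := by
  rw [MonoidHom.map_closure, ← Set.image_comp, ← Set.image_comp]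
  rfl

/-- Orders and commutation descend from `E`. For the intersection property, two elements of proper
parabolic subgroups with the same image are shown to be equal already in `E`. -/
theorem isStringCGroup (N : IsNullRoot D j m o c r')
    (M : IsToroidModulus D j m o c s z₀) :
    IsStringCGroup (fun i => D.modReduction j m s (D.gens j m N.lt i)) := by
  have hinv : ∀ i, D.gens j m N.lt i * D.gens j m N.lt i = 1 :=
    fun i => Subtype.ext (D.r_mul_self _)
  refine ⟨?_, fun i => ?_, fun i k hik => ?_, fun I J => ?_⟩
  · have h1 : Subgroup.closure (Set.range (D.gens j m N.lt)) = ⊤ := by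
      rw [← Set.image_univ]
      apply Subgroup.map_injective (Subgroup.subtype_injective (D.parabolic j (j + m)))
      rw [N.map_gens, ← MonoidHom.range_eq_map, Subgroup.range_subtype, Set.image_univ]
      unfold parabolic
      congr 1
      ext g
      constructor
      · rintro ⟨_, ⟨i, rfl⟩, rfl⟩
        exact ⟨_, by simp, by simp; omega, rfl⟩
      · rintro ⟨i, h1, h2, rfl⟩
        exact ⟨i, ⟨⟨i - j, by omega⟩, Fin.ext (by simp; omega)⟩, rfl⟩
    have h2 : Set.range (fun i => D.modReduction j m s (D.gens j m N.lt i)) =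
        D.modReduction j m s '' Set.range (D.gens j m N.lt) :=
      Set.range_comp (D.modReduction j m s) (D.gens j m N.lt)
    rw [h2, ← MonoidHom.map_closure, h1, ← MonoidHom.range_eq_map]
    exact MonoidHom.range_eq_top.2 (MonoidHom.subgroupMap_surjective _ _)
  · refine orderOf_eq_prime ?_ fun h => ?_
    · rw [pow_two, ← map_mul, hinv, map_one]
    -- A generator in the kernel would be a translation of square `1`, hence trivial, against its
    -- determinant `-1`.
    · have h1 : D.gens j m N.lt i ∈ (D.modReduction j m s).ker := h
      rw [N.ker_modReduction_eq M] at h1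
      have h2 := congrArg Subtype.val (N.eq_one_of_mul_self M h1 (hinv i))
      have h3 : D.r ⟨j + i, by have := N.lt; omega⟩ = 1 := h2
      have h4 := congrArg (fun g => g.val.det) h3
      simp [det_r] at h4
  · have hfar := D.cartan_far ⟨j + i, by have := N.lt; omega⟩ ⟨j + k, by have := N.lt; omega⟩
      (by simp; omega)
    have h1 : (D.gens j m N.lt i * D.gens j m N.lt k) ^ 2 = 1 := by
      refine Subtype.ext (GL_ext_mulVec fun x => ?_)
      change (((D.r ⟨j + i, by have := N.lt; omega⟩ * D.r ⟨j + k, by have := N.lt; omega⟩) ^ 2 :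
        Matrix.GeneralLinearGroup (Fin n) ℤ)).val *ᵥ x = _
      rw [pow_two]
      simp only [Units.val_mul, ← Matrix.mulVec_mulVec]
      conv_lhs => rw [show x = x + (0 : ℤ) • Pi.single ⟨j + i, by have := N.lt; omega⟩ 1 +
        (0 : ℤ) • Pi.single ⟨j + k, by have := N.lt; omega⟩ 1 by simp]
      simp only [r_mulVec_left, r_mulVec_right, hfar.1, hfar.2]
      simp
    rw [← map_mul, ← map_pow, h1, map_one]
  · apply le_antisymm
    · rintro x ⟨hI, hJ⟩
      have himg : ∀ I : Set (Fin (m + 1)),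
          Subgroup.closure ((fun i => D.modReduction j m s (D.gens j m N.lt i)) '' I) =
          (Subgroup.closure (D.gens j m N.lt '' I)).map (D.modReduction j m s) := by
        intro I
        rw [MonoidHom.map_closure, ← Set.image_comp]
        rfl
      -- If one of the index sets is everything there is nothing to prove; otherwise each set omits
      -- an index, and with it preserves a coordinate.
      by_cases hIu : ∀ i, i ∈ I
      · rw [Set.eq_univ_of_forall hIu, Set.univ_inter]
        exact hJ
      by_cases hJu : ∀ i, i ∈ J
      · rw [Set.eq_univ_of_forall hJu, Set.inter_univ]
        exact hI
      push Not at hIu hJu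
      obtain ⟨i, hi⟩ := hIu
      obtain ⟨k, hk⟩ := hJu
      rw [himg] at hI hJ ⊢
      obtain ⟨g, hg, rfl⟩ := hI
      obtain ⟨h, hh, hgh⟩ := hJ
      have hg' := Subgroup.mem_map_of_mem (D.parabolic j (j + m)).subtype hg
      have hh' := Subgroup.mem_map_of_mem (D.parabolic j (j + m)).subtype hh
      rw [N.map_gens] at hg' hh'
      have hinj : Function.Injective (fun i : Fin (m + 1) =>
          (⟨j + i, by have := N.lt; omega⟩ : Fin n)) := by
        intro a b hab
        simpa [Fin.ext_iff] using hab
      -- Once the two lifts agree, the intersection property of the linear group gives a common lift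
      -- in `⟨I ∩ J⟩`.
      suffices hEq : g = h by
        subst hEq
        refine Subgroup.mem_map_of_mem _ ?_
        have h1 := (D.closure_inf_closure _ _).le (Subgroup.mem_inf.2 ⟨hg', hh'⟩)
        rw [← Set.image_inter hinj, ← N.map_gens] at h1
        obtain ⟨g', hg1, hg2⟩ := h1
        rwa [← Subgroup.subtype_injective _ hg2]
      have hker : g⁻¹ * h ∈ (D.modReduction j m s).ker := by
        rw [MonoidHom.mem_ker, map_mul, map_inv, hgh, inv_mul_cancel]
      have hker' := (mem_ker_modReduction_iff _).1 hker
      rw [N.ker_modReduction_eq M] at hker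
      obtain ⟨z, hz, H⟩ := hker
      simp only [H] at hker'
      obtain ⟨w, hw, h₀, hh₀, H₀⟩ := N.exists_decomposition g.2
      -- With `g = t_w h₀` and `h = g t_z`, `g` preserves the coordinate at `j + i` and `h` the one
      -- at `j + k`. Dividing by the coordinates of `c` and eliminating the contribution of `w`
      -- leaves the displacement formula for `z` in terms of `h₀` alone.
      have hz0 : z = 0 := by
        refine M.eq_zero_of_displacement z hz hker' ⟨j + i, by have := N.lt; omega⟩
          ⟨j + k, by have := N.lt; omega⟩ (by simp) (by simp; omega) (by simp) (by simp; omega)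
          h₀ hh₀ fun x hx => ?_
        have hx' := mem_rootSpan_of_succ_le hx
        have e1 : realAct h.1 x = realAct g.1 x - D.nform o z x • c := by
          have e2 : h.1 = g.1 * (g⁻¹ * h).1 := by simp
          rw [e2, realAct_mul, H, N.eichler_eq hx', map_sub, map_smul, N.fix g.2]
        have e3 : realAct g.1 x = realAct h₀ x - D.nform o w (realAct h₀ x) • c := by
          rw [H₀, N.eichler_eq (D.realAct_mem_rootSpan (by omega) le_rfl hh₀ hx')]
        have f1 := D.realAct_apply_of_mem_closure hh'
          (k := ⟨j + k, by have := N.lt; omega⟩) (by rwa [hinj.mem_set_image]) x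
        have f2 := D.realAct_apply_of_mem_closure hg'
          (k := ⟨j + i, by have := N.lt; omega⟩) (by rwa [hinj.mem_set_image]) x
        change realAct h.1 x _ = _ at f1
        change realAct g.1 x _ = _ at f2
        rw [e3] at e1 f2
        rw [e1] at f1
        simp only [Pi.sub_apply, Pi.smul_apply, smul_eq_mul] at f1 f2
        have g1 := N.ne_zero ⟨j + i, by have := N.lt; omega⟩ (by simp) (by simp; omega)
        have g2 := N.ne_zero ⟨j + k, by have := N.lt; omega⟩ (by simp) (by simp; omega)
        rw [← f1, ← f2]
        field_simp
        ring
      refine (eq_of_inv_mul_eq_one ?_)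
      refine Subtype.ext (realAct_injective fun x => ?_)
      rw [H, hz0, eichler_zero]
      exact (realAct_one x).symm
    · exact le_inf (Subgroup.closure_mono (Set.image_mono Set.inter_subset_left))
        (Subgroup.closure_mono (Set.image_mono Set.inter_subset_right))

/-- A product of generators after node `j` leaves the coordinate at `o` unchanged, whereas the
translation by `z` changes that of `b i` by minus the product of `z` and `b i`, because `c o = 1`.
So these products are divisible by `s`, and the translation is trivial modulo `s` on the span of `b
j, …, b (j + m)`. -/
theorem translations_inf_parabolic (N : IsNullRoot D j m o c r')
    (hT : ∀ t ∈ (D.translations j (j + m)).map (changeRing n (ZMod s)),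
      (∀ x ∈ rootSpan n (ZMod s) j (j + m), t.val *ᵥ x = x) → t = 1) (l : ℕ) :
    (D.translations j (j + m)).map (changeRing n (ZMod s)) ⊓
      (D.parabolic (j + 1) (j + l)).map (changeRing n (ZMod s)) = ⊥ := by
  rw [eq_bot_iff]
  rintro y ⟨hy, hy'⟩
  refine Subgroup.mem_bot.2 (hT y hy ?_)
  obtain ⟨t, ht, rfl⟩ := hy
  obtain ⟨g, hg, hgt⟩ := hy'
  have ht' : (⟨t, ht.1⟩ : D.parabolic j (j + m)) ∈
      (D.translations j (j + m)).subgroupOf (D.parabolic j (j + m)) := ht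
  rw [N.translations_subgroupOf_eq] at ht'
  obtain ⟨z, hz, H⟩ := ht'
  change ∀ x, realAct t x = _ at H
  rw [eq_comm, changeRing_eq_iff] at hgt
  have hb : ∀ i : Fin n, j ≤ (i : ℕ) → (i : ℕ) ≤ j + m →
      (changeRing n (ZMod s) t).val *ᵥ Pi.single i 1 = Pi.single i 1 := by
    intro i h1 h2
    have h3 : (changeRing n (ZMod s) t).val *ᵥ Pi.single i 1 =
        (changeRing n (ZMod s) 1).val *ᵥ Pi.single i 1 := by
      rw [changeRing_mulVec_single_eq_iff, realAct_one, H, N.eichler_eq (single_mem_rootSpan h1 h2)]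
      obtain ⟨d, hd⟩ := hgt i o
      rw [Pi.sub_apply, D.realAct_apply_of_notMem hg (by have := N.val_o; omega), H,
        N.eichler_eq (single_mem_rootSpan h1 h2)] at hd
      simp only [Pi.sub_apply, Pi.smul_apply, smul_eq_mul, N.coord, mul_one] at hd
      have h4 : (Pi.single i 1 : Fin n → ℝ) - D.nform o z (Pi.single i 1) • c - Pi.single i 1 =
        (-D.nform o z (Pi.single i 1)) • c := by module
      rw [h4]
      exact smul_mem_multiples N.integral ⟨d, by linarith⟩
    rw [h3, map_one, Units.val_one, Matrix.one_mulVec]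
  intro x hx
  induction hx using Submodule.span_induction with
  | mem x hx => obtain ⟨i, h1, h2, rfl⟩ := hx; exact hb i h1 h2
  | zero => simp
  | add x y _ _ hx hy => rw [Matrix.mulVec_add, hx, hy]
  | smul a x _ hx => rw [Matrix.mulVec_smul, hx]

end IsNullRoot

/-- The structure of `E`, of its reduction modulo `s` and of the corresponding toroid. -/
theorem toroid_of_isToroidModulus (N : IsNullRoot D j m o c r') {s : ℕ} {z₀ : Fin n → ℝ}
    (M : IsToroidModulus D j m o c s z₀) (X : EuclideanFamily) (q k : ℕ)
    (ht : ∀ x, realAct ((((List.range k).map fun i =>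
      standardTranslation X (D.gens j m N.lt) i ^ q).prod : D.parabolic j (j + m)) :
      Matrix.GeneralLinearGroup (Fin n) ℤ) x = eichler (D.nform o) c z₀ x) :
    ((D.translations j (j + m)).subgroupOf (D.parabolic j (j + m))).Normal ∧
    Subgroup.IsComplement'
      ((D.translations j (j + m)).subgroupOf (D.parabolic j (j + m)))
      ((D.parabolic (j + 1) (j + m)).subgroupOf (D.parabolic j (j + m))) ∧
    Set.InjOn (changeRing n (ZMod s)) (D.parabolic (j + 1) (j + m)) ∧
    (D.modReduction j m s).ker ≤
      (D.translations j (j + m)).subgroupOf (D.parabolic j (j + m)) ∧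
    IsStringCGroup (fun i => D.modReduction j m s (D.gens j m N.lt i)) ∧
    (toroidKernel X (D.gens j m N.lt) q k ≠ ⊥ ∧
      toroidKernel X (D.gens j m N.lt) q k ≤
        (D.translations j (j + m)).subgroupOf (D.parabolic j (j + m)) ∧
      (D.modReduction j m s).ker = toroidKernel X (D.gens j m N.lt) q k ∧
      ∃ Φ : (D.parabolic j (j + m)).map (changeRing n (ZMod s)) ≃*
          QuotientAut (D.gens j m N.lt) (toroidKernel X (D.gens j m N.lt) q k),
        ∀ (g : D.parabolic j (j + m)) (F : Face (D.gens j m N.lt)),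
          Φ (D.modReduction j m s g) (QuotientFace.mk _ _ F) = QuotientFace.mk _ _ (g • F)) ∧
    ((∀ t ∈ (D.translations j (j + m)).map (changeRing n (ZMod s)),
        (∀ x ∈ rootSpan n (ZMod s) j (j + m), t.val *ᵥ x = x) → t = 1) →
      ∀ l : ℕ, m ≤ l → j + l < n →
        (D.translations j (j + m)).map (changeRing n (ZMod s)) ⊓
          (D.parabolic (j + 1) (j + l)).map (changeRing n (ZMod s)) = ⊥) := by
  have hL : toroidKernel X (D.gens j m N.lt) q k = N.latticeTranslations M.mem :=
    N.normalClosure_eq M.mem _ ht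
  have hker : (D.modReduction j m s).ker = toroidKernel X (D.gens j m N.lt) q k := by
    rw [hL, N.ker_modReduction_eq M]
  have hle : toroidKernel X (D.gens j m N.lt) q k ≤
      (D.translations j (j + m)).subgroupOf (D.parabolic j (j + m)) := by
    rw [hL]
    exact N.latticeTranslations_le M
  refine ⟨?_, N.isComplement', N.injOn_changeRing M, hker.le.trans hle, N.isStringCGroup M,
    ⟨fun hbot => M.ne_zero ?_, hle, hker, ?_⟩, fun hT l _ _ => N.translations_inf_parabolic hT l⟩
  · rw [N.translations_subgroupOf_eq]
    exact N.latticeTranslations_normal _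
  · have h1 : ((List.range k).map fun i =>
        standardTranslation X (D.gens j m N.lt) i ^ q).prod ∈
        toroidKernel X (D.gens j m N.lt) q k :=
      Subgroup.subset_normalClosure (Set.mem_singleton _)
    rw [hbot, Subgroup.mem_bot] at h1
    rw [h1] at ht
    refine N.eichler_injective (mem_rootSpan_of_mem_orbitLattice N.root_mem M.mem) (zero_mem _)
      fun x => ?_
    rw [← ht, eichler_zero]
    exact realAct_one x
  · rw [← hker]
    exact exists_mulEquiv_quotientAut _ (MonoidHom.subgroupMap_surjective _ _) (N.isStringCGroup M)

end StringBasicSystem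
end

noncomputable section

/-! ### Coordinates along a string -/

/-- The restriction to the nodes `0, …, n - 1` of a function on `ℕ`. -/
def nodeVec (n : ℕ) (f : ℕ → ℝ) : Fin n → ℝ := fun k => f k

theorem nodeVec_apply {n : ℕ} (f : ℕ → ℝ) (k : Fin n) : nodeVec n f k = f k := rfl

theorem nodeVec_mem_rootSpan {n : ℕ} {f : ℕ → ℝ} {a b : ℕ}
    (h : ∀ k, ¬ (a ≤ k ∧ k ≤ b) → f k = 0) : nodeVec n f ∈ rootSpan n ℝ a b :=
  mem_rootSpan_iff.2 fun k hk => h k hk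

namespace StringBasicSystem

variable {n : ℕ} (D : StringBasicSystem n)

/-- Only the neighbours of `i` contribute. At the ends the Cartan integers vanish by convention,
which neutralizes the truncated `i - 1` and the value of `f` beyond the last node. -/
theorem sum_cartan_mul (i : Fin n) (f : ℕ → ℝ) : ∑ k, (D.cartan i k : ℝ) * nodeVec n f k =
    D.cartanLeft i * f (i - 1) - 2 * f i + D.cartanRight i * f (i + 1) := by
  classical
  have h1 : ∀ k : Fin n, (D.cartan i k : ℝ) * nodeVec n f k =
      (if (k : ℕ) + 1 = i then (D.cartan i k : ℝ) * f k else 0) +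
      (if k = i then (D.cartan i k : ℝ) * f k else 0) +
      (if (k : ℕ) = i + 1 then (D.cartan i k : ℝ) * f k else 0) := by
    intro k
    rw [nodeVec_apply]
    rcases lt_trichotomy (k : ℕ) i with h | h | h
    · rw [if_neg (fun h' => by rw [h'] at h; omega : ¬ k = i),
        if_neg (by omega : ¬ (k : ℕ) = i + 1)]
      split_ifs with h2
      · ring
      · rw [(D.cartan_far k i (by omega)).2]; simp
    · rw [if_neg (by omega : ¬ (k : ℕ) + 1 = i), if_pos (Fin.ext h),
        if_neg (by omega : ¬ (k : ℕ) = i + 1)]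
      ring
    · rw [if_neg (by omega : ¬ (k : ℕ) + 1 = i),
        if_neg (fun h' => by rw [h'] at h; omega : ¬ k = i)]
      split_ifs with h2
      · ring
      · rw [(D.cartan_far i k (by omega)).1]; simp
  rw [Finset.sum_congr rfl fun k _ => h1 k, Finset.sum_add_distrib, Finset.sum_add_distrib]
  have e1 : ∑ k : Fin n, (if (k : ℕ) + 1 = i then (D.cartan i k : ℝ) * f k else 0) =
      D.cartanLeft i * f (i - 1) := by
    by_cases h : 1 ≤ (i : ℕ)
    · rw [Finset.sum_eq_single (⟨i - 1, by omega⟩ : Fin n)]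
      · rw [if_pos (by simp; omega), cartanLeft, dif_pos ⟨h, i.2⟩]
      · intro k _ hk
        rw [if_neg]
        intro h'
        exact hk (Fin.ext (by simp; omega))
      · simp
    · rw [cartanLeft, dif_neg (fun h' => h h'.1), Finset.sum_eq_zero]
      · simp
      · intro k _
        rw [if_neg (by omega)]
  have e2 : ∑ k : Fin n, (if k = i then (D.cartan i k : ℝ) * f k else 0) = -2 * f i := by
    simp [D.cartan_self]
  have e3 : ∑ k : Fin n, (if (k : ℕ) = i + 1 then (D.cartan i k : ℝ) * f k else 0) =
      D.cartanRight i * f (i + 1) := by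
    by_cases h : (i : ℕ) + 1 < n
    · rw [Finset.sum_eq_single (⟨i + 1, h⟩ : Fin n)]
      · rw [if_pos rfl, cartanRight, dif_pos h]
      · intro k _ hk
        rw [if_neg]
        intro h'
        exact hk (Fin.ext h')
      · simp
    · rw [cartanRight, dif_neg h, Finset.sum_eq_zero]
      · simp
      · intro k _
        rw [if_neg (by omega)]
  rw [e1, e2, e3]
  ring

theorem realAct_r_nodeVec (i : Fin n) (f : ℕ → ℝ) : realAct (D.r i) (nodeVec n f) =
    nodeVec n f + (D.cartanLeft i * f (i - 1) - 2 * f i + D.cartanRight i * f (i + 1)) •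
      Pi.single i 1 := by
  rw [realAct_r, sum_cartan_mul]

theorem nform_single_nodeVec (o i : Fin n) (f : ℕ → ℝ) :
    D.nform o (Pi.single i 1) (nodeVec n f) =
    -(D.cartanLeft i * f (i - 1) - 2 * f i + D.cartanRight i * f (i + 1)) *
      (D.label i / D.label o) := by
  rw [nform_single_left, sum_cartan_mul]

theorem cartanRight_mul_label {i : ℕ} (hi : i + 1 < n) :
    (D.cartanRight i : ℝ) * D.label ⟨i, by omega⟩ = D.cartanLeft (i + 1) * D.label ⟨i + 1, hi⟩ := by
  rw [cartanRight, cartanLeft, dif_pos hi, dif_pos ⟨by omega, hi⟩, D.cartan_mul_label]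
  simp

theorem nform_of_mem_rootSpan (o : Fin n) {a b : ℕ} {x : Fin n → ℝ} (hx : x ∈ rootSpan n ℝ a b)
    (i : Fin n) : D.nform o x (Pi.single i 1) =
      ∑ k : Fin n, if a ≤ (k : ℕ) ∧ (k : ℕ) ≤ b then
        x k * (-(D.cartan k i : ℝ) * (D.label k / D.label o)) else 0 := by
  conv_lhs => rw [sum_single_eq x]
  simp only [map_sum, map_smul, LinearMap.sum_apply, LinearMap.smul_apply, nform_single,
    smul_eq_mul]
  refine Finset.sum_congr rfl fun k _ => ?_
  split_ifs with h
  · rfl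
  · rw [mem_rootSpan_iff.1 hx k h, zero_mul]

theorem nform_eq_zero_of_far (o : Fin n) {a b : ℕ} {x : Fin n → ℝ} (hx : x ∈ rootSpan n ℝ a b)
    {i : Fin n} (hi : (i : ℕ) + 1 < a ∨ b + 1 < i) : D.nform o x (Pi.single i 1) = 0 := by
  rw [D.nform_of_mem_rootSpan o hx]
  refine Finset.sum_eq_zero fun k _ => ?_
  split_ifs with h
  · have : D.cartan k i = 0 := by
      rcases hi with hi | hi
      · exact (D.cartan_far i k (by omega)).2
      · exact (D.cartan_far k i (by omega)).1
    simp [this]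
  · rfl

theorem nform_right_neighbour (o : Fin n) {a b : ℕ} (hab : a ≤ b) (hb : b < n) {x : Fin n → ℝ}
    (hx : x ∈ rootSpan n ℝ a b) {i : Fin n} (hi : (i : ℕ) = b + 1) :
    D.nform o x (Pi.single i 1) =
      -(x ⟨b, hb⟩ * D.cartanRight b * (D.label ⟨b, hb⟩ / D.label o)) := by
  rw [D.nform_of_mem_rootSpan o hx, Finset.sum_eq_single (⟨b, hb⟩ : Fin n)]
  · rw [if_pos ⟨hab, le_rfl⟩, cartanRight, dif_pos (by omega)]
    rw [show (⟨b + 1, by omega⟩ : Fin n) = i from Fin.ext hi.symm]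
    ring
  · intro k _ hk
    split_ifs with h
    · have h1 : (k : ℕ) ≠ b := fun h => hk (Fin.ext h)
      rw [(D.cartan_far k i (by omega)).1]
      simp
    · rfl
  · simp

theorem nform_left_neighbour (o : Fin n) {b : ℕ} (hb : (o : ℕ) ≤ b) {x : Fin n → ℝ}
    (hx : x ∈ rootSpan n ℝ o b) {i : Fin n} (hi : (i : ℕ) + 1 = o) :
    D.nform o x (Pi.single i 1) = -(x o * D.cartanLeft o) := by
  have := (D.label_pos o).ne'
  rw [D.nform_of_mem_rootSpan o hx, Finset.sum_eq_single o]
  · rw [if_pos ⟨le_rfl, hb⟩, cartanLeft, dif_pos ⟨by omega, o.2⟩, div_self this]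
    rw [show (⟨(o : ℕ) - 1, by omega⟩ : Fin n) = i from Fin.ext (by simp; omega)]
    simp
  · intro k _ hk
    split_ifs with h
    · have h1 : (k : ℕ) ≠ o := fun h => hk (Fin.ext h)
      rw [(D.cartan_far i k (by omega)).2]
      simp
    · rfl
  · simp

variable {D} {j m : ℕ} {o : Fin n} {c : Fin n → ℝ}
  {r' : Matrix.GeneralLinearGroup (Fin n) ℤ}

namespace IsNullRoot

/-- As `v o = 0` and `c o = 1`, the coordinate at `o` is `-a`, so the two conditions separate. -/
theorem sub_smul_mem_multiples_iff (N : IsNullRoot D j m o c r') {s : ℕ} {v : Fin n → ℝ}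
    (hv : v o = 0) (a : ℝ) :
    v - a • c ∈ multiples n s ↔ v ∈ multiples n s ∧ ∃ d : ℤ, a = s * d := by
  constructor
  · intro h
    have ha : ∃ d : ℤ, a = s * d := by
      obtain ⟨d, hd⟩ := h o
      simp only [Pi.sub_apply, Pi.smul_apply, hv, N.coord, smul_eq_mul, mul_one] at hd
      exact ⟨-d, by push_cast; linarith⟩
    refine ⟨?_, ha⟩
    have := add_mem h (smul_mem_multiples N.integral ha)
    simpa using this
  · rintro ⟨h, ha⟩
    exact sub_mem h (smul_mem_multiples N.integral ha)

theorem exists_nform_eq_of_integral {s : ℕ} {z : Fin n → ℝ}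
    (h : ∀ i : Fin n, j + 1 ≤ (i : ℕ) → (i : ℕ) ≤ j + m →
      ∃ d : ℤ, D.nform o z (Pi.single i 1) = s * d)
    {x : Fin n → ℝ} (hx : x ∈ rootSpan n ℝ (j + 1) (j + m)) (hx' : x ∈ multiples n 1) :
    ∃ d : ℤ, D.nform o z x = s * d := by
  have h1 : ∀ i : Fin n, ∃ d : ℤ, x i * D.nform o z (Pi.single i 1) = s * d := by
    intro i
    by_cases hi : j + 1 ≤ (i : ℕ) ∧ (i : ℕ) ≤ j + m
    · obtain ⟨d, hd⟩ := h i hi.1 hi.2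
      obtain ⟨e, he⟩ := hx' i
      exact ⟨e * d, by rw [hd, he]; push_cast; ring⟩
    · exact ⟨0, by rw [mem_rootSpan_iff.1 hx i hi]; simp⟩
  choose d hd using h1
  refine ⟨∑ i, d i, ?_⟩
  conv_lhs => rw [sum_single_eq x]
  simp only [map_sum, map_smul, smul_eq_mul, hd]
  push_cast
  rw [Finset.mul_sum]

/-- The coefficient by which translation vectors enter the image of the right neighbour. -/
def rightCoeff (D : StringBasicSystem n) (j m : ℕ) (o e : Fin n) (x : Fin n → ℝ) : ℝ :=
  x e * D.cartanRight (j + m) * (D.label e / D.label o)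

theorem nform_right (N : IsNullRoot D j m o c r') (hm : 1 ≤ m) {e : Fin n} (he : (e : ℕ) = j + m)
    {x : Fin n → ℝ} {a : ℕ} (ha : a ≤ j + 1) (hx : x ∈ rootSpan n ℝ a (j + m)) {i : Fin n}
    (hi : (i : ℕ) = j + m + 1) : D.nform o x (Pi.single i 1) = -rightCoeff D j m o e x := by
  rw [D.nform_right_neighbour o (by omega) N.lt hx hi, rightCoeff]
  rw [show (⟨j + m, N.lt⟩ : Fin n) = e from Fin.ext he.symm]

/-- The conditions for a translation to be trivial modulo `s`. -/
theorem eichler_congruence_iff (N : IsNullRoot D j m o c r') (hm : 1 ≤ m) {e : Fin n}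
    (he : (e : ℕ) = j + m) {s : ℕ} {z : Fin n → ℝ} (hz : z ∈ rootSpan n ℝ (j + 1) (j + m)) :
    (∀ i, eichler (D.nform o) c z (Pi.single i 1) - Pi.single i 1 ∈ multiples n s) ↔
    (∀ i : Fin n, j + 1 ≤ (i : ℕ) → (i : ℕ) ≤ j + m →
      ∃ d : ℤ, D.nform o z (Pi.single i 1) = s * d) ∧
    ((D.cartanLeft j : ℝ) • z ∈ multiples n s ∧
      ∃ d : ℤ, (D.cartanLeft j : ℝ) * (D.nform o z z / 2) = s * d) ∧
    (rightCoeff D j m o e c • z ∈ multiples n s ∧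
      ∃ d : ℤ, rightCoeff D j m o e z + D.nform o z z / 2 * rightCoeff D j m o e c = s * d) := by
  have ho := N.val_o
  have hin : ∀ i : Fin n, j ≤ (i : ℕ) → (i : ℕ) ≤ j + m →
      (eichler (D.nform o) c z (Pi.single i 1) - Pi.single i 1 ∈ multiples n s ↔
        ∃ d : ℤ, D.nform o z (Pi.single i 1) = s * d) := by
    intro i h1 h2
    rw [N.eichler_eq (single_mem_rootSpan h1 h2), sub_right_comm, sub_self,
      N.sub_smul_mem_multiples_iff rfl]
    simp [zero_mem]
  have hleft : ∀ i : Fin n, (i : ℕ) + 1 = j →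
      (eichler (D.nform o) c z (Pi.single i 1) - Pi.single i 1 ∈ multiples n s ↔
        ((D.cartanLeft j : ℝ) • z ∈ multiples n s ∧
          ∃ d : ℤ, (D.cartanLeft j : ℝ) * (D.nform o z z / 2) = s * d)) := by
    intro i hi
    have h1 : D.nform o c (Pi.single i 1) = -(D.cartanLeft j : ℝ) := by
      have := D.nform_left_neighbour o (b := j + m) (by omega) (x := c) (by rw [ho]; exact N.mem)
        (i := i) (by omega)
      rw [this, N.coord, ho, one_mul]
    have h2 : D.nform o z (Pi.single i 1) = 0 :=
      D.nform_eq_zero_of_far o hz (Or.inl (by omega))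
    have h3 : eichler (D.nform o) c z (Pi.single i 1) - Pi.single i 1 =
        (-(D.cartanLeft j : ℝ)) • z - (-((D.cartanLeft j : ℝ) * (D.nform o z z / 2))) • c := by
      rw [eichler, h1, h2]
      module
    rw [h3, N.sub_smul_mem_multiples_iff (by simp [N.apply_o hz]), neg_smul, neg_mem_iff]
    refine and_congr_right fun _ => ?_
    constructor
    · rintro ⟨d, hd⟩; exact ⟨-d, by push_cast; linarith⟩
    · rintro ⟨d, hd⟩; exact ⟨-d, by push_cast; linarith⟩
  have hright : ∀ i : Fin n, (i : ℕ) = j + m + 1 →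
      (eichler (D.nform o) c z (Pi.single i 1) - Pi.single i 1 ∈ multiples n s ↔
        (rightCoeff D j m o e c • z ∈ multiples n s ∧
      ∃ d : ℤ, rightCoeff D j m o e z + D.nform o z z / 2 * rightCoeff D j m o e c = s * d)) := by
    intro i hi
    have h1 := N.nform_right hm he (by omega) N.mem hi
    have h2 := N.nform_right hm he le_rfl hz hi
    have h3 : eichler (D.nform o) c z (Pi.single i 1) - Pi.single i 1 =
        (-rightCoeff D j m o e c) • z -
          (-(rightCoeff D j m o e z + D.nform o z z / 2 * rightCoeff D j m o e c)) • c := by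
      rw [eichler, h1, h2]
      module
    rw [h3, N.sub_smul_mem_multiples_iff (by simp [N.apply_o hz]), neg_smul, neg_mem_iff]
    refine and_congr_right fun _ => ?_
    constructor
    · rintro ⟨d, hd⟩; exact ⟨-d, by push_cast; linarith⟩
    · rintro ⟨d, hd⟩; exact ⟨-d, by push_cast; linarith⟩
  constructor
  · intro h
    refine ⟨fun i h1 h2 => (hin i (by omega) h2).1 (h i), ?_, ?_⟩
    -- For `j = 0` there is no left neighbour, and the convention `m_{0,-1} = 0` makes the condition
    -- empty.
    · rcases Nat.eq_zero_or_pos j with hj | hj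
      · have : D.cartanLeft j = 0 := by rw [cartanLeft, dif_neg (by omega)]
        rw [this]
        exact ⟨by simp [zero_mem], 0, by simp⟩
      · exact (hleft ⟨j - 1, by omega⟩ (by simp; omega)).1 (h _)
    · by_cases hj : j + m + 1 < n
      · exact (hright ⟨j + m + 1, hj⟩ rfl).1 (h _)
      · have h0 : ∀ x, rightCoeff D j m o e x = 0 := by
          intro x
          rw [rightCoeff, cartanRight, dif_neg hj]
          simp
        rw [h0, h0]
        exact ⟨by simp [zero_mem], 0, by simp⟩
  · rintro ⟨h1, h2, h3⟩ i
    rcases lt_trichotomy ((i : ℕ) + 1) j with hi | hi | hi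
    · have e1 : D.nform o c (Pi.single i 1) = 0 := D.nform_eq_zero_of_far o N.mem (Or.inl hi)
      have e2 : D.nform o z (Pi.single i 1) = 0 :=
        D.nform_eq_zero_of_far o hz (Or.inl (by omega))
      rw [eichler, e1, e2]
      simp [zero_mem]
    · exact (hleft i hi).2 h2
    · rcases lt_trichotomy (i : ℕ) (j + m + 1) with hi' | hi' | hi'
      · refine (hin i (by omega) (by omega)).2 ?_
        -- Node `o` gives no new condition: since `z` is orthogonal to `c`, its product with `b o`
        -- is minus that with `c - b o`, an integral combination of the roots of `H`.
        by_cases hio : i = o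
        · subst hio
          have h4 : D.nform i z (Pi.single i 1) = -D.nform i z (c - Pi.single i 1) := by
            have : D.nform i z c = 0 := by
              rw [D.nform_symm]; exact N.orth_mem (mem_rootSpan_of_succ_le hz)
            rw [map_sub, this]
            ring
          obtain ⟨d, hd⟩ := exists_nform_eq_of_integral h1 N.root_mem
            (sub_mem N.integral (single_mem_multiples i))
          exact ⟨-d, by rw [h4, hd]; push_cast; ring⟩
        · have : (i : ℕ) ≠ o := fun h => hio (Fin.ext h)
          exact h1 i (by omega) (by omega)
      · exact (hright i hi').2 h3
      · have e1 : D.nform o c (Pi.single i 1) = 0 := D.nform_eq_zero_of_far o N.mem (Or.inr hi')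
        have e2 : D.nform o z (Pi.single i 1) = 0 := D.nform_eq_zero_of_far o hz (Or.inr hi')
        rw [eichler, e1, e2]
        simp [zero_mem]

/-- The action on the point group lattice of an element of `E` that is trivial modulo `s`. -/
theorem congruence_of_mem_ker (N : IsNullRoot D j m o c r') {s : ℕ}
    {z : Fin n → ℝ} {h : Matrix.GeneralLinearGroup (Fin n) ℤ}
    (hh : h ∈ D.parabolic (j + 1) (j + m))
    (H : ∀ i, eichler (D.nform o) c z (realAct h (Pi.single i 1)) - Pi.single i 1 ∈ multiples n s)
    (i : Fin n) (h1 : j + 1 ≤ (i : ℕ)) (h2 : (i : ℕ) ≤ j + m) :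
    realAct h (Pi.single i 1) - Pi.single i 1 ∈ multiples n s ∧
      ∃ d : ℤ, D.nform o z (realAct h (Pi.single i 1)) = s * d := by
  have h3 := D.realAct_mem_rootSpan le_rfl le_rfl hh (single_mem_rootSpan (R := ℝ) h1 h2)
  have h4 := H i
  rw [N.eichler_eq (mem_rootSpan_of_succ_le h3), sub_right_comm,
    N.sub_smul_mem_multiples_iff] at h4
  · exact h4
  · rw [Pi.sub_apply, N.apply_o h3, N.apply_o (single_mem_rootSpan (R := ℝ) h1 h2), sub_zero]

theorem congruence_of_integral {s : ℕ} {h : Matrix.GeneralLinearGroup (Fin n) ℤ}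
    (H : ∀ i : Fin n, j + 1 ≤ (i : ℕ) → (i : ℕ) ≤ j + m →
      realAct h (Pi.single i 1) - Pi.single i 1 ∈ multiples n s) {x : Fin n → ℝ}
    (hx : x ∈ rootSpan n ℝ (j + 1) (j + m)) (hx' : x ∈ multiples n 1) :
    realAct h x - x ∈ multiples n s := by
  rw [sum_single_eq x, map_sum, ← Finset.sum_sub_distrib]
  refine sum_mem fun i _ => ?_
  rw [map_smul, ← smul_sub]
  by_cases hi : j + 1 ≤ (i : ℕ) ∧ (i : ℕ) ≤ j + m
  · obtain ⟨d, hd⟩ := hx' i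
    exact int_smul_mem_multiples (H i hi.1 hi.2) ⟨d, by simpa using hd⟩
  · rw [mem_rootSpan_iff.1 hx i hi, zero_smul]
    exact zero_mem _

/-- The left neighbour is fixed by `H`, so it sees only the translation part. -/
theorem left_of_mem_ker (N : IsNullRoot D j m o c r') {s : ℕ}
    {z : Fin n → ℝ} (hz : z ∈ rootSpan n ℝ (j + 1) (j + m))
    {h : Matrix.GeneralLinearGroup (Fin n) ℤ} (hh : h ∈ D.parabolic (j + 1) (j + m))
    (H : ∀ i, eichler (D.nform o) c z (realAct h (Pi.single i 1)) - Pi.single i 1 ∈ multiples n s) :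
    (D.cartanLeft j : ℝ) • z ∈ multiples n s := by
  have ho := N.val_o
  rcases Nat.eq_zero_or_pos j with hj | hj
  · have : D.cartanLeft j = 0 := by rw [cartanLeft, dif_neg (by omega)]
    rw [this]
    simp [zero_mem]
  · have h1 : D.nform o c (Pi.single ⟨j - 1, by omega⟩ 1) = -(D.cartanLeft j : ℝ) := by
      have := D.nform_left_neighbour o (b := j + m) (by omega) (x := c) (by rw [ho]; exact N.mem)
        (i := ⟨j - 1, by omega⟩) (by simp; omega)
      rw [this, N.coord, ho, one_mul]
    have h2 : D.nform o z (Pi.single ⟨j - 1, by omega⟩ 1) = 0 :=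
      D.nform_eq_zero_of_far o hz (Or.inl (by simp; omega))
    have h3 : realAct h (Pi.single ⟨j - 1, by omega⟩ 1) = Pi.single ⟨j - 1, by omega⟩ 1 := by
      clear H
      induction hh using D.parabolic_induction with
      | one => exact realAct_one _
      | mul i hi _ g _ ih =>
        rw [realAct_mul, ih, realAct_r_single,
          (D.cartan_far ⟨j - 1, by omega⟩ i (by simp; omega)).2]
        simp
    have h4 := H ⟨j - 1, by omega⟩
    have h5 : eichler (D.nform o) c z (Pi.single ⟨j - 1, by omega⟩ 1) -
        Pi.single ⟨j - 1, by omega⟩ 1 =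
        (-(D.cartanLeft j : ℝ)) • z - (-((D.cartanLeft j : ℝ) * (D.nform o z z / 2))) • c := by
      rw [eichler, h1, h2]
      module
    rw [h3, h5, N.sub_smul_mem_multiples_iff (by simp [N.apply_o hz]), neg_smul,
      neg_mem_iff] at h4
    exact h4.1

/-- The right neighbour is in general moved by `h` as well, and modulo `s` its displacement by `h`
must match the one caused by `z`. For the modulus `2` this links sign changes in `H` to the
translation part. -/
theorem right_of_mem_ker (N : IsNullRoot D j m o c r') (hm : 1 ≤ m) {e : Fin n}
    (he : (e : ℕ) = j + m) {s : ℕ} {z : Fin n → ℝ} (hz : z ∈ rootSpan n ℝ (j + 1) (j + m))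
    {h : Matrix.GeneralLinearGroup (Fin n) ℤ} (hh : h ∈ D.parabolic (j + 1) (j + m))
    (H : ∀ i, eichler (D.nform o) c z (realAct h (Pi.single i 1)) - Pi.single i 1 ∈ multiples n s)
    {i : Fin n} (hi : (i : ℕ) = j + m + 1) :
    realAct h (Pi.single i 1) - Pi.single i 1 - rightCoeff D j m o e c • z ∈ multiples n s := by
  have h1 := N.nform_right hm he (by omega) N.mem hi
  have hw : realAct h (Pi.single i 1) - Pi.single i 1 ∈ rootSpan n ℝ (j + 1) (j + m) := by
    rw [mem_rootSpan_iff]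
    intro k hk
    rw [Pi.sub_apply, D.realAct_apply_of_notMem hh hk, sub_self]
  have h2 : D.nform o c (realAct h (Pi.single i 1)) = -rightCoeff D j m o e c := by
    have h3 := N.orth_mem (mem_rootSpan_of_succ_le hw)
    rw [map_sub, h1] at h3
    linarith
  have h4 := H i
  rw [eichler, h2] at h4
  have h5 : ∀ a : ℝ, realAct h (Pi.single i 1) + -rightCoeff D j m o e c • z - a • c -
      Pi.single i 1 = (realAct h (Pi.single i 1) - Pi.single i 1 - rightCoeff D j m o e c • z) -
      a • c := by
    intro a
    module
  rw [h5, N.sub_smul_mem_multiples_iff] at h4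
  · exact h4.1
  · rw [Pi.sub_apply, N.apply_o hw, Pi.smul_apply, N.apply_o hz]
    simp

end IsNullRoot

end StringBasicSystem
end

/-! ### Powers and products of translations, and the orthogonal coordinates of the cubic groups -/

noncomputable section

namespace StringBasicSystem

variable {n : ℕ} {D : StringBasicSystem n} {j m : ℕ} {o : Fin n} {c : Fin n → ℝ}
  {r' : Matrix.GeneralLinearGroup (Fin n) ℤ}

/-- `Fin.ofNat` reduces modulo `m + 1`, which has no effect for `i ≤ m`. -/
theorem gens_ofNat (h : j + m < n) {i : ℕ} (hi : i ≤ m) :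
    ((D.gens j m h (Fin.ofNat (m + 1) i) : D.parabolic j (j + m)) :
      Matrix.GeneralLinearGroup (Fin n) ℤ) = D.r ⟨j + i, by omega⟩ := by
  change D.r _ = _
  congr 2
  simp only [Fin.ofNat_eq_cast, Fin.val_natCast]
  rw [Nat.mod_eq_of_lt (by omega)]

/-- The conjugate of a reflection is the reflection in the image of the root. -/
theorem realAct_conj_r (o : Fin n) {a b : ℕ} {w : Matrix.GeneralLinearGroup (Fin n) ℤ}
    (hw : w ∈ D.parabolic a b) (i : Fin n) (x : Fin n → ℝ) :
    realAct (w * D.r i * w⁻¹) x = x - (D.label o / D.label i *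
      D.nform o (realAct w (Pi.single i 1)) x) • realAct w (Pi.single i 1) := by
  have h1 : D.nform o (Pi.single i 1) (realAct w⁻¹ x) =
      D.nform o (realAct w (Pi.single i 1)) x := by
    rw [← D.nform_parabolic o hw, realAct_self_inv]
  rw [realAct_mul, realAct_mul, D.realAct_r_eq_sub o, map_sub, map_smul, realAct_self_inv, h1]

namespace IsNullRoot

theorem eichler_pow (N : IsNullRoot D j m o c r') {z : Fin n → ℝ}
    (hz : z ∈ rootSpan n ℝ (j + 1) (j + m)) {t : D.parabolic j (j + m)}
    (ht : ∀ x, realAct t.1 x = eichler (D.nform o) c z x) (q : ℕ) (x : Fin n → ℝ) :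
    realAct (t ^ q).1 x = eichler (D.nform o) c ((q : ℝ) • z) x := by
  induction q generalizing x with
  | zero => simp [eichler_zero, realAct_one]
  | succ q ih =>
    have h1 : ((q + 1 : ℕ) : ℝ) • z = (q : ℝ) • z + z := by push_cast; module
    rw [h1, N.eichler_add' (Submodule.smul_mem _ _ hz) hz, ← ht, ← ih, pow_succ]
    exact realAct_mul _ _ _

theorem eichler_prod (N : IsNullRoot D j m o c r') {v : ℕ → Fin n → ℝ}
    {t : ℕ → D.parabolic j (j + m)} {k : ℕ} (hv : ∀ i < k, v i ∈ rootSpan n ℝ (j + 1) (j + m))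
    (ht : ∀ i < k, ∀ x, realAct (t i).1 x = eichler (D.nform o) c (v i) x) (q : ℕ)
    (x : Fin n → ℝ) :
    realAct (((List.range k).map fun i => t i ^ q).prod).1 x =
      eichler (D.nform o) c ((q : ℝ) • ∑ i ∈ Finset.range k, v i) x := by
  induction k generalizing x with
  | zero => simp [eichler_zero, realAct_one]
  | succ k ih =>
    rw [List.range_succ, List.map_append, List.prod_append, Finset.sum_range_succ, smul_add,
      N.eichler_add' (Submodule.smul_mem _ _ (Submodule.sum_mem _ fun i hi =>
        hv i (by have := Finset.mem_range.1 hi; omega))) (Submodule.smul_mem _ _ (hv k (by omega))),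
      ← N.eichler_pow (hv k (by omega)) (ht k (by omega)),
      ← ih (fun i hi => hv i (by omega)) fun i hi => ht i (by omega)]
    simp only [List.map_cons, List.map_nil, List.prod_cons, List.prod_nil, mul_one]
    exact realAct_mul _ _ _

end IsNullRoot

/-! ### The groups `[4, 3, …, 3, 4]` and `[∞]` -/

/-- The nodes `j, …, j + m` carry the simple roots `c - κ ε₁, ε₁ - ε₂, …, κ' εₘ` for orthogonal
vectors `ε₁, …, εₘ` of the same length. -/
structure IsCubicString (D : StringBasicSystem n) (j m : ℕ) (o e : Fin n) (κ κ' : ℝ) :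
    Prop where
  val_o : (o : ℕ) = j
  val_e : (e : ℕ) = j + m
  one_le : 1 ≤ m
  scale : (κ = 2 ∧ κ' = 2) ∨ (κ = 1 ∧ κ' = 1) ∨ (κ = 2 ∧ κ' = 1)
  label : D.label e / D.label o = κ' ^ 2 / κ ^ 2
  left : ∀ i, 1 ≤ i → i ≤ m → (D.cartanLeft (j + i) : ℝ) =
    (if i = 1 then κ else 1) * (if i = m then 2 / κ' else 1)
  right : ∀ i, i < m → (D.cartanRight (j + i) : ℝ) =
    (if i = 0 then 2 / κ else 1) * (if i + 1 = m then κ' else 1)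

/-- The coordinates of the vector `κ εₖ`. -/
def cubicCoord (j m : ℕ) (κ κ' : ℝ) (k l : ℕ) : ℝ :=
  if j + k ≤ l ∧ l < j + m then κ else if l = j + m ∧ k ≤ m then κ / κ' else 0

/-- The vector `κ εₖ`. -/
def cubicVec (n j m : ℕ) (κ κ' : ℝ) (k : ℕ) : Fin n → ℝ := nodeVec n (cubicCoord j m κ κ' k)

theorem cubicCoord_lt {κ κ' : ℝ} {k l : ℕ} (hl : l < m) :
    cubicCoord j m κ κ' k (j + l) = if k ≤ l then κ else 0 := by
  unfold cubicCoord
  by_cases h : k ≤ l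
  · rw [if_pos ⟨by omega, by omega⟩, if_pos h]
  · rw [if_neg (by omega), if_neg (by omega), if_neg h]

theorem cubicCoord_last {κ κ' : ℝ} {k : ℕ} (hk : k ≤ m) :
    cubicCoord j m κ κ' k (j + m) = κ / κ' := by
  unfold cubicCoord
  rw [if_neg (by omega), if_pos ⟨rfl, hk⟩]

theorem cubicCoord_gt {κ κ' : ℝ} {k l : ℕ} (hl : j + m < l ∨ l < j + k ∧ l < j + m) :
    cubicCoord j m κ κ' k l = 0 := by
  unfold cubicCoord
  rw [if_neg (by omega), if_neg (by omega)]

namespace IsCubicString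

variable {e : Fin n} {κ κ' : ℝ}

theorem lt (C : IsCubicString D j m o e κ κ') : j + m < n := C.val_e ▸ e.2

theorem pos (C : IsCubicString D j m o e κ κ') : 0 < κ ∧ 0 < κ' := by
  rcases C.scale with ⟨rfl, rfl⟩ | ⟨rfl, rfl⟩ | ⟨rfl, rfl⟩ <;> norm_num

theorem cubicVec_mem (C : IsCubicString D j m o e κ κ') {k : ℕ} (hk : 1 ≤ k) :
    cubicVec n j m κ κ' k ∈ rootSpan n ℝ (j + 1) (j + m) := by
  have := C.one_le
  exact nodeVec_mem_rootSpan fun l hl => cubicCoord_gt (by omega)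

theorem single_eq (C : IsCubicString D j m o e κ κ') {i : ℕ} (h2 : i < m) :
    κ • (Pi.single ⟨j + i, by have := C.lt; omega⟩ 1 : Fin n → ℝ) =
      cubicVec n j m κ κ' i - cubicVec n j m κ κ' (i + 1) := by
  ext ⟨l, hl⟩
  rw [Pi.sub_apply, Pi.smul_apply, Pi.single_apply, cubicVec, cubicVec, nodeVec_apply,
    nodeVec_apply]
  simp only [Fin.mk.injEq, smul_eq_mul]
  unfold cubicCoord
  by_cases h : l = j + i
  · rw [if_pos h, if_pos (by omega), if_neg (by omega), if_neg (by omega)]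
    ring
  · rw [if_neg h]
    by_cases h3 : j + i ≤ l ∧ l < j + m
    · rw [if_pos h3, if_pos (by omega : j + (i + 1) ≤ l ∧ l < j + m)]
      ring
    · rw [if_neg h3, if_neg (by omega : ¬ (j + (i + 1) ≤ l ∧ l < j + m))]
      by_cases h4 : l = j + m
      · rw [if_pos ⟨h4, h2.le⟩, if_pos ⟨h4, by omega⟩]
        ring
      · rw [if_neg (by omega), if_neg (by omega)]
        ring

theorem single_last_eq (C : IsCubicString D j m o e κ κ') :
    (κ / κ') • (Pi.single e 1 : Fin n → ℝ) = cubicVec n j m κ κ' m := by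
  ext l
  rw [Pi.smul_apply, Pi.single_apply, cubicVec, nodeVec_apply]
  unfold cubicCoord
  have h := C.val_e
  rw [if_neg (by omega : ¬ (j + m ≤ (l : ℕ) ∧ (l : ℕ) < j + m))]
  by_cases hl : l = e
  · rw [if_pos hl, if_pos ⟨by rw [hl, h], le_rfl⟩]
    simp
  · rw [if_neg hl, if_neg]
    · simp
    · rintro ⟨h', -⟩
      exact hl (Fin.ext (by omega))

/-- The node `j + i` carries the root `εᵢ - εᵢ₊₁`, whose reflection interchanges the two orthogonal
vectors; the proof checks the reflection coefficient from three consecutive coordinates. -/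
theorem realAct_swap (C : IsCubicString D j m o e κ κ') {i k : ℕ} (h1 : 1 ≤ i) (h2 : i < m)
    (hk : 1 ≤ k) (hk' : k ≤ m) :
    realAct (D.r ⟨j + i, by have := C.lt; omega⟩) (cubicVec n j m κ κ' k) =
      cubicVec n j m κ κ' (Equiv.swap i (i + 1) k) := by
  have hpos := C.pos
  have key : (D.cartanLeft (j + i) : ℝ) * cubicCoord j m κ κ' k (j + i - 1) -
      2 * cubicCoord j m κ κ' k (j + i) +
      D.cartanRight (j + i) * cubicCoord j m κ κ' k (j + i + 1) =
      (if k = i + 1 then κ else 0) - (if k = i then κ else 0) := by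
    -- For `i = 1` the preceding node is `j`, which lies outside the support of all the vectors `κ
    -- εₖ`.
    have e1 : (D.cartanLeft (j + i) : ℝ) * cubicCoord j m κ κ' k (j + i - 1) =
        if k ≤ i - 1 then κ else 0 := by
      rw [show j + i - 1 = j + (i - 1) by omega, cubicCoord_lt (by omega), C.left i h1 h2.le]
      by_cases hi : i = 1
      · rw [if_neg (by omega : ¬ k ≤ i - 1), mul_zero]
      · rw [if_neg hi, if_neg (by omega : ¬ i = m)]
        ring
    have e2 : (D.cartanRight (j + i) : ℝ) * cubicCoord j m κ κ' k (j + i + 1) =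
        if k ≤ i + 1 then κ else 0 := by
      rw [C.right i h2, if_neg (by omega)]
      by_cases hi : i + 1 = m
      · rw [if_pos hi, add_assoc, hi, cubicCoord_last hk', if_pos hk']
        have := hpos.2.ne'
        field_simp
      · rw [if_neg hi, add_assoc, cubicCoord_lt (by omega)]
        ring
    rw [e1, e2, cubicCoord_lt h2]
    rcases lt_trichotomy k i with h | h | h
    · rw [if_pos (by omega), if_pos (by omega), if_pos (by omega), if_neg (by omega),
        if_neg (by omega)]
      ring
    · rw [if_neg (by omega), if_pos (by omega), if_pos (by omega), if_neg (by omega),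
        if_pos (by omega)]
      ring
    · rw [if_neg (by omega), if_neg (by omega), if_neg (by omega : ¬ k = i)]
      by_cases h' : k = i + 1
      · rw [if_pos (by omega), if_pos h']
        ring
      · rw [if_neg (by omega), if_neg h']
        ring
  rw [cubicVec, D.realAct_r_nodeVec, key, ← cubicVec, sub_smul, ite_smul, ite_smul,
    C.single_eq h2, zero_smul]
  by_cases ha : k = i
  · subst ha
    simp
  · by_cases hb : k = i + 1
    · subst hb
      simp
    · rw [if_neg ha, if_neg hb, Equiv.swap_apply_of_ne_of_ne ha hb]
      simp

theorem realAct_last (C : IsCubicString D j m o e κ κ') {k : ℕ} (hk : 1 ≤ k) (hk' : k ≤ m) :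
    realAct (D.r e) (cubicVec n j m κ κ' k) =
      if k = m then -cubicVec n j m κ κ' k else cubicVec n j m κ κ' k := by
  have hpos := C.pos
  have hm := C.one_le
  have hp := hpos.2.ne'
  have key : (D.cartanLeft e : ℝ) * cubicCoord j m κ κ' k (e - 1) -
      2 * cubicCoord j m κ κ' k e +
      D.cartanRight e * cubicCoord j m κ κ' k (e + 1) =
      if k = m then -2 * (κ / κ') else 0 := by
    have e1 : (D.cartanLeft e : ℝ) * cubicCoord j m κ κ' k (e - 1) =
        if k = m then 0 else 2 * (κ / κ') := by
      rw [C.val_e, show j + m - 1 = j + (m - 1) by omega, cubicCoord_lt (by omega),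
        C.left m hm le_rfl, if_pos rfl]
      by_cases hi : k = m
      · rw [if_neg (by omega : ¬ k ≤ m - 1), mul_zero, if_pos hi]
      · rw [if_pos (by omega : k ≤ m - 1), if_neg (by omega : ¬ m = 1), if_neg hi]
        ring
    rw [e1, C.val_e, cubicCoord_last hk', cubicCoord_gt (by omega)]
    split_ifs <;> ring
  rw [cubicVec, D.realAct_r_nodeVec, key, ← cubicVec, ite_smul, zero_smul]
  split_ifs with h
  · rw [mul_smul, C.single_last_eq, h]
    module
  · simp

/-- The null vector. -/
theorem orth (C : IsCubicString D j m o e κ κ') {i : Fin n} (h1 : j ≤ (i : ℕ))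
    (h2 : (i : ℕ) ≤ j + m) :
    D.nform o (Pi.single o 1 + cubicVec n j m κ κ' 1) (Pi.single i 1) = 0 := by
  have hpos := C.pos
  have hm := C.one_le
  have hp := hpos.2.ne'
  have hp' := hpos.1.ne'
  have hval := C.val_o
  have hc : Pi.single o 1 + cubicVec n j m κ κ' 1 =
      nodeVec n (fun l => if l = j then 1 else cubicCoord j m κ κ' 1 l) := by
    ext l
    rw [Pi.add_apply, cubicVec, nodeVec_apply, nodeVec_apply, Pi.single_apply]
    by_cases hl : l = o
    · rw [if_pos hl, if_pos (by rw [hl, hval]), cubicCoord_gt, add_zero]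
      right
      rw [hl]
      omega
    · rw [if_neg hl, if_neg (fun h => hl (Fin.ext (by omega))), zero_add]
  rw [D.nform_symm, hc, D.nform_single_nodeVec]
  refine mul_eq_zero_of_left ?_ _
  rw [neg_eq_zero]
  obtain ⟨t, ht⟩ : ∃ t, (i : ℕ) = j + t := ⟨i - j, by omega⟩
  rw [ht]
  rcases Nat.eq_zero_or_pos t with rfl | hpt
  · have e1 : (D.cartanLeft (j + 0) : ℝ) *
        (if j + 0 - 1 = j then 1 else cubicCoord j m κ κ' 1 (j + 0 - 1)) = 0 := by
      rcases Nat.eq_zero_or_pos j with h0 | h0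
      · have : D.cartanLeft (j + 0) = 0 := by rw [cartanLeft, dif_neg (by omega)]
        rw [this]
        simp
      · rw [if_neg (by omega), cubicCoord_gt (by omega), mul_zero]
    rw [e1, if_pos (by omega), if_neg (by omega), C.right 0 (by omega), if_pos rfl, add_assoc j 0 1,
      zero_add]
    by_cases h : 1 = m
    · rw [if_pos h, ← h, cubicCoord_last le_rfl]
      field_simp
      ring
    · rw [if_neg h, cubicCoord_lt (by omega), if_pos le_rfl]
      field_simp
      ring
  · have e2 : (if j + t = j then (1 : ℝ) else cubicCoord j m κ κ' 1 (j + t)) =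
        if t = m then κ / κ' else κ := by
      rw [if_neg (by omega)]
      by_cases h : t = m
      · rw [if_pos h, h, cubicCoord_last (by omega)]
      · rw [if_neg h, cubicCoord_lt (by omega), if_pos (by omega)]
    have e3 : (D.cartanRight (j + t) : ℝ) *
        (if j + t + 1 = j then 1 else cubicCoord j m κ κ' 1 (j + t + 1)) =
        if t = m then 0 else κ := by
      rw [if_neg (by omega)]
      by_cases h : t = m
      · rw [if_pos h, h, cubicCoord_gt (by omega), mul_zero]
      · rw [if_neg h, C.right t (by omega), if_neg (by omega), add_assoc]
        by_cases h' : t + 1 = m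
        · rw [if_pos h', h', cubicCoord_last (by omega)]
          field_simp
        · rw [if_neg h', cubicCoord_lt (by omega), if_pos (by omega)]
          ring
    have e1 : (D.cartanLeft (j + t) : ℝ) *
        (if j + t - 1 = j then 1 else cubicCoord j m κ κ' 1 (j + t - 1)) =
        if t = m then 2 * (κ / κ') else κ := by
      rw [C.left t hpt (by omega)]
      by_cases h1 : t = 1
      · rw [if_pos h1, if_pos (by omega : j + t - 1 = j)]
        split_ifs <;> ring
      · rw [if_neg h1, if_neg (by omega : ¬ j + t - 1 = j), show j + t - 1 = j + (t - 1) by omega,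
          cubicCoord_lt (by omega), if_pos (by omega : 1 ≤ t - 1)]
        split_ifs <;> ring
    rw [e1, e2, e3]
    split_ifs <;> ring

theorem orth_mem (C : IsCubicString D j m o e κ κ') {x : Fin n → ℝ}
    (hx : x ∈ rootSpan n ℝ j (j + m)) :
    D.nform o (Pi.single o 1 + cubicVec n j m κ κ' 1) x = 0 := by
  induction hx using Submodule.span_induction with
  | mem x hx => obtain ⟨i, h1, h2, rfl⟩ := hx; exact C.orth h1 h2
  | zero => simp
  | add x y _ _ hx hy => rw [(D.nform o _).map_add, hx, hy, add_zero]
  | smul a x _ hx => rw [(D.nform o _).map_smul, hx, smul_zero]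

theorem single_mem (C : IsCubicString D j m o e κ κ') :
    (Pi.single o 1 : Fin n → ℝ) ∈ rootSpan n ℝ j (j + m) :=
  single_mem_rootSpan C.val_o.ge (by have := C.val_o; omega)

/-- The null vector is orthogonal to `b o`, of norm `2`, and to `κ ε₁`, so `κ ε₁` has norm `2`;
interchanges carry this to the other indices. The sign change of `εₘ` makes it orthogonal to the
others, and interchanges lower the larger index from `m` downwards. -/
theorem nform_cubicVec (C : IsCubicString D j m o e κ κ') {k l : ℕ} (hk : 1 ≤ k) (hk' : k ≤ m)
    (hl : 1 ≤ l) (hl' : l ≤ m) :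
    D.nform o (cubicVec n j m κ κ' k) (cubicVec n j m κ κ' l) = if k = l then 2 else 0 := by
  have hdiag : ∀ k, 1 ≤ k → k ≤ m →
      D.nform o (cubicVec n j m κ κ' k) (cubicVec n j m κ κ' k) = 2 := by
    intro k hk
    induction k, hk using Nat.le_induction with
    | base =>
      intro _
      have h1 := C.orth_mem (mem_rootSpan_of_succ_le (C.cubicVec_mem le_rfl))
      have h2 := C.orth_mem C.single_mem
      have h3 := D.nform_self o
      have h4 := D.nform_symm o (Pi.single o 1) (cubicVec n j m κ κ' 1)
      simp only [map_add, LinearMap.add_apply] at h1 h2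
      linarith
    | succ k hk ih =>
      intro h
      rw [← ih (by omega), ← D.nform_r o ⟨j + k, by have := C.lt; omega⟩
        (cubicVec n j m κ κ' k), C.realAct_swap hk (by omega) hk (by omega)]
      simp
  have hoff : ∀ t k, 1 ≤ k → k < m - t →
      D.nform o (cubicVec n j m κ κ' k) (cubicVec n j m κ κ' (m - t)) = 0 := by
    intro t
    induction t with
    | zero =>
      intro k h1 h2
      have h3 := D.nform_r o e (cubicVec n j m κ κ' k) (cubicVec n j m κ κ' m)
      rw [C.realAct_last h1 (by omega), C.realAct_last C.one_le le_rfl, if_neg (by omega),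
        if_pos rfl, map_neg] at h3
      rw [Nat.sub_zero]
      linarith
    | succ t ih =>
      intro k h1 h2
      have h3 := D.nform_r o ⟨j + (m - (t + 1)), by have := C.lt; omega⟩
        (cubicVec n j m κ κ' k) (cubicVec n j m κ κ' (m - (t + 1)))
      rw [C.realAct_swap (by omega) (by omega) h1 (by omega),
        C.realAct_swap (by omega) (by omega) (by omega) (by omega), Equiv.swap_apply_left,
        Equiv.swap_apply_of_ne_of_ne (by omega) (by omega),
        show m - (t + 1) + 1 = m - t by omega, ih k h1 (by omega)] at h3
      exact h3.symm
  rcases lt_trichotomy k l with h | h | h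
  · rw [if_neg (by omega)]
    have := hoff (m - l) k hk (by omega)
    rwa [show m - (m - l) = l by omega] at this
  · rw [if_pos h, ← h]
    exact hdiag k hk hk'
  · rw [if_neg (by omega), D.nform_symm]
    have := hoff (m - k) l hl (by omega)
    rwa [show m - (m - k) = k by omega] at this

end IsCubicString

/-- The vector with coordinates `x` with respect to the vectors `κ εₖ`. -/
def cubicSum (n j m : ℕ) (κ κ' : ℝ) (x : ℕ → ℝ) : Fin n → ℝ :=
  ∑ k ∈ Finset.Icc 1 m, x k • cubicVec n j m κ κ' k

namespace IsCubicString

variable {e : Fin n} {κ κ' : ℝ}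

theorem cubicSum_mem (C : IsCubicString D j m o e κ κ') (x : ℕ → ℝ) :
    cubicSum n j m κ κ' x ∈ rootSpan n ℝ (j + 1) (j + m) :=
  Submodule.sum_mem _ fun _ hk =>
    Submodule.smul_mem _ _ (C.cubicVec_mem (Finset.mem_Icc.1 hk).1)

theorem nform_cubicSum (C : IsCubicString D j m o e κ κ') (x : ℕ → ℝ) {l : ℕ} (hl : 1 ≤ l)
    (hl' : l ≤ m) : D.nform o (cubicSum n j m κ κ' x) (cubicVec n j m κ κ' l) = 2 * x l := by
  simp only [cubicSum, map_sum, LinearMap.sum_apply, map_smul, LinearMap.smul_apply, smul_eq_mul]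
  rw [Finset.sum_eq_single l]
  · rw [C.nform_cubicVec hl hl' hl hl', if_pos rfl, mul_comm]
  · intro k hk hkl
    rw [C.nform_cubicVec (Finset.mem_Icc.1 hk).1 (Finset.mem_Icc.1 hk).2 hl hl', if_neg hkl,
      mul_zero]
  · intro h
    exact absurd (Finset.mem_Icc.2 ⟨hl, hl'⟩) h

theorem nform_cubicSum_self (C : IsCubicString D j m o e κ κ') (x : ℕ → ℝ) :
    D.nform o (cubicSum n j m κ κ' x) (cubicSum n j m κ κ' x) =
      2 * ∑ k ∈ Finset.Icc 1 m, x k ^ 2 := by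
  conv_lhs => enter [2]; rw [cubicSum]
  rw [map_sum, Finset.mul_sum]
  refine Finset.sum_congr rfl fun k hk => ?_
  rw [map_smul, C.nform_cubicSum x (Finset.mem_Icc.1 hk).1 (Finset.mem_Icc.1 hk).2, smul_eq_mul]
  ring

/-- The vector `κ εₖ` is constant from node `j + k` on, up to the last node, so coordinates with
respect to the simple roots are partial sums. -/
theorem cubicSum_apply_lt (C : IsCubicString D j m o e κ κ') (x : ℕ → ℝ) {l : ℕ} (hl : l < m) :
    cubicSum n j m κ κ' x ⟨j + l, by have := C.lt; omega⟩ =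
      κ * ∑ k ∈ Finset.Icc 1 l, x k := by
  simp only [cubicSum, Finset.sum_apply, Pi.smul_apply, smul_eq_mul, cubicVec, nodeVec_apply]
  rw [Finset.mul_sum, ← Finset.sum_subset (Finset.Icc_subset_Icc_right hl.le)]
  · refine Finset.sum_congr rfl fun k hk => ?_
    rw [cubicCoord_lt hl, if_pos (Finset.mem_Icc.1 hk).2, mul_comm]
  · intro k hk hk'
    rw [cubicCoord_lt hl, if_neg, mul_zero]
    intro h
    exact hk' (Finset.mem_Icc.2 ⟨(Finset.mem_Icc.1 hk).1, h⟩)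

theorem cubicSum_apply_last (C : IsCubicString D j m o e κ κ') (x : ℕ → ℝ) :
    cubicSum n j m κ κ' x e = κ / κ' * ∑ k ∈ Finset.Icc 1 m, x k := by
  simp only [cubicSum, Finset.sum_apply, Pi.smul_apply, smul_eq_mul, cubicVec, nodeVec_apply]
  rw [Finset.mul_sum]
  refine Finset.sum_congr rfl fun k hk => ?_
  rw [C.val_e, cubicCoord_last (Finset.mem_Icc.1 hk).2, mul_comm]

theorem single_eq_cubicVec (C : IsCubicString D j m o e κ κ') {i : Fin n} (h1 : j + 1 ≤ (i : ℕ))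
    (h2 : (i : ℕ) ≤ j + m) : (i = e ∧
      (Pi.single i 1 : Fin n → ℝ) = (κ' / κ) • cubicVec n j m κ κ' m) ∨
    ((i : ℕ) < j + m ∧ (Pi.single i 1 : Fin n → ℝ) =
      (1 / κ) • (cubicVec n j m κ κ' (i - j) - cubicVec n j m κ κ' (i - j + 1))) := by
  have hp := C.pos.1.ne'
  have hp' := C.pos.2.ne'
  rcases Nat.lt_or_ge (i : ℕ) (j + m) with h | h
  · right
    refine ⟨h, ?_⟩
    rw [← C.single_eq (i := i - j) (by omega), smul_smul, one_div_mul_cancel hp,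
      one_smul]
    congr 1
    exact Fin.ext (by simp; omega)
  · left
    have : i = e := Fin.ext (by rw [C.val_e]; omega)
    refine ⟨this, ?_⟩
    rw [← C.single_last_eq, smul_smul, this]
    rw [show κ' / κ * (κ / κ') = 1 by field_simp, one_smul]

theorem exists_cubicSum (C : IsCubicString D j m o e κ κ') {w : Fin n → ℝ}
    (hw : w ∈ rootSpan n ℝ (j + 1) (j + m)) : ∃ x, w = cubicSum n j m κ κ' x := by
  have hvec : ∀ k, 1 ≤ k → k ≤ m →
      cubicVec n j m κ κ' k = cubicSum n j m κ κ' (Pi.single k 1) := by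
    intro k h1 h2
    rw [cubicSum, Finset.sum_eq_single k]
    · simp
    · intro l _ hl
      simp [hl]
    · intro h
      exact absurd (Finset.mem_Icc.2 ⟨h1, h2⟩) h
  have hadd : ∀ x y, cubicSum n j m κ κ' x + cubicSum n j m κ κ' y =
      cubicSum n j m κ κ' (x + y) := by
    intro x y
    simp only [cubicSum, ← Finset.sum_add_distrib, Pi.add_apply, add_smul]
  have hsmul : ∀ (a : ℝ) x, a • cubicSum n j m κ κ' x = cubicSum n j m κ κ' (a • x) := by
    intro a x
    simp only [cubicSum, Finset.smul_sum, Pi.smul_apply, smul_eq_mul, mul_smul]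
  induction hw using Submodule.span_induction with
  | mem w hw =>
    obtain ⟨i, h1, h2, rfl⟩ := hw
    rcases C.single_eq_cubicVec h1 h2 with ⟨_, h⟩ | ⟨_, h⟩
    · rw [h, hvec m C.one_le le_rfl, hsmul]
      exact ⟨_, rfl⟩
    · rw [h, hvec _ (by omega) (by omega), hvec _ (by omega) (by omega), sub_eq_add_neg,
        ← neg_one_smul ℝ (cubicSum n j m κ κ' (Pi.single ((i : ℕ) - j + 1) 1)), hsmul, hadd, hsmul]
      exact ⟨_, rfl⟩
  | zero => exact ⟨0, by simp [cubicSum]⟩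
  | add x y _ _ hx hy =>
    obtain ⟨x, rfl⟩ := hx
    obtain ⟨y, rfl⟩ := hy
    exact ⟨_, hadd x y⟩
  | smul a x _ hx =>
    obtain ⟨x, rfl⟩ := hx
    exact ⟨_, hsmul a x⟩

/-- Orthogonal expansion, with vectors of norm `2`. -/
theorem eq_cubicSum (C : IsCubicString D j m o e κ κ') {w : Fin n → ℝ}
    (hw : w ∈ rootSpan n ℝ (j + 1) (j + m)) :
    w = cubicSum n j m κ κ' (fun k => D.nform o w (cubicVec n j m κ κ' k) / 2) := by
  obtain ⟨x, rfl⟩ := C.exists_cubicSum hw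
  rw [cubicSum, cubicSum]
  refine Finset.sum_congr rfl fun k hk => ?_
  change _ = (D.nform o (cubicSum n j m κ κ' x) _ / 2) • _
  rw [C.nform_cubicSum x (Finset.mem_Icc.1 hk).1 (Finset.mem_Icc.1 hk).2]
  congr 1
  ring

/-- The reflection of the point group parallel to the first generator. -/
def parallel (D : StringBasicSystem n) (j m : ℕ) (h : j + m < n) : D.parabolic j (j + m) :=
  prefixProduct (D.gens j m h) * D.gens j m h (Fin.last m) * (prefixProduct (D.gens j m h))⁻¹

theorem prefixProduct_mem (C : IsCubicString D j m o e κ κ') :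
    ((prefixProduct (D.gens j m C.lt) : D.parabolic j (j + m)) :
      Matrix.GeneralLinearGroup (Fin n) ℤ) ∈ D.parabolic (j + 1) (j + m) := by
  have : prefixProduct (D.gens j m C.lt) ∈
      (D.parabolic (j + 1) (j + m)).subgroupOf (D.parabolic j (j + m)) := by
    refine Subgroup.list_prod_mem _ fun g hg => ?_
    obtain ⟨i, hi, rfl⟩ := List.mem_map.1 hg
    have := List.mem_range.1 hi
    rw [Subgroup.mem_subgroupOf, gens_ofNat C.lt (by omega)]
    exact D.r_mem_parabolic (by simp) (by simp; omega)
  exact this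

/-- The successive interchanges carry index `m` down to `1`, one step at a time. -/
theorem realAct_prefixProduct (C : IsCubicString D j m o e κ κ') :
    realAct ((prefixProduct (D.gens j m C.lt) : D.parabolic j (j + m)) :
      Matrix.GeneralLinearGroup (Fin n) ℤ) (cubicVec n j m κ κ' m) = cubicVec n j m κ κ' 1 := by
  have key : ∀ t, t ≤ m - 1 →
      realAct ((((List.range t).map fun i =>
        D.gens j m C.lt (Fin.ofNat (m + 1) (i + 1))).prod : D.parabolic j (j + m)) :
        Matrix.GeneralLinearGroup (Fin n) ℤ) (cubicVec n j m κ κ' (t + 1)) =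
      cubicVec n j m κ κ' 1 := by
    intro t
    induction t with
    | zero => intro _; exact realAct_one _
    | succ t ih =>
      intro h
      rw [List.range_succ, List.map_append, List.prod_append]
      simp only [List.map_cons, List.map_nil, List.prod_cons, List.prod_nil, mul_one]
      rw [Subgroup.coe_mul, realAct_mul, gens_ofNat C.lt (by omega),
        C.realAct_swap (by omega) (by omega) (by omega) (by omega), Equiv.swap_apply_right]
      exact ih (by omega)
  have := key (m - 1) le_rfl
  rwa [show m - 1 + 1 = m by have := C.one_le; omega] at this

/-- The null vector is `b o + κ ε₁`. The reflection parallel to `r o` changes the sign of `ε₁`; it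
is the conjugate by `prefixProduct` of the last generator, which changes the sign of `εₘ`. -/
theorem isNullRoot (C : IsCubicString D j m o e κ κ') :
    IsNullRoot D j m o (Pi.single o 1 + cubicVec n j m κ κ' 1) (parallel D j m C.lt).1 := by
  have hval := C.val_o
  have hm := C.one_le
  have hp := C.pos.1.ne'
  have hp' := C.pos.2.ne'
  have hcoord : ∀ i : Fin n, i ≠ o → (Pi.single o 1 + cubicVec n j m κ κ' 1 : Fin n → ℝ) i =
      cubicCoord j m κ κ' 1 i := by
    intro i hi
    simp [hi, cubicVec, nodeVec_apply]
  have hco : (Pi.single o 1 + cubicVec n j m κ κ' 1 : Fin n → ℝ) o = 1 := by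
    rw [Pi.add_apply, Pi.single_eq_same, cubicVec, nodeVec_apply, cubicCoord_gt (by omega),
      add_zero]
  have heq : (Pi.single o 1 + cubicVec n j m κ κ' 1 : Fin n → ℝ) - Pi.single o 1 =
      cubicVec n j m κ κ' 1 := by simp
  have hpre := C.prefixProduct_mem
  have hgl : (D.gens j m C.lt (Fin.last m)).1 = D.r e := by
    change D.r _ = _
    congr 1
    exact Fin.ext (by simp [C.val_e])
  have hrm : D.r e ∈ D.parabolic (j + 1) (j + m) :=
    D.r_mem_parabolic (by rw [C.val_e]; omega) C.val_e.le
  have hcoe : (parallel D j m C.lt).1 = (prefixProduct (D.gens j m C.lt)).1 * D.r e *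
      ((prefixProduct (D.gens j m C.lt)).1)⁻¹ := by
    rw [← hgl]
    rfl
  refine ⟨hval, C.lt, ?_, hco, ?_, ?_, fun i h1 h2 => C.orth h1 h2, ?_, ?_, ?_⟩
  · exact add_mem C.single_mem (mem_rootSpan_of_succ_le (C.cubicVec_mem le_rfl))
  · refine add_mem (single_mem_multiples o) fun k => ?_
    rw [cubicVec, nodeVec_apply]
    unfold cubicCoord
    rcases C.scale with ⟨rfl, rfl⟩ | ⟨rfl, rfl⟩ | ⟨rfl, rfl⟩ <;> split_ifs
    · exact ⟨2, by norm_num⟩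
    · exact ⟨1, by norm_num⟩
    · exact ⟨0, by norm_num⟩
    · exact ⟨1, by norm_num⟩
    · exact ⟨1, by norm_num⟩
    · exact ⟨0, by norm_num⟩
    · exact ⟨2, by norm_num⟩
    · exact ⟨2, by norm_num⟩
    · exact ⟨0, by norm_num⟩
  · intro i h1 h2
    by_cases hio : i = o
    · rw [hio, hco]
      exact one_ne_zero
    · rw [hcoord i hio]
      have : (i : ℕ) ≠ o := fun h => hio (Fin.ext h)
      unfold cubicCoord
      by_cases h : (i : ℕ) < j + m
      · rw [if_pos (by omega)]
        exact hp
      · rw [if_neg (by omega), if_pos (by omega)]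
        exact div_ne_zero hp hp'
  · intro x hx h
    have hz : ∀ y ∈ rootSpan n ℝ (j + 1) (j + m), D.nform o x y = 0 := by
      intro y hy
      induction hy using Submodule.span_induction with
      | mem y hy => obtain ⟨i, h1, h2, rfl⟩ := hy; exact h i h1 h2
      | zero => simp
      | add y y' _ _ hy hy' => simp [hy, hy']
      | smul a y _ hy => simp [hy]
    rw [C.eq_cubicSum hx, cubicSum]
    refine Finset.sum_eq_zero fun k hk => ?_
    rw [hz _ (C.cubicVec_mem (Finset.mem_Icc.1 hk).1)]
    simp
  · rw [hcoe]
    exact mul_mem (mul_mem hpre hrm) (inv_mem hpre)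
  · intro x
    have h1 : realAct (prefixProduct (D.gens j m C.lt)).1 (Pi.single e 1) =
        (κ' / κ) • cubicVec n j m κ κ' 1 := by
      rw [← C.realAct_prefixProduct, ← map_smul, ← C.single_last_eq, smul_smul,
        show κ' / κ * (κ / κ') = 1 by field_simp, one_smul]
    have h2 : D.label o / D.label e = κ ^ 2 / κ' ^ 2 := by
      rw [← inv_div, C.label, inv_div]
    rw [heq, hcoe, realAct_conj_r o hpre, h1, h2, map_smul, LinearMap.smul_apply, smul_smul,
      smul_eq_mul]
    congr 2
    field_simp

theorem realAct_cubicTranslation (C : IsCubicString D j m o e κ κ') {i : ℕ} (hi : i < m)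
    (x : Fin n → ℝ) :
    realAct ((cubicTranslation (D.gens j m C.lt) i : D.parabolic j (j + m)) :
      Matrix.GeneralLinearGroup (Fin n) ℤ) x =
      eichler (D.nform o) (Pi.single o 1 + cubicVec n j m κ κ' 1)
        (cubicVec n j m κ κ' (i + 1)) x := by
  induction i generalizing x with
  | zero =>
    have h := C.isNullRoot.realAct_r_mul x
    rw [add_sub_cancel_left] at h
    rw [← h]
    have h0 : D.r o = (D.gens j m C.lt 0).1 := by
      change _ = D.r _
      congr 1
      exact Fin.ext (by simp [C.val_o])
    rw [h0]
    rfl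
  | succ i ih =>
    have hr := D.r_mem_parabolic (a := j) (b := j + m)
      (i := ⟨j + (i + 1), by have := C.lt; omega⟩) (by simp) (by simp; omega)
    change realAct ((D.gens j m C.lt (Fin.ofNat (m + 1) (i + 1))).1 *
      (cubicTranslation (D.gens j m C.lt) i).1 *
      ((D.gens j m C.lt (Fin.ofNat (m + 1) (i + 1))).1)⁻¹) x = _
    rw [gens_ofNat C.lt (by omega), realAct_mul, realAct_mul, ih (by omega),
      C.isNullRoot.eichler_conj' hr, realAct_self_inv,
      C.realAct_swap (by omega) (by omega) (by omega) (by omega), Equiv.swap_apply_left]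

end IsCubicString

end StringBasicSystem
end

/-! ### The cubic groups: congruences and the action of signed permutations -/

noncomputable section

theorem exists_eq_mul_iff_dvd {s : ℕ} {a : ℤ} {r : ℝ} (h : r = a) :
    (∃ d : ℤ, r = s * d) ↔ (s : ℤ) ∣ a := by
  constructor
  · rintro ⟨d, hd⟩
    exact ⟨d, by rw [h] at hd; exact_mod_cast hd⟩
  · rintro ⟨d, hd⟩
    exact ⟨d, by rw [h, hd]; push_cast; ring⟩

theorem int_eq_zero_of_abs_lt {s : ℕ} {d : ℤ} {r : ℝ} (h : r = s * d) (hr : |r| < s) : r = 0 := by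
  rw [h, abs_mul, Nat.abs_cast] at hr
  have hs : (0 : ℝ) < s := by
    rcases Nat.eq_zero_or_pos s with rfl | hs
    · simp at hr
    · exact_mod_cast hs
  have h1 : |(d : ℝ)| < 1 := by
    by_contra hd
    nlinarith [not_lt.1 hd]
  have h2 : d = 0 := Int.abs_lt_one_iff.1 (by exact_mod_cast h1)
  rw [h, h2]
  simp

namespace StringBasicSystem

variable {n : ℕ} {D : StringBasicSystem n} {j m : ℕ} {o e : Fin n} {κ κ' : ℝ}

theorem smul_cubicSum (a : ℝ) (x : ℕ → ℝ) :
    a • cubicSum n j m κ κ' x = cubicSum n j m κ κ' fun k => a * x k := by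
  simp only [cubicSum, Finset.smul_sum, mul_smul]

theorem cubicSum_sub (x y : ℕ → ℝ) :
    cubicSum n j m κ κ' x - cubicSum n j m κ κ' y = cubicSum n j m κ κ' fun k => x k - y k := by
  simp only [cubicSum, ← Finset.sum_sub_distrib, sub_smul]

theorem cubicSum_congr {x y : ℕ → ℝ} (h : ∀ k, 1 ≤ k → k ≤ m → x k = y k) :
    cubicSum n j m κ κ' x = cubicSum n j m κ κ' y :=
  Finset.sum_congr rfl fun k hk => by rw [h k (Finset.mem_Icc.1 hk).1 (Finset.mem_Icc.1 hk).2]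

namespace IsCubicString

theorem cubicVec_apply_lt (C : IsCubicString D j m o e κ κ') {k l : ℕ} (hl : l < m) :
    cubicVec n j m κ κ' k ⟨j + l, by have := C.lt; omega⟩ = if k ≤ l then κ else 0 := by
  rw [cubicVec, nodeVec_apply, cubicCoord_lt hl]

theorem cubicVec_apply_last (C : IsCubicString D j m o e κ κ') {k : ℕ} (hk : k ≤ m) :
    cubicVec n j m κ κ' k e = κ / κ' := by
  rw [cubicVec, nodeVec_apply, C.val_e, cubicCoord_last hk]

/-- The vertices of the base chamber are `(1, …, 1, 0, …, 0)` in the coordinates of the translation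
lattice: divided by `c`, the vector `κ εₖ` is a step function on the nodes. -/
theorem cubicVec_div (C : IsCubicString D j m o e κ κ') {k : ℕ} (hk : 1 ≤ k) (hk' : k ≤ m)
    {i : Fin n} (h1 : j ≤ (i : ℕ)) (h2 : (i : ℕ) ≤ j + m) :
    cubicVec n j m κ κ' k i / (Pi.single o 1 + cubicVec n j m κ κ' 1 : Fin n → ℝ) i =
      if j + k ≤ i then 1 else 0 := by
  have hp := C.pos.1.ne'
  have hp' := C.pos.2.ne'
  have ho := C.val_o
  obtain ⟨t, ht⟩ : ∃ t, (i : ℕ) = j + t := ⟨i - j, by omega⟩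
  rcases Nat.lt_or_ge t m with h | h
  · have hi : i = ⟨j + t, by have := C.lt; omega⟩ := Fin.ext ht
    have h3 : cubicVec n j m κ κ' k i = if k ≤ t then κ else 0 := by
      rw [hi, C.cubicVec_apply_lt h]
    rw [h3, ht]
    by_cases hkt : k ≤ t
    · have hio : i ≠ o := fun h' => by rw [h'] at ht; omega
      rw [if_pos hkt, if_pos (by omega), Pi.add_apply, Pi.single_eq_of_ne hio, hi,
        C.cubicVec_apply_lt h, if_pos (by omega), zero_add, div_self hp]
    · rw [if_neg hkt, if_neg (by omega), zero_div]
  · have hi : i = e := Fin.ext (by rw [C.val_e]; omega)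
    have hio : i ≠ o := fun h' => by rw [h'] at ht; omega
    rw [if_pos (by omega), Pi.add_apply, Pi.single_eq_of_ne hio, hi, C.cubicVec_apply_last hk',
      C.cubicVec_apply_last C.one_le, zero_add, div_self (div_ne_zero hp hp')]

/-- The factor turns `κ εₖ` into `κ' εₖ`, which for `k = m` is the last simple root; this is the
integral multiple to which congruences modulo `s` are applied. -/
theorem smul_cubicVec_integral (C : IsCubicString D j m o e κ κ') (k : ℕ) :
    (κ' / κ) • cubicVec n j m κ κ' k ∈ multiples n 1 := by
  intro l
  rw [Pi.smul_apply, cubicVec, nodeVec_apply]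
  unfold cubicCoord
  rcases C.scale with ⟨rfl, rfl⟩ | ⟨rfl, rfl⟩ | ⟨rfl, rfl⟩ <;> split_ifs
  · exact ⟨2, by norm_num⟩
  · exact ⟨1, by norm_num⟩
  · exact ⟨0, by norm_num⟩
  · exact ⟨1, by norm_num⟩
  · exact ⟨1, by norm_num⟩
  · exact ⟨0, by norm_num⟩
  · exact ⟨1, by norm_num⟩
  · exact ⟨1, by norm_num⟩
  · exact ⟨0, by norm_num⟩

/-- Coordinates at the nodes are partial sums; the case `l = 0` is the empty sum, and the last node
carries the factor `κ / κ'` in place of `κ`. -/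
theorem smul_cubicSum_mem_multiples_iff (C : IsCubicString D j m o e κ κ') {s : ℕ} (a : ℝ)
    (x : ℕ → ℝ) : a • cubicSum n j m κ κ' x ∈ multiples n s ↔
      (∀ l < m, ∃ d : ℤ, a * (κ * ∑ k ∈ Finset.Icc 1 l, x k) = s * d) ∧
      ∃ d : ℤ, a * (κ / κ' * ∑ k ∈ Finset.Icc 1 m, x k) = s * d := by
  have hlt := C.lt
  have he := C.val_e
  constructor
  · intro h
    refine ⟨fun l hl => ?_, ?_⟩
    · have := h ⟨j + l, by omega⟩
      rwa [Pi.smul_apply, C.cubicSum_apply_lt x hl] at this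
    · have := h e
      rwa [Pi.smul_apply, C.cubicSum_apply_last] at this
  · rintro ⟨h1, h2⟩ i
    rw [Pi.smul_apply]
    by_cases hi : j + 1 ≤ (i : ℕ) ∧ (i : ℕ) ≤ j + m
    · rcases Nat.lt_or_ge (i : ℕ) (j + m) with h | h
      · have : i = ⟨j + (i - j), by omega⟩ := Fin.ext (by simp; omega)
        rw [this, C.cubicSum_apply_lt x (by omega)]
        exact h1 _ (by omega)
      · have : i = e := Fin.ext (by omega)
        rw [this, C.cubicSum_apply_last]
        exact h2
    · rw [mem_rootSpan_iff.1 (C.cubicSum_mem x) i hi]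
      exact ⟨0, by simp⟩

theorem rightCoeff_cubicSum (C : IsCubicString D j m o e κ κ') (x : ℕ → ℝ) :
    IsNullRoot.rightCoeff D j m o e (cubicSum n j m κ κ' x) =
      D.cartanRight (j + m) * (κ' / κ) * ∑ k ∈ Finset.Icc 1 m, x k := by
  have hp := C.pos.1.ne'
  have hp' := C.pos.2.ne'
  rw [IsNullRoot.rightCoeff, C.cubicSum_apply_last, C.label]
  field_simp

theorem rightCoeff_null (C : IsCubicString D j m o e κ κ') :
    IsNullRoot.rightCoeff D j m o e (Pi.single o 1 + cubicVec n j m κ κ' 1) =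
      D.cartanRight (j + m) * (κ' / κ) := by
  have hp := C.pos.1.ne'
  have hp' := C.pos.2.ne'
  have hoe : e ≠ o := fun h => by
    have h1 := C.val_o
    have h2 := C.val_e
    have h3 := C.one_le
    rw [h] at h2
    omega
  rw [IsNullRoot.rightCoeff, C.label, Pi.add_apply, Pi.single_eq_of_ne hoe,
    C.cubicVec_apply_last C.one_le, zero_add]
  field_simp

/-- The conditions for the translation by `cubicSum x` to be trivial modulo `s`. -/
theorem eichler_congruence_iff (C : IsCubicString D j m o e κ κ') {s : ℕ} (x : ℕ → ℝ) :
    (∀ i, eichler (D.nform o) (Pi.single o 1 + cubicVec n j m κ κ' 1) (cubicSum n j m κ κ' x)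
      (Pi.single i 1) - Pi.single i 1 ∈ multiples n s) ↔
    ((∀ i, 1 ≤ i → i < m → ∃ d : ℤ, 2 / κ * (x i - x (i + 1)) = s * d) ∧
      ∃ d : ℤ, 2 * (κ' / κ) * x m = s * d) ∧
    ((D.cartanLeft j : ℝ) • cubicSum n j m κ κ' x ∈ multiples n s ∧
      ∃ d : ℤ, D.cartanLeft j * ∑ k ∈ Finset.Icc 1 m, x k ^ 2 = s * d) ∧
    ((D.cartanRight (j + m) * (κ' / κ)) • cubicSum n j m κ κ' x ∈ multiples n s ∧
      ∃ d : ℤ, D.cartanRight (j + m) * (κ' / κ) *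
        (∑ k ∈ Finset.Icc 1 m, x k + ∑ k ∈ Finset.Icc 1 m, x k ^ 2) = s * d) := by
  have hlt := C.lt
  have he := C.val_e
  have hm := C.one_le
  have hfirst : (∀ i : Fin n, j + 1 ≤ (i : ℕ) → (i : ℕ) ≤ j + m →
      ∃ d : ℤ, D.nform o (cubicSum n j m κ κ' x) (Pi.single i 1) = s * d) ↔
      ((∀ i, 1 ≤ i → i < m → ∃ d : ℤ, 2 / κ * (x i - x (i + 1)) = s * d) ∧
      ∃ d : ℤ, 2 * (κ' / κ) * x m = s * d) := by
    have e1 : ∀ i : Fin n, j + 1 ≤ (i : ℕ) → (i : ℕ) < j + m →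
        D.nform o (cubicSum n j m κ κ' x) (Pi.single i 1) =
          2 / κ * (x (i - j) - x (i - j + 1)) := by
      intro i h1 h2
      rcases C.single_eq_cubicVec h1 h2.le with ⟨h, -⟩ | ⟨-, h⟩
      · rw [h] at h2; omega
      · rw [h, map_smul, map_sub, C.nform_cubicSum x (by omega) (by omega),
          C.nform_cubicSum x (by omega) (by omega), smul_eq_mul]
        ring
    have e2 : D.nform o (cubicSum n j m κ κ' x) (Pi.single e 1) = 2 * (κ' / κ) * x m := by
      rcases C.single_eq_cubicVec (i := e) (by omega) (by omega) with ⟨-, h⟩ | ⟨h, -⟩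
      · rw [h, map_smul, C.nform_cubicSum x hm le_rfl, smul_eq_mul]
        ring
      · omega
    constructor
    · intro h
      refine ⟨fun i h1 h2 => ?_, ?_⟩
      · have h3 := h ⟨j + i, by omega⟩ (by simp; omega) (by simp; omega)
        rw [e1 _ (by simp; omega) (by simp; omega)] at h3
        simpa using h3
      · rw [← e2]
        exact h e (by omega) (by omega)
    · rintro ⟨h1, h2⟩ i h3 h4
      rcases Nat.lt_or_ge (i : ℕ) (j + m) with h | h
      · rw [e1 i h3 h]
        exact h1 _ (by omega) (by omega)
      · rw [show i = e from Fin.ext (by omega), e2]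
        exact h2
  rw [C.isNullRoot.eichler_congruence_iff hm he (C.cubicSum_mem x), hfirst, C.rightCoeff_null,
    C.rightCoeff_cubicSum, C.nform_cubicSum_self]
  have e3 : 2 * ∑ k ∈ Finset.Icc 1 m, x k ^ 2 / 2 = ∑ k ∈ Finset.Icc 1 m, x k ^ 2 := by
    rw [← Finset.sum_div]
    ring
  refine and_congr Iff.rfl (and_congr (and_congr Iff.rfl ?_) (and_congr Iff.rfl ?_))
  · refine exists_congr fun d => ?_
    rw [mul_div_cancel_left₀ _ two_ne_zero]
  · refine exists_congr fun d => ?_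
    rw [mul_div_cancel_left₀ _ two_ne_zero, mul_add, mul_comm (∑ k ∈ Finset.Icc 1 m, x k ^ 2)]

/-! ### The action of the point group -/

/-- The point group acts by signed permutations, since its generators are interchanges and one sign
change. -/
theorem realAct_cubicVec (C : IsCubicString D j m o e κ κ')
    {h : Matrix.GeneralLinearGroup (Fin n) ℤ} (hh : h ∈ D.parabolic (j + 1) (j + m)) {k : ℕ}
    (hk : 1 ≤ k) (hk' : k ≤ m) : ∃ l, (1 ≤ l ∧ l ≤ m) ∧ ∃ ε : ℝ, (ε = 1 ∨ ε = -1) ∧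
      realAct h (cubicVec n j m κ κ' k) = ε • cubicVec n j m κ κ' l := by
  have he := C.val_e
  have hlt := C.lt
  induction hh using D.parabolic_induction with
  | one => exact ⟨k, ⟨hk, hk'⟩, 1, Or.inl rfl, by rw [realAct_one, one_smul]⟩
  | mul i h1 h2 g _ ih =>
    obtain ⟨l, ⟨hl, hl'⟩, ε, hε, hg⟩ := ih
    rw [realAct_mul, hg, map_smul]
    rcases Nat.lt_or_ge (i : ℕ) (j + m) with h | h
    · have hi : i = ⟨j + (i - j), by omega⟩ := Fin.ext (by simp; omega)
      rw [hi, C.realAct_swap (by omega) (by omega) hl hl']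
      refine ⟨_, ?_, ε, hε, rfl⟩
      rw [Equiv.swap_apply_def]
      split_ifs <;> omega
    · have hi : i = e := Fin.ext (by omega)
      rw [hi, C.realAct_last hl hl']
      split_ifs
      · exact ⟨l, ⟨hl, hl'⟩, -ε, by rcases hε with rfl | rfl <;> simp, by simp⟩
      · exact ⟨l, ⟨hl, hl'⟩, ε, hε, rfl⟩

theorem exists_int_cubicSum (C : IsCubicString D j m o e κ κ') {z : Fin n → ℝ}
    (hz : z ∈ D.orbitLattice (j + 1) (j + m) (cubicVec n j m κ κ' 1)) :
    ∃ x : ℕ → ℤ, z = cubicSum n j m κ κ' fun k => (x k : ℝ) := by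
  induction hz using AddSubgroup.closure_induction with
  | mem z hz =>
    obtain ⟨h, hh, rfl⟩ := hz
    obtain ⟨l, ⟨hl, hl'⟩, ε, hε, hg⟩ := C.realAct_cubicVec hh le_rfl C.one_le
    obtain ⟨d, rfl⟩ : ∃ d : ℤ, ε = d := by
      rcases hε with rfl | rfl
      · exact ⟨1, by simp⟩
      · exact ⟨-1, by simp⟩
    refine ⟨fun k => if k = l then d else 0, ?_⟩
    rw [hg, cubicSum, Finset.sum_eq_single l]
    · simp
    · intro k _ hk
      simp [hk]
    · intro h
      exact absurd (Finset.mem_Icc.2 ⟨hl, hl'⟩) h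
  | zero => exact ⟨0, by simp [cubicSum]⟩
  | add z w _ _ hz hw =>
    obtain ⟨x, rfl⟩ := hz
    obtain ⟨y, rfl⟩ := hw
    exact ⟨x + y, by simp [cubicSum, add_smul, Finset.sum_add_distrib]⟩
  | neg z _ hz =>
    obtain ⟨x, rfl⟩ := hz
    exact ⟨-x, by simp [cubicSum]⟩

theorem realAct_eq_self_of_cubicVec (C : IsCubicString D j m o e κ κ')
    {h : Matrix.GeneralLinearGroup (Fin n) ℤ}
    (H : ∀ k, 1 ≤ k → k ≤ m → realAct h (cubicVec n j m κ κ' k) = cubicVec n j m κ κ' k)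
    {x : Fin n → ℝ} (hx : x ∈ rootSpan n ℝ (j + 1) (j + m)) : realAct h x = x := by
  obtain ⟨y, rfl⟩ := C.exists_cubicSum hx
  rw [cubicSum, map_sum]
  refine Finset.sum_congr rfl fun k hk => ?_
  rw [map_smul, H k (Finset.mem_Icc.1 hk).1 (Finset.mem_Icc.1 hk).2]

/-! ### Lattices invariant under signed permutations -/

section Lattice

variable {A : AddSubgroup (Fin n → ℝ)}

/-- Interchanges of neighbours connect all indices. -/
theorem smul_cubicVec_mem_succ (C : IsCubicString D j m o e κ κ')
    (hA : ∀ v ∈ A, ∀ g ∈ D.parabolic (j + 1) (j + m), realAct g v ∈ A) {a : ℝ} {k l : ℕ}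
    (hk : 1 ≤ k) (hk' : k ≤ m) (hl : 1 ≤ l) (hl' : l ≤ m)
    (h : a • cubicVec n j m κ κ' k ∈ A) : a • cubicVec n j m κ κ' l ∈ A := by
  have hlt := C.lt
  have step : ∀ i, 1 ≤ i → i < m → (a • cubicVec n j m κ κ' i ∈ A ↔
      a • cubicVec n j m κ κ' (i + 1) ∈ A) := by
    intro i h1 h2
    have hr := D.r_mem_parabolic (a := j + 1) (b := j + m) (i := ⟨j + i, by omega⟩)
      (by simp; omega) (by simp; omega)
    constructor
    · intro h
      have := hA _ h _ hr
      rwa [map_smul, C.realAct_swap h1 h2 h1 h2.le, Equiv.swap_apply_left] at this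
    · intro h
      have := hA _ h _ hr
      rwa [map_smul, C.realAct_swap h1 h2 (by omega) (by omega), Equiv.swap_apply_right] at this
  have key : ∀ k, 1 ≤ k → k ≤ m → (a • cubicVec n j m κ κ' k ∈ A ↔
      a • cubicVec n j m κ κ' 1 ∈ A) := by
    intro k hk
    induction k, hk using Nat.le_induction with
    | base => exact fun _ => Iff.rfl
    | succ k hk ih => exact fun h => (step k hk (by omega)).symm.trans (ih (by omega))
  exact (key l hl hl').2 ((key k hk hk').1 h)

theorem cubicSum_mem_of_smul_mem (C : IsCubicString D j m o e κ κ')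
    (hA : ∀ v ∈ A, ∀ g ∈ D.parabolic (j + 1) (j + m), realAct g v ∈ A) {a : ℤ} {k : ℕ}
    (hk : 1 ≤ k) (hk' : k ≤ m) (h : (a : ℝ) • cubicVec n j m κ κ' k ∈ A) {x : ℕ → ℤ}
    (hx : ∀ l, 1 ≤ l → l ≤ m → a ∣ x l) : (cubicSum n j m κ κ' fun l => (x l : ℝ)) ∈ A := by
  refine sum_mem fun l hl => ?_
  obtain ⟨h1, h2⟩ := Finset.mem_Icc.1 hl
  obtain ⟨d, hd⟩ := hx l h1 h2
  have h3 := A.zsmul_mem (C.smul_cubicVec_mem_succ hA hk hk' h1 h2 h) d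
  rw [← Int.cast_smul_eq_zsmul ℝ, smul_smul] at h3
  have e : (x l : ℝ) = d * a := by rw [hd]; push_cast; ring
  change (x l : ℝ) • _ ∈ A
  rw [e]
  exact h3

end Lattice

/-- The lattice is `q` times a sublattice of the integral one. Divisibility by `q` is all that the
displacement bound uses. -/
theorem orbitLattice_smul_le (C : IsCubicString D j m o e κ κ') (q k : ℕ) {z : Fin n → ℝ}
    (hk : k ≤ m) (hz : z ∈ D.orbitLattice (j + 1) (j + m)
      ((q : ℝ) • ∑ i ∈ Finset.range k, cubicVec n j m κ κ' (i + 1))) :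
    ∃ x : ℕ → ℤ, z = cubicSum n j m κ κ' fun k => (q * x k : ℝ) := by
  have hmem : ∀ i < k, cubicVec n j m κ κ' (i + 1) ∈
      D.orbitLattice (j + 1) (j + m) (cubicVec n j m κ κ' 1) := by
    intro i hi
    have h1 : (1 : ℝ) • cubicVec n j m κ κ' 1 ∈
      D.orbitLattice (j + 1) (j + m) (cubicVec n j m κ κ' 1) := by
      rw [one_smul]
      exact self_mem_orbitLattice _ _ _
    have := C.smul_cubicVec_mem_succ (fun v hv g hg => realAct_mem_orbitLattice hv hg) le_rfl
      C.one_le (by omega : 1 ≤ i + 1) (by omega) h1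
    rwa [one_smul] at this
  have h1 : D.orbitLattice (j + 1) (j + m)
      ((q : ℝ) • ∑ i ∈ Finset.range k, cubicVec n j m κ κ' (i + 1)) ≤
      (D.orbitLattice (j + 1) (j + m) (cubicVec n j m κ κ' 1)).map
        (DistribSMul.toAddMonoidHom (Fin n → ℝ) (q : ℝ)) := by
    refine orbitLattice_le ?_ ?_
    · exact ⟨_, sum_mem fun i hi => hmem i (Finset.mem_range.1 hi), rfl⟩
    · rintro i h1 h2 _ ⟨w, hw, rfl⟩
      exact ⟨_, realAct_mem_orbitLattice hw (D.r_mem_parabolic h1 h2),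
        (map_smul (realAct (D.r i)) _ _).symm⟩
  obtain ⟨w, hw, rfl⟩ := h1 hz
  obtain ⟨x, rfl⟩ := C.exists_int_cubicSum hw
  exact ⟨x, smul_cubicSum _ _⟩

theorem standard_mem (C : IsCubicString D j m o e κ κ') (q : ℕ) {k : ℕ} (hk : k ≤ m) :
    (q : ℝ) • ∑ i ∈ Finset.range k, cubicVec n j m κ κ' (i + 1) ∈
      D.orbitLattice (j + 1) (j + m) (cubicVec n j m κ κ' 1) := by
  rw [Finset.smul_sum]
  refine sum_mem fun i hi => ?_
  have := Finset.mem_range.1 hi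
  refine C.smul_cubicVec_mem_succ (fun v hv g hg => realAct_mem_orbitLattice hv hg) le_rfl
    C.one_le (by omega : 1 ≤ i + 1) (by omega) ?_
  rw [Nat.cast_smul_eq_nsmul ℝ]
  exact AddSubgroup.nsmul_mem _ (self_mem_orbitLattice _ _ _) q

theorem standard_eq_cubicSum (q : ℕ) {k : ℕ} (hk : k ≤ m) :
    (q : ℝ) • ∑ i ∈ Finset.range k, cubicVec n j m κ κ' (i + 1) =
      cubicSum n j m κ κ' fun l => ((if l ≤ k then (q : ℤ) else 0 : ℤ) : ℝ) := by
  rw [cubicSum, ← Finset.sum_subset (Finset.Icc_subset_Icc_right hk), Finset.smul_sum,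
    Finset.range_eq_Ico, Finset.sum_Ico_add' (fun i => (q : ℝ) • cubicVec n j m κ κ' i) 0 k 1]
  · refine Finset.sum_congr ?_ fun l hl => ?_
    · ext l
      simp only [Finset.mem_Ico, Finset.mem_Icc]
      omega
    · rw [if_pos (by simp at hl; omega)]
      simp
  · intro l hl hl'
    simp only [Finset.mem_Icc] at hl hl'
    rw [if_neg (by omega)]
    simp

/-- A translation along a type vector moves no vertex of the base chamber to another vertex of a
chamber that contains the base vertex. -/
theorem eq_zero_of_displacement (C : IsCubicString D j m o e κ κ') {q k : ℕ} (hq : 2 ≤ q)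
    (hk : k ≤ m) {z : Fin n → ℝ} (hz : z ∈ D.orbitLattice (j + 1) (j + m)
      ((q : ℝ) • ∑ i ∈ Finset.range k, cubicVec n j m κ κ' (i + 1)))
    {a b : Fin n} (ha : j ≤ (a : ℕ)) (ha' : (a : ℕ) ≤ j + m) (hb : j ≤ (b : ℕ))
    (hb' : (b : ℕ) ≤ j + m) {h : Matrix.GeneralLinearGroup (Fin n) ℤ}
    (hh : h ∈ D.parabolic (j + 1) (j + m)) {c : Fin n → ℝ}
    (hc : c = Pi.single o 1 + cubicVec n j m κ κ' 1)
    (H : ∀ x ∈ rootSpan n ℝ (j + 1) (j + m), D.nform o z x =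
      (realAct h x b / c b - realAct h x a / c a) - (x b / c b - x a / c a)) : z = 0 := by
  obtain ⟨x, rfl⟩ := C.orbitLattice_smul_le q k hk hz
  have h0 : ∀ l, 1 ≤ l → l ≤ m → x l = 0 := by
    intro l h1 h2
    have h3 := H _ (C.cubicVec_mem h1)
    obtain ⟨l', ⟨h4, h5⟩, ε, hε, h6⟩ := C.realAct_cubicVec hh h1 h2
    rw [C.nform_cubicSum _ h1 h2, h6, Pi.smul_apply, Pi.smul_apply, smul_eq_mul, smul_eq_mul,
      mul_div_assoc, mul_div_assoc, hc, C.cubicVec_div h1 h2 hb hb', C.cubicVec_div h1 h2 ha ha',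
      C.cubicVec_div h4 h5 hb hb', C.cubicVec_div h4 h5 ha ha'] at h3
    -- Each bracket of the displacement is, up to sign, a difference of values of a step function,
    -- so `|2 q x_l| ≤ 2`. As `q ≥ 2`, this leaves only `x_l = 0`.
    have h7 : |(q : ℝ) * x l| ≤ 1 := by
      rw [abs_le]
      rcases hε with rfl | rfl <;> split_ifs at h3 <;> constructor <;> linarith
    have h8 : |(q : ℤ) * x l| ≤ 1 := by exact_mod_cast h7
    rw [abs_mul, Nat.abs_cast] at h8
    have h9 : |x l| < 1 := by
      by_contra h10
      have : (2 : ℤ) ≤ q := by exact_mod_cast hq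
      nlinarith [not_lt.1 h10]
    exact Int.abs_lt_one_iff.1 h9
  rw [cubicSum]
  refine Finset.sum_eq_zero fun l hl => ?_
  rw [h0 l (Finset.mem_Icc.1 hl).1 (Finset.mem_Icc.1 hl).2]
  simp

/-! ### Elements that are trivial modulo `s` -/

section Kernel

variable {s : ℕ} {h : Matrix.GeneralLinearGroup (Fin n) ℤ} {z : Fin n → ℝ}

/-- The congruence is applied to the integral vector `κ' εₖ`. Its coordinate `1` at the last node
isolates the sign, and the other nodes compare the steps at `k` and `l`. -/
theorem congruence_cubicVec (C : IsCubicString D j m o e κ κ')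
    (hh : h ∈ D.parabolic (j + 1) (j + m))
    (H : ∀ i, eichler (D.nform o) (Pi.single o 1 + cubicVec n j m κ κ' 1) z
      (realAct h (Pi.single i 1)) - Pi.single i 1 ∈ multiples n s) {k l : ℕ} (hk : 1 ≤ k)
    (hk' : k ≤ m) (hl' : l ≤ m) {ε : ℝ}
    (hε : realAct h (cubicVec n j m κ κ' k) = ε • cubicVec n j m κ κ' l) :
    (∃ d : ℤ, ε - 1 = s * d) ∧ ∀ t < m, ∃ d : ℤ,
      κ' * (ε * (if l ≤ t then 1 else 0) - if k ≤ t then 1 else 0) = s * d := by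
  have hp := C.pos.1.ne'
  have hp' := C.pos.2.ne'
  have h1 := IsNullRoot.congruence_of_integral
    (fun i h1 h2 => (C.isNullRoot.congruence_of_mem_ker hh H i h1 h2).1)
    (Submodule.smul_mem _ (κ' / κ) (C.cubicVec_mem hk)) (C.smul_cubicVec_integral k)
  rw [map_smul, hε] at h1
  refine ⟨?_, fun t ht => ?_⟩
  · obtain ⟨d, hd⟩ := h1 e
    refine ⟨d, hd ▸ ?_⟩
    simp only [Pi.sub_apply, Pi.smul_apply, smul_eq_mul, C.cubicVec_apply_last hk',
      C.cubicVec_apply_last hl']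
    field_simp
  · obtain ⟨d, hd⟩ := h1 ⟨j + t, by have := C.lt; omega⟩
    refine ⟨d, hd ▸ ?_⟩
    simp only [Pi.sub_apply, Pi.smul_apply, smul_eq_mul, C.cubicVec_apply_lt ht]
    split_ifs <;> field_simp <;> ring

/-- By invariance of the form `h` is moved to `z`, after which the congruence extends linearly to
the integral vector `κ' εₖ`. -/
theorem nform_realAct_cubicVec (C : IsCubicString D j m o e κ κ')
    (hh : h ∈ D.parabolic (j + 1) (j + m))
    (H : ∀ i, eichler (D.nform o) (Pi.single o 1 + cubicVec n j m κ κ' 1) z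
      (realAct h (Pi.single i 1)) - Pi.single i 1 ∈ multiples n s) {k : ℕ} (hk : 1 ≤ k) :
    ∃ d : ℤ, κ' / κ * D.nform o z (realAct h (cubicVec n j m κ κ' k)) = s * d := by
  have h1 : ∀ x, D.nform o (realAct h⁻¹ z) x = D.nform o z (realAct h x) := by
    intro x
    rw [← D.nform_parabolic o hh, realAct_self_inv]
  obtain ⟨d, hd⟩ := IsNullRoot.exists_nform_eq_of_integral (s := s) (z := realAct h⁻¹ z)
    (o := o) (fun i h2 h3 => by
      rw [h1]; exact (C.isNullRoot.congruence_of_mem_ker hh H i h2 h3).2)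
    (Submodule.smul_mem _ (κ' / κ) (C.cubicVec_mem hk)) (C.smul_cubicVec_integral k)
  exact ⟨d, by rw [← hd, h1, map_smul, map_smul, smul_eq_mul]⟩

/-- Signs differ by `0` or `2`, and coordinates of step functions by at most `κ' ≤ 2`. For `s ≥ 3`
such congruences are equalities. -/
theorem fix_of_three_le (C : IsCubicString D j m o e κ κ') (hs : 3 ≤ s)
    (hh : h ∈ D.parabolic (j + 1) (j + m))
    (H : ∀ i, eichler (D.nform o) (Pi.single o 1 + cubicVec n j m κ κ' 1) z
      (realAct h (Pi.single i 1)) - Pi.single i 1 ∈ multiples n s)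
    {x : Fin n → ℝ} (hx : x ∈ rootSpan n ℝ (j + 1) (j + m)) : realAct h x = x := by
  have hs' : (3 : ℝ) ≤ s := by exact_mod_cast hs
  have hκ : κ' = 1 ∨ κ' = 2 := by
    rcases C.scale with ⟨-, h⟩ | ⟨-, h⟩ | ⟨-, h⟩ <;> simp [h]
  refine C.realAct_eq_self_of_cubicVec (fun k hk hk' => ?_) hx
  obtain ⟨l, ⟨hl, hl'⟩, ε, hε, h1⟩ := C.realAct_cubicVec hh hk hk'
  obtain ⟨⟨d, hd⟩, h2⟩ := C.congruence_cubicVec hh H hk hk' hl' h1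
  have h3 : ε = 1 := by
    have := int_eq_zero_of_abs_lt hd (by
      rcases hε with rfl | rfl <;> norm_num <;> linarith)
    linarith
  subst h3
  have h4 : ∀ t < m, (k ≤ t ↔ l ≤ t) := by
    intro t ht
    obtain ⟨d, hd⟩ := h2 t ht
    have h5 : |κ' * (1 * (if l ≤ t then 1 else 0) - if k ≤ t then 1 else 0)| < s := by
      have : |(1 * (if l ≤ t then 1 else 0) - if k ≤ t then 1 else 0 : ℝ)| ≤ 1 := by
        split_ifs <;> norm_num
      rw [abs_mul]
      rcases hκ with h | h <;> rw [h] <;> norm_num at this ⊢ <;> linarith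
    rcases mul_eq_zero.1 (int_eq_zero_of_abs_lt hd h5) with h6 | h6
    · exact absurd h6 C.pos.2.ne'
    · by_cases h7 : k ≤ t <;> by_cases h8 : l ≤ t <;> simp [h7, h8] at h6 ⊢
  have h5 : l = k := by
    rcases lt_trichotomy k l with h | h | h
    · have := h4 k (by omega); omega
    · exact h.symm
    · have := h4 l (by omega); omega
  rw [h1, h5, one_smul]

/-- The right neighbour, for an element of the point group that acts by changes of sign. -/
theorem congruence_right (C : IsCubicString D j m o e κ κ') (hp : D.cartanRight (j + m) ≠ 0)
    (hz : z ∈ rootSpan n ℝ (j + 1) (j + m)) (hh : h ∈ D.parabolic (j + 1) (j + m))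
    (H : ∀ i, eichler (D.nform o) (Pi.single o 1 + cubicVec n j m κ κ' 1) z
      (realAct h (Pi.single i 1)) - Pi.single i 1 ∈ multiples n s) {ε : ℕ → ℝ}
    (hε : ∀ k, 1 ≤ k → k ≤ m → (ε k = 1 ∨ ε k = -1) ∧
      realAct h (cubicVec n j m κ κ' k) = ε k • cubicVec n j m κ κ' k) :
    (D.cartanRight (j + m) * (κ' / κ)) •
      (cubicSum n j m κ κ' (fun k => (1 - ε k) / 2) - z) ∈ multiples n s := by
  have hlt : j + m + 1 < n := by
    by_contra h
    exact hp (by rw [cartanRight, dif_neg h])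
  have hpos := C.pos.1.ne'
  have hpos' := C.pos.2.ne'
  obtain ⟨i, hi⟩ : ∃ i : Fin n, (i : ℕ) = j + m + 1 := ⟨⟨_, hlt⟩, rfl⟩
  have h1 := C.isNullRoot.right_of_mem_ker C.one_le C.val_e hz hh H hi
  rw [C.rightCoeff_null] at h1
  have hw : realAct h (Pi.single i 1) - Pi.single i 1 ∈ rootSpan n ℝ (j + 1) (j + m) := by
    rw [mem_rootSpan_iff]
    intro k hk
    rw [Pi.sub_apply, D.realAct_apply_of_notMem hh hk, sub_self]
  -- Since `h` multiplies `κ εₖ` by the sign `ε k`, it does the same to the product of `b i` with `κ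
  -- εₖ`; the factor `1 - ε k` is the resulting change.
  have h2 : ∀ k, 1 ≤ k → k ≤ m → D.nform o (realAct h (Pi.single i 1) - Pi.single i 1)
      (cubicVec n j m κ κ' k) = (1 - ε k) * (D.cartanRight (j + m) * (κ' / κ)) := by
    intro k hk hk'
    have h3 : D.nform o (cubicVec n j m κ κ' k) (Pi.single i 1) =
        -(D.cartanRight (j + m) * (κ' / κ)) := by
      rw [C.isNullRoot.nform_right C.one_le C.val_e le_rfl (C.cubicVec_mem hk) hi,
        IsNullRoot.rightCoeff, C.cubicVec_apply_last hk', C.label]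
      congr 1
      field_simp
    have h4 : ε k • realAct h (cubicVec n j m κ κ' k) = cubicVec n j m κ κ' k := by
      obtain ⟨h5 | h5, h6⟩ := hε k hk hk' <;> rw [h6, h5] <;> simp
    have h5 : D.nform o (realAct h (Pi.single i 1)) (cubicVec n j m κ κ' k) =
        ε k * D.nform o (Pi.single i 1) (cubicVec n j m κ κ' k) := by
      conv_lhs => rw [← h4]
      rw [map_smul, D.nform_parabolic o hh, smul_eq_mul]
    rw [map_sub, LinearMap.sub_apply, h5, D.nform_symm, h3]
    ring
  have h3 : realAct h (Pi.single i 1) - Pi.single i 1 = (D.cartanRight (j + m) * (κ' / κ)) •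
      cubicSum n j m κ κ' fun k => (1 - ε k) / 2 := by
    rw [C.eq_cubicSum hw, smul_cubicSum]
    refine cubicSum_congr fun k hk hk' => ?_
    rw [h2 k hk hk']
    ring
  rwa [h3, ← smul_sub] at h1

end Kernel

end IsCubicString

end StringBasicSystem
end

/-! ### The cubic groups: solving the congruences -/

noncomputable section

/-- An odd `a` is coprime to `2`. Odd Cartan integers at the ends improve `s ∣ 2 * x` to `s ∣ x` in
this way. -/
theorem Int.dvd_of_dvd_two_mul_of_dvd_odd_mul {s a x : ℤ} (ha : Odd a) (h2 : s ∣ 2 * x)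
    (h : s ∣ a * x) : s ∣ x := by
  obtain ⟨t, rfl⟩ := ha
  have : x = (2 * t + 1) * x - t * (2 * x) := by ring
  rw [this]
  exact dvd_sub h (h2.mul_left t)

theorem sum_Icc_ite_le {k m : ℕ} (hk : k ≤ m) (a : ℤ) :
    ∑ l ∈ Finset.Icc 1 m, (if l ≤ k then a else 0) = k * a := by
  rw [← Finset.sum_subset (Finset.Icc_subset_Icc_right hk), Finset.sum_congr rfl fun l hl =>
    if_pos (Finset.mem_Icc.1 hl).2]
  · simp
  · intro l hl hl'
    simp only [Finset.mem_Icc] at hl hl'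
    rw [if_neg (by omega)]

/-- A coordinate is the difference of two consecutive partial sums. -/
theorem dvd_of_dvd_sum_Icc {s p : ℤ} {m : ℕ} {x : ℕ → ℤ}
    (h : ∀ l ≤ m, s ∣ p * ∑ k ∈ Finset.Icc 1 l, x k) {l : ℕ} (hl : 1 ≤ l) (hl' : l ≤ m) :
    s ∣ p * x l := by
  obtain ⟨t, rfl⟩ : ∃ t, l = t + 1 := ⟨l - 1, by omega⟩
  have h1 := dvd_sub (h (t + 1) hl') (h t (by omega))
  rwa [Finset.sum_Icc_succ_top (by omega), mul_add, add_sub_cancel_left] at h1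

theorem dvd_sub_of_step {s : ℤ} {m : ℕ} {x : ℕ → ℤ}
    (h : ∀ i, 1 ≤ i → i < m → s ∣ x i - x (i + 1)) {l : ℕ} (hl : 1 ≤ l) (hl' : l ≤ m) :
    s ∣ x l - x 1 := by
  induction l, hl using Nat.le_induction with
  | base => simp
  | succ l hl ih =>
    have := dvd_sub (ih (by omega)) (h l hl (by omega))
    rwa [show x l - x 1 - (x l - x (l + 1)) = x (l + 1) - x 1 by ring] at this

namespace StringBasicSystem

variable {n : ℕ} {D : StringBasicSystem n} {j m : ℕ} {o e : Fin n} {κ κ' : ℝ}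

namespace IsCubicString

/-- The translation by `cubicSum x` is trivial modulo `s`. -/
def Kernel (D : StringBasicSystem n) (j m : ℕ) (o : Fin n) (κ κ' : ℝ) (s : ℕ) (x : ℕ → ℤ) : Prop :=
  ∀ i, eichler (D.nform o) (Pi.single o 1 + cubicVec n j m κ κ' 1)
    (cubicSum n j m κ κ' fun k => (x k : ℝ)) (Pi.single i 1) - Pi.single i 1 ∈ multiples n s

/-- The vector of the translation with type vector `(q^k, 0^(m-k))`. -/
abbrev standard (n j m : ℕ) (κ κ' : ℝ) (q k : ℕ) : Fin n → ℝ :=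
  (q : ℝ) • ∑ i ∈ Finset.range k, cubicVec n j m κ κ' (i + 1)

/-- The displacement condition needs only `q ≥ 2`. The component in `H` is automatically trivial for
`s ≥ 3`; the second alternative of `hfix` serves the modulus `2`, where the neighbours have to be
used. -/
theorem isToroidModulus (C : IsCubicString D j m o e κ κ') {s q k : ℕ} (hq : 2 ≤ q) (hk : 1 ≤ k)
    (hk' : k ≤ m)
    (hfix : 3 ≤ s ∨ ∀ x : ℕ → ℤ, ∀ h ∈ D.parabolic (j + 1) (j + m),
      (∀ i, eichler (D.nform o) (Pi.single o 1 + cubicVec n j m κ κ' 1)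
        (cubicSum n j m κ κ' fun k => (x k : ℝ)) (realAct h (Pi.single i 1)) - Pi.single i 1 ∈
          multiples n s) →
      ∀ l, 1 ≤ l → l ≤ m → realAct h (cubicVec n j m κ κ' l) = cubicVec n j m κ κ' l)
    (hker : Kernel D j m o κ κ' s fun l => if l ≤ k then q else 0)
    (hlat : ∀ x, Kernel D j m o κ κ' s x → (cubicSum n j m κ κ' fun k => (x k : ℝ)) ∈
      D.orbitLattice (j + 1) (j + m) (standard n j m κ κ' q k)) :
    IsToroidModulus D j m o (Pi.single o 1 + cubicVec n j m κ κ' 1) s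
      (standard n j m κ κ' q k) where
  mem := by
    rw [add_sub_cancel_left]
    exact C.standard_mem q hk'
  ne_zero := by
    intro h0
    rw [standard] at h0
    have h1 := C.nform_cubicSum (fun l => ((if l ≤ k then (q : ℤ) else 0 : ℤ) : ℝ)) le_rfl C.one_le
    rw [← standard_eq_cubicSum q hk', h0, if_pos hk] at h1
    simp only [map_zero, LinearMap.zero_apply, Int.cast_natCast] at h1
    have : (2 : ℝ) ≤ q := by exact_mod_cast hq
    linarith
  fix_of_mem_ker := by
    rw [add_sub_cancel_left]
    intro z hz h hh H x hx
    rcases hfix with hs | hfix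
    · exact C.fix_of_three_le hs hh H hx
    · obtain ⟨y, rfl⟩ := C.exists_int_cubicSum hz
      exact C.realAct_eq_self_of_cubicVec (hfix y h hh H) hx
  mem_ker := by
    rw [standard, standard_eq_cubicSum q hk']
    exact hker
  mem_lattice := by
    rw [add_sub_cancel_left]
    intro z hz H
    obtain ⟨x, rfl⟩ := C.exists_int_cubicSum hz
    exact hlat x H
  eq_zero_of_displacement := fun z hz _ a b ha ha' hb hb' h hh H =>
    C.eq_zero_of_displacement hq hk' hz ha ha' hb hb' hh rfl H

/-- All coordinates except the last are twice a partial sum; the last one is the full sum without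
the factor `2`, since `κ / κ' = 1`. -/
theorem kernel_iff_of_two_two (C : IsCubicString D j m o e 2 2) {s : ℕ} (x : ℕ → ℤ) :
    Kernel D j m o 2 2 s x ↔
    ((∀ i, 1 ≤ i → i < m → (s : ℤ) ∣ x i - x (i + 1)) ∧ (s : ℤ) ∣ 2 * x m) ∧
    (((∀ l < m, (s : ℤ) ∣ D.cartanLeft j * (2 * ∑ k ∈ Finset.Icc 1 l, x k)) ∧
      (s : ℤ) ∣ D.cartanLeft j * ∑ k ∈ Finset.Icc 1 m, x k) ∧
      (s : ℤ) ∣ D.cartanLeft j * ∑ k ∈ Finset.Icc 1 m, x k ^ 2) ∧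
    (((∀ l < m, (s : ℤ) ∣ D.cartanRight (j + m) * (2 * ∑ k ∈ Finset.Icc 1 l, x k)) ∧
      (s : ℤ) ∣ D.cartanRight (j + m) * ∑ k ∈ Finset.Icc 1 m, x k) ∧
      (s : ℤ) ∣ D.cartanRight (j + m) *
        (∑ k ∈ Finset.Icc 1 m, x k + ∑ k ∈ Finset.Icc 1 m, x k ^ 2)) := by
  rw [Kernel, C.eichler_congruence_iff, C.smul_cubicSum_mem_multiples_iff,
    C.smul_cubicSum_mem_multiples_iff]
  refine and_congr (and_congr (forall₃_congr fun i _ _ => ?_) ?_)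
    (and_congr (and_congr (and_congr (forall₂_congr fun l _ => ?_) ?_) ?_)
      (and_congr (and_congr (forall₂_congr fun l _ => ?_) ?_) ?_)) <;>
  · refine exists_eq_mul_iff_dvd ?_
    push_cast
    ring

theorem kernel_iff_of_one_one (C : IsCubicString D j m o e 1 1) {s : ℕ} (x : ℕ → ℤ) :
    Kernel D j m o 1 1 s x ↔
    ((∀ i, 1 ≤ i → i < m → (s : ℤ) ∣ 2 * (x i - x (i + 1))) ∧ (s : ℤ) ∣ 2 * x m) ∧
    (((∀ l < m, (s : ℤ) ∣ D.cartanLeft j * ∑ k ∈ Finset.Icc 1 l, x k) ∧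
      (s : ℤ) ∣ D.cartanLeft j * ∑ k ∈ Finset.Icc 1 m, x k) ∧
      (s : ℤ) ∣ D.cartanLeft j * ∑ k ∈ Finset.Icc 1 m, x k ^ 2) ∧
    (((∀ l < m, (s : ℤ) ∣ D.cartanRight (j + m) * ∑ k ∈ Finset.Icc 1 l, x k) ∧
      (s : ℤ) ∣ D.cartanRight (j + m) * ∑ k ∈ Finset.Icc 1 m, x k) ∧
      (s : ℤ) ∣ D.cartanRight (j + m) *
        (∑ k ∈ Finset.Icc 1 m, x k + ∑ k ∈ Finset.Icc 1 m, x k ^ 2)) := by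
  rw [Kernel, C.eichler_congruence_iff, C.smul_cubicSum_mem_multiples_iff,
    C.smul_cubicSum_mem_multiples_iff]
  refine and_congr (and_congr (forall₃_congr fun i _ _ => ?_) ?_)
    (and_congr (and_congr (and_congr (forall₂_congr fun l _ => ?_) ?_) ?_)
      (and_congr (and_congr (forall₂_congr fun l _ => ?_) ?_) ?_)) <;>
  · refine exists_eq_mul_iff_dvd ?_
    push_cast
    ring

/-- The factor `κ' / κ = 1 / 2` on the right cancels against `κ` in the coordinates, but turns the
condition involving the norm into a congruence modulo `2 s`. -/
theorem kernel_iff_of_two_one (C : IsCubicString D j m o e 2 1) {s : ℕ} (x : ℕ → ℤ) :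
    Kernel D j m o 2 1 s x ↔
    ((∀ i, 1 ≤ i → i < m → (s : ℤ) ∣ x i - x (i + 1)) ∧ (s : ℤ) ∣ x m) ∧
    (((∀ l < m, (s : ℤ) ∣ D.cartanLeft j * (2 * ∑ k ∈ Finset.Icc 1 l, x k)) ∧
      (s : ℤ) ∣ D.cartanLeft j * (2 * ∑ k ∈ Finset.Icc 1 m, x k)) ∧
      (s : ℤ) ∣ D.cartanLeft j * ∑ k ∈ Finset.Icc 1 m, x k ^ 2) ∧
    (((∀ l < m, (s : ℤ) ∣ D.cartanRight (j + m) * ∑ k ∈ Finset.Icc 1 l, x k) ∧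
      (s : ℤ) ∣ D.cartanRight (j + m) * ∑ k ∈ Finset.Icc 1 m, x k) ∧
      (s * 2 : ℤ) ∣ D.cartanRight (j + m) *
        (∑ k ∈ Finset.Icc 1 m, x k + ∑ k ∈ Finset.Icc 1 m, x k ^ 2)) := by
  rw [Kernel, C.eichler_congruence_iff, C.smul_cubicSum_mem_multiples_iff,
    C.smul_cubicSum_mem_multiples_iff]
  refine and_congr (and_congr (forall₃_congr fun i _ _ => ?_) ?_)
    (and_congr (and_congr (and_congr (forall₂_congr fun l _ => ?_) ?_) ?_)
      (and_congr (and_congr (forall₂_congr fun l _ => ?_) ?_) ?_))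
  · exact exists_eq_mul_iff_dvd (by push_cast; ring)
  · exact exists_eq_mul_iff_dvd (by ring)
  · exact exists_eq_mul_iff_dvd (by push_cast; ring)
  · exact exists_eq_mul_iff_dvd (by push_cast; ring)
  · exact exists_eq_mul_iff_dvd (by push_cast; ring)
  · exact exists_eq_mul_iff_dvd (by push_cast; ring)
  · exact exists_eq_mul_iff_dvd (by push_cast; ring)
  · have : ((s * 2 : ℕ) : ℤ) = s * 2 := rfl
    rw [← this, ← exists_eq_mul_iff_dvd (s := s * 2) rfl]
    refine exists_congr fun d => ?_
    push_cast
    constructor <;> intro h <;> linarith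

/-- Signed permutations of `(q, 0, …, 0)` span all vectors divisible by `q`. -/
theorem mem_orbitLattice_standard_one (C : IsCubicString D j m o e κ κ') {q : ℕ} {x : ℕ → ℤ}
    (hx : ∀ l, 1 ≤ l → l ≤ m → (q : ℤ) ∣ x l) : (cubicSum n j m κ κ' fun k => (x k : ℝ)) ∈
      D.orbitLattice (j + 1) (j + m) (standard n j m κ κ' q 1) := by
  refine C.cubicSum_mem_of_smul_mem (fun v hv g hg => realAct_mem_orbitLattice hv hg) le_rfl
    C.one_le ?_ hx
  have := self_mem_orbitLattice (D := D) (j + 1) (j + m) (standard n j m κ κ' q 1)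
  simpa [standard] using this

theorem cubicSum_sub_realAct_last (C : IsCubicString D j m o e κ κ') (x : ℕ → ℝ) :
    cubicSum n j m κ κ' x - realAct (D.r e) (cubicSum n j m κ κ' x) =
      (2 * x m) • cubicVec n j m κ κ' m := by
  rw [cubicSum, map_sum, ← Finset.sum_sub_distrib, Finset.sum_eq_single m]
  · rw [map_smul, C.realAct_last C.one_le le_rfl, if_pos rfl]
    module
  · intro k hk hkm
    rw [map_smul, C.realAct_last (Finset.mem_Icc.1 hk).1 (Finset.mem_Icc.1 hk).2, if_neg hkm,
      sub_self]
  · intro h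
    exact absurd (Finset.mem_Icc.2 ⟨C.one_le, le_rfl⟩) h

theorem r_last_mem (C : IsCubicString D j m o e κ κ') : D.r e ∈ D.parabolic (j + 1) (j + m) :=
  D.r_mem_parabolic (by rw [C.val_e]; have := C.one_le; omega) C.val_e.le

/-- The difference of `(q, …, q)` and its image under a sign change is `2 q` times a unit vector. So
the lattice contains all vectors whose coordinates are multiples of `q` congruent to each other
modulo `2 q`. -/
theorem mem_orbitLattice_standard_all (C : IsCubicString D j m o e κ κ') {q : ℕ} {x : ℕ → ℤ}
    (hx : (q : ℤ) ∣ x 1) (hx' : ∀ l, 1 ≤ l → l ≤ m → (2 * q : ℤ) ∣ x l - x 1) :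
    (cubicSum n j m κ κ' fun k => (x k : ℝ)) ∈
      D.orbitLattice (j + 1) (j + m) (standard n j m κ κ' q m) := by
  have h1 := self_mem_orbitLattice (D := D) (j + 1) (j + m) (standard n j m κ κ' q m)
  have h2 : ((2 * q : ℤ) : ℝ) • cubicVec n j m κ κ' m ∈
      D.orbitLattice (j + 1) (j + m) (standard n j m κ κ' q m) := by
    have h3 := sub_mem h1 (realAct_mem_orbitLattice h1 C.r_last_mem)
    conv at h3 => enter [2]; rw [standard, standard_eq_cubicSum q le_rfl]
    rw [C.cubicSum_sub_realAct_last, if_pos le_rfl] at h3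
    exact_mod_cast h3
  have h3 := C.cubicSum_mem_of_smul_mem (fun v hv g hg => realAct_mem_orbitLattice hv hg)
    C.one_le le_rfl h2 (x := fun l => x l - x 1) hx'
  obtain ⟨d, hd⟩ := hx
  have h4 := add_mem h3 (AddSubgroup.zsmul_mem _ h1 d)
  convert h4 using 1
  rw [standard, standard_eq_cubicSum q le_rfl, ← Int.cast_smul_eq_zsmul ℝ, smul_cubicSum, cubicSum,
    cubicSum, cubicSum, ← Finset.sum_add_distrib]
  refine Finset.sum_congr rfl fun k hk => ?_
  rw [if_pos (Finset.mem_Icc.1 hk).2, ← add_smul, hd]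
  congr 1
  push_cast
  ring

/-- The lattice of `(q, q, 0, …, 0)` contains `q (ε₁ + εₗ)` for `l ≥ 2` and `2 q ε₁`, and these span
`q` times the vectors with even coordinate sum. -/
theorem mem_orbitLattice_standard_two (C : IsCubicString D j m o e κ κ') (hm : 2 ≤ m) {q : ℕ}
    {y : ℕ → ℤ} (hy : Even (∑ k ∈ Finset.Icc 1 m, y k)) :
    (cubicSum n j m κ κ' fun k => ((q * y k : ℤ) : ℝ)) ∈
      D.orbitLattice (j + 1) (j + m) (standard n j m κ κ' q 2) := by
  have hlt := C.lt
  have h1 : ∀ l, 2 ≤ l → l ≤ m → (q : ℝ) • (cubicVec n j m κ κ' 1 + cubicVec n j m κ κ' l) ∈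
      D.orbitLattice (j + 1) (j + m) (standard n j m κ κ' q 2) := by
    intro l hl
    induction l, hl using Nat.le_induction with
    | base =>
      intro _
      have := self_mem_orbitLattice (D := D) (j + 1) (j + m) (standard n j m κ κ' q 2)
      simpa [standard, Finset.sum_range_succ] using this
    | succ l hl ih =>
      intro h
      have := realAct_mem_orbitLattice (ih (by omega)) (D.r_mem_parabolic (a := j + 1) (b := j + m)
        (i := ⟨j + l, by omega⟩) (by simp; omega) (by simp; omega))
      rwa [map_smul, map_add, C.realAct_swap (by omega) (by omega) le_rfl (by omega),
        C.realAct_swap (by omega) (by omega) (by omega) (by omega), Equiv.swap_apply_left,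
        Equiv.swap_apply_of_ne_of_ne (by omega) (by omega)] at this
  have h2 : (2 * q : ℝ) • cubicVec n j m κ κ' 1 ∈
      D.orbitLattice (j + 1) (j + m) (standard n j m κ κ' q 2) := by
    refine C.smul_cubicVec_mem_succ (fun v hv g hg => realAct_mem_orbitLattice hv hg) C.one_le
      le_rfl le_rfl C.one_le ?_
    have h3 := sub_mem (h1 m hm le_rfl)
      (realAct_mem_orbitLattice (h1 m hm le_rfl) C.r_last_mem)
    rw [map_smul, map_add, C.realAct_last le_rfl C.one_le, C.realAct_last C.one_le le_rfl,
      if_neg (by omega), if_pos rfl] at h3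
    convert h3 using 1
    module
  obtain ⟨t, ht⟩ := hy
  have h3 : ∀ k ∈ Finset.Icc 1 m, (y k : ℝ) • (q : ℝ) •
      (cubicVec n j m κ κ' 1 + cubicVec n j m κ κ' k) ∈
      D.orbitLattice (j + 1) (j + m) (standard n j m κ κ' q 2) := by
    intro k hk
    obtain ⟨hk1, hk2⟩ := Finset.mem_Icc.1 hk
    rw [Int.cast_smul_eq_zsmul ℝ]
    refine AddSubgroup.zsmul_mem _ ?_ _
    rcases hk1.eq_or_lt with h | h
    · rw [← h]
      convert h2 using 1
      module
    · exact h1 k h hk2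
  have h4 := sub_mem (sum_mem h3) (AddSubgroup.zsmul_mem _ h2 t)
  convert h4 using 1
  have h5 : (t : ℝ) * (2 * q) = ∑ k ∈ Finset.Icc 1 m, (y k : ℝ) * q := by
    rw [← Finset.sum_mul, ← Int.cast_sum, ht]
    push_cast
    ring
  rw [cubicSum, ← Int.cast_smul_eq_zsmul ℝ, smul_smul, h5, Finset.sum_smul,
    ← Finset.sum_sub_distrib]
  refine Finset.sum_congr rfl fun k _ => ?_
  push_cast
  module

/-! ### The point group modulo `2` -/

section Signs

variable {s : ℕ} {h : Matrix.GeneralLinearGroup (Fin n) ℤ} {x : ℕ → ℤ}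

/-- With `κ' = 1`, an index moved from `k` to `l` would change a coordinate at a node between them
by `1` or `-1`, which is impossible modulo `s ≥ 2`. So the permutation is trivial. -/
theorem exists_signs (C : IsCubicString D j m o e κ 1)
    (hs : 2 ≤ s) (hh : h ∈ D.parabolic (j + 1) (j + m)) {z : Fin n → ℝ}
    (H : ∀ i, eichler (D.nform o) (Pi.single o 1 + cubicVec n j m κ 1 1)
      z (realAct h (Pi.single i 1)) - Pi.single i 1 ∈ multiples n s) :
    ∃ ε : ℕ → ℝ, ∀ k, 1 ≤ k → k ≤ m → (ε k = 1 ∨ ε k = -1) ∧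
      realAct h (cubicVec n j m κ 1 k) = ε k • cubicVec n j m κ 1 k := by
  have hs' : (2 : ℝ) ≤ s := by exact_mod_cast hs
  have key : ∀ k, ∃ ε : ℝ, 1 ≤ k → k ≤ m → (ε = 1 ∨ ε = -1) ∧
      realAct h (cubicVec n j m κ 1 k) = ε • cubicVec n j m κ 1 k := by
    intro k
    by_cases hk : 1 ≤ k ∧ k ≤ m
    · obtain ⟨l, ⟨hl, hl'⟩, ε, hε, h1⟩ := C.realAct_cubicVec hh hk.1 hk.2
      obtain ⟨-, h2⟩ := C.congruence_cubicVec hh H hk.1 hk.2 hl' h1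
      have h5 : l = k := by
        rcases lt_trichotomy k l with h | h | h
        · exfalso
          obtain ⟨d, hd⟩ := h2 k (by omega)
          rw [if_neg (by omega), if_pos le_rfl] at hd
          have := int_eq_zero_of_abs_lt hd (by norm_num; linarith)
          norm_num at this
        · exact h.symm
        · exfalso
          obtain ⟨d, hd⟩ := h2 l (by omega)
          rw [if_pos le_rfl, if_neg (by omega)] at hd
          have := int_eq_zero_of_abs_lt hd (by rcases hε with rfl | rfl <;> norm_num <;> linarith)
          rcases hε with rfl | rfl <;> norm_num at this
      exact ⟨ε, fun _ _ => ⟨hε, h5 ▸ h1⟩⟩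
    · exact ⟨1, fun h1 h2 => absurd ⟨h1, h2⟩ hk⟩
  choose ε hε using key
  exact ⟨ε, hε⟩

/-- Modulo `2` a sign change is invisible within `H`. With an odd Cartan integer, the right
neighbour shows that the indicator of the changed signs is congruent to the translation coordinates,
which are even. -/
theorem fix_of_signs (C : IsCubicString D j m o e κ 1) (hp' : Odd (D.cartanRight (j + m)))
    (hx : ∀ k, 1 ≤ k → k ≤ m → Even (x k)) (hh : h ∈ D.parabolic (j + 1) (j + m))
    (H : ∀ i, eichler (D.nform o) (Pi.single o 1 + cubicVec n j m κ 1 1)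
      (cubicSum n j m κ 1 fun k => (x k : ℝ)) (realAct h (Pi.single i 1)) - Pi.single i 1 ∈
        multiples n 2) {k : ℕ} (hk : 1 ≤ k) (hk' : k ≤ m) :
    realAct h (cubicVec n j m κ 1 k) = cubicVec n j m κ 1 k := by
  obtain ⟨ε, hε⟩ := C.exists_signs le_rfl hh H
  have h1 := C.congruence_right (fun h0 => by simp [h0] at hp') (C.cubicSum_mem _) hh H hε
  rw [cubicSum_sub, C.smul_cubicSum_mem_multiples_iff] at h1
  have hpos := C.pos.1.ne'
  have key : ∀ k, ∃ χ : ℤ, 1 ≤ k → k ≤ m → (1 - ε k) / 2 = χ ∧ (χ = 0 ∨ χ = 1) := by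
    intro k
    by_cases hk : 1 ≤ k ∧ k ≤ m
    · rcases (hε k hk.1 hk.2).1 with h | h
      · exact ⟨0, fun _ _ => ⟨by rw [h]; simp, Or.inl rfl⟩⟩
      · exact ⟨1, fun _ _ => ⟨by rw [h]; norm_num, Or.inr rfl⟩⟩
    · exact ⟨0, fun h1 h2 => absurd ⟨h1, h2⟩ hk⟩
  choose χ hχ using key
  have h2 : ∀ l ≤ m, (2 : ℤ) ∣ D.cartanRight (j + m) * ∑ k ∈ Finset.Icc 1 l, (χ k - x k) := by
    intro l hl
    have e1 : ∑ k ∈ Finset.Icc 1 l, ((1 - ε k) / 2 - x k) =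
        ((∑ k ∈ Finset.Icc 1 l, (χ k - x k) : ℤ) : ℝ) := by
      push_cast
      refine Finset.sum_congr rfl fun k hk => ?_
      have := Finset.mem_Icc.1 hk
      rw [(hχ k this.1 (by omega)).1]
    rcases hl.lt_or_eq with h | h
    · refine (exists_eq_mul_iff_dvd (s := 2) ?_).1 (h1.1 l h)
      rw [e1]
      push_cast
      field_simp
    · rw [h] at e1 ⊢
      refine (exists_eq_mul_iff_dvd (s := 2) ?_).1 h1.2
      rw [e1]
      push_cast
      field_simp
  have h3 := dvd_of_dvd_sum_Icc h2 hk hk'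
  have h4 := (Int.Prime.dvd_mul' Nat.prime_two h3).resolve_left fun h =>
    (Int.not_even_iff_odd.2 hp') (even_iff_two_dvd.2 h)
  obtain ⟨h5, h6⟩ := hχ k hk hk'
  have h7 : χ k = 0 := by
    obtain ⟨a, ha⟩ := hx k hk hk'
    rcases h6 with h6 | h6 <;> push_cast at h4 <;> omega
  rw [h7] at h5
  have h8 : ε k = 1 := by push_cast at h5; linarith
  rw [(hε k hk hk').2, h8, one_smul]

/-- The case of the modulus `2` in which the point group is not distinguished by the signs and
the permutation separately. -/
theorem fix_of_two_two (C : IsCubicString D j m o e 2 2) (hm : 2 ≤ m) (hmo : Odd m)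
    (hp : Odd (D.cartanLeft j)) (hp' : Odd (D.cartanRight (j + m)))
    (hh : h ∈ D.parabolic (j + 1) (j + m))
    (H : ∀ i, eichler (D.nform o) (Pi.single o 1 + cubicVec n j m 2 2 1)
      (cubicSum n j m 2 2 fun k => (x k : ℝ)) (realAct h (Pi.single i 1)) - Pi.single i 1 ∈
        multiples n 2) {k : ℕ} (hk : 1 ≤ k) (hk' : k ≤ m) :
    realAct h (cubicVec n j m 2 2 k) = cubicVec n j m 2 2 k := by
  have hlt := C.lt
  have hm3 : 3 ≤ m := by
    obtain ⟨t, ht⟩ := hmo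
    omega
  have key : ∀ k, ∃ (l : ℕ) (ε : ℝ), 1 ≤ k → k ≤ m → ((1 ≤ l ∧ l ≤ m) ∧ (ε = 1 ∨ ε = -1) ∧
      realAct h (cubicVec n j m 2 2 k) = ε • cubicVec n j m 2 2 l) := by
    intro k
    by_cases hk : 1 ≤ k ∧ k ≤ m
    · obtain ⟨l, hl, ε, hε, h1⟩ := C.realAct_cubicVec hh hk.1 hk.2
      exact ⟨l, ε, fun _ _ => ⟨hl, hε, h1⟩⟩
    · exact ⟨1, 1, fun h1 h2 => absurd ⟨h1, h2⟩ hk⟩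
  choose l ε hε using key
  -- The congruence for `b (j + i)`, which is half of `κ εᵢ - κ εᵢ₊₁` as `κ = 2`.
  have hcong : ∀ i, 1 ≤ i → i < m → (1 / 2 : ℝ) • (ε i • cubicVec n j m 2 2 (l i) -
      ε (i + 1) • cubicVec n j m 2 2 (l (i + 1))) -
      (1 / 2 : ℝ) • (cubicVec n j m 2 2 i - cubicVec n j m 2 2 (i + 1)) ∈ multiples n 2 := by
    intro i h1 h2
    have h3 := (C.isNullRoot.congruence_of_mem_ker hh H ⟨j + i, by omega⟩ (by simp; omega)
      (by simp; omega)).1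
    have h4 : (Pi.single ⟨j + i, by omega⟩ 1 : Fin n → ℝ) =
        (1 / 2 : ℝ) • (cubicVec n j m 2 2 i - cubicVec n j m 2 2 (i + 1)) := by
      rw [← C.single_eq h2, smul_smul]
      norm_num
    rw [h4, map_smul, map_sub, (hε i h1 h2.le).2.2, (hε (i + 1) (by omega) (by omega)).2.2] at h3
    exact h3
  -- At the last node the displacement is half the difference of two signs, at most `1` in absolute
  -- value, yet even; so consecutive signs agree.
  have hsign : ∀ i, 1 ≤ i → i < m → ε (i + 1) = ε i := by
    intro i h1 h2
    obtain ⟨d, hd⟩ := hcong i h1 h2 e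
    obtain ⟨⟨-, a1⟩, a2, -⟩ := hε i h1 h2.le
    obtain ⟨⟨-, b1⟩, b2, -⟩ := hε (i + 1) (by omega) (by omega)
    simp only [Pi.sub_apply, Pi.smul_apply, smul_eq_mul, C.cubicVec_apply_last a1,
      C.cubicVec_apply_last b1, C.cubicVec_apply_last h2.le,
      C.cubicVec_apply_last (by omega : i + 1 ≤ m)] at hd
    have := int_eq_zero_of_abs_lt hd (by
      rcases a2 with a2 | a2 <;> rcases b2 with b2 | b2 <;> rw [a2, b2] <;> norm_num)
    norm_num at this
    linarith
  -- At the other nodes only the parity is known: the interval between `l i` and `l (i + 1)`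
  -- consists of the single node `i`. So the pair `{i, i + 1}` is preserved, possibly with an
  -- interchange.
  have hperm : ∀ i, 1 ≤ i → i < m →
      (l i = i ∧ l (i + 1) = i + 1) ∨ (l i = i + 1 ∧ l (i + 1) = i) := by
    intro i h1 h2
    obtain ⟨⟨a0, a1⟩, a2, -⟩ := hε i h1 h2.le
    obtain ⟨⟨b0, b1⟩, -, -⟩ := hε (i + 1) (by omega) (by omega)
    have h3 : ∀ t < m, ((l i ≤ t ↔ l (i + 1) ≤ t) ↔ t ≠ i) := by
      intro t ht
      obtain ⟨d, hd⟩ := hcong i h1 h2 ⟨j + t, by omega⟩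
      simp only [Pi.sub_apply, Pi.smul_apply, smul_eq_mul, C.cubicVec_apply_lt ht, hsign i h1 h2]
        at hd
      have h4 : ∃ f : ℤ, ε i = f ∧ (f = 1 ∨ f = -1) := by
        rcases a2 with a2 | a2
        · exact ⟨1, by simp [a2]⟩
        · exact ⟨-1, by simp [a2]⟩
      obtain ⟨f, hf, hf'⟩ := h4
      rw [hf] at hd
      have h5 : f * ((if l i ≤ t then 1 else 0) - if l (i + 1) ≤ t then 1 else 0) -
          ((if i ≤ t then 1 else 0) - if i + 1 ≤ t then 1 else 0) = 2 * d := by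
        have : (f : ℝ) * ((if l i ≤ t then 1 else 0) - if l (i + 1) ≤ t then 1 else 0) -
          ((if i ≤ t then 1 else 0) - if i + 1 ≤ t then 1 else 0) = 2 * d := by
          have h6 : ∀ p : Prop, ∀ [Decidable p], (if p then (2 : ℝ) else 0) =
              2 * if p then 1 else 0 := by
            intro p _
            split_ifs <;> simp
          rw [h6, h6, h6, h6] at hd
          push_cast at hd
          linarith
        exact_mod_cast this
      rcases hf' with rfl | rfl <;> split_ifs at h5 <;> omega
    have c1 := h3 i h2
    have c2 := h3 (l i)
    have c3 := h3 (l i - 1)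
    have c4 := h3 (l (i + 1))
    have c5 := h3 (l (i + 1) - 1)
    omega
  -- As `m` is odd and at least `2`, there are at least three indices. The pairs `{1, 2}` and `{2,
  -- 3}` are both preserved, hence so is `2`, and then every index.
  have hl : ∀ k, 1 ≤ k → k ≤ m → l k = k ∧ ε k = ε 1 := by
    intro k hk
    induction k, hk using Nat.le_induction with
    | base =>
      intro _
      have h1 : (l 1 = 1 ∧ l 2 = 2) ∨ (l 1 = 2 ∧ l 2 = 1) := hperm 1 le_rfl (by omega)
      have h2 : (l 2 = 2 ∧ l 3 = 3) ∨ (l 2 = 3 ∧ l 3 = 2) := hperm 2 (by omega) (by omega)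
      exact ⟨by omega, rfl⟩
    | succ k hk ih =>
      intro h
      have h1 := hperm k hk (by omega)
      have h2 := ih (by omega)
      exact ⟨by omega, (hsign k hk (by omega)).trans h2.2⟩
  -- All signs are equal. If they were `-1`, the right neighbour would make `m - ∑ x k` even and the
  -- left one `∑ x k` even, contradicting that `m` is odd.
  have hε1 : ε 1 = 1 := by
    refine (hε 1 le_rfl (by omega)).2.1.resolve_right fun h1 => ?_
    have h2 := C.congruence_right (ε := fun _ => -1) (fun h0 => by simp [h0] at hp')
      (C.cubicSum_mem _) hh H fun k hk hk' => ⟨Or.inr rfl, by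
        have := (hε k hk hk').2.2
        rwa [(hl k hk hk').1, (hl k hk hk').2, h1] at this⟩
    have h3 := C.isNullRoot.left_of_mem_ker (C.cubicSum_mem _) hh H
    rw [cubicSum_sub, C.smul_cubicSum_mem_multiples_iff] at h2
    rw [C.smul_cubicSum_mem_multiples_iff] at h3
    have h4 := (exists_eq_mul_iff_dvd (s := 2)
      (a := D.cartanRight (j + m) * (m - ∑ k ∈ Finset.Icc 1 m, x k)) (by
        rw [Finset.sum_sub_distrib]; push_cast; norm_num)).1 h2.2
    have h5 := (exists_eq_mul_iff_dvd (s := 2)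
      (a := D.cartanLeft j * ∑ k ∈ Finset.Icc 1 m, x k) (by push_cast; ring)).1 h3.2
    have h6 : Even (D.cartanRight (j + m) * (m - ∑ k ∈ Finset.Icc 1 m, x k)) :=
      even_iff_two_dvd.2 h4
    have h7 : Even (D.cartanLeft j * ∑ k ∈ Finset.Icc 1 m, x k) := even_iff_two_dvd.2 h5
    have hmo' : Odd (m : ℤ) := by exact_mod_cast hmo
    rw [Int.even_mul, ← Int.not_odd_iff_even, Int.even_sub] at h6
    rw [Int.even_mul, ← Int.not_odd_iff_even] at h7
    rw [← Int.not_even_iff_odd] at hmo'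
    tauto
  have h1 := (hε k hk hk').2.2
  rwa [(hl k hk hk').1, (hl k hk hk').2, hε1, one_smul] at h1

end Signs

/-! ### The toroids -/

section Modulus

variable {s : ℕ}

/-- The congruences of `H` say that all coordinates are congruent to `x 1` modulo `s` and that `s ∣
2 * x 1`. A neighbour with Cartan integer `p` adds `s ∣ p * m * x 1`, so an odd `p * m`, or an odd
`s`, gives `s ∣ x 1`. -/
theorem isToroidModulus_two_two (C : IsCubicString D j m o e 2 2) (hs : 2 ≤ s)
    (h3 : 3 ≤ s ∨ 2 ≤ m ∧ Odd m ∧ Odd (D.cartanLeft j) ∧ Odd (D.cartanRight (j + m)))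
    (h : Odd s ∨ Odd m ∧ (Odd (D.cartanLeft j) ∨ Odd (D.cartanRight (j + m)))) :
    IsToroidModulus D j m o (Pi.single o 1 + cubicVec n j m 2 2 1) s (standard n j m 2 2 s 1) := by
  refine C.isToroidModulus hs le_rfl C.one_le ?_ ?_ fun x hx => ?_
  · rcases Nat.lt_or_ge 2 s with h2 | h2
    · exact Or.inl h2
    · obtain rfl : s = 2 := by omega
      obtain ⟨h3, h4, h5, h6⟩ := h3.resolve_left (by omega)
      exact Or.inr fun x h hh H k hk hk' => C.fix_of_two_two h3 h4 h5 h6 hh H hk hk'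
  · rw [C.kernel_iff_of_two_two]
    have hd : ∀ k, (s : ℤ) ∣ if k ≤ 1 then (s : ℤ) else 0 := fun k => by split_ifs <;> simp
    have hd2 : ∀ k, (s : ℤ) ∣ (if k ≤ 1 then (s : ℤ) else 0) ^ 2 :=
      fun k => (hd k).trans (dvd_pow_self _ two_ne_zero)
    have hsum : ∀ l, (s : ℤ) ∣ ∑ k ∈ Finset.Icc 1 l, if k ≤ 1 then (s : ℤ) else 0 :=
      fun l => Finset.dvd_sum fun k _ => hd k
    have hsq : ∀ l, (s : ℤ) ∣ ∑ k ∈ Finset.Icc 1 l, (if k ≤ 1 then (s : ℤ) else 0) ^ 2 :=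
      fun l => Finset.dvd_sum fun k _ => hd2 k
    exact ⟨⟨fun i _ _ => dvd_sub (hd _) (hd _), (hd _).mul_left _⟩,
      ⟨⟨fun l _ => ((hsum l).mul_left _).mul_left _, (hsum m).mul_left _⟩, (hsq m).mul_left _⟩,
      ⟨⟨fun l _ => ((hsum l).mul_left _).mul_left _, (hsum m).mul_left _⟩,
        (dvd_add (hsum m) (hsq m)).mul_left _⟩⟩
  · rw [C.kernel_iff_of_two_two] at hx
    obtain ⟨⟨h1, h2⟩, ⟨⟨-, h4⟩, -⟩, ⟨⟨-, h5⟩, -⟩⟩ := hx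
    have hstep : ∀ l, 1 ≤ l → l ≤ m → (s : ℤ) ∣ x l - x 1 := fun l hl hl' =>
      dvd_sub_of_step h1 hl hl'
    have h6 : (s : ℤ) ∣ 2 * x 1 := by
      have := dvd_sub h2 ((hstep m C.one_le le_rfl).mul_left 2)
      rwa [show 2 * x m - 2 * (x m - x 1) = 2 * x 1 by ring] at this
    have h7 : (s : ℤ) ∣ ∑ k ∈ Finset.Icc 1 m, x k - m * x 1 := by
      have : ∑ k ∈ Finset.Icc 1 m, x k - m * x 1 = ∑ k ∈ Finset.Icc 1 m, (x k - x 1) := by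
        rw [Finset.sum_sub_distrib]
        simp
      rw [this]
      exact Finset.dvd_sum fun k hk =>
        hstep k (Finset.mem_Icc.1 hk).1 (Finset.mem_Icc.1 hk).2
    have h8 : ∀ p : ℤ, (s : ℤ) ∣ p * ∑ k ∈ Finset.Icc 1 m, x k → (s : ℤ) ∣ (p * m) * x 1 := by
      intro p hp
      have := dvd_sub hp (h7.mul_left p)
      rwa [show p * ∑ k ∈ Finset.Icc 1 m, x k - p * (∑ k ∈ Finset.Icc 1 m, x k - m * x 1) =
        p * m * x 1 by ring] at this
    have h9 : (s : ℤ) ∣ x 1 := by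
      rcases h with h | ⟨hm, h | h⟩
      · exact Int.dvd_of_dvd_two_mul_of_dvd_odd_mul (a := s) (by exact_mod_cast h) h6
          (dvd_mul_right _ _)
      · exact Int.dvd_of_dvd_two_mul_of_dvd_odd_mul (h.mul (by exact_mod_cast hm)) h6 (h8 _ h4)
      · exact Int.dvd_of_dvd_two_mul_of_dvd_odd_mul (h.mul (by exact_mod_cast hm)) h6 (h8 _ h5)
    refine C.mem_orbitLattice_standard_one fun l hl hl' => ?_
    have := dvd_add (hstep l hl hl') h9
    rwa [sub_add_cancel] at this

/-- With no odd coefficient, what remains is that all coordinates agree modulo `s` and are multiples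
of `s / 2`, which is the lattice of `(s/2, …, s/2)`. -/
theorem isToroidModulus_two_two_half (C : IsCubicString D j m o e 2 2) (hs : 4 ≤ s) (he : Even s)
    (h : Even m ∨ Even (D.cartanLeft j) ∧ Even (D.cartanRight (j + m))) :
    IsToroidModulus D j m o (Pi.single o 1 + cubicVec n j m 2 2 1) s
      (standard n j m 2 2 (s / 2) m) := by
  obtain ⟨t, rfl⟩ := he
  rw [show (t + t) / 2 = t by omega]
  refine C.isToroidModulus (by omega) C.one_le le_rfl (Or.inl (by omega)) ?_ fun x hx => ?_
  · rw [C.kernel_iff_of_two_two]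
    have hd : ∀ l ≤ m, ∑ k ∈ Finset.Icc 1 l, (if k ≤ m then (t : ℤ) else 0) = l * t := by
      intro l hl
      rw [← sum_Icc_ite_le le_rfl]
      refine Finset.sum_congr rfl fun k hk => ?_
      have := Finset.mem_Icc.1 hk
      rw [if_pos (by omega), if_pos (by omega)]
    have hd2 : ∑ k ∈ Finset.Icc 1 m, (if k ≤ m then (t : ℤ) else 0) ^ 2 = m * t ^ 2 := by
      rw [← sum_Icc_ite_le le_rfl]
      refine Finset.sum_congr rfl fun k hk => ?_
      rw [if_pos (Finset.mem_Icc.1 hk).2, if_pos (Finset.mem_Icc.1 hk).2]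
    have hev : Even (D.cartanLeft j * m) ∧ Even (D.cartanRight (j + m) * m) := by
      rcases h with h | ⟨h, h'⟩
      · have : Even (m : ℤ) := by exact_mod_cast h
        exact ⟨this.mul_left _, this.mul_left _⟩
      · exact ⟨h.mul_right _, h'.mul_right _⟩
    obtain ⟨⟨u, hu⟩, v, hv⟩ := hev
    have htwo : ∀ p : ℤ, ∀ l < m, ((t + t : ℕ) : ℤ) ∣
        p * (2 * ∑ k ∈ Finset.Icc 1 l, (if k ≤ m then (t : ℤ) else 0)) := by
      intro p l hl
      rw [hd l hl.le]
      exact ⟨p * l, by push_cast; ring⟩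
    refine ⟨⟨fun i _ h => ?_, ?_⟩, ⟨⟨htwo _, ?_⟩, ?_⟩, ⟨htwo _, ?_⟩, ?_⟩
    · rw [if_pos (by omega), if_pos (by omega), sub_self]
      exact dvd_zero _
    · rw [if_pos le_rfl]
      exact ⟨1, by push_cast; ring⟩
    · rw [hd m le_rfl]
      exact ⟨u, by push_cast; linear_combination t * hu⟩
    · rw [hd2]
      exact ⟨u * t, by push_cast; linear_combination t ^ 2 * hu⟩
    · rw [hd m le_rfl]
      exact ⟨v, by push_cast; linear_combination t * hv⟩
    · rw [hd m le_rfl, hd2]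
      exact ⟨v * (1 + t), by push_cast; linear_combination (t + t ^ 2 : ℤ) * hv⟩
  · rw [C.kernel_iff_of_two_two] at hx
    obtain ⟨⟨h1, h2⟩, -, -⟩ := hx
    have hstep : ∀ l, 1 ≤ l → l ≤ m → (2 * t : ℤ) ∣ x l - x 1 := fun l hl hl' => by
      have := dvd_sub_of_step h1 hl hl'
      rwa [show ((t + t : ℕ) : ℤ) = 2 * t by push_cast; ring] at this
    refine C.mem_orbitLattice_standard_all ?_ hstep
    have h3 : (2 * t : ℤ) ∣ 2 * x 1 := by
      rw [show ((t + t : ℕ) : ℤ) = 2 * t by push_cast; ring] at h2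
      have := dvd_sub h2 ((hstep m C.one_le le_rfl).mul_left 2)
      rwa [show 2 * x m - 2 * (x m - x 1) = 2 * x 1 by ring] at this
    exact Int.dvd_of_mul_dvd_mul_left two_ne_zero h3

theorem two_mul_dvd_of_one_one (C : IsCubicString D j m o e 1 1) {x : ℕ → ℤ}
    (hx : Kernel D j m o 1 1 s x) {l : ℕ} (hl : 1 ≤ l) (hl' : l ≤ m) : (s : ℤ) ∣ 2 * x l := by
  rw [C.kernel_iff_of_one_one] at hx
  obtain ⟨⟨h1, h2⟩, -, -⟩ := hx
  have hstep : ∀ l, 1 ≤ l → l ≤ m → (s : ℤ) ∣ 2 * x l - 2 * x 1 := fun l hl hl' =>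
    dvd_sub_of_step (x := fun i => 2 * x i) (fun i h3 h4 => by
      simpa only [mul_sub] using h1 i h3 h4) hl hl'
  have := dvd_add (dvd_sub h2 (hstep m C.one_le le_rfl)) (hstep l hl hl')
  rwa [show 2 * x m - (2 * x m - 2 * x 1) + (2 * x l - 2 * x 1) = 2 * x l by ring] at this

/-- The congruences of `H` give `s ∣ 2 * x l` for every coordinate. An odd Cartan integer at either
end controls all partial sums and removes the factor `2`. -/
theorem isToroidModulus_one_one (C : IsCubicString D j m o e 1 1) (hs : 2 ≤ s)
    (h3 : 3 ≤ s ∨ Odd (D.cartanLeft j) ∧ Odd (D.cartanRight (j + m)))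
    (h : Odd s ∨ Odd (D.cartanLeft j) ∨ Odd (D.cartanRight (j + m))) :
    IsToroidModulus D j m o (Pi.single o 1 + cubicVec n j m 1 1 1) s (standard n j m 1 1 s 1) := by
  refine C.isToroidModulus hs le_rfl C.one_le ?_ ?_ fun x hx => ?_
  · rcases Nat.lt_or_ge 2 s with h2 | h2
    · exact Or.inl h2
    · obtain rfl : s = 2 := by omega
      obtain ⟨h3, h4⟩ := h3.resolve_left (by omega)
      refine Or.inr fun x h hh H k hk hk' =>
        C.fix_of_signs h4 (fun l hl hl' => ?_) hh H hk hk'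
      -- The left neighbour is fixed by `H`; its odd Cartan integer makes all partial sums, hence
      -- all translation coordinates, even.
      have h5 := C.isNullRoot.left_of_mem_ker (C.cubicSum_mem _) hh H
      rw [C.smul_cubicSum_mem_multiples_iff] at h5
      have h6 : ∀ l ≤ m, (2 : ℤ) ∣ D.cartanLeft j * ∑ k ∈ Finset.Icc 1 l, x k := by
        intro l hl
        rcases hl.lt_or_eq with h | h
        · exact (exists_eq_mul_iff_dvd (s := 2) (by push_cast; ring)).1 (h5.1 l h)
        · rw [h]
          exact (exists_eq_mul_iff_dvd (s := 2) (by push_cast; ring)).1 h5.2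
      have h7 := even_iff_two_dvd.2 (dvd_of_dvd_sum_Icc h6 hl hl')
      exact (Int.even_mul.1 h7).resolve_left (Int.not_even_iff_odd.2 h3)
  · rw [C.kernel_iff_of_one_one]
    have hd : ∀ k, (s : ℤ) ∣ if k ≤ 1 then (s : ℤ) else 0 := fun k => by split_ifs <;> simp
    have hd2 : ∀ k, (s : ℤ) ∣ (if k ≤ 1 then (s : ℤ) else 0) ^ 2 :=
      fun k => (hd k).trans (dvd_pow_self _ two_ne_zero)
    have hsum : ∀ l, (s : ℤ) ∣ ∑ k ∈ Finset.Icc 1 l, if k ≤ 1 then (s : ℤ) else 0 :=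
      fun l => Finset.dvd_sum fun k _ => hd k
    have hsq : ∀ l, (s : ℤ) ∣ ∑ k ∈ Finset.Icc 1 l, (if k ≤ 1 then (s : ℤ) else 0) ^ 2 :=
      fun l => Finset.dvd_sum fun k _ => hd2 k
    exact ⟨⟨fun i _ _ => (dvd_sub (hd _) (hd _)).mul_left _, (hd _).mul_left _⟩,
      ⟨⟨fun l _ => (hsum l).mul_left _, (hsum m).mul_left _⟩, (hsq m).mul_left _⟩,
      ⟨⟨fun l _ => (hsum l).mul_left _, (hsum m).mul_left _⟩,
        (dvd_add (hsum m) (hsq m)).mul_left _⟩⟩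
  · have h2 : ∀ l, 1 ≤ l → l ≤ m → (s : ℤ) ∣ 2 * x l := fun l hl hl' =>
      C.two_mul_dvd_of_one_one hx hl hl'
    rw [C.kernel_iff_of_one_one] at hx
    obtain ⟨-, ⟨⟨h4, h5⟩, -⟩, ⟨⟨h6, h7⟩, -⟩⟩ := hx
    have hall : ∀ p : ℤ, (∀ l < m, (s : ℤ) ∣ p * ∑ k ∈ Finset.Icc 1 l, x k) →
        (s : ℤ) ∣ p * ∑ k ∈ Finset.Icc 1 m, x k →
        ∀ l ≤ m, (s : ℤ) ∣ p * ∑ k ∈ Finset.Icc 1 l, x k := by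
      intro p h8 h9 l hl
      rcases hl.lt_or_eq with h | h
      · exact h8 l h
      · rw [h]; exact h9
    refine C.mem_orbitLattice_standard_one fun l hl hl' => ?_
    rcases h with h | h | h
    · exact Int.dvd_of_dvd_two_mul_of_dvd_odd_mul (a := s) (by exact_mod_cast h) (h2 l hl hl')
        (dvd_mul_right _ _)
    · exact Int.dvd_of_dvd_two_mul_of_dvd_odd_mul h (h2 l hl hl')
        (dvd_of_dvd_sum_Icc (hall _ h4 h5) hl hl')
    · exact Int.dvd_of_dvd_two_mul_of_dvd_odd_mul h (h2 l hl hl')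
        (dvd_of_dvd_sum_Icc (hall _ h6 h7) hl hl')

/-- Even Cartan integers at both ends supply the missing factor `2`, so multiples of `s / 2` are
already trivial. -/
theorem isToroidModulus_one_one_half (C : IsCubicString D j m o e 1 1) (hs : 4 ≤ s) (he : Even s)
    (hp : Even (D.cartanLeft j)) (hp' : Even (D.cartanRight (j + m))) :
    IsToroidModulus D j m o (Pi.single o 1 + cubicVec n j m 1 1 1) s
      (standard n j m 1 1 (s / 2) 1) := by
  obtain ⟨t, rfl⟩ := he
  rw [show (t + t) / 2 = t by omega]
  have htt : ((t + t : ℕ) : ℤ) = 2 * t := by push_cast; ring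
  refine C.isToroidModulus (by omega) le_rfl C.one_le (Or.inl (by omega)) ?_ fun x hx => ?_
  · rw [C.kernel_iff_of_one_one, htt]
    have hd : ∀ k, (t : ℤ) ∣ if k ≤ 1 then (t : ℤ) else 0 := fun k => by split_ifs <;> simp
    have hd2 : ∀ k, (t : ℤ) ∣ (if k ≤ 1 then (t : ℤ) else 0) ^ 2 :=
      fun k => (hd k).trans (dvd_pow_self _ two_ne_zero)
    have hsum : ∀ l, (t : ℤ) ∣ ∑ k ∈ Finset.Icc 1 l, if k ≤ 1 then (t : ℤ) else 0 :=
      fun l => Finset.dvd_sum fun k _ => hd k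
    have hsq : ∀ l, (t : ℤ) ∣ ∑ k ∈ Finset.Icc 1 l, (if k ≤ 1 then (t : ℤ) else 0) ^ 2 :=
      fun l => Finset.dvd_sum fun k _ => hd2 k
    have h2 := even_iff_two_dvd.1 hp
    have h2' := even_iff_two_dvd.1 hp'
    exact ⟨⟨fun i _ _ => mul_dvd_mul_left _ (dvd_sub (hd _) (hd _)), mul_dvd_mul_left _ (hd _)⟩,
      ⟨⟨fun l _ => mul_dvd_mul h2 (hsum l), mul_dvd_mul h2 (hsum m)⟩, mul_dvd_mul h2 (hsq m)⟩,
      ⟨⟨fun l _ => mul_dvd_mul h2' (hsum l), mul_dvd_mul h2' (hsum m)⟩,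
        mul_dvd_mul h2' (dvd_add (hsum m) (hsq m))⟩⟩
  · refine C.mem_orbitLattice_standard_one fun l hl hl' => ?_
    have := C.two_mul_dvd_of_one_one hx hl hl'
    rw [htt] at this
    exact Int.dvd_of_mul_dvd_mul_left two_ne_zero this

theorem dvd_of_two_one (C : IsCubicString D j m o e 2 1) {x : ℕ → ℤ}
    (hx : Kernel D j m o 2 1 s x) {l : ℕ} (hl : 1 ≤ l) (hl' : l ≤ m) : (s : ℤ) ∣ x l := by
  rw [C.kernel_iff_of_two_one] at hx
  obtain ⟨⟨h1, h2⟩, -, -⟩ := hx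
  have := dvd_add (dvd_sub h2 (dvd_sub_of_step h1 C.one_le le_rfl)) (dvd_sub_of_step h1 hl hl')
  rwa [show x m - (x m - x 1) + (x l - x 1) = x l by ring] at this

/-- For multiples of `s` only the condition modulo `2 s` on the right is not automatic. -/
theorem kernel_of_two_one (C : IsCubicString D j m o e 2 1) {x : ℕ → ℤ}
    (hd : ∀ k, (s : ℤ) ∣ x k) (h : (s * 2 : ℤ) ∣ D.cartanRight (j + m) *
        (∑ k ∈ Finset.Icc 1 m, x k + ∑ k ∈ Finset.Icc 1 m, x k ^ 2)) :
    Kernel D j m o 2 1 s x := by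
  rw [C.kernel_iff_of_two_one]
  have hsum : ∀ l, (s : ℤ) ∣ ∑ k ∈ Finset.Icc 1 l, x k :=
    fun l => Finset.dvd_sum fun k _ => hd k
  have hsq : (s : ℤ) ∣ ∑ k ∈ Finset.Icc 1 m, x k ^ 2 :=
    Finset.dvd_sum fun k _ => (hd k).trans (dvd_pow_self _ two_ne_zero)
  exact ⟨⟨fun i _ _ => dvd_sub (hd _) (hd _), hd _⟩,
      ⟨⟨fun l _ => ((hsum l).mul_left _).mul_left _, ((hsum m).mul_left _).mul_left _⟩,
        hsq.mul_left _⟩, ⟨fun l _ => (hsum l).mul_left _, (hsum m).mul_left _⟩, h⟩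

/-- For `s = 2` the product of the translation vector with the image of `½ κ εₗ` is `± x l`, so the
congruences of `H` make the coordinates even and the right neighbour excludes sign changes. -/
theorem fix_of_two_one (C : IsCubicString D j m o e 2 1) (hs : 2 ≤ s)
    (hp' : Odd (D.cartanRight (j + m))) : 3 ≤ s ∨ ∀ x : ℕ → ℤ, ∀ h ∈ D.parabolic (j + 1) (j + m),
      (∀ i, eichler (D.nform o) (Pi.single o 1 + cubicVec n j m 2 1 1)
        (cubicSum n j m 2 1 fun k => (x k : ℝ)) (realAct h (Pi.single i 1)) - Pi.single i 1 ∈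
          multiples n s) →
      ∀ l, 1 ≤ l → l ≤ m → realAct h (cubicVec n j m 2 1 l) = cubicVec n j m 2 1 l := by
  rcases Nat.lt_or_ge 2 s with h2 | h2
  · exact Or.inl h2
  · obtain rfl : s = 2 := by omega
    refine Or.inr fun x h hh H k hk hk' =>
      C.fix_of_signs hp' (fun l hl hl' => ?_) hh H hk hk'
    obtain ⟨ε, hε⟩ := C.exists_signs le_rfl hh H
    obtain ⟨d, hd⟩ := C.nform_realAct_cubicVec hh H hl
    obtain ⟨h3, h4⟩ := hε l hl hl'
    rw [h4, map_smul, C.nform_cubicSum _ hl hl', smul_eq_mul] at hd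
    rcases h3 with h3 | h3
    · refine ⟨d, ?_⟩
      have : (x l : ℝ) = d + d := by rw [h3] at hd; push_cast at hd; linarith
      exact_mod_cast this
    · refine ⟨-d, ?_⟩
      have : (x l : ℝ) = -d + -d := by rw [h3] at hd; push_cast at hd; linarith
      exact_mod_cast this

/-- For the vector `(s, 0, …, 0)` the condition on the right requires an even value of the right
Cartan integer times `1 + s`. -/
theorem isToroidModulus_two_one (C : IsCubicString D j m o e 2 1) (hs : 3 ≤ s)
    (h : Odd s ∨ Even (D.cartanRight (j + m))) :
    IsToroidModulus D j m o (Pi.single o 1 + cubicVec n j m 2 1 1) s (standard n j m 2 1 s 1) := by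
  refine C.isToroidModulus (by omega) le_rfl C.one_le (Or.inl hs) ?_ fun x hx =>
    C.mem_orbitLattice_standard_one fun l hl hl' => C.dvd_of_two_one hx hl hl'
  refine C.kernel_of_two_one (fun k => by split_ifs <;> simp) ?_
  simp only [ite_pow, zero_pow two_ne_zero]
  rw [sum_Icc_ite_le C.one_le, sum_Icc_ite_le C.one_le]
  have h1 : Even (D.cartanRight (j + m) * (1 + s : ℤ)) := by
    rcases h with h | h
    · have : Odd (s : ℤ) := by exact_mod_cast h
      exact (odd_one.add_odd this).mul_left _
    · exact h.mul_right _
  obtain ⟨u, hu⟩ := h1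
  exact ⟨u, by push_cast; linear_combination s * hu⟩

/-- For coordinates `s * y k` the condition modulo `2 s` becomes the evenness of `∑ y + s ∑ y²`, and
`s` is even. -/
theorem even_sum_of_two_one (C : IsCubicString D j m o e 2 1) (hs : 2 ≤ s) (he : Even s)
    (hp' : Odd (D.cartanRight (j + m))) {y : ℕ → ℤ} {x : ℕ → ℤ}
    (hy : ∀ k ∈ Finset.Icc 1 m, x k = s * y k)
    (hx : Kernel D j m o 2 1 s x) : Even (∑ k ∈ Finset.Icc 1 m, y k) := by
  rw [C.kernel_iff_of_two_one] at hx
  obtain ⟨-, -, -, h⟩ := hx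
  have h1 : ∑ k ∈ Finset.Icc 1 m, x k + ∑ k ∈ Finset.Icc 1 m, x k ^ 2 =
      s * (∑ k ∈ Finset.Icc 1 m, y k + s * ∑ k ∈ Finset.Icc 1 m, y k ^ 2) := by
    rw [mul_add, Finset.mul_sum, Finset.mul_sum, Finset.mul_sum]
    congr 1
    · exact Finset.sum_congr rfl hy
    · refine Finset.sum_congr rfl fun k hk => ?_
      rw [hy k hk]
      ring
  rw [h1, mul_left_comm] at h
  have h2 := even_iff_two_dvd.2 (Int.dvd_of_mul_dvd_mul_left (by omega : (s : ℤ) ≠ 0) h)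
  have h3 : Even (s : ℤ) := by exact_mod_cast he
  have h4 := (Int.even_mul.1 h2).resolve_left (Int.not_even_iff_odd.2 hp')
  exact (Int.even_add.1 h4).2 (h3.mul_right _)

theorem isToroidModulus_two_one_pair (C : IsCubicString D j m o e 2 1) (hm : 2 ≤ m) (hs : 2 ≤ s)
    (he : Even s) (hp' : Odd (D.cartanRight (j + m))) :
    IsToroidModulus D j m o (Pi.single o 1 + cubicVec n j m 2 1 1) s (standard n j m 2 1 s 2) := by
  refine C.isToroidModulus hs (by omega) hm (C.fix_of_two_one hs hp') ?_ fun x hx => ?_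
  · refine C.kernel_of_two_one (fun k => by split_ifs <;> simp) ?_
    simp only [ite_pow, zero_pow two_ne_zero]
    rw [sum_Icc_ite_le hm, sum_Icc_ite_le hm]
    exact ⟨D.cartanRight (j + m) * (1 + s), by push_cast; ring⟩
  · have h1 : ∀ k, ∃ y : ℤ, k ∈ Finset.Icc 1 m → x k = s * y := by
      intro k
      by_cases hk : k ∈ Finset.Icc 1 m
      · obtain ⟨y, hy⟩ := C.dvd_of_two_one hx (Finset.mem_Icc.1 hk).1 (Finset.mem_Icc.1 hk).2
        exact ⟨y, fun _ => hy⟩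
      · exact ⟨0, fun h => absurd h hk⟩
    choose y hy using h1
    have h2 := C.mem_orbitLattice_standard_two hm (q := s) (C.even_sum_of_two_one hs he hp' hy hx)
    rwa [cubicSum_congr fun k hk hk' => by rw [← hy k (Finset.mem_Icc.2 ⟨hk, hk'⟩)]] at h2

/-- In dimension `1` an even coordinate sum is an even coordinate, so the lattice is generated by `2
s`. -/
theorem isToroidModulus_two_one_double (C : IsCubicString D j 1 o e 2 1) (hs : 2 ≤ s)
    (he : Even s) (hp' : Odd (D.cartanRight (j + 1))) :
    IsToroidModulus D j 1 o (Pi.single o 1 + cubicVec n j 1 2 1 1) s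
      (standard n j 1 2 1 (2 * s) 1) := by
  refine C.isToroidModulus (by omega) le_rfl le_rfl (C.fix_of_two_one hs hp') ?_ fun x hx => ?_
  · refine C.kernel_of_two_one (fun k => by split_ifs <;> simp) ?_
    simp only [ite_pow, zero_pow two_ne_zero]
    rw [sum_Icc_ite_le le_rfl, sum_Icc_ite_le le_rfl]
    exact ⟨D.cartanRight (j + 1) * (1 + 2 * s), by push_cast; ring⟩
  · obtain ⟨y, hy⟩ := C.dvd_of_two_one hx le_rfl le_rfl
    have h1 := C.even_sum_of_two_one (y := fun _ => y) hs he hp' (by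
      intro k hk
      have := Finset.mem_Icc.1 hk
      obtain rfl : k = 1 := by omega
      exact hy) hx
    simp only [Finset.Icc_self, Finset.sum_singleton] at h1
    obtain ⟨u, hu⟩ := h1
    refine C.mem_orbitLattice_standard_one fun l hl hl' => ?_
    obtain rfl : l = 1 := by omega
    exact ⟨u, by rw [hy, hu]; push_cast; ring⟩

end Modulus

end IsCubicString

end StringBasicSystem
end

noncomputable section

namespace StringBasicSystem

variable {n : ℕ} {D : StringBasicSystem n} {j m : ℕ} {o : Fin n} {c : Fin n → ℝ}
  {r' : Matrix.GeneralLinearGroup (Fin n) ℤ}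

/-! ### Positive and negative roots -/

theorem exists_wordProd_of_mem_parabolic {a b : ℕ} {g : Matrix.GeneralLinearGroup (Fin n) ℤ}
    (hg : g ∈ D.parabolic a b) : ∃ L, D.wordProd L = g := by
  induction hg using D.parabolic_induction with
  | one => exact ⟨[], rfl⟩
  | mul i _ _ g _ ih =>
    obtain ⟨L, rfl⟩ := ih
    exact ⟨i :: L, D.wordProd_cons i L⟩

/-- Multiplication by `r i` either lengthens `g` or shortens it; in the second case `column_nonneg`
applies to `g * r i`, whose image of `b i` has the opposite sign. -/
theorem root_nonneg_or_nonpos {a b : ℕ} {g : Matrix.GeneralLinearGroup (Fin n) ℤ}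
    (hg : g ∈ D.parabolic a b) (i : Fin n) :
    (∀ k, 0 ≤ realAct g (Pi.single i 1) k) ∨ ∀ k, realAct g (Pi.single i 1) k ≤ 0 := by
  obtain ⟨L, rfl⟩ := exists_wordProd_of_mem_parabolic hg
  rcases lt_or_gt_of_ne (D.wordLength_mul_r_ne L i) with h | h
  · right
    have h1 := D.column_nonneg (L ++ [i]) i (by simpa [mul_assoc, r_mul_self] using h)
    intro k
    have h2 := h1 k
    have h3 : realAct (D.wordProd (L ++ [i])) (Pi.single i 1) =
        -realAct (D.wordProd L) (Pi.single i 1) := by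
      rw [wordProd_append, realAct_mul, ← map_neg]
      congr 1
      simp only [wordProd_cons, wordProd_nil, mul_one]
      rw [D.realAct_r_single, D.cartan_self]
      push_cast
      module
    have h4 := congrFun h3 k
    rw [realAct_single_apply, Pi.neg_apply] at h4
    rw [Matrix.mulVec_single_one] at h2
    have h5 : (0 : ℝ) ≤ ((D.wordProd (L ++ [i])).val k i : ℤ) := by exact_mod_cast h2
    linarith
  · left
    have h1 := D.column_nonneg L i h
    intro k
    have h2 := h1 k
    rw [Matrix.mulVec_single_one] at h2
    rw [realAct_single_apply]
    exact_mod_cast h2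

namespace IsNullRoot

theorem nform_root_self (N : IsNullRoot D j m o c r') :
    D.nform o (c - Pi.single o 1) (c - Pi.single o 1) = 2 := by
  have h1 := N.isotropic
  have h2 := N.orth_mem N.single_mem
  have h3 := D.nform_symm o (Pi.single o 1) c
  have h4 := D.nform_self o
  simp only [map_sub, LinearMap.sub_apply]
  linarith

/-- The image of `c - b o` is `c - g (b o)`, and `g (b o)` has coordinate `1` at `o`, so it is a
nonnegative root. -/
theorem root_le (N : IsNullRoot D j m o c r') {g : Matrix.GeneralLinearGroup (Fin n) ℤ}
    (hg : g ∈ D.parabolic (j + 1) (j + m)) (i : Fin n) :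
    realAct g (c - Pi.single o 1) i ≤ c i := by
  have h1 : 0 ≤ realAct g (Pi.single o 1) i := by
    rcases root_nonneg_or_nonpos hg o with h | h
    · exact h i
    · have h2 := h o
      rw [D.realAct_apply_of_notMem hg (by have := N.val_o; omega), Pi.single_eq_same] at h2
      linarith
  rw [map_sub, N.fix (D.parabolic_succ_le hg), Pi.sub_apply]
  linarith

theorem neg_root_le (N : IsNullRoot D j m o c r') {g : Matrix.GeneralLinearGroup (Fin n) ℤ}
    (hg : g ∈ D.parabolic (j + 1) (j + m)) (i : Fin n) :
    -c i ≤ realAct g (c - Pi.single o 1) i := by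
  have h1 : realAct r' (c - Pi.single o 1) = -(c - Pi.single o 1) := by
    rw [N.refl_act, N.nform_root_self]
    module
  have h2 := N.root_le (mul_mem hg N.refl_mem) i
  rw [realAct_mul, h1, map_neg, Pi.neg_apply] at h2
  linarith

/-- The variation of a root over the vertices of the base chamber. -/
theorem abs_root_div_sub_le (N : IsNullRoot D j m o c r')
    {w : Matrix.GeneralLinearGroup (Fin n) ℤ} (hw : w ∈ D.parabolic (j + 1) (j + m)) {i₀ : Fin n}
    (hwc : realAct w (Pi.single i₀ 1) = c - Pi.single o 1)
    {g : Matrix.GeneralLinearGroup (Fin n) ℤ} (hg : g ∈ D.parabolic (j + 1) (j + m)) {i k : Fin n}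
    (hi : j ≤ (i : ℕ)) (hi' : (i : ℕ) ≤ j + m) (hk : j ≤ (k : ℕ)) (hk' : (k : ℕ) ≤ j + m) :
    |realAct g (c - Pi.single o 1) k / c k - realAct g (c - Pi.single o 1) i / c i| ≤ 1 := by
  have hpos : ∀ i : Fin n, j ≤ (i : ℕ) → (i : ℕ) ≤ j + m → 0 < c i := by
    intro i h1 h2
    have h3 := N.root_le hg i
    have h4 := N.neg_root_le hg i
    exact lt_of_le_of_ne (by linarith) (N.ne_zero i h1 h2).symm
  have h1 : ∀ i : Fin n, j ≤ (i : ℕ) → (i : ℕ) ≤ j + m →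
      realAct g (c - Pi.single o 1) i / c i ≤ 1 ∧ -1 ≤ realAct g (c - Pi.single o 1) i / c i := by
    intro i h1 h2
    have h3 := hpos i h1 h2
    rw [div_le_one h3, le_div_iff₀ h3]
    exact ⟨N.root_le hg i, by linarith [N.neg_root_le hg i]⟩
  -- As `c - b o` is itself in the orbit of a simple root, its image has all coordinates of one
  -- sign. The quotients by `c` thus lie in `[0, 1]` or in `[-1, 0]`.
  have h2 := root_nonneg_or_nonpos (mul_mem hg hw) i₀
  rw [realAct_mul, hwc] at h2
  obtain ⟨a1, a2⟩ := h1 i hi hi'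
  obtain ⟨b1, b2⟩ := h1 k hk hk'
  rw [abs_le]
  rcases h2 with h2 | h2
  · have a3 := div_nonneg (h2 i) (hpos i hi hi').le
    have b3 := div_nonneg (h2 k) (hpos k hk hk').le
    constructor <;> linarith
  · have a3 := div_nonpos_of_nonpos_of_nonneg (h2 i) (hpos i hi hi').le
    have b3 := div_nonpos_of_nonpos_of_nonneg (h2 k) (hpos k hk hk').le
    constructor <;> linarith

theorem realAct_integral {v : Fin n → ℝ} (hv : v ∈ multiples n 1) {a b : ℕ}
    {g : Matrix.GeneralLinearGroup (Fin n) ℤ} (hg : g ∈ D.parabolic a b) :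
    realAct g v ∈ multiples n 1 := by
  induction hg using D.parabolic_induction with
  | one => rwa [realAct_one]
  | mul i _ _ g _ ih =>
    rw [realAct_mul, D.realAct_r]
    refine add_mem ih (smul_mem_multiples (single_mem_multiples i) ?_)
    choose d hd using ih
    refine ⟨∑ k, D.cartan i k * d k, ?_⟩
    push_cast
    rw [one_mul]
    refine Finset.sum_congr rfl fun k _ => ?_
    rw [hd]
    push_cast
    ring

theorem root_integral (N : IsNullRoot D j m o c r') : c - Pi.single o 1 ∈ multiples n 1 :=
  sub_mem N.integral (single_mem_multiples o)

/-- On roots in the orbit of `c - b o` the product with `z` is a multiple of `s ≥ 3`, but also a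
difference of two variations of absolute value at most `1`. So it vanishes, and these roots span. -/
theorem eq_zero_of_displacement (N : IsNullRoot D j m o c r') (hm : 1 ≤ m) {s : ℕ} (hs : 3 ≤ s)
    {w : Matrix.GeneralLinearGroup (Fin n) ℤ} (hw : w ∈ D.parabolic (j + 1) (j + m)) {i₀ : Fin n}
    (hwc : realAct w (Pi.single i₀ 1) = c - Pi.single o 1)
    (hspan : ∀ i : Fin n, j + 1 ≤ (i : ℕ) → (i : ℕ) ≤ j + m → ∃ a : ℝ, a ≠ 0 ∧
      a • Pi.single i 1 ∈ D.orbitLattice (j + 1) (j + m) (c - Pi.single o 1))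
    {z : Fin n → ℝ} (hz : z ∈ rootSpan n ℝ (j + 1) (j + m))
    (hker : ∀ i, eichler (D.nform o) c z (Pi.single i 1) - Pi.single i 1 ∈ multiples n s)
    {i k : Fin n} (hi : j ≤ (i : ℕ)) (hi' : (i : ℕ) ≤ j + m) (hk : j ≤ (k : ℕ))
    (hk' : (k : ℕ) ≤ j + m) {h : Matrix.GeneralLinearGroup (Fin n) ℤ}
    (hh : h ∈ D.parabolic (j + 1) (j + m))
    (H : ∀ x ∈ rootSpan n ℝ (j + 1) (j + m), D.nform o z x =
      (realAct h x k / c k - realAct h x i / c i) - (x k / c k - x i / c i)) : z = 0 := by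
  have hk1 := ((N.eichler_congruence_iff hm (e := ⟨j + m, N.lt⟩) rfl hz).1 hker).1
  have h1 : ∀ g ∈ D.parabolic (j + 1) (j + m),
      D.nform o z (realAct g (c - Pi.single o 1)) = 0 := by
    intro g hg
    have h2 := D.realAct_mem_rootSpan le_rfl le_rfl hg N.root_mem
    obtain ⟨d, hd⟩ := exists_nform_eq_of_integral hk1 h2 (realAct_integral N.root_integral hg)
    refine int_eq_zero_of_abs_lt hd ?_
    have h3 := H _ h2
    have h4 := N.abs_root_div_sub_le hw hwc hg hi hi' hk hk'
    have h5 := N.abs_root_div_sub_le hw hwc (mul_mem hh hg) hi hi' hk hk'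
    rw [realAct_mul] at h5
    rw [h3]
    have h6 : (3 : ℝ) ≤ s := by exact_mod_cast hs
    rw [abs_le] at h4 h5
    rw [abs_lt]
    constructor <;> linarith
  have h2 : ∀ v ∈ D.orbitLattice (j + 1) (j + m) (c - Pi.single o 1), D.nform o z v = 0 := by
    intro v hv
    induction hv using AddSubgroup.closure_induction with
    | mem v hv => obtain ⟨g, hg, rfl⟩ := hv; exact h1 g hg
    | zero => simp
    | add v w _ _ hv hw => rw [map_add, hv, hw, add_zero]
    | neg v _ hv => rw [map_neg, hv, neg_zero]
  refine N.nondeg z hz fun i h3 h4 => ?_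
  obtain ⟨a, ha, ha'⟩ := hspan i h3 h4
  have h5 := h2 _ ha'
  rw [map_smul, smul_eq_mul] at h5
  exact (mul_eq_zero.1 h5).resolve_left ha

/-- The translation by `s` times the root `c - b o` is trivial modulo `s`. -/
theorem mem_ker_smul_root (N : IsNullRoot D j m o c r') (hm : 1 ≤ m) {e : Fin n}
    (he : (e : ℕ) = j + m) {a : ℤ} (ha : rightCoeff D j m o e c = a) (s : ℕ) (i : Fin n) :
    eichler (D.nform o) c ((s : ℝ) • (c - Pi.single o 1)) (Pi.single i 1) - Pi.single i 1 ∈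
      multiples n s := by
  have hroot := N.root_integral
  refine (N.eichler_congruence_iff hm he (Submodule.smul_mem _ _ N.root_mem)).2 ⟨?_, ?_, ?_⟩ i
  · intro i h1 h2
    refine ⟨D.cartan o i, ?_⟩
    rw [map_smul, LinearMap.smul_apply, map_sub, LinearMap.sub_apply, N.orth i (by omega) h2,
      D.nform_single, div_self (D.label_pos o).ne', smul_eq_mul]
    ring
  · refine ⟨?_, D.cartanLeft j * s, ?_⟩
    · rw [smul_smul]
      exact smul_mem_multiples hroot ⟨D.cartanLeft j, mul_comm _ _⟩
    · simp only [map_smul, LinearMap.smul_apply, N.nform_root_self, smul_eq_mul]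
      push_cast
      ring
  · have h1 : rightCoeff D j m o e ((s : ℝ) • (c - Pi.single o 1)) = s * a := by
      have hoe : e ≠ o := fun h => by have := N.val_o; rw [h] at he; omega
      rw [← ha, rightCoeff, rightCoeff, Pi.smul_apply, Pi.sub_apply, Pi.single_eq_of_ne hoe,
        smul_eq_mul]
      ring
    rw [h1, ha]
    refine ⟨?_, a * (1 + s), ?_⟩
    · rw [smul_smul]
      exact smul_mem_multiples hroot ⟨a, mul_comm _ _⟩
    · simp only [map_smul, LinearMap.smul_apply, N.nform_root_self, smul_eq_mul]
      push_cast
      ring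

end IsNullRoot

/-- An isometry of a definite lattice that is trivial modulo `s ≥ 3` fixes the short vectors. -/
theorem realAct_eq_of_congruence {s : ℕ} (hs : 3 ≤ s) {a b : ℕ} {μ ν : ℝ} (hν : 4 * μ < 9 * ν)
    (hpos : ∀ v ∈ rootSpan n ℝ a b, 0 ≤ D.nform o v v)
    (hmin : ∀ v ∈ rootSpan n ℝ a b, v ∈ multiples n 1 → v ≠ 0 → ν ≤ D.nform o v v)
    {h : Matrix.GeneralLinearGroup (Fin n) ℤ} (hh : h ∈ D.parabolic a b) {v : Fin n → ℝ}
    (hv : v ∈ rootSpan n ℝ a b) (hμ : D.nform o v v = μ)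
    (hc : realAct h v - v ∈ multiples n s) : realAct h v = v := by
  have hs' : (3 : ℝ) ≤ s := by exact_mod_cast hs
  have hs0 : (s : ℝ) ≠ 0 := by positivity
  have hhv := D.realAct_mem_rootSpan le_rfl le_rfl hh hv
  set w : Fin n → ℝ := (s : ℝ)⁻¹ • (realAct h v - v) with hw
  have hw1 : w ∈ rootSpan n ℝ a b := Submodule.smul_mem _ _ (sub_mem hhv hv)
  have hw2 : w ∈ multiples n 1 := by
    intro k
    obtain ⟨d, hd⟩ := hc k
    refine ⟨d, ?_⟩
    rw [hw, Pi.smul_apply, hd, smul_eq_mul]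
    field_simp
    simp
  have hw3 : realAct h v - v = (s : ℝ) • w := by
    rw [hw, smul_smul, mul_inv_cancel₀ hs0, one_smul]
  clear_value w
  -- The norm of `h v + v` is nonnegative, so by the parallelogram law that of `h v - v` is at most
  -- `4 μ`.
  have hb : D.nform o (realAct h v - v) (realAct h v - v) ≤ 4 * μ := by
    have h1 := hpos _ (add_mem hhv hv)
    have h2 := D.nform_parabolic o hh v v
    simp only [map_add, map_sub, LinearMap.add_apply, LinearMap.sub_apply, h2, hμ] at h1 ⊢
    linarith
  rw [hw3, map_smul, map_smul, LinearMap.smul_apply, smul_eq_mul, smul_eq_mul] at hb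
  -- A nonzero `w` would give `9 ν ≤ s² ν ≤ 4 μ`.
  have hw0 : w = 0 := by
    by_contra h0
    have h1 := hmin w hw1 hw2 h0
    have h2 := hpos w hw1
    nlinarith [mul_nonneg (sub_nonneg.2 hs') h2, mul_nonneg (sub_nonneg.2 hs')
      (mul_nonneg (by linarith : (0 : ℝ) ≤ s) h2)]
  rw [hw0, smul_zero, sub_eq_zero] at hw3
  exact hw3

end StringBasicSystem
end

noncomputable section

namespace StringBasicSystem

variable {n : ℕ} {D : StringBasicSystem n} {j : ℕ} {o i₁ i₂ i₃ i₄ : Fin n} {μ ν : ℤ}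

/-! ### The group `[3, 3, 4, 3]` -/

/-- The nodes `j, …, j + 4` form a diagram for `[3, 3, 4, 3]`, whose branch between `i₂` and `i₃`
has the Cartan integers `μ` and `ν`. -/
structure IsF4String (D : StringBasicSystem n) (j : ℕ) (o i₁ i₂ i₃ i₄ : Fin n) (μ ν : ℤ) :
    Prop where
  val_o : (o : ℕ) = j
  val₁ : (i₁ : ℕ) = j + 1
  val₂ : (i₂ : ℕ) = j + 2
  val₃ : (i₃ : ℕ) = j + 3
  val₄ : (i₄ : ℕ) = j + 4
  scale : (μ = 2 ∧ ν = 1) ∨ (μ = 1 ∧ ν = 2)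
  cartan₀₁ : D.cartan o i₁ = 1
  cartan₁₀ : D.cartan i₁ o = 1
  cartan₁₂ : D.cartan i₁ i₂ = 1
  cartan₂₁ : D.cartan i₂ i₁ = 1
  cartan₂₃ : D.cartan i₂ i₃ = μ
  cartan₃₂ : D.cartan i₃ i₂ = ν
  cartan₃₄ : D.cartan i₃ i₄ = 1
  cartan₄₃ : D.cartan i₄ i₃ = 1
  label₁ : D.label i₁ / D.label o = 1
  label₂ : D.label i₂ / D.label o = 1
  label₃ : D.label i₃ / D.label o = μ / ν
  label₄ : D.label i₄ / D.label o = μ / ν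

/-- The vector with coordinates `a`, `b`, `c`, `d` with respect to the roots `b i₁`, `b i₂`,
`ν • b i₃` and `ν • b i₄`. -/
def f4Vec (i₁ i₂ i₃ i₄ : Fin n) (ν : ℤ) (a b c d : ℝ) : Fin n → ℝ :=
  a • Pi.single i₁ 1 + b • Pi.single i₂ 1 + (c * ν) • Pi.single i₃ 1 + (d * ν) • Pi.single i₄ 1

section F4Vec

theorem f4Vec_add (a b c d a' b' c' d' : ℝ) :
    f4Vec i₁ i₂ i₃ i₄ ν a b c d + f4Vec i₁ i₂ i₃ i₄ ν a' b' c' d' =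
      f4Vec i₁ i₂ i₃ i₄ ν (a + a') (b + b') (c + c') (d + d') := by
  unfold f4Vec
  module

theorem f4Vec_sub (a b c d a' b' c' d' : ℝ) :
    f4Vec i₁ i₂ i₃ i₄ ν a b c d - f4Vec i₁ i₂ i₃ i₄ ν a' b' c' d' =
      f4Vec i₁ i₂ i₃ i₄ ν (a - a') (b - b') (c - c') (d - d') := by
  unfold f4Vec
  module

theorem smul_f4Vec (t a b c d : ℝ) : t • f4Vec i₁ i₂ i₃ i₄ ν a b c d =
    f4Vec i₁ i₂ i₃ i₄ ν (t * a) (t * b) (t * c) (t * d) := by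
  unfold f4Vec
  module

end F4Vec

namespace IsF4String

theorem cartan_far (F : IsF4String D j o i₁ i₂ i₃ i₄ μ ν) :
    (D.cartan o i₂ = 0 ∧ D.cartan i₂ o = 0) ∧ (D.cartan o i₃ = 0 ∧ D.cartan i₃ o = 0) ∧
    (D.cartan o i₄ = 0 ∧ D.cartan i₄ o = 0) ∧ (D.cartan i₁ i₃ = 0 ∧ D.cartan i₃ i₁ = 0) ∧
    (D.cartan i₁ i₄ = 0 ∧ D.cartan i₄ i₁ = 0) ∧ (D.cartan i₂ i₄ = 0 ∧ D.cartan i₄ i₂ = 0) := by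
  have h0 := F.val_o
  have h1 := F.val₁
  have h2 := F.val₂
  have h3 := F.val₃
  have h4 := F.val₄
  exact ⟨D.cartan_far _ _ (by omega), D.cartan_far _ _ (by omega), D.cartan_far _ _ (by omega),
    D.cartan_far _ _ (by omega), D.cartan_far _ _ (by omega), D.cartan_far _ _ (by omega)⟩

theorem cast_scale (F : IsF4String D j o i₁ i₂ i₃ i₄ μ ν) :
    ((μ : ℝ) = 2 ∧ (ν : ℝ) = 1) ∨ ((μ : ℝ) = 1 ∧ (ν : ℝ) = 2) := by
  rcases F.scale with ⟨h, h'⟩ | ⟨h, h'⟩ <;> simp [h, h']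

theorem realAct_r₁ (F : IsF4String D j o i₁ i₂ i₃ i₄ μ ν) (a b c d : ℝ) :
    realAct (D.r i₁) (f4Vec i₁ i₂ i₃ i₄ ν a b c d) = f4Vec i₁ i₂ i₃ i₄ ν (b - a) b c d := by
  obtain ⟨-, -, -, h13, h14, -⟩ := F.cartan_far
  simp only [f4Vec, map_add, map_smul, D.realAct_r_single, D.cartan_self, F.cartan₁₂, h13.1, h14.1]
  push_cast
  module

theorem realAct_r₂ (F : IsF4String D j o i₁ i₂ i₃ i₄ μ ν) (a b c d : ℝ) :
    realAct (D.r i₂) (f4Vec i₁ i₂ i₃ i₄ ν a b c d) =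
      f4Vec i₁ i₂ i₃ i₄ ν a (a - b + 2 * c) c d := by
  obtain ⟨-, -, -, -, -, h24⟩ := F.cartan_far
  simp only [f4Vec, map_add, map_smul, D.realAct_r_single, D.cartan_self, F.cartan₂₁, F.cartan₂₃,
    h24.1]
  rcases F.cast_scale with ⟨h, h'⟩ | ⟨h, h'⟩ <;> rw [h, h'] <;> push_cast <;> module

theorem realAct_r₃ (F : IsF4String D j o i₁ i₂ i₃ i₄ μ ν) (a b c d : ℝ) :
    realAct (D.r i₃) (f4Vec i₁ i₂ i₃ i₄ ν a b c d) =
      f4Vec i₁ i₂ i₃ i₄ ν a b (b - c + d) d := by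
  obtain ⟨-, -, -, h13, -, -⟩ := F.cartan_far
  simp only [f4Vec, map_add, map_smul, D.realAct_r_single, D.cartan_self, F.cartan₃₂, F.cartan₃₄,
    h13.2]
  push_cast
  module

theorem realAct_r₄ (F : IsF4String D j o i₁ i₂ i₃ i₄ μ ν) (a b c d : ℝ) :
    realAct (D.r i₄) (f4Vec i₁ i₂ i₃ i₄ ν a b c d) =
      f4Vec i₁ i₂ i₃ i₄ ν a b c (c - d) := by
  obtain ⟨-, -, -, -, h14, h24⟩ := F.cartan_far
  simp only [f4Vec, map_add, map_smul, D.realAct_r_single, D.cartan_self, F.cartan₄₃,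
    h14.2, h24.2]
  push_cast
  module

theorem nform_f4Vec_o (F : IsF4String D j o i₁ i₂ i₃ i₄ μ ν) (a b c d : ℝ) :
    D.nform o (f4Vec i₁ i₂ i₃ i₄ ν a b c d) (Pi.single o 1) = -a := by
  obtain ⟨h02, h03, h04, -, -, -⟩ := F.cartan_far
  simp only [f4Vec, map_add, map_smul, LinearMap.add_apply, LinearMap.smul_apply, D.nform_single,
    F.cartan₁₀, h02.2, h03.2, h04.2, F.label₁, smul_eq_mul]
  push_cast
  ring

theorem nform_f4Vec₁ (F : IsF4String D j o i₁ i₂ i₃ i₄ μ ν) (a b c d : ℝ) :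
    D.nform o (f4Vec i₁ i₂ i₃ i₄ ν a b c d) (Pi.single i₁ 1) = 2 * a - b := by
  obtain ⟨-, -, -, h13, h14, -⟩ := F.cartan_far
  simp only [f4Vec, map_add, map_smul, LinearMap.add_apply, LinearMap.smul_apply, D.nform_single,
    D.cartan_self, F.cartan₂₁, h13.2, h14.2, F.label₁, F.label₂, smul_eq_mul]
  push_cast
  ring

theorem nform_f4Vec₂ (F : IsF4String D j o i₁ i₂ i₃ i₄ μ ν) (a b c d : ℝ) :
    D.nform o (f4Vec i₁ i₂ i₃ i₄ ν a b c d) (Pi.single i₂ 1) = -a + 2 * b - 2 * c := by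
  obtain ⟨-, -, -, -, -, h24⟩ := F.cartan_far
  simp only [f4Vec, map_add, map_smul, LinearMap.add_apply, LinearMap.smul_apply, D.nform_single,
    D.cartan_self, F.cartan₁₂, F.cartan₃₂, h24.2, F.label₁, F.label₂, F.label₃, smul_eq_mul]
  rcases F.cast_scale with ⟨h, h'⟩ | ⟨h, h'⟩ <;> rw [h, h'] <;> push_cast <;> ring

theorem nform_f4Vec₃ (F : IsF4String D j o i₁ i₂ i₃ i₄ μ ν) (a b c d : ℝ) :
    D.nform o (f4Vec i₁ i₂ i₃ i₄ ν a b c d) (Pi.single i₃ 1) = μ * (-b + 2 * c - d) := by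
  obtain ⟨-, -, -, h13, -, -⟩ := F.cartan_far
  simp only [f4Vec, map_add, map_smul, LinearMap.add_apply, LinearMap.smul_apply, D.nform_single,
    D.cartan_self, F.cartan₂₃, F.cartan₄₃, h13.1, F.label₂, F.label₃, F.label₄, smul_eq_mul]
  rcases F.cast_scale with ⟨h, h'⟩ | ⟨h, h'⟩ <;> rw [h, h'] <;> push_cast <;> ring

theorem nform_f4Vec₄ (F : IsF4String D j o i₁ i₂ i₃ i₄ μ ν) (a b c d : ℝ) :
    D.nform o (f4Vec i₁ i₂ i₃ i₄ ν a b c d) (Pi.single i₄ 1) = μ * (-c + 2 * d) := by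
  obtain ⟨-, -, -, -, h14, h24⟩ := F.cartan_far
  simp only [f4Vec, map_add, map_smul, LinearMap.add_apply, LinearMap.smul_apply, D.nform_single,
    D.cartan_self, F.cartan₃₄, h14.1, h24.1, F.label₃, F.label₄, smul_eq_mul]
  rcases F.cast_scale with ⟨h, h'⟩ | ⟨h, h'⟩ <;> rw [h, h'] <;> push_cast <;> ring

theorem nform_f4Vec_self (F : IsF4String D j o i₁ i₂ i₃ i₄ μ ν) (a b c d : ℝ) :
    D.nform o (f4Vec i₁ i₂ i₃ i₄ ν a b c d) (f4Vec i₁ i₂ i₃ i₄ ν a b c d) =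
      2 * (a ^ 2 + b ^ 2 + 2 * c ^ 2 + 2 * d ^ 2 - a * b - 2 * b * c - 2 * c * d) := by
  conv_lhs => enter [2]; rw [f4Vec]
  simp only [map_add, map_smul, F.nform_f4Vec₁, F.nform_f4Vec₂, F.nform_f4Vec₃, F.nform_f4Vec₄,
    smul_eq_mul]
  rcases F.cast_scale with ⟨h, h'⟩ | ⟨h, h'⟩ <;> rw [h, h'] <;> ring

theorem apply (F : IsF4String D j o i₁ i₂ i₃ i₄ μ ν) (a b c d : ℝ) :
    f4Vec i₁ i₂ i₃ i₄ ν a b c d o = 0 ∧ f4Vec i₁ i₂ i₃ i₄ ν a b c d i₁ = a ∧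
    f4Vec i₁ i₂ i₃ i₄ ν a b c d i₂ = b ∧ f4Vec i₁ i₂ i₃ i₄ ν a b c d i₃ = c * ν ∧
    f4Vec i₁ i₂ i₃ i₄ ν a b c d i₄ = d * ν := by
  have h0 := F.val_o
  have h1 := F.val₁
  have h2 := F.val₂
  have h3 := F.val₃
  have h4 := F.val₄
  simp only [f4Vec, Pi.add_apply, Pi.smul_apply, Pi.single_apply, smul_eq_mul, Fin.ext_iff, h0, h1,
    h2, h3, h4]
  simp

theorem f4Vec_mem (F : IsF4String D j o i₁ i₂ i₃ i₄ μ ν) (a b c d : ℝ) :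
    f4Vec i₁ i₂ i₃ i₄ ν a b c d ∈ rootSpan n ℝ (j + 1) (j + 4) := by
  have h1 := F.val₁
  have h2 := F.val₂
  have h3 := F.val₃
  have h4 := F.val₄
  exact add_mem (add_mem (add_mem
    (Submodule.smul_mem _ _ (single_mem_rootSpan (by omega) (by omega)))
    (Submodule.smul_mem _ _ (single_mem_rootSpan (by omega) (by omega))))
    (Submodule.smul_mem _ _ (single_mem_rootSpan (by omega) (by omega))))
    (Submodule.smul_mem _ _ (single_mem_rootSpan (by omega) (by omega)))

theorem cases_node (F : IsF4String D j o i₁ i₂ i₃ i₄ μ ν) {i : Fin n} (h : j + 1 ≤ (i : ℕ))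
    (h' : (i : ℕ) ≤ j + 4) : i = i₁ ∨ i = i₂ ∨ i = i₃ ∨ i = i₄ := by
  have h1 := F.val₁
  have h2 := F.val₂
  have h3 := F.val₃
  have h4 := F.val₄
  simp only [Fin.ext_iff]
  omega

theorem exists_f4Vec (F : IsF4String D j o i₁ i₂ i₃ i₄ μ ν) {v : Fin n → ℝ}
    (hv : v ∈ rootSpan n ℝ (j + 1) (j + 4)) :
    v = f4Vec i₁ i₂ i₃ i₄ ν (v i₁) (v i₂) (v i₃ / ν) (v i₄ / ν) := by
  have hν : (ν : ℝ) ≠ 0 := by rcases F.cast_scale with ⟨-, h⟩ | ⟨-, h⟩ <;> rw [h] <;> norm_num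
  have ha := F.apply (v i₁) (v i₂) (v i₃ / ν) (v i₄ / ν)
  ext i
  by_cases hi : j + 1 ≤ (i : ℕ) ∧ (i : ℕ) ≤ j + 4
  · rcases F.cases_node hi.1 hi.2 with rfl | rfl | rfl | rfl
    · exact ha.2.1.symm
    · exact ha.2.2.1.symm
    · rw [ha.2.2.2.1]; field_simp
    · rw [ha.2.2.2.2]; field_simp
  · rw [mem_rootSpan_iff.1 hv i hi, mem_rootSpan_iff.1 (F.f4Vec_mem _ _ _ _) i hi]

theorem f4Vec_integral (a b c d : ℤ) : f4Vec i₁ i₂ i₃ i₄ ν a b c d ∈ multiples n 1 := by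
  refine add_mem (add_mem (add_mem
    (smul_mem_multiples (single_mem_multiples _) ⟨a, by simp⟩)
    (smul_mem_multiples (single_mem_multiples _) ⟨b, by simp⟩))
    (smul_mem_multiples (single_mem_multiples _) ⟨c * ν, by simp⟩))
    (smul_mem_multiples (single_mem_multiples _) ⟨d * ν, by simp⟩)

theorem nform_nonneg (F : IsF4String D j o i₁ i₂ i₃ i₄ μ ν) {v : Fin n → ℝ}
    (hv : v ∈ rootSpan n ℝ (j + 1) (j + 4)) : 0 ≤ D.nform o v v := by
  rw [F.exists_f4Vec hv, F.nform_f4Vec_self]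
  generalize v i₁ = a
  generalize v i₂ = b
  generalize v i₃ / (ν : ℝ) = c
  generalize v i₄ / (ν : ℝ) = d
  -- The squares come from completing the square in `a`, `b`, `c` and `d` in turn.
  nlinarith [sq_nonneg (2 * a - b), sq_nonneg (3 * b - 4 * c), sq_nonneg (2 * c - 3 * d),
    sq_nonneg d]

theorem eq_zero_of_nform (F : IsF4String D j o i₁ i₂ i₃ i₄ μ ν) {v : Fin n → ℝ}
    (hv : v ∈ rootSpan n ℝ (j + 1) (j + 4)) (h : D.nform o v v = 0) : v = 0 := by
  rw [F.exists_f4Vec hv, F.nform_f4Vec_self] at h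
  rw [F.exists_f4Vec hv]
  generalize v i₁ = a at *
  generalize v i₂ = b at *
  generalize v i₃ / (ν : ℝ) = c at *
  generalize v i₄ / (ν : ℝ) = d at *
  have hd : d ^ 2 = 0 := by
    nlinarith [sq_nonneg (2 * a - b), sq_nonneg (3 * b - 4 * c), sq_nonneg (2 * c - 3 * d),
      sq_nonneg d]
  obtain rfl : d = 0 := by simpa using hd
  have hc : c ^ 2 = 0 := by
    nlinarith [sq_nonneg (2 * a - b), sq_nonneg (3 * b - 4 * c), sq_nonneg c]
  obtain rfl : c = 0 := by simpa using hc
  have hb : b ^ 2 = 0 := by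
    nlinarith [sq_nonneg (2 * a - b), sq_nonneg b]
  obtain rfl : b = 0 := by simpa using hb
  have ha : a ^ 2 = 0 := by nlinarith
  obtain rfl : a = 0 := by simpa using ha
  simp [f4Vec]

/-- The form takes integral values on integral vectors and is positive definite. -/
theorem one_le_nform (F : IsF4String D j o i₁ i₂ i₃ i₄ μ ν) {v : Fin n → ℝ}
    (hv : v ∈ rootSpan n ℝ (j + 1) (j + 4)) (hv' : v ∈ multiples n 1) (h0 : v ≠ 0) :
    1 ≤ D.nform o v v := by
  obtain ⟨a, ha⟩ := hv' i₁
  obtain ⟨b, hb⟩ := hv' i₂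
  obtain ⟨c, hc⟩ := hv' i₃
  obtain ⟨d, hd⟩ := hv' i₄
  have h1 : ∃ N : ℤ, D.nform o v v = N := by
    rw [F.exists_f4Vec hv, F.nform_f4Vec_self, ha, hb, hc, hd]
    rcases F.cast_scale with ⟨-, h⟩ | ⟨-, h⟩ <;> rw [h]
    · exact ⟨2 * (a ^ 2 + b ^ 2 + 2 * c ^ 2 + 2 * d ^ 2 - a * b - 2 * b * c - 2 * c * d), by
        push_cast; ring⟩
    · exact ⟨2 * a ^ 2 + 2 * b ^ 2 + c ^ 2 + d ^ 2 - 2 * a * b - 2 * b * c - c * d, by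
        push_cast; ring⟩
  obtain ⟨N, hN⟩ := h1
  have h2 := F.nform_nonneg hv
  have h3 : D.nform o v v ≠ 0 := fun h => h0 (F.eq_zero_of_nform hv h)
  rw [hN] at h2 h3 ⊢
  have h4 : 0 ≤ N := by exact_mod_cast h2
  have h5 : N ≠ 0 := by exact_mod_cast h3
  exact_mod_cast (by omega : 1 ≤ N)

/-- The bound for short vectors applies to norm `2`, since `4 * 2 < 9 * 1`. It would fail for a
simple root of norm `4`, so four spanning vectors of norm `2` replace the simple roots. -/
theorem fix_of_congruence (F : IsF4String D j o i₁ i₂ i₃ i₄ μ ν) {s : ℕ} (hs : 3 ≤ s)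
    {h : Matrix.GeneralLinearGroup (Fin n) ℤ} (hh : h ∈ D.parabolic (j + 1) (j + 4))
    (H : ∀ i : Fin n, j + 1 ≤ (i : ℕ) → (i : ℕ) ≤ j + 4 →
      realAct h (Pi.single i 1) - Pi.single i 1 ∈ multiples n s)
    {x : Fin n → ℝ} (hx : x ∈ rootSpan n ℝ (j + 1) (j + 4)) : realAct h x = x := by
  have key : ∀ a b c d : ℤ, D.nform o (f4Vec i₁ i₂ i₃ i₄ ν a b c d)
      (f4Vec i₁ i₂ i₃ i₄ ν a b c d) = 2 →
      realAct h (f4Vec i₁ i₂ i₃ i₄ ν a b c d) = f4Vec i₁ i₂ i₃ i₄ ν a b c d := by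
    intro a b c d h2
    exact realAct_eq_of_congruence hs (by norm_num : (4 : ℝ) * 2 < 9 * 1)
      (fun v hv => F.nform_nonneg hv) (fun v hv hv' h0 => F.one_le_nform hv hv' h0) hh
      (F.f4Vec_mem _ _ _ _) h2
      (IsNullRoot.congruence_of_integral H (F.f4Vec_mem _ _ _ _) (f4Vec_integral _ _ _ _))
  have h1 := key 1 0 0 0 (by rw [F.nform_f4Vec_self]; norm_num)
  have h2 := key 0 1 0 0 (by rw [F.nform_f4Vec_self]; norm_num)
  have h3 := key 0 1 1 0 (by rw [F.nform_f4Vec_self]; norm_num)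
  have h4 := key 0 1 1 1 (by rw [F.nform_f4Vec_self]; norm_num)
  have h5 : ∀ a b c d : ℝ, f4Vec i₁ i₂ i₃ i₄ ν a b c d =
      a • f4Vec i₁ i₂ i₃ i₄ ν (1 : ℤ) (0 : ℤ) (0 : ℤ) (0 : ℤ) +
      (b - c) • f4Vec i₁ i₂ i₃ i₄ ν (0 : ℤ) (1 : ℤ) (0 : ℤ) (0 : ℤ) +
      (c - d) • f4Vec i₁ i₂ i₃ i₄ ν (0 : ℤ) (1 : ℤ) (1 : ℤ) (0 : ℤ) +
      d • f4Vec i₁ i₂ i₃ i₄ ν (0 : ℤ) (1 : ℤ) (1 : ℤ) (1 : ℤ) := by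
    intro a b c d
    unfold f4Vec
    push_cast
    module
  rw [F.exists_f4Vec hx, h5]
  simp only [map_add, map_smul, h1, h2, h3, h4]

end IsF4String

end StringBasicSystem
end

/-! ### The group `[3, 3, 4, 3]`: translations, lattices and toroids -/

noncomputable section

namespace StringBasicSystem

variable {n : ℕ} {D : StringBasicSystem n} {j : ℕ} {o i₁ i₂ i₃ i₄ : Fin n} {μ ν : ℤ}

/-- The element of the point group that takes `b i₁` to its highest root in the orbit. -/
def f4Word (D : StringBasicSystem n) (i₁ i₂ i₃ i₄ : Fin n) :
    Matrix.GeneralLinearGroup (Fin n) ℤ :=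
  D.r i₁ * D.r i₂ * D.r i₃ * D.r i₄ * D.r i₂ * D.r i₃ * D.r i₂

namespace IsF4String

theorem r_mem (F : IsF4String D j o i₁ i₂ i₃ i₄ μ ν) :
    D.r i₁ ∈ D.parabolic (j + 1) (j + 4) ∧ D.r i₂ ∈ D.parabolic (j + 1) (j + 4) ∧
    D.r i₃ ∈ D.parabolic (j + 1) (j + 4) ∧ D.r i₄ ∈ D.parabolic (j + 1) (j + 4) := by
  have h1 := F.val₁
  have h2 := F.val₂
  have h3 := F.val₃
  have h4 := F.val₄
  exact ⟨D.r_mem_parabolic (by omega) (by omega), D.r_mem_parabolic (by omega) (by omega),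
    D.r_mem_parabolic (by omega) (by omega), D.r_mem_parabolic (by omega) (by omega)⟩

theorem f4Word_mem (F : IsF4String D j o i₁ i₂ i₃ i₄ μ ν) :
    f4Word D i₁ i₂ i₃ i₄ ∈ D.parabolic (j + 1) (j + 4) := by
  obtain ⟨h1, h2, h3, h4⟩ := F.r_mem
  exact mul_mem (mul_mem (mul_mem (mul_mem (mul_mem (mul_mem h1 h2) h3) h4) h2) h3) h2

theorem single_eq : (Pi.single i₁ 1 : Fin n → ℝ) = f4Vec i₁ i₂ i₃ i₄ ν 1 0 0 0 := by
  simp [f4Vec]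

theorem realAct_f4Word (F : IsF4String D j o i₁ i₂ i₃ i₄ μ ν) :
    realAct (f4Word D i₁ i₂ i₃ i₄) (Pi.single i₁ 1) = f4Vec i₁ i₂ i₃ i₄ ν 2 3 2 1 := by
  rw [single_eq (i₂ := i₂) (i₃ := i₃) (i₄ := i₄) (ν := ν), f4Word]
  simp only [realAct_mul, F.realAct_r₁, F.realAct_r₂, F.realAct_r₃, F.realAct_r₄]
  norm_num

/-- The null vector is `b o` plus the highest root `(2, 3, 2, 1)` in the orbit of `b i₁`, and the
parallel reflection is the corresponding conjugate of `r i₁`. -/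
theorem isNullRoot (F : IsF4String D j o i₁ i₂ i₃ i₄ μ ν) :
    IsNullRoot D j 4 o (Pi.single o 1 + f4Vec i₁ i₂ i₃ i₄ ν 2 3 2 1)
      (f4Word D i₁ i₂ i₃ i₄ * D.r i₁ * (f4Word D i₁ i₂ i₃ i₄)⁻¹) := by
  have h0 := F.val_o
  have h1 := F.val₁
  have h2 := F.val₂
  have h3 := F.val₃
  have h4 := F.val₄
  have hν : (ν : ℝ) ≠ 0 := by rcases F.cast_scale with ⟨-, h⟩ | ⟨-, h⟩ <;> rw [h] <;> norm_num
  have hμ : (μ : ℝ) ≠ 0 := by rcases F.cast_scale with ⟨h, -⟩ | ⟨h, -⟩ <;> rw [h] <;> norm_num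
  obtain ⟨a0, a1, a2, a3, a4⟩ := F.apply 2 3 2 1
  have hne : i₁ ≠ o ∧ i₂ ≠ o ∧ i₃ ≠ o ∧ i₄ ≠ o := by
    simp only [ne_eq, Fin.ext_iff]
    omega
  obtain ⟨n1, n2, n3, n4⟩ := hne
  have hmem := F.f4Vec_mem 2 3 2 1
  have hcases : ∀ i : Fin n, j ≤ (i : ℕ) → (i : ℕ) ≤ j + 4 →
      i = o ∨ i = i₁ ∨ i = i₂ ∨ i = i₃ ∨ i = i₄ := by
    intro i h5 h6
    simp only [Fin.ext_iff]
    omega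
  obtain ⟨f02, f03, f04, -, -, -⟩ := F.cartan_far
  have hoo : D.label o / D.label o = 1 := div_self (D.label_pos o).ne'
  refine ⟨h0, by omega, ?_, ?_, ?_, ?_, ?_, ?_, ?_, ?_⟩
  · exact add_mem (single_mem_rootSpan (by omega) (by omega)) (mem_rootSpan_of_succ_le hmem)
  · rw [Pi.add_apply, a0, Pi.single_eq_same, add_zero]
  · have h5 := f4Vec_integral (i₁ := i₁) (i₂ := i₂) (i₃ := i₃) (i₄ := i₄) (ν := ν) 2 3 2 1
    push_cast at h5
    exact add_mem (single_mem_multiples o) h5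
  · intro i h5 h6
    rw [Pi.add_apply]
    rcases hcases i h5 h6 with h | h | h | h | h <;> rw [h]
    · rw [a0, Pi.single_eq_same]; norm_num
    · rw [a1, Pi.single_eq_of_ne n1]; norm_num
    · rw [a2, Pi.single_eq_of_ne n2]; norm_num
    · rw [a3, Pi.single_eq_of_ne n3, zero_add]; exact mul_ne_zero two_ne_zero hν
    · rw [a4, Pi.single_eq_of_ne n4, zero_add]; exact mul_ne_zero one_ne_zero hν
  · intro i h5 h6
    rw [map_add, LinearMap.add_apply]
    rcases hcases i h5 h6 with h | h | h | h | h <;> rw [h]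
    · rw [F.nform_f4Vec_o, D.nform_self]; norm_num
    · rw [F.nform_f4Vec₁, D.nform_single, F.cartan₀₁, hoo]; norm_num
    · rw [F.nform_f4Vec₂, D.nform_single, f02.1, hoo]; norm_num
    · rw [F.nform_f4Vec₃, D.nform_single, f03.1, hoo]; norm_num
    · rw [F.nform_f4Vec₄, D.nform_single, f04.1, hoo]; norm_num
  · intro x hx hx'
    refine F.eq_zero_of_nform hx ?_
    conv_lhs => enter [2]; rw [F.exists_f4Vec hx, f4Vec]
    simp only [map_add, map_smul, hx' i₁ (by omega) (by omega), hx' i₂ (by omega) (by omega),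
      hx' i₃ (by omega) (by omega), hx' i₄ (by omega) (by omega), smul_zero, add_zero]
  · exact mul_mem (mul_mem F.f4Word_mem F.r_mem.1) (inv_mem F.f4Word_mem)
  · intro x
    have h5 : D.label o / D.label i₁ = 1 := by rw [← inv_div, F.label₁, inv_one]
    rw [realAct_conj_r o F.f4Word_mem, F.realAct_f4Word, h5, add_sub_cancel_left, one_mul]

/-- The translation vectors of the first two standard translations. -/
def shift (i₁ i₂ i₃ i₄ : Fin n) (ν : ℤ) : ℕ → Fin n → ℝ
  | 0 => f4Vec i₁ i₂ i₃ i₄ ν 2 3 2 1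
  | _ => f4Vec i₁ i₂ i₃ i₄ ν 0 1 1 1

theorem coe_gens (F : IsF4String D j o i₁ i₂ i₃ i₄ μ ν) :
    (D.gens j 4 F.isNullRoot.lt (Fin.ofNat 5 0)).1 = D.r o ∧
    (D.gens j 4 F.isNullRoot.lt (Fin.ofNat 5 1)).1 = D.r i₁ ∧
    (D.gens j 4 F.isNullRoot.lt (Fin.ofNat 5 2)).1 = D.r i₂ ∧
    (D.gens j 4 F.isNullRoot.lt (Fin.ofNat 5 3)).1 = D.r i₃ ∧
    (D.gens j 4 F.isNullRoot.lt (Fin.ofNat 5 4)).1 = D.r i₄ := by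
  have hlt := F.isNullRoot.lt
  refine ⟨?_, ?_, ?_, ?_, ?_⟩
  · rw [gens_ofNat hlt (by omega)]; exact congrArg D.r (Fin.ext F.val_o.symm)
  · rw [gens_ofNat hlt (by omega)]; exact congrArg D.r (Fin.ext F.val₁.symm)
  · rw [gens_ofNat hlt (by omega)]; exact congrArg D.r (Fin.ext F.val₂.symm)
  · rw [gens_ofNat hlt (by omega)]; exact congrArg D.r (Fin.ext F.val₃.symm)
  · rw [gens_ofNat hlt (by omega)]; exact congrArg D.r (Fin.ext F.val₄.symm)

/-- Type vectors of this family have at most two nonzero entries, so the first two translations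
suffice. -/
theorem realAct_f4Translation (F : IsF4String D j o i₁ i₂ i₃ i₄ μ ν) {i : ℕ} (hi : i < 2)
    (x : Fin n → ℝ) :
    realAct ((f4Translation (D.gens j 4 F.isNullRoot.lt) i : D.parabolic j (j + 4)) :
      Matrix.GeneralLinearGroup (Fin n) ℤ) x =
      eichler (D.nform o) (Pi.single o 1 + f4Vec i₁ i₂ i₃ i₄ ν 2 3 2 1)
        (shift i₁ i₂ i₃ i₄ ν i) x := by
  obtain ⟨g0, g1, g2, g3, g4⟩ := F.coe_gens
  have hzero : ∀ x, realAct ((f4Translation (D.gens j 4 F.isNullRoot.lt) 0 :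
      D.parabolic j (j + 4)) : Matrix.GeneralLinearGroup (Fin n) ℤ) x =
      eichler (D.nform o) (Pi.single o 1 + f4Vec i₁ i₂ i₃ i₄ ν 2 3 2 1)
        (f4Vec i₁ i₂ i₃ i₄ ν 2 3 2 1) x := by
    intro x
    have h := F.isNullRoot.realAct_r_mul x
    rw [add_sub_cancel_left] at h
    rw [← h]
    simp only [f4Translation, Subgroup.coe_mul, Subgroup.coe_inv, g0, g1, g2, g3, g4, f4Word]
  rcases (by omega : i = 0 ∨ i = 1) with rfl | rfl
  · exact hzero x
  · obtain ⟨h1, h2, h3, h4⟩ := F.r_mem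
    have hu : D.r i₁ * D.r i₂ * D.r i₃ * D.r i₂ * D.r i₁ ∈ D.parabolic j (j + 4) :=
      D.parabolic_succ_le (mul_mem (mul_mem (mul_mem (mul_mem h1 h2) h3) h2) h1)
    have e1 : ((f4Translation (D.gens j 4 F.isNullRoot.lt) 1 :
        D.parabolic j (j + 4)) : Matrix.GeneralLinearGroup (Fin n) ℤ) =
        (D.r i₁ * D.r i₂ * D.r i₃ * D.r i₂ * D.r i₁) *
        (f4Translation (D.gens j 4 F.isNullRoot.lt) 0 : D.parabolic j (j + 4)) *
        (D.r i₁ * D.r i₂ * D.r i₃ * D.r i₂ * D.r i₁)⁻¹ := by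
      simp only [f4Translation, Subgroup.coe_mul, Subgroup.coe_inv, g0, g1, g2, g3, g4]
    rw [e1, realAct_mul, realAct_mul, hzero, F.isNullRoot.eichler_conj' hu, realAct_self_inv]
    congr 1
    simp only [realAct_mul, F.realAct_r₁, F.realAct_r₂, F.realAct_r₃, shift]
    norm_num

/-- The vectors with integral coordinates with respect to the basis of `f4Vec`. -/
def intVec (i₁ i₂ i₃ i₄ : Fin n) (ν : ℤ) : AddSubgroup (Fin n → ℝ) where
  carrier := {v | ∃ a b c d : ℤ, v = f4Vec i₁ i₂ i₃ i₄ ν a b c d}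
  zero_mem' := ⟨0, 0, 0, 0, by simp [f4Vec]⟩
  add_mem' := by
    rintro _ _ ⟨a, b, c, d, rfl⟩ ⟨a', b', c', d', rfl⟩
    exact ⟨a + a', b + b', c + c', d + d', by rw [f4Vec_add]; push_cast; rfl⟩
  neg_mem' := by
    rintro _ ⟨a, b, c, d, rfl⟩
    exact ⟨-a, -b, -c, -d, by unfold f4Vec; push_cast; module⟩

theorem exists_int (F : IsF4String D j o i₁ i₂ i₃ i₄ μ ν) {z : Fin n → ℝ}
    (hz : z ∈ D.orbitLattice (j + 1) (j + 4) (f4Vec i₁ i₂ i₃ i₄ ν 2 3 2 1)) :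
    ∃ a b c d : ℤ, z = f4Vec i₁ i₂ i₃ i₄ ν a b c d := by
  refine orbitLattice_le (A := intVec i₁ i₂ i₃ i₄ ν) ⟨2, 3, 2, 1, by norm_num⟩ ?_ hz
  rintro i h1 h2 _ ⟨a, b, c, d, rfl⟩
  rcases F.cases_node h1 h2 with h | h | h | h <;> rw [h]
  · exact ⟨b - a, b, c, d, by rw [F.realAct_r₁]; push_cast; rfl⟩
  · exact ⟨a, a - b + 2 * c, c, d, by rw [F.realAct_r₂]; push_cast; rfl⟩
  · exact ⟨a, b, b - c + d, d, by rw [F.realAct_r₃]; push_cast; rfl⟩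
  · exact ⟨a, b, c, c - d, by rw [F.realAct_r₄]; push_cast; rfl⟩

section Lattice

variable {A : AddSubgroup (Fin n → ℝ)}

theorem mem_of_basis {k₁ k₂ k₃ k₄ : ℝ} (h1 : f4Vec i₁ i₂ i₃ i₄ ν k₁ 0 0 0 ∈ A)
    (h2 : f4Vec i₁ i₂ i₃ i₄ ν 0 k₂ 0 0 ∈ A) (h3 : f4Vec i₁ i₂ i₃ i₄ ν 0 0 k₃ 0 ∈ A)
    (h4 : f4Vec i₁ i₂ i₃ i₄ ν 0 0 0 k₄ ∈ A) (a b c d : ℤ) :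
    f4Vec i₁ i₂ i₃ i₄ ν (k₁ * a) (k₂ * b) (k₃ * c) (k₄ * d) ∈ A := by
  have := add_mem (add_mem (add_mem (A.zsmul_mem h1 a) (A.zsmul_mem h2 b)) (A.zsmul_mem h3 c))
    (A.zsmul_mem h4 d)
  simp only [← Int.cast_smul_eq_zsmul ℝ, smul_f4Vec, f4Vec_add] at this
  convert this using 1
  congr 1 <;> ring

/-- The inverse word takes the vector to `q` times the first simple root; differences with
successive reflections then yield the other basis vectors. -/
theorem basis_mem (F : IsF4String D j o i₁ i₂ i₃ i₄ μ ν)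
    (hA : ∀ v ∈ A, ∀ g ∈ D.parabolic (j + 1) (j + 4), realAct g v ∈ A) {q : ℝ}
    (h : q • f4Vec i₁ i₂ i₃ i₄ ν 2 3 2 1 ∈ A) :
    f4Vec i₁ i₂ i₃ i₄ ν q 0 0 0 ∈ A ∧ f4Vec i₁ i₂ i₃ i₄ ν 0 q 0 0 ∈ A ∧
    f4Vec i₁ i₂ i₃ i₄ ν 0 0 q 0 ∈ A ∧ f4Vec i₁ i₂ i₃ i₄ ν 0 0 0 q ∈ A := by
  obtain ⟨r1, r2, r3, r4⟩ := F.r_mem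
  have h1 : f4Vec i₁ i₂ i₃ i₄ ν q 0 0 0 ∈ A := by
    have := hA _ h _ (inv_mem F.f4Word_mem)
    rw [map_smul, ← F.realAct_f4Word, realAct_inv_self,
      single_eq (i₂ := i₂) (i₃ := i₃) (i₄ := i₄) (ν := ν), smul_f4Vec] at this
    simpa using this
  have h2 : f4Vec i₁ i₂ i₃ i₄ ν 0 q 0 0 ∈ A := by
    have := sub_mem (hA _ h1 _ r2) h1
    rw [F.realAct_r₂, f4Vec_sub] at this
    simpa using this
  have h3 : f4Vec i₁ i₂ i₃ i₄ ν 0 0 q 0 ∈ A := by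
    have := sub_mem (hA _ h2 _ r3) h2
    rw [F.realAct_r₃, f4Vec_sub] at this
    simpa using this
  have h4 : f4Vec i₁ i₂ i₃ i₄ ν 0 0 0 q ∈ A := by
    have := sub_mem (hA _ h3 _ r4) h3
    rw [F.realAct_r₄, f4Vec_sub] at this
    simpa using this
  exact ⟨h1, h2, h3, h4⟩

/-- The same differences, started from the last node. Passing the branch between `i₃` and `i₂`
doubles the vector, so the first two basis vectors appear with `2 q`. -/
theorem basis_mem_pair (F : IsF4String D j o i₁ i₂ i₃ i₄ μ ν)
    (hA : ∀ v ∈ A, ∀ g ∈ D.parabolic (j + 1) (j + 4), realAct g v ∈ A) {q : ℝ}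
    (h : q • f4Vec i₁ i₂ i₃ i₄ ν 2 4 3 2 ∈ A) :
    f4Vec i₁ i₂ i₃ i₄ ν (2 * q) 0 0 0 ∈ A ∧ f4Vec i₁ i₂ i₃ i₄ ν 0 (2 * q) 0 0 ∈ A ∧
    f4Vec i₁ i₂ i₃ i₄ ν 0 0 q 0 ∈ A ∧ f4Vec i₁ i₂ i₃ i₄ ν 0 0 0 q ∈ A := by
  obtain ⟨r1, r2, r3, r4⟩ := F.r_mem
  have h4 : f4Vec i₁ i₂ i₃ i₄ ν 0 0 0 q ∈ A := by
    have := sub_mem h (hA _ h _ r4)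
    rw [map_smul, F.realAct_r₄, ← smul_sub, f4Vec_sub, smul_f4Vec] at this
    norm_num at this
    exact this
  have h3 : f4Vec i₁ i₂ i₃ i₄ ν 0 0 q 0 ∈ A := by
    have := sub_mem (hA _ h4 _ r3) h4
    rw [F.realAct_r₃, f4Vec_sub] at this
    simpa using this
  have h2 : f4Vec i₁ i₂ i₃ i₄ ν 0 (2 * q) 0 0 ∈ A := by
    have := sub_mem (hA _ h3 _ r2) h3
    rw [F.realAct_r₂, f4Vec_sub] at this
    simpa using this
  have h1 : f4Vec i₁ i₂ i₃ i₄ ν (2 * q) 0 0 0 ∈ A := by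
    have := sub_mem (hA _ h2 _ r1) h2
    rw [F.realAct_r₁, f4Vec_sub] at this
    simpa using this
  exact ⟨h1, h2, h3, h4⟩

end Lattice

theorem isToroidModulus (F : IsF4String D j o i₁ i₂ i₃ i₄ μ ν) {s : ℕ} (hs : 3 ≤ s)
    {z₀ : Fin n → ℝ}
    (hmem : z₀ ∈ D.orbitLattice (j + 1) (j + 4) (f4Vec i₁ i₂ i₃ i₄ ν 2 3 2 1)) (hne : z₀ ≠ 0)
    (hker : ∀ i, eichler (D.nform o) (Pi.single o 1 + f4Vec i₁ i₂ i₃ i₄ ν 2 3 2 1) z₀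
      (Pi.single i 1) - Pi.single i 1 ∈ multiples n s)
    (hlat : ∀ a b c d : ℤ, (∀ i, eichler (D.nform o)
      (Pi.single o 1 + f4Vec i₁ i₂ i₃ i₄ ν 2 3 2 1) (f4Vec i₁ i₂ i₃ i₄ ν a b c d)
      (Pi.single i 1) - Pi.single i 1 ∈ multiples n s) →
      f4Vec i₁ i₂ i₃ i₄ ν a b c d ∈ D.orbitLattice (j + 1) (j + 4) z₀) :
    IsToroidModulus D j 4 o (Pi.single o 1 + f4Vec i₁ i₂ i₃ i₄ ν 2 3 2 1) s z₀ where
  mem := by rwa [add_sub_cancel_left]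
  ne_zero := hne
  fix_of_mem_ker := fun z _ h hh H x hx =>
    F.fix_of_congruence hs hh
      (fun i h1 h2 => (F.isNullRoot.congruence_of_mem_ker hh H i h1 h2).1) hx
  mem_ker := hker
  mem_lattice := by
    rw [add_sub_cancel_left]
    intro z hz H
    obtain ⟨a, b, c, d, rfl⟩ := F.exists_int hz
    exact hlat a b c d H
  eq_zero_of_displacement := by
    intro z hz H a b ha ha' hb hb' h hh hd
    have hν : (ν : ℝ) ≠ 0 := by rcases F.cast_scale with ⟨-, h⟩ | ⟨-, h⟩ <;> rw [h] <;> norm_num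
    have hz' : z ∈ rootSpan n ℝ (j + 1) (j + 4) := mem_rootSpan_of_mem_orbitLattice
      (mem_rootSpan_of_mem_orbitLattice (F.f4Vec_mem _ _ _ _) hmem) hz
    refine F.isNullRoot.eq_zero_of_displacement (by norm_num) hs F.f4Word_mem (i₀ := i₁) ?_ ?_ hz'
      H ha ha' hb hb' hh hd
    · rw [add_sub_cancel_left, F.realAct_f4Word]
    · rw [add_sub_cancel_left]
      intro i h1 h2
      obtain ⟨b1, b2, b3, b4⟩ := F.basis_mem (q := 1)
        (A := D.orbitLattice (j + 1) (j + 4) (f4Vec i₁ i₂ i₃ i₄ ν 2 3 2 1))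
        (fun v hv g hg => realAct_mem_orbitLattice hv hg)
        (by rw [one_smul]; exact self_mem_orbitLattice _ _ _)
      rcases F.cases_node h1 h2 with h | h | h | h <;> rw [h]
      · exact ⟨1, one_ne_zero, by simpa [f4Vec] using b1⟩
      · exact ⟨1, one_ne_zero, by simpa [f4Vec] using b2⟩
      · exact ⟨ν, hν, by simpa [f4Vec] using b3⟩
      · exact ⟨ν, hν, by simpa [f4Vec] using b4⟩

theorem rightCoeff_null (F : IsF4String D j o i₁ i₂ i₃ i₄ μ ν) :
    IsNullRoot.rightCoeff D j 4 o i₄ (Pi.single o 1 + f4Vec i₁ i₂ i₃ i₄ ν 2 3 2 1) =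
      (D.cartanRight (j + 4) * μ : ℤ) := by
  have hν : (ν : ℝ) ≠ 0 := by rcases F.cast_scale with ⟨-, h⟩ | ⟨-, h⟩ <;> rw [h] <;> norm_num
  have hne : i₄ ≠ o := fun h => by have h1 := F.val₄; rw [h, F.val_o] at h1; omega
  obtain ⟨-, -, -, -, h4⟩ := F.apply 2 3 2 1
  rw [IsNullRoot.rightCoeff, Pi.add_apply, Pi.single_eq_of_ne hne, h4, F.label₄]
  push_cast
  field_simp
  ring

/-- The consequences of the congruences for the nodes `i₁, …, i₄`. -/
theorem dvd_of_mem_ker (F : IsF4String D j o i₁ i₂ i₃ i₄ μ ν) {s : ℕ} {a b c d : ℤ}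
    (H : ∀ i, eichler (D.nform o)
      (Pi.single o 1 + f4Vec i₁ i₂ i₃ i₄ ν 2 3 2 1) (f4Vec i₁ i₂ i₃ i₄ ν a b c d)
      (Pi.single i 1) - Pi.single i 1 ∈ multiples n s) :
    ((s : ℤ) ∣ a ∧ (s : ℤ) ∣ b ∧ (s : ℤ) ∣ μ * c ∧ (s : ℤ) ∣ μ * d) ∧
      (ν = 1 → (s : ℤ) ∣ D.cartanLeft j * c ∧ (s : ℤ) ∣ D.cartanLeft j * d) := by
  have h1 := F.val₁
  have h2 := F.val₂
  have h3 := F.val₃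
  have h4 := F.val₄
  obtain ⟨hk, ⟨hl, -⟩, -⟩ := (F.isNullRoot.eichler_congruence_iff (by norm_num) h4
    (F.f4Vec_mem _ _ _ _)).1 H
  obtain ⟨e1, k1⟩ := hk i₁ (by omega) (by omega)
  obtain ⟨e2, k2⟩ := hk i₂ (by omega) (by omega)
  obtain ⟨e3, k3⟩ := hk i₃ (by omega) (by omega)
  obtain ⟨e4, k4⟩ := hk i₄ (by omega) (by omega)
  rw [F.nform_f4Vec₁] at k1
  rw [F.nform_f4Vec₂] at k2
  rw [F.nform_f4Vec₃] at k3
  rw [F.nform_f4Vec₄] at k4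
  norm_cast at k1 k2 k3 k4
  refine ⟨?_, fun hν => ?_⟩
  · rcases F.scale with ⟨rfl, -⟩ | ⟨rfl, -⟩
    · have d4 : 2 * d = s * (2 * e1 + 4 * e2 + 3 * e3 + 2 * e4) := by
        linear_combination 2 * k1 + 4 * k2 + 3 * k3 + 2 * k4
      have d3 : 2 * c = s * (2 * (2 * e1 + 4 * e2 + 3 * e3 + 2 * e4) - e4) := by
        linear_combination 2 * d4 - k4
      have d2 : b = s * (e1 + 2 * e2 + e3 + (2 * e1 + 4 * e2 + 3 * e3 + 2 * e4)) := by
        linear_combination d4 + k1 + 2 * k2 + k3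
      refine ⟨?_, ⟨_, d2⟩, ⟨_, d3⟩, ⟨_, d4⟩⟩
      have : a = 2 * b - 2 * c - s * e2 := by linear_combination -k2
      rw [this]
      exact dvd_sub (dvd_sub (Dvd.dvd.mul_left ⟨_, d2⟩ _) ⟨_, d3⟩) (dvd_mul_right _ _)
    · have d4 : d = s * (e1 + 2 * e2 + 3 * e3 + 2 * e4) := by
        linear_combination k1 + 2 * k2 + 3 * k3 + 2 * k4
      have d3 : c = s * (2 * (e1 + 2 * e2 + 3 * e3 + 2 * e4) - e4) := by
        linear_combination 2 * d4 - k4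
      have d2 : b = s * (2 * (2 * (e1 + 2 * e2 + 3 * e3 + 2 * e4) - e4) -
          (e1 + 2 * e2 + 3 * e3 + 2 * e4) - e3) := by
        linear_combination 2 * d3 - d4 - k3
      refine ⟨?_, ⟨_, d2⟩, by rw [one_mul]; exact ⟨_, d3⟩, by rw [one_mul]; exact ⟨_, d4⟩⟩
      have : a = 2 * b - 2 * c - s * e2 := by linear_combination -k2
      rw [this]
      exact dvd_sub (dvd_sub (Dvd.dvd.mul_left ⟨_, d2⟩ _) (Dvd.dvd.mul_left ⟨_, d3⟩ _))
        (dvd_mul_right _ _)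
  · obtain ⟨-, -, -, a3, a4⟩ := F.apply a b c d
    constructor
    · refine (exists_eq_mul_iff_dvd ?_).1 (hl i₃)
      rw [Pi.smul_apply, a3, hν]
      push_cast
      simp
    · refine (exists_eq_mul_iff_dvd ?_).1 (hl i₄)
      rw [Pi.smul_apply, a4, hν]
      push_cast
      simp

/-- For `μ = 2` the congruences of `H` give only `s ∣ 2 * c` and `s ∣ 2 * d`; an odd `s` or an odd
left Cartan integer removes the factor `2`. For `μ = 1` there is no such factor. -/
theorem isToroidModulus_full (F : IsF4String D j o i₁ i₂ i₃ i₄ μ ν) {s : ℕ} (hs : 3 ≤ s)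
    (h : μ = 1 ∨ Odd s ∨ Odd (D.cartanLeft j)) :
    IsToroidModulus D j 4 o (Pi.single o 1 + f4Vec i₁ i₂ i₃ i₄ ν 2 3 2 1) s
      ((s : ℝ) • ∑ i ∈ Finset.range 1, shift i₁ i₂ i₃ i₄ ν i) := by
  rw [Finset.sum_range_one, shift]
  have hs0 : (s : ℝ) ≠ 0 := by positivity
  refine F.isToroidModulus hs ?_ ?_ ?_ ?_
  · rw [Nat.cast_smul_eq_nsmul]
    exact AddSubgroup.nsmul_mem _ (self_mem_orbitLattice _ _ _) s
  · rw [smul_ne_zero_iff]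
    refine ⟨hs0, fun h0 => ?_⟩
    have h1 := (F.apply 2 3 2 1).2.1
    rw [h0] at h1
    norm_num at h1
  · have h1 := F.isNullRoot.mem_ker_smul_root (by norm_num) F.val₄ F.rightCoeff_null s
    rwa [add_sub_cancel_left] at h1
  · intro a b c d H
    obtain ⟨⟨ha, hb, hc, hd⟩, hl⟩ := F.dvd_of_mem_ker H
    have key : (s : ℤ) ∣ c ∧ (s : ℤ) ∣ d := by
      rcases F.scale with ⟨rfl, hν⟩ | ⟨rfl, -⟩
      · rcases h with h | h | h
        · norm_num at h
        · have : Odd (s : ℤ) := by exact_mod_cast h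
          exact ⟨Int.dvd_of_dvd_two_mul_of_dvd_odd_mul this hc (dvd_mul_right _ _),
            Int.dvd_of_dvd_two_mul_of_dvd_odd_mul this hd (dvd_mul_right _ _)⟩
        · exact ⟨Int.dvd_of_dvd_two_mul_of_dvd_odd_mul h hc (hl hν).1,
            Int.dvd_of_dvd_two_mul_of_dvd_odd_mul h hd (hl hν).2⟩
      · rw [one_mul] at hc hd
        exact ⟨hc, hd⟩
    obtain ⟨a, rfl⟩ := ha
    obtain ⟨b, rfl⟩ := hb
    obtain ⟨⟨c, rfl⟩, d, rfl⟩ := key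
    obtain ⟨b1, b2, b3, b4⟩ := F.basis_mem (fun v hv g hg => realAct_mem_orbitLattice hv hg)
      (self_mem_orbitLattice (D := D) (j + 1) (j + 4)
        ((s : ℝ) • f4Vec i₁ i₂ i₃ i₄ ν 2 3 2 1))
    have := mem_of_basis b1 b2 b3 b4 a b c d
    push_cast
    exact this

/-- What remains is `s ∣ a`, `s ∣ b`, `s ∣ 2 * c`, `s ∣ 2 * d`. This is the lattice of `s / 2` times
`(2, 4, 3, 2)`, the sum of the vectors of the first two translations. -/
theorem isToroidModulus_half (F : IsF4String D j o i₁ i₂ i₃ i₄ 2 1) {s : ℕ} (hs : 4 ≤ s)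
    (he : Even s) (hp : Even (D.cartanLeft j)) :
    IsToroidModulus D j 4 o (Pi.single o 1 + f4Vec i₁ i₂ i₃ i₄ 1 2 3 2 1) s
      (((s / 2 : ℕ) : ℝ) • ∑ i ∈ Finset.range 2, shift i₁ i₂ i₃ i₄ 1 i) := by
  obtain ⟨t, rfl⟩ := he
  rw [show (t + t) / 2 = t by omega]
  have hsum : ∑ i ∈ Finset.range 2, shift i₁ i₂ i₃ i₄ 1 i = f4Vec i₁ i₂ i₃ i₄ 1 2 4 3 2 := by
    rw [Finset.sum_range_succ, Finset.sum_range_one]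
    change f4Vec i₁ i₂ i₃ i₄ 1 2 3 2 1 + f4Vec i₁ i₂ i₃ i₄ 1 0 1 1 1 = _
    rw [f4Vec_add]
    norm_num
  rw [hsum]
  have ht0 : (t : ℝ) ≠ 0 := by
    have : 2 ≤ t := by omega
    positivity
  refine F.isToroidModulus (by omega) ?_ ?_ ?_ ?_
  · obtain ⟨b1, b2, b3, b4⟩ := F.basis_mem (q := 1)
        (A := D.orbitLattice (j + 1) (j + 4) (f4Vec i₁ i₂ i₃ i₄ 1 2 3 2 1))
        (fun v hv g hg => realAct_mem_orbitLattice hv hg)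
        (by rw [one_smul]; exact self_mem_orbitLattice _ _ _)
    rw [Nat.cast_smul_eq_nsmul]
    have h1 := mem_of_basis b1 b2 b3 b4 2 4 3 2
    norm_num at h1
    exact AddSubgroup.nsmul_mem _ h1 t
  · rw [smul_ne_zero_iff]
    refine ⟨ht0, fun h0 => ?_⟩
    have h1 := (F.apply 2 4 3 2).2.1
    rw [h0] at h1
    norm_num at h1
  · obtain ⟨p, hp⟩ := hp
    have hvec : (t : ℝ) • f4Vec i₁ i₂ i₃ i₄ 1 2 4 3 2 ∈ multiples n t := by
      have h1 := f4Vec_integral (i₁ := i₁) (i₂ := i₂) (i₃ := i₃) (i₄ := i₄) (ν := 1) 2 4 3 2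
      push_cast at h1
      exact smul_mem_multiples h1 ⟨1, by simp⟩
    have htwo : ∀ u : ℤ, (2 * u : ℝ) • (t : ℝ) • f4Vec i₁ i₂ i₃ i₄ 1 2 4 3 2 ∈
        multiples n (t + t) := by
      intro u k
      obtain ⟨d, hd⟩ := hvec k
      exact ⟨u * d, by rw [Pi.smul_apply, hd, smul_eq_mul]; push_cast; ring⟩
    have hnorm : D.nform o ((t : ℝ) • f4Vec i₁ i₂ i₃ i₄ 1 2 4 3 2)
        ((t : ℝ) • f4Vec i₁ i₂ i₃ i₄ 1 2 4 3 2) = 4 * t ^ 2 := by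
      rw [map_smul, map_smul, LinearMap.smul_apply, F.nform_f4Vec_self, smul_eq_mul, smul_eq_mul]
      ring
    refine (F.isNullRoot.eichler_congruence_iff (by norm_num) F.val₄
      (Submodule.smul_mem _ _ (F.f4Vec_mem _ _ _ _))).2 ⟨?_, ⟨?_, ?_⟩, ?_, ?_⟩
    · intro i h1 h2
      rw [smul_f4Vec]
      rcases F.cases_node h1 h2 with h | h | h | h <;> rw [h]
      · exact ⟨0, by rw [F.nform_f4Vec₁]; push_cast; ring⟩
      · exact ⟨0, by rw [F.nform_f4Vec₂]; push_cast; ring⟩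
      · exact ⟨0, by rw [F.nform_f4Vec₃]; push_cast; ring⟩
      · exact ⟨1, by rw [F.nform_f4Vec₄]; push_cast; ring⟩
    · have := htwo p
      rw [hp]
      push_cast
      rwa [← two_mul (p : ℝ)]
    · rw [hnorm, hp]
      exact ⟨p * (2 * t), by push_cast; ring⟩
    · rw [F.rightCoeff_null]
      have := htwo (D.cartanRight (j + 4))
      push_cast
      rwa [mul_comm]
    · rw [F.rightCoeff_null, hnorm, IsNullRoot.rightCoeff, F.label₄, smul_f4Vec,
        (F.apply _ _ _ _).2.2.2.2]
      exact ⟨D.cartanRight (j + 4) * (2 + 2 * t), by push_cast; ring⟩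
  · intro a b c d H
    obtain ⟨⟨⟨a, rfl⟩, ⟨b, rfl⟩, hc, hd⟩, -⟩ := F.dvd_of_mem_ker H
    rw [show ((t + t : ℕ) : ℤ) = 2 * t by push_cast; ring] at hc hd
    obtain ⟨c, rfl⟩ := Int.dvd_of_mul_dvd_mul_left two_ne_zero hc
    obtain ⟨d, rfl⟩ := Int.dvd_of_mul_dvd_mul_left two_ne_zero hd
    obtain ⟨b1, b2, b3, b4⟩ := F.basis_mem_pair (fun v hv g hg => realAct_mem_orbitLattice hv hg)
      (self_mem_orbitLattice (D := D) (j + 1) (j + 4)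
        ((t : ℝ) • f4Vec i₁ i₂ i₃ i₄ 1 2 4 3 2))
    have := mem_of_basis b1 b2 b3 b4 a b c d
    push_cast
    rwa [← two_mul]

end IsF4String

end StringBasicSystem
end

noncomputable section

namespace StringBasicSystem

variable {n : ℕ} {D : StringBasicSystem n} {j : ℕ} {o i₁ i₂ : Fin n} {μ ν : ℤ}

/-! ### The group `[3, 6]` -/

/-- The nodes `j, j + 1, j + 2` form a diagram for `[3, 6]`, whose branch between `i₁` and `i₂`
has the Cartan integers `μ` and `ν`. -/
structure IsHexagonalString (D : StringBasicSystem n) (j : ℕ) (o i₁ i₂ : Fin n) (μ ν : ℤ) :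
    Prop where
  val_o : (o : ℕ) = j
  val₁ : (i₁ : ℕ) = j + 1
  val₂ : (i₂ : ℕ) = j + 2
  scale : (μ = 3 ∧ ν = 1) ∨ (μ = 1 ∧ ν = 3)
  cartan₀₁ : D.cartan o i₁ = 1
  cartan₁₀ : D.cartan i₁ o = 1
  cartan₁₂ : D.cartan i₁ i₂ = μ
  cartan₂₁ : D.cartan i₂ i₁ = ν
  label₁ : D.label i₁ / D.label o = 1
  label₂ : D.label i₂ / D.label o = μ / ν

/-- The vector with coordinates `a`, `b` with respect to the roots `b i₁` and `ν • b i₂`. -/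
def hexVec (i₁ i₂ : Fin n) (ν : ℤ) (a b : ℝ) : Fin n → ℝ :=
  a • Pi.single i₁ 1 + (b * ν) • Pi.single i₂ 1

theorem hexVec_add (a b a' b' : ℝ) :
    hexVec i₁ i₂ ν a b + hexVec i₁ i₂ ν a' b' = hexVec i₁ i₂ ν (a + a') (b + b') := by
  unfold hexVec
  module

theorem hexVec_sub (a b a' b' : ℝ) :
    hexVec i₁ i₂ ν a b - hexVec i₁ i₂ ν a' b' = hexVec i₁ i₂ ν (a - a') (b - b') := by
  unfold hexVec
  module

theorem smul_hexVec (t a b : ℝ) : t • hexVec i₁ i₂ ν a b = hexVec i₁ i₂ ν (t * a) (t * b) := by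
  unfold hexVec
  module

namespace IsHexagonalString

theorem cartan_far (F : IsHexagonalString D j o i₁ i₂ μ ν) :
    D.cartan o i₂ = 0 ∧ D.cartan i₂ o = 0 :=
  D.cartan_far _ _ (by rw [F.val_o, F.val₂])

theorem cast_scale (F : IsHexagonalString D j o i₁ i₂ μ ν) :
    ((μ : ℝ) = 3 ∧ (ν : ℝ) = 1) ∨ ((μ : ℝ) = 1 ∧ (ν : ℝ) = 3) := by
  rcases F.scale with ⟨h, h'⟩ | ⟨h, h'⟩ <;> simp [h, h']

theorem realAct_r₁ (F : IsHexagonalString D j o i₁ i₂ μ ν) (a b : ℝ) :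
    realAct (D.r i₁) (hexVec i₁ i₂ ν a b) = hexVec i₁ i₂ ν (3 * b - a) b := by
  simp only [hexVec, map_add, map_smul, D.realAct_r_single, D.cartan_self, F.cartan₁₂]
  rcases F.cast_scale with ⟨h, h'⟩ | ⟨h, h'⟩ <;> rw [h, h'] <;> push_cast <;> module

theorem realAct_r₂ (F : IsHexagonalString D j o i₁ i₂ μ ν) (a b : ℝ) :
    realAct (D.r i₂) (hexVec i₁ i₂ ν a b) = hexVec i₁ i₂ ν a (a - b) := by
  simp only [hexVec, map_add, map_smul, D.realAct_r_single, D.cartan_self, F.cartan₂₁]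
  push_cast
  module

theorem nform_hexVec_o (F : IsHexagonalString D j o i₁ i₂ μ ν) (a b : ℝ) :
    D.nform o (hexVec i₁ i₂ ν a b) (Pi.single o 1) = -a := by
  simp only [hexVec, map_add, map_smul, LinearMap.add_apply, LinearMap.smul_apply, D.nform_single,
    F.cartan₁₀, F.cartan_far.2, F.label₁, smul_eq_mul]
  push_cast
  ring

theorem nform_hexVec₁ (F : IsHexagonalString D j o i₁ i₂ μ ν) (a b : ℝ) :
    D.nform o (hexVec i₁ i₂ ν a b) (Pi.single i₁ 1) = 2 * a - 3 * b := by
  simp only [hexVec, map_add, map_smul, LinearMap.add_apply, LinearMap.smul_apply, D.nform_single,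
    D.cartan_self, F.cartan₂₁, F.label₁, F.label₂, smul_eq_mul]
  rcases F.cast_scale with ⟨h, h'⟩ | ⟨h, h'⟩ <;> rw [h, h'] <;> push_cast <;> ring

theorem nform_hexVec₂ (F : IsHexagonalString D j o i₁ i₂ μ ν) (a b : ℝ) :
    D.nform o (hexVec i₁ i₂ ν a b) (Pi.single i₂ 1) = μ * (-a + 2 * b) := by
  simp only [hexVec, map_add, map_smul, LinearMap.add_apply, LinearMap.smul_apply, D.nform_single,
    D.cartan_self, F.cartan₁₂, F.label₁, F.label₂, smul_eq_mul]
  rcases F.cast_scale with ⟨h, h'⟩ | ⟨h, h'⟩ <;> rw [h, h'] <;> push_cast <;> ring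

theorem nform_hexVec_self (F : IsHexagonalString D j o i₁ i₂ μ ν) (a b : ℝ) :
    D.nform o (hexVec i₁ i₂ ν a b) (hexVec i₁ i₂ ν a b) =
      2 * (a ^ 2 + 3 * b ^ 2 - 3 * a * b) := by
  conv_lhs => enter [2]; rw [hexVec]
  simp only [map_add, map_smul, F.nform_hexVec₁, F.nform_hexVec₂, smul_eq_mul]
  rcases F.cast_scale with ⟨h, h'⟩ | ⟨h, h'⟩ <;> rw [h, h'] <;> ring

theorem apply (F : IsHexagonalString D j o i₁ i₂ μ ν) (a b : ℝ) :
    hexVec i₁ i₂ ν a b o = 0 ∧ hexVec i₁ i₂ ν a b i₁ = a ∧ hexVec i₁ i₂ ν a b i₂ = b * ν := by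
  simp only [hexVec, Pi.add_apply, Pi.smul_apply, Pi.single_apply, smul_eq_mul, Fin.ext_iff,
    F.val_o, F.val₁, F.val₂]
  simp

theorem hexVec_mem (F : IsHexagonalString D j o i₁ i₂ μ ν) (a b : ℝ) :
    hexVec i₁ i₂ ν a b ∈ rootSpan n ℝ (j + 1) (j + 2) := by
  have h1 := F.val₁
  have h2 := F.val₂
  exact add_mem (Submodule.smul_mem _ _ (single_mem_rootSpan (by omega) (by omega)))
    (Submodule.smul_mem _ _ (single_mem_rootSpan (by omega) (by omega)))

theorem cases_node (F : IsHexagonalString D j o i₁ i₂ μ ν) {i : Fin n} (h : j + 1 ≤ (i : ℕ))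
    (h' : (i : ℕ) ≤ j + 2) : i = i₁ ∨ i = i₂ := by
  have h1 := F.val₁
  have h2 := F.val₂
  simp only [Fin.ext_iff]
  omega

theorem exists_hexVec (F : IsHexagonalString D j o i₁ i₂ μ ν) {v : Fin n → ℝ}
    (hv : v ∈ rootSpan n ℝ (j + 1) (j + 2)) : v = hexVec i₁ i₂ ν (v i₁) (v i₂ / ν) := by
  have hν : (ν : ℝ) ≠ 0 := by rcases F.cast_scale with ⟨-, h⟩ | ⟨-, h⟩ <;> rw [h] <;> norm_num
  have ha := F.apply (v i₁) (v i₂ / ν)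
  ext i
  by_cases hi : j + 1 ≤ (i : ℕ) ∧ (i : ℕ) ≤ j + 2
  · rcases F.cases_node hi.1 hi.2 with rfl | rfl
    · exact ha.2.1.symm
    · rw [ha.2.2]; field_simp
  · rw [mem_rootSpan_iff.1 hv i hi, mem_rootSpan_iff.1 (F.hexVec_mem _ _) i hi]

theorem hexVec_integral (a b : ℤ) : hexVec i₁ i₂ ν a b ∈ multiples n 1 :=
  add_mem (smul_mem_multiples (single_mem_multiples _) ⟨a, by simp⟩)
    (smul_mem_multiples (single_mem_multiples _) ⟨b * ν, by simp⟩)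

theorem nform_nonneg (F : IsHexagonalString D j o i₁ i₂ μ ν) {v : Fin n → ℝ}
    (hv : v ∈ rootSpan n ℝ (j + 1) (j + 2)) : 0 ≤ D.nform o v v := by
  rw [F.exists_hexVec hv, F.nform_hexVec_self]
  nlinarith [sq_nonneg (2 * v i₁ - 3 * (v i₂ / ν)), sq_nonneg (v i₂ / ν)]

theorem eq_zero_of_nform (F : IsHexagonalString D j o i₁ i₂ μ ν) {v : Fin n → ℝ}
    (hv : v ∈ rootSpan n ℝ (j + 1) (j + 2)) (h : D.nform o v v = 0) : v = 0 := by
  rw [F.exists_hexVec hv, F.nform_hexVec_self] at h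
  rw [F.exists_hexVec hv]
  generalize v i₁ = a at *
  generalize v i₂ / (ν : ℝ) = b at *
  have hb : b ^ 2 = 0 := by nlinarith [sq_nonneg (2 * a - 3 * b), sq_nonneg b]
  obtain rfl : b = 0 := by simpa using hb
  have ha : a ^ 2 = 0 := by nlinarith
  obtain rfl : a = 0 := by simpa using ha
  simp [hexVec]

/-- The norm of an integral vector is an integral multiple of `2 / ν`. -/
theorem le_nform (F : IsHexagonalString D j o i₁ i₂ μ ν) {v : Fin n → ℝ}
    (hv : v ∈ rootSpan n ℝ (j + 1) (j + 2)) (hv' : v ∈ multiples n 1) (h0 : v ≠ 0) :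
    2 / ν ≤ D.nform o v v := by
  obtain ⟨a, ha⟩ := hv' i₁
  obtain ⟨b, hb⟩ := hv' i₂
  have h1 : ∃ N : ℤ, D.nform o v v = 2 / ν * N := by
    rw [F.exists_hexVec hv, F.nform_hexVec_self, ha, hb]
    rcases F.cast_scale with ⟨-, h⟩ | ⟨-, h⟩ <;> rw [h]
    · exact ⟨a ^ 2 + 3 * b ^ 2 - 3 * a * b, by push_cast; ring⟩
    · exact ⟨3 * a ^ 2 + b ^ 2 - 3 * a * b, by push_cast; ring⟩
  obtain ⟨N, hN⟩ := h1
  have hν : (0 : ℝ) < 2 / ν := by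
    rcases F.cast_scale with ⟨-, h⟩ | ⟨-, h⟩ <;> rw [h] <;> norm_num
  have h2 := F.nform_nonneg hv
  have h3 : D.nform o v v ≠ 0 := fun h => h0 (F.eq_zero_of_nform hv h)
  rw [hN] at h2 h3 ⊢
  have h4 : 0 ≤ N := by exact_mod_cast nonneg_of_mul_nonneg_right h2 hν
  have h5 : N ≠ 0 := by
    rintro rfl
    simp at h3
  have h6 : (1 : ℝ) ≤ N := by exact_mod_cast (by omega : 1 ≤ N)
  nlinarith

/-- In both scalings two independent integral vectors have the minimal norm `2 / ν`, so the bound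
for short vectors holds with `4 < 9`. -/
theorem fix_of_congruence (F : IsHexagonalString D j o i₁ i₂ μ ν) {s : ℕ} (hs : 3 ≤ s)
    {h : Matrix.GeneralLinearGroup (Fin n) ℤ} (hh : h ∈ D.parabolic (j + 1) (j + 2))
    (H : ∀ i : Fin n, j + 1 ≤ (i : ℕ) → (i : ℕ) ≤ j + 2 →
      realAct h (Pi.single i 1) - Pi.single i 1 ∈ multiples n s)
    {x : Fin n → ℝ} (hx : x ∈ rootSpan n ℝ (j + 1) (j + 2)) : realAct h x = x := by
  have hν : (0 : ℝ) < 2 / ν := by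
    rcases F.cast_scale with ⟨-, h⟩ | ⟨-, h⟩ <;> rw [h] <;> norm_num
  have key : ∀ a b : ℝ, hexVec i₁ i₂ ν a b ∈ multiples n 1 →
      D.nform o (hexVec i₁ i₂ ν a b) (hexVec i₁ i₂ ν a b) = 2 / ν →
      realAct h (hexVec i₁ i₂ ν a b) = hexVec i₁ i₂ ν a b := fun a b h1 h2 =>
    realAct_eq_of_congruence hs (by linarith : (4 : ℝ) * (2 / ν) < 9 * (2 / ν))
      (fun v hv => F.nform_nonneg hv) (fun v hv hv' h0 => F.le_nform hv hv' h0) hh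
      (F.hexVec_mem _ _) h2 (IsNullRoot.congruence_of_integral H (F.hexVec_mem _ _) h1)
  rw [F.exists_hexVec hx]
  generalize x i₁ = a
  generalize x i₂ / (ν : ℝ) = b
  rcases F.scale with ⟨-, rfl⟩ | ⟨-, rfl⟩
  · have h1 := key 1 0 (by exact_mod_cast hexVec_integral 1 0)
      (by rw [F.nform_hexVec_self]; norm_num)
    have h2 := key 1 1 (by exact_mod_cast hexVec_integral 1 1)
      (by rw [F.nform_hexVec_self]; norm_num)
    have h3 : hexVec i₁ i₂ 1 a b = (a - b) • hexVec i₁ i₂ 1 1 0 + b • hexVec i₁ i₂ 1 1 1 := by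
      unfold hexVec
      module
    rw [h3, map_add, map_smul, map_smul, h1, h2]
  · have h1 := key 0 (1 / 3) (by simpa [hexVec] using single_mem_multiples i₂)
      (by rw [F.nform_hexVec_self]; norm_num)
    have h2 := key 1 (1 / 3) (by
      simpa [hexVec] using add_mem (single_mem_multiples i₁) (single_mem_multiples i₂))
      (by rw [F.nform_hexVec_self]; norm_num)
    have h3 : hexVec i₁ i₂ 3 a b = (3 * b - a) • hexVec i₁ i₂ 3 0 (1 / 3) +
        a • hexVec i₁ i₂ 3 1 (1 / 3) := by
      unfold hexVec
      push_cast
      module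
    rw [h3, map_add, map_smul, map_smul, h1, h2]

theorem r_mem (F : IsHexagonalString D j o i₁ i₂ μ ν) :
    D.r i₁ ∈ D.parabolic (j + 1) (j + 2) ∧ D.r i₂ ∈ D.parabolic (j + 1) (j + 2) := by
  have h1 := F.val₁
  have h2 := F.val₂
  exact ⟨D.r_mem_parabolic (by omega) (by omega), D.r_mem_parabolic (by omega) (by omega)⟩

theorem word_mem (F : IsHexagonalString D j o i₁ i₂ μ ν) :
    D.r i₁ * D.r i₂ ∈ D.parabolic (j + 1) (j + 2) := mul_mem F.r_mem.1 F.r_mem.2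

theorem single_eq : (Pi.single i₁ 1 : Fin n → ℝ) = hexVec i₁ i₂ ν 1 0 := by
  simp [hexVec]

theorem realAct_word (F : IsHexagonalString D j o i₁ i₂ μ ν) :
    realAct (D.r i₁ * D.r i₂) (Pi.single i₁ 1) = hexVec i₁ i₂ ν 2 1 := by
  rw [single_eq (i₂ := i₂) (ν := ν)]
  simp only [realAct_mul, F.realAct_r₁, F.realAct_r₂]
  norm_num

theorem isNullRoot (F : IsHexagonalString D j o i₁ i₂ μ ν) :
    IsNullRoot D j 2 o (Pi.single o 1 + hexVec i₁ i₂ ν 2 1)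
      (D.r i₁ * D.r i₂ * D.r i₁ * (D.r i₁ * D.r i₂)⁻¹) := by
  have h0 := F.val_o
  have h1 := F.val₁
  have h2 := F.val₂
  have hν : (ν : ℝ) ≠ 0 := by rcases F.cast_scale with ⟨-, h⟩ | ⟨-, h⟩ <;> rw [h] <;> norm_num
  obtain ⟨a0, a1, a2⟩ := F.apply 2 1
  have hne : i₁ ≠ o ∧ i₂ ≠ o := by
    simp only [ne_eq, Fin.ext_iff]
    omega
  obtain ⟨n1, n2⟩ := hne
  have hmem := F.hexVec_mem 2 1
  have hcases : ∀ i : Fin n, j ≤ (i : ℕ) → (i : ℕ) ≤ j + 2 → i = o ∨ i = i₁ ∨ i = i₂ := by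
    intro i h5 h6
    simp only [Fin.ext_iff]
    omega
  have hoo : D.label o / D.label o = 1 := div_self (D.label_pos o).ne'
  refine ⟨h0, by omega, ?_, ?_, ?_, ?_, ?_, ?_, ?_, ?_⟩
  · exact add_mem (single_mem_rootSpan (by omega) (by omega)) (mem_rootSpan_of_succ_le hmem)
  · rw [Pi.add_apply, a0, Pi.single_eq_same, add_zero]
  · have h5 := hexVec_integral (i₁ := i₁) (i₂ := i₂) (ν := ν) 2 1
    push_cast at h5
    exact add_mem (single_mem_multiples o) h5
  · intro i h5 h6
    rw [Pi.add_apply]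
    rcases hcases i h5 h6 with h | h | h <;> rw [h]
    · rw [a0, Pi.single_eq_same]; norm_num
    · rw [a1, Pi.single_eq_of_ne n1]; norm_num
    · rw [a2, Pi.single_eq_of_ne n2, zero_add]; exact mul_ne_zero one_ne_zero hν
  · intro i h5 h6
    rw [map_add, LinearMap.add_apply]
    rcases hcases i h5 h6 with h | h | h <;> rw [h]
    · rw [F.nform_hexVec_o, D.nform_self]; norm_num
    · rw [F.nform_hexVec₁, D.nform_single, F.cartan₀₁, hoo]; norm_num
    · rw [F.nform_hexVec₂, D.nform_single, F.cartan_far.1, hoo]; norm_num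
  · intro x hx hx'
    refine F.eq_zero_of_nform hx ?_
    conv_lhs => enter [2]; rw [F.exists_hexVec hx, hexVec]
    simp only [map_add, map_smul, hx' i₁ (by omega) (by omega), hx' i₂ (by omega) (by omega),
      smul_zero, add_zero]
  · exact mul_mem (mul_mem F.word_mem F.r_mem.1) (inv_mem F.word_mem)
  · intro x
    have h5 : D.label o / D.label i₁ = 1 := by rw [← inv_div, F.label₁, inv_one]
    rw [realAct_conj_r o F.word_mem, F.realAct_word, h5, add_sub_cancel_left, one_mul]

/-- The translation vectors of the standard translations. -/
def shift (i₁ i₂ : Fin n) (ν : ℤ) : ℕ → Fin n → ℝ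
  | 0 => hexVec i₁ i₂ ν 2 1
  | _ => hexVec i₁ i₂ ν 1 1

theorem coe_gens (F : IsHexagonalString D j o i₁ i₂ μ ν) :
    (D.gens j 2 F.isNullRoot.lt (Fin.ofNat 3 0)).1 = D.r o ∧
    (D.gens j 2 F.isNullRoot.lt (Fin.ofNat 3 1)).1 = D.r i₁ ∧
    (D.gens j 2 F.isNullRoot.lt (Fin.ofNat 3 2)).1 = D.r i₂ := by
  have hlt := F.isNullRoot.lt
  refine ⟨?_, ?_, ?_⟩
  · rw [gens_ofNat hlt (by omega)]; exact congrArg D.r (Fin.ext F.val_o.symm)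
  · rw [gens_ofNat hlt (by omega)]; exact congrArg D.r (Fin.ext F.val₁.symm)
  · rw [gens_ofNat hlt (by omega)]; exact congrArg D.r (Fin.ext F.val₂.symm)

theorem realAct_hexagonalTranslation (F : IsHexagonalString D j o i₁ i₂ μ ν) {i : ℕ} (hi : i < 2)
    (x : Fin n → ℝ) :
    realAct ((hexagonalTranslation (D.gens j 2 F.isNullRoot.lt) i : D.parabolic j (j + 2)) :
      Matrix.GeneralLinearGroup (Fin n) ℤ) x =
      eichler (D.nform o) (Pi.single o 1 + hexVec i₁ i₂ ν 2 1) (shift i₁ i₂ ν i) x := by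
  obtain ⟨g0, g1, g2⟩ := F.coe_gens
  have hzero : ∀ x, realAct ((hexagonalTranslation (D.gens j 2 F.isNullRoot.lt) 0 :
      D.parabolic j (j + 2)) : Matrix.GeneralLinearGroup (Fin n) ℤ) x =
      eichler (D.nform o) (Pi.single o 1 + hexVec i₁ i₂ ν 2 1) (hexVec i₁ i₂ ν 2 1) x := by
    intro x
    have h := F.isNullRoot.realAct_r_mul x
    rw [add_sub_cancel_left] at h
    rw [← h]
    simp only [hexagonalTranslation, Subgroup.coe_mul, Subgroup.coe_inv, g0, g1, g2]
  rcases (by omega : i = 0 ∨ i = 1) with rfl | rfl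
  · exact hzero x
  · have hu := D.parabolic_succ_le F.word_mem
    have e1 : ((hexagonalTranslation (D.gens j 2 F.isNullRoot.lt) 1 :
        D.parabolic j (j + 2)) : Matrix.GeneralLinearGroup (Fin n) ℤ) =
        (D.r i₁ * D.r i₂) *
        (hexagonalTranslation (D.gens j 2 F.isNullRoot.lt) 0 : D.parabolic j (j + 2)) *
        (D.r i₁ * D.r i₂)⁻¹ := by
      simp only [hexagonalTranslation, Subgroup.coe_mul, Subgroup.coe_inv, g0, g1, g2]
    rw [e1, realAct_mul, realAct_mul, hzero, F.isNullRoot.eichler_conj' hu, realAct_self_inv]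
    congr 1
    simp only [realAct_mul, F.realAct_r₁, F.realAct_r₂, shift]
    norm_num

/-- The vectors with integral coordinates with respect to the basis of `hexVec`. -/
def intVec (i₁ i₂ : Fin n) (ν : ℤ) : AddSubgroup (Fin n → ℝ) where
  carrier := {v | ∃ a b : ℤ, v = hexVec i₁ i₂ ν a b}
  zero_mem' := ⟨0, 0, by simp [hexVec]⟩
  add_mem' := by
    rintro _ _ ⟨a, b, rfl⟩ ⟨a', b', rfl⟩
    exact ⟨a + a', b + b', by rw [hexVec_add]; push_cast; rfl⟩
  neg_mem' := by
    rintro _ ⟨a, b, rfl⟩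
    exact ⟨-a, -b, by unfold hexVec; push_cast; module⟩

theorem exists_int (F : IsHexagonalString D j o i₁ i₂ μ ν) {z : Fin n → ℝ}
    (hz : z ∈ D.orbitLattice (j + 1) (j + 2) (hexVec i₁ i₂ ν 2 1)) :
    ∃ a b : ℤ, z = hexVec i₁ i₂ ν a b := by
  refine orbitLattice_le (A := intVec i₁ i₂ ν) ⟨2, 1, by norm_num⟩ ?_ hz
  rintro i h1 h2 _ ⟨a, b, rfl⟩
  rcases F.cases_node h1 h2 with h | h <;> rw [h]
  · exact ⟨3 * b - a, b, by rw [F.realAct_r₁]; push_cast; rfl⟩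
  · exact ⟨a, a - b, by rw [F.realAct_r₂]; push_cast; rfl⟩

section Lattice

variable {A : AddSubgroup (Fin n → ℝ)}

theorem mem_of_basis {k₁ k₂ : ℝ} (h1 : hexVec i₁ i₂ ν k₁ 0 ∈ A) (h2 : hexVec i₁ i₂ ν 0 k₂ ∈ A)
    (a b : ℤ) : hexVec i₁ i₂ ν (k₁ * a) (k₂ * b) ∈ A := by
  have := add_mem (A.zsmul_mem h1 a) (A.zsmul_mem h2 b)
  simp only [← Int.cast_smul_eq_zsmul ℝ, smul_hexVec, hexVec_add] at this
  convert this using 1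
  congr 1 <;> ring

theorem basis_mem (F : IsHexagonalString D j o i₁ i₂ μ ν)
    (hA : ∀ v ∈ A, ∀ g ∈ D.parabolic (j + 1) (j + 2), realAct g v ∈ A) {q : ℝ}
    (h : q • hexVec i₁ i₂ ν 2 1 ∈ A) : hexVec i₁ i₂ ν q 0 ∈ A ∧ hexVec i₁ i₂ ν 0 q ∈ A := by
  obtain ⟨r1, r2⟩ := F.r_mem
  have h1 : hexVec i₁ i₂ ν q 0 ∈ A := by
    have := hA _ h _ (inv_mem F.word_mem)
    rw [map_smul, ← F.realAct_word, realAct_inv_self, single_eq (i₂ := i₂) (ν := ν),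
      smul_hexVec] at this
    simpa using this
  have h2 : hexVec i₁ i₂ ν 0 q ∈ A := by
    have := sub_mem (hA _ h1 _ r2) h1
    rw [F.realAct_r₂, hexVec_sub] at this
    simpa using this
  exact ⟨h1, h2⟩

/-- The last coordinate is isolated first; crossing the branch of period `6` then multiplies by `3`.
-/
theorem basis_mem_pair (F : IsHexagonalString D j o i₁ i₂ μ ν)
    (hA : ∀ v ∈ A, ∀ g ∈ D.parabolic (j + 1) (j + 2), realAct g v ∈ A) {q : ℝ}
    (h : q • hexVec i₁ i₂ ν 3 2 ∈ A) :
    hexVec i₁ i₂ ν (3 * q) 0 ∈ A ∧ hexVec i₁ i₂ ν 0 q ∈ A := by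
  obtain ⟨r1, r2⟩ := F.r_mem
  have h2 : hexVec i₁ i₂ ν 0 q ∈ A := by
    have := sub_mem h (hA _ h _ r2)
    rw [map_smul, F.realAct_r₂, ← smul_sub, hexVec_sub, smul_hexVec] at this
    norm_num at this
    exact this
  have h1 : hexVec i₁ i₂ ν (3 * q) 0 ∈ A := by
    have := sub_mem (hA _ h2 _ r1) h2
    rw [F.realAct_r₁, hexVec_sub] at this
    simpa using this
  exact ⟨h1, h2⟩

end Lattice

theorem isToroidModulus (F : IsHexagonalString D j o i₁ i₂ μ ν) {s : ℕ} (hs : 3 ≤ s)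
    {z₀ : Fin n → ℝ}
    (hmem : z₀ ∈ D.orbitLattice (j + 1) (j + 2) (hexVec i₁ i₂ ν 2 1)) (hne : z₀ ≠ 0)
    (hker : ∀ i, eichler (D.nform o) (Pi.single o 1 + hexVec i₁ i₂ ν 2 1) z₀
      (Pi.single i 1) - Pi.single i 1 ∈ multiples n s)
    (hlat : ∀ a b : ℤ, (∀ i, eichler (D.nform o)
      (Pi.single o 1 + hexVec i₁ i₂ ν 2 1) (hexVec i₁ i₂ ν a b)
      (Pi.single i 1) - Pi.single i 1 ∈ multiples n s) →
      hexVec i₁ i₂ ν a b ∈ D.orbitLattice (j + 1) (j + 2) z₀) :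
    IsToroidModulus D j 2 o (Pi.single o 1 + hexVec i₁ i₂ ν 2 1) s z₀ where
  mem := by rwa [add_sub_cancel_left]
  ne_zero := hne
  fix_of_mem_ker := fun z _ h hh H x hx =>
    F.fix_of_congruence hs hh
      (fun i h1 h2 => (F.isNullRoot.congruence_of_mem_ker hh H i h1 h2).1) hx
  mem_ker := hker
  mem_lattice := by
    rw [add_sub_cancel_left]
    intro z hz H
    obtain ⟨a, b, rfl⟩ := F.exists_int hz
    exact hlat a b H
  eq_zero_of_displacement := by
    intro z hz H a b ha ha' hb hb' h hh hd
    have hν : (ν : ℝ) ≠ 0 := by rcases F.cast_scale with ⟨-, h⟩ | ⟨-, h⟩ <;> rw [h] <;> norm_num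
    have hz' : z ∈ rootSpan n ℝ (j + 1) (j + 2) := mem_rootSpan_of_mem_orbitLattice
      (mem_rootSpan_of_mem_orbitLattice (F.hexVec_mem _ _) hmem) hz
    refine F.isNullRoot.eq_zero_of_displacement (by norm_num) hs F.word_mem (i₀ := i₁) ?_ ?_ hz'
      H ha ha' hb hb' hh hd
    · rw [add_sub_cancel_left, F.realAct_word]
    · rw [add_sub_cancel_left]
      intro i h1 h2
      obtain ⟨b1, b2⟩ := F.basis_mem (q := 1)
        (A := D.orbitLattice (j + 1) (j + 2) (hexVec i₁ i₂ ν 2 1))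
        (fun v hv g hg => realAct_mem_orbitLattice hv hg)
        (by rw [one_smul]; exact self_mem_orbitLattice _ _ _)
      rcases F.cases_node h1 h2 with h | h <;> rw [h]
      · exact ⟨1, one_ne_zero, by simpa [hexVec] using b1⟩
      · exact ⟨ν, hν, by simpa [hexVec] using b2⟩

theorem rightCoeff_null (F : IsHexagonalString D j o i₁ i₂ μ ν) :
    IsNullRoot.rightCoeff D j 2 o i₂ (Pi.single o 1 + hexVec i₁ i₂ ν 2 1) =
      (D.cartanRight (j + 2) * μ : ℤ) := by
  have hν : (ν : ℝ) ≠ 0 := by rcases F.cast_scale with ⟨-, h⟩ | ⟨-, h⟩ <;> rw [h] <;> norm_num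
  have hne : i₂ ≠ o := fun h => by have h1 := F.val₂; rw [h, F.val_o] at h1; omega
  rw [IsNullRoot.rightCoeff, Pi.add_apply, Pi.single_eq_of_ne hne, (F.apply 2 1).2.2, F.label₂]
  push_cast
  field_simp
  ring

/-- The consequences of the congruences for the nodes `i₁` and `i₂`. -/
theorem dvd_of_mem_ker (F : IsHexagonalString D j o i₁ i₂ μ ν) {s : ℕ} {a b : ℤ}
    (H : ∀ i, eichler (D.nform o)
      (Pi.single o 1 + hexVec i₁ i₂ ν 2 1) (hexVec i₁ i₂ ν a b)
      (Pi.single i 1) - Pi.single i 1 ∈ multiples n s) :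
    ((s : ℤ) ∣ a ∧ (s : ℤ) ∣ μ * b) ∧ (ν = 1 → (s : ℤ) ∣ D.cartanLeft j * b) := by
  have h1 := F.val₁
  have h2 := F.val₂
  obtain ⟨hk, ⟨hl, -⟩, -⟩ := (F.isNullRoot.eichler_congruence_iff (by norm_num) h2
    (F.hexVec_mem _ _)).1 H
  obtain ⟨e1, k1⟩ := hk i₁ (by omega) (by omega)
  obtain ⟨e2, k2⟩ := hk i₂ (by omega) (by omega)
  rw [F.nform_hexVec₁] at k1
  rw [F.nform_hexVec₂] at k2
  norm_cast at k1 k2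
  refine ⟨?_, fun hν => ?_⟩
  · rcases F.scale with ⟨rfl, -⟩ | ⟨rfl, -⟩
    · exact ⟨⟨2 * e1 + e2, by linear_combination 2 * k1 + k2⟩,
        ⟨2 * (2 * e1 + e2) - e1, by linear_combination 3 * k1 + 2 * k2⟩⟩
    · exact ⟨⟨2 * e1 + 3 * e2, by linear_combination 2 * k1 + 3 * k2⟩,
        ⟨e1 + 2 * e2, by linear_combination k1 + 2 * k2⟩⟩
  · refine (exists_eq_mul_iff_dvd ?_).1 (hl i₂)
    rw [Pi.smul_apply, (F.apply _ _).2.2, hν]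
    push_cast
    simp

/-- For `μ = 3` the congruences of `H` give `s ∣ a` and only `s ∣ 3 * b`. The factor `3` is removed
if `3` does not divide `s` or does not divide the left Cartan integer. -/
theorem isToroidModulus_full (F : IsHexagonalString D j o i₁ i₂ μ ν) {s : ℕ} (hs : 3 ≤ s)
    (h : μ = 1 ∨ ¬ 3 ∣ s ∨ ¬ (3 : ℤ) ∣ D.cartanLeft j) :
    IsToroidModulus D j 2 o (Pi.single o 1 + hexVec i₁ i₂ ν 2 1) s
      ((s : ℝ) • ∑ i ∈ Finset.range 1, shift i₁ i₂ ν i) := by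
  rw [Finset.sum_range_one, shift]
  have hs0 : (s : ℝ) ≠ 0 := by positivity
  refine F.isToroidModulus hs ?_ ?_ ?_ ?_
  · rw [Nat.cast_smul_eq_nsmul]
    exact AddSubgroup.nsmul_mem _ (self_mem_orbitLattice _ _ _) s
  · rw [smul_ne_zero_iff]
    refine ⟨hs0, fun h0 => ?_⟩
    have h1 := (F.apply 2 1).2.1
    rw [h0] at h1
    norm_num at h1
  · have h1 := F.isNullRoot.mem_ker_smul_root (by norm_num) F.val₂ F.rightCoeff_null s
    rwa [add_sub_cancel_left] at h1
  · intro a b H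
    obtain ⟨⟨ha, hb⟩, hl⟩ := F.dvd_of_mem_ker H
    have key : (s : ℤ) ∣ b := by
      rcases F.scale with ⟨rfl, hν⟩ | ⟨rfl, -⟩
      · rcases h with h | h | h
        · norm_num at h
        · have h1 : ¬ (3 : ℤ) ∣ s := by exact_mod_cast h
          exact ((Int.prime_three.coprime_iff_not_dvd.2 h1).symm).dvd_of_dvd_mul_left hb
        · obtain ⟨u, v, huv⟩ := Int.prime_three.coprime_iff_not_dvd.2 h
          have : b = u * (3 * b) + v * (D.cartanLeft j * b) := by linear_combination -b * huv
          rw [this]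
          exact dvd_add (hb.mul_left _) ((hl hν).mul_left _)
      · rwa [one_mul] at hb
    obtain ⟨a, rfl⟩ := ha
    obtain ⟨b, rfl⟩ := key
    obtain ⟨b1, b2⟩ := F.basis_mem (fun v hv g hg => realAct_mem_orbitLattice hv hg)
      (self_mem_orbitLattice (D := D) (j + 1) (j + 2) ((s : ℝ) • hexVec i₁ i₂ ν 2 1))
    have := mem_of_basis b1 b2 a b
    push_cast
    exact this

/-- The conditions `s ∣ a` and `s ∣ 3 * b` describe the lattice of `s / 3` times `(3, 2)`, the sum
of the vectors of the two standard translations. -/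
theorem isToroidModulus_third (F : IsHexagonalString D j o i₁ i₂ 3 1) {s : ℕ} (hs : 3 ≤ s)
    (h3 : 3 ∣ s) (hp : (3 : ℤ) ∣ D.cartanLeft j) :
    IsToroidModulus D j 2 o (Pi.single o 1 + hexVec i₁ i₂ 1 2 1) s
      (((s / 3 : ℕ) : ℝ) • ∑ i ∈ Finset.range 2, shift i₁ i₂ 1 i) := by
  obtain ⟨t, rfl⟩ := h3
  rw [show 3 * t / 3 = t by omega]
  have hsum : ∑ i ∈ Finset.range 2, shift i₁ i₂ 1 i = hexVec i₁ i₂ 1 3 2 := by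
    rw [Finset.sum_range_succ, Finset.sum_range_one]
    change hexVec i₁ i₂ 1 2 1 + hexVec i₁ i₂ 1 1 1 = _
    rw [hexVec_add]
    norm_num
  rw [hsum]
  have ht0 : (t : ℝ) ≠ 0 := by
    have : 1 ≤ t := by omega
    positivity
  refine F.isToroidModulus (by omega) ?_ ?_ ?_ ?_
  · obtain ⟨b1, b2⟩ := F.basis_mem (q := 1)
        (A := D.orbitLattice (j + 1) (j + 2) (hexVec i₁ i₂ 1 2 1))
        (fun v hv g hg => realAct_mem_orbitLattice hv hg)
        (by rw [one_smul]; exact self_mem_orbitLattice _ _ _)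
    rw [Nat.cast_smul_eq_nsmul]
    have h1 := mem_of_basis b1 b2 3 2
    norm_num at h1
    exact AddSubgroup.nsmul_mem _ h1 t
  · rw [smul_ne_zero_iff]
    refine ⟨ht0, fun h0 => ?_⟩
    have h1 := (F.apply 3 2).2.1
    rw [h0] at h1
    norm_num at h1
  · obtain ⟨p, hp⟩ := hp
    have hthree : ∀ u : ℤ, (3 * u : ℝ) • (t : ℝ) • hexVec i₁ i₂ 1 3 2 ∈
        multiples n (3 * t) := by
      intro u
      have h1 := hexVec_integral (i₁ := i₁) (i₂ := i₂) (ν := 1) 3 2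
      push_cast at h1
      rw [smul_smul]
      exact smul_mem_multiples h1 ⟨u, by push_cast; ring⟩
    have hnorm : D.nform o ((t : ℝ) • hexVec i₁ i₂ 1 3 2) ((t : ℝ) • hexVec i₁ i₂ 1 3 2) =
        6 * t ^ 2 := by
      rw [map_smul, map_smul, LinearMap.smul_apply, F.nform_hexVec_self, smul_eq_mul, smul_eq_mul]
      ring
    refine (F.isNullRoot.eichler_congruence_iff (by norm_num) F.val₂
      (Submodule.smul_mem _ _ (F.hexVec_mem _ _))).2 ⟨?_, ⟨?_, ?_⟩, ?_, ?_⟩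
    · intro i h1 h2
      rw [smul_hexVec]
      rcases F.cases_node h1 h2 with h | h <;> rw [h]
      · exact ⟨0, by rw [F.nform_hexVec₁]; push_cast; ring⟩
      · exact ⟨1, by rw [F.nform_hexVec₂]; push_cast; ring⟩
    · have := hthree p
      rw [hp]
      push_cast
      exact this
    · rw [hnorm, hp]
      exact ⟨p * (3 * t), by push_cast; ring⟩
    · rw [F.rightCoeff_null]
      have := hthree (D.cartanRight (j + 2))
      push_cast
      rwa [mul_comm (D.cartanRight (j + 2) : ℝ)]
    · rw [F.rightCoeff_null, hnorm, IsNullRoot.rightCoeff, F.label₂, smul_hexVec,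
        (F.apply _ _).2.2]
      exact ⟨D.cartanRight (j + 2) * (2 + 3 * t), by push_cast; ring⟩
  · intro a b H
    obtain ⟨⟨⟨a, rfl⟩, hb⟩, -⟩ := F.dvd_of_mem_ker H
    rw [show ((3 * t : ℕ) : ℤ) = 3 * t by push_cast; ring] at hb
    obtain ⟨b, rfl⟩ := Int.dvd_of_mul_dvd_mul_left three_ne_zero hb
    obtain ⟨b1, b2⟩ := F.basis_mem_pair (fun v hv g hg => realAct_mem_orbitLattice hv hg)
      (self_mem_orbitLattice (D := D) (j + 1) (j + 2) ((t : ℝ) • hexVec i₁ i₂ 1 3 2))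
    have := mem_of_basis b1 b2 a b
    push_cast
    exact this

end IsHexagonalString

end StringBasicSystem
end

noncomputable section

namespace StringBasicSystem

variable {n : ℕ} {D : StringBasicSystem n} {j m s : ℕ}

/-! ### The Cartan integers of the entries -/

/-- The Cartan integers of a single branch are determined by the ratio of the labels. -/
theorem SingleString.cartan_eq {f : ℕ → ℝ} (hD : D.SingleString j m f) (hjm : j + m < n) {i : ℕ}
    (hi : i < m) {x y : ℤ} (hx : 0 < x) (hy : 0 < y) (hxy : x = 1 ∨ y = 1)
    (hf : x * f i = y * f (i + 1)) :
    D.cartanRight (j + i) = x ∧ D.cartanLeft (j + (i + 1)) = y := by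
  have h1 : D.label ⟨j + i, by omega⟩ = f i := by
    rw [hD.1 _ (by simp) (by simp; omega)]
    simp
  have h2 : D.label ⟨j + i + 1, by omega⟩ = f (i + 1) := by
    rw [hD.1 _ (by simp; omega) (by simp; omega)]
    congr 1
    simp only
    omega
  have hb := D.cartanRight_mul_label (i := j + i) (by omega)
  have hpos := D.label_pos ⟨j + i, by omega⟩
  rw [h1] at hb hpos
  rw [h2] at hb
  have hor := hD.2 (j + i) (by omega) (by omega)
  rw [← Nat.add_assoc]
  generalize D.cartanRight (j + i) = R at *
  generalize D.cartanLeft (j + i + 1) = L at *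
  -- Both pairs are proportional through the ratio of the labels. Each contains a `1` and `(x, y)`
  -- is positive, so they coincide.
  have hc : R * y = L * x := by
    have : ((R * y : ℤ) : ℝ) * f i = ((L * x : ℤ) : ℝ) * f i := by
      push_cast
      linear_combination (y : ℝ) * hb - (L : ℝ) * hf
    exact_mod_cast mul_right_cancel₀ hpos.ne' this
  rcases hor with rfl | rfl <;> rcases hxy with rfl | rfl
  · exact ⟨rfl, by linarith⟩
  · have := Int.eq_one_or_neg_one_of_mul_eq_one' (show L * x = 1 by linarith)
    omega
  · have := Int.eq_one_or_neg_one_of_mul_eq_one' (show R * y = 1 by linarith)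
    omega
  · exact ⟨by linarith, rfl⟩

theorem NodeOE.even_cartanLeft {i : ℕ} (h : D.NodeOE i) (hR : Odd (D.cartanRight i)) :
    Even (D.cartanLeft i) :=
  h.elim (fun h => absurd h.2 (Int.not_even_iff_odd.2 hR)) And.left

theorem NodeOE.even_cartanRight {i : ℕ} (h : D.NodeOE i) (hL : Odd (D.cartanLeft i)) :
    Even (D.cartanRight i) :=
  h.elim And.right fun h => absurd h.1 (Int.not_even_iff_odd.2 hL)

theorem NodeOE.odd_cartanLeft {i : ℕ} (h : D.NodeOE i) (hR : Even (D.cartanRight i)) :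
    Odd (D.cartanLeft i) :=
  h.elim And.left fun h => absurd hR (Int.not_even_iff_odd.2 h.2)

theorem NodeOE.odd_cartanRight {i : ℕ} (h : D.NodeOE i) (hL : Even (D.cartanLeft i)) :
    Odd (D.cartanRight i) :=
  h.elim (fun h => absurd hL (Int.not_even_iff_odd.2 h.1)) And.right

theorem DoubleBranch.even (h : D.DoubleBranch j) :
    Even (D.cartanRight j) ∧ Even (D.cartanLeft (j + 1)) := by
  obtain ⟨a, -, hR, hL⟩ := h
  rw [hR, hL]
  exact ⟨even_two, even_two⟩

theorem cartanRight_eq {i k : Fin n} (h : (k : ℕ) = i + 1) : D.cartanRight i = D.cartan i k := by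
  rw [cartanRight, dif_pos (by omega)]
  congr 1
  exact Fin.ext h.symm

theorem cartanLeft_eq {i k : Fin n} (h : (k : ℕ) = i + 1) : D.cartanLeft k = D.cartan k i := by
  rw [cartanLeft, dif_pos (by omega)]
  congr 1
  apply Fin.ext
  simp only
  omega

variable {o e : Fin n} {κ κ' : ℝ}

namespace IsCubicString

/-- Here `k`, `k'` are `κ`, `κ'`, and `u = 2 / κ`, `u' = 2 / κ'` are the opposite Cartan integers of
the end branches. The hypothesis `hkk` leaves out the labels `a, 2a, …, 2a, 4a`, the reversal of an
admitted diagram. -/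
theorem of_endLabels (hm : 2 ≤ m) (hjm : j + m < n) {A B C : ℝ}
    (hD : D.SingleString j m (endLabels m A B C)) {k u k' u' : ℤ}
    (hk : (k = 2 ∧ u = 1) ∨ (k = 1 ∧ u = 2)) (hk' : (k' = 2 ∧ u' = 1) ∨ (k' = 1 ∧ u' = 2))
    (hkk : k = 2 ∨ k' = 1) (hA : u * A = k * B) (hC : k' * B = u' * C) :
    IsCubicString D j m ⟨j, by omega⟩ ⟨j + m, hjm⟩ k k' := by
  have h0 : D.cartanRight (j + 0) = u ∧ D.cartanLeft (j + (0 + 1)) = k := by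
    refine hD.cartan_eq hjm (by omega) (by omega) (by omega) (by omega) ?_
    simpa [endLabels, show 1 ≠ m by omega] using hA
  have h1 : D.cartanRight (j + (m - 1)) = k' ∧ D.cartanLeft (j + (m - 1 + 1)) = u' := by
    refine hD.cartan_eq hjm (by omega) (by omega) (by omega) (by omega) ?_
    simpa [endLabels, show m - 1 ≠ 0 by omega, show m - 1 ≠ m by omega,
      show m - 1 + 1 = m by omega, show m ≠ 0 by omega] using hC
  have h2 : ∀ i, 1 ≤ i → i + 1 < m →
      D.cartanRight (j + i) = 1 ∧ D.cartanLeft (j + (i + 1)) = 1 := by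
    intro i hi hi'
    refine hD.cartan_eq hjm (by omega) one_pos one_pos (Or.inl rfl) ?_
    simp [endLabels, show i ≠ 0 by omega, show i ≠ m by omega, show i + 1 ≠ m by omega]
  have hA' : D.label ⟨j, by omega⟩ = A := by
    rw [hD.1 _ le_rfl (by simp)]
    simp [endLabels]
  have hC' : D.label ⟨j + m, hjm⟩ = C := by
    rw [hD.1 _ (by simp) le_rfl]
    simp [endLabels, show m ≠ 0 by omega]
  have hpos := D.label_pos ⟨j, by omega⟩
  rw [hA'] at hpos
  have hkR : (u : ℝ) = 2 / k := by rcases hk with ⟨rfl, rfl⟩ | ⟨rfl, rfl⟩ <;> norm_num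
  have hkR' : (u' : ℝ) = 2 / k' := by rcases hk' with ⟨rfl, rfl⟩ | ⟨rfl, rfl⟩ <;> norm_num
  refine ⟨rfl, rfl, by omega, ?_, ?_, fun i hi hi' => ?_, fun i hi => ?_⟩
  · rcases hk with ⟨rfl, -⟩ | ⟨rfl, -⟩ <;> rcases hk' with ⟨rfl, -⟩ | ⟨rfl, -⟩ <;> simp at *
  · rw [hA', hC', div_eq_div_iff hpos.ne' (by rcases hk with ⟨rfl, -⟩ | ⟨rfl, -⟩ <;> norm_num)]
    rcases hk with ⟨rfl, rfl⟩ | ⟨rfl, rfl⟩ <;> rcases hk' with ⟨rfl, rfl⟩ | ⟨rfl, rfl⟩ <;>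
      push_cast at * <;> linarith
  · rw [← hkR']
    rcases eq_or_ne i 1 with rfl | h
    · rw [if_pos rfl, if_neg (by omega), mul_one, h0.2]
    · rw [if_neg h, one_mul]
      split_ifs with h3
      · rw [h3, ← h1.2, Nat.sub_add_cancel (by omega)]
      · have := (h2 (i - 1) (by omega) (by omega)).2
        rw [Nat.sub_add_cancel hi] at this
        rw [this, Int.cast_one]
  · rw [← hkR]
    rcases eq_or_ne i 0 with rfl | h
    · rw [if_pos rfl, if_neg (by omega), mul_one, h0.1]
    · rw [if_neg h, one_mul]
      split_ifs with h3
      · rw [show i = m - 1 by omega, h1.1]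
      · rw [(h2 i (by omega) (by omega)).1, Int.cast_one]

theorem left_last (C : IsCubicString D j m o e κ κ') (hm : 2 ≤ m) :
    (D.cartanLeft (j + m) : ℝ) = 2 / κ' := by
  simp [C.left m C.one_le le_rfl, show m ≠ 1 by omega]

theorem right_first (C : IsCubicString D j m o e κ κ') (hm : 2 ≤ m) :
    (D.cartanRight j : ℝ) = 2 / κ := by
  simpa [show 1 ≠ m by omega] using C.right 0 C.one_le

theorem of_doubleBranch (hj : j + 1 < n) (hD : D.DoubleBranch j) :
    IsCubicString D j 1 ⟨j, by omega⟩ ⟨j + 1, hj⟩ 1 1 := by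
  obtain ⟨a, hl, hR, hL⟩ := hD
  refine ⟨rfl, rfl, le_rfl, by simp, ?_, fun i hi hi' => ?_, fun i hi => ?_⟩
  · rw [hl _ (Or.inr rfl), hl _ (Or.inl rfl), ← hl ⟨j, by omega⟩ (Or.inl rfl),
      div_self (D.label_pos _).ne']
    norm_num
  · obtain rfl : i = 1 := by omega
    simp [hL]
  · obtain rfl : i = 0 := by omega
    simp [hR]

/-- For `m = 1` the end factors `κ` and `2 / κ'` sit on the same branch and multiply to the Cartan
integer `4`. -/
theorem of_single_branch (hj : j + 1 < n) {a : ℝ}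
    (hD : D.SingleString j 1 (endLabels 1 (4 * a) a a)) :
    IsCubicString D j 1 ⟨j, by omega⟩ ⟨j + 1, hj⟩ 2 1 ∧ Even (D.cartanLeft (j + 1)) := by
  obtain ⟨hR, hL⟩ : D.cartanRight (j + 0) = 1 ∧ D.cartanLeft (j + (0 + 1)) = 4 :=
    hD.cartan_eq hj (by omega) (by omega) (by omega) (by omega) (by simp [endLabels])
  have h1 : D.label ⟨j, by omega⟩ = 4 * a := by
    rw [hD.1 _ le_rfl (by simp)]
    simp [endLabels]
  have h2 : D.label ⟨j + 1, hj⟩ = a := by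
    rw [hD.1 _ (by simp) le_rfl]
    simp [endLabels]
  refine ⟨⟨rfl, rfl, le_rfl, by simp, ?_, fun i hi hi' => ?_, fun i hi => ?_⟩, 2, hL⟩
  · rw [h1, h2, div_eq_div_iff (h1 ▸ (D.label_pos _).ne') (by norm_num)]
    ring
  · obtain rfl : i = 1 := by omega
    rw [hL]
    norm_num
  · obtain rfl : i = 0 := by omega
    rw [hR]
    norm_num

theorem realAct_prod (C : IsCubicString D j m o e κ κ') {k : ℕ} (hk : k ≤ m) (q : ℕ)
    (x : Fin n → ℝ) :
    realAct (((List.range k).map fun i => cubicTranslation (D.gens j m C.lt) i ^ q).prod).1 x =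
      eichler (D.nform o) (Pi.single o 1 + cubicVec n j m κ κ' 1) (standard n j m κ κ' q k) x :=
  C.isNullRoot.eichler_prod (fun i _ => C.cubicVec_mem (by omega))
    (fun i hi => C.realAct_cubicTranslation (by omega)) q x

end IsCubicString

variable {i₁ i₂ i₃ i₄ : Fin n} {μ ν : ℤ}

namespace IsF4String

theorem of_labels (hj : j + 4 < n) {A B : ℝ}
    (hD : D.SingleString j 4 fun i => if i ≤ 2 then A else B) {μ ν : ℤ}
    (hμ : (μ = 2 ∧ ν = 1) ∨ (μ = 1 ∧ ν = 2)) (h : μ * A = ν * B) :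
    IsF4String D j ⟨j, by omega⟩ ⟨j + 1, by omega⟩ ⟨j + 2, by omega⟩ ⟨j + 3, by omega⟩
      ⟨j + 4, hj⟩ μ ν := by
  have hl : ∀ i (hi : i ≤ 4), D.label ⟨j + i, by omega⟩ = if i ≤ 2 then A else B := by
    intro i hi
    rw [hD.1 _ (by simp) (by simp; omega)]
    simp
  have hA : A ≠ 0 := by
    have := hl 0 (by omega)
    simp only [Nat.zero_le, if_true] at this
    exact this ▸ (D.label_pos _).ne'
  have hB : B / A = μ / ν := by
    have : (ν : ℝ) ≠ 0 := by rcases hμ with ⟨-, rfl⟩ | ⟨-, rfl⟩ <;> norm_num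
    rw [div_eq_div_iff hA this]
    linarith
  have h0 := hD.cartan_eq hj (i := 0) (x := 1) (y := 1) (by omega) one_pos one_pos (Or.inl rfl)
    (by simp)
  have h1 := hD.cartan_eq hj (i := 1) (x := 1) (y := 1) (by omega) one_pos one_pos (Or.inl rfl)
    (by simp)
  have h2 := hD.cartan_eq hj (i := 2) (x := μ) (y := ν) (by omega) (by omega) (by omega) (by omega)
    (by simpa using h)
  have h3 := hD.cartan_eq hj (i := 3) (x := 1) (y := 1) (by omega) one_pos one_pos (Or.inl rfl)
    (by simp)
  refine ⟨rfl, rfl, rfl, rfl, rfl, hμ, ?_, ?_, ?_, ?_, ?_, ?_, ?_, ?_, ?_, ?_, ?_, ?_⟩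
  · rw [← cartanRight_eq rfl]; exact h0.1
  · rw [← cartanLeft_eq rfl]; exact h0.2
  · rw [← cartanRight_eq rfl]; exact h1.1
  · rw [← cartanLeft_eq rfl]; exact h1.2
  · rw [← cartanRight_eq rfl]; exact h2.1
  · rw [← cartanLeft_eq rfl]; exact h2.2
  · rw [← cartanRight_eq rfl]; exact h3.1
  · rw [← cartanLeft_eq rfl]; exact h3.2
  · rw [hl 1 (by omega)]; exact (congrArg _ (hl 0 (by omega))).trans (by simp [hA])
  · rw [hl 2 (by omega)]; exact (congrArg _ (hl 0 (by omega))).trans (by simp [hA])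
  · rw [hl 3 (by omega)]; exact (congrArg _ (hl 0 (by omega))).trans (by simpa using hB)
  · rw [hl 4 (by omega)]; exact (congrArg _ (hl 0 (by omega))).trans (by simpa using hB)

theorem realAct_prod (F : IsF4String D j o i₁ i₂ i₃ i₄ μ ν) {k : ℕ} (hk : k ≤ 2) (q : ℕ)
    (x : Fin n → ℝ) :
    realAct (((List.range k).map fun i =>
      f4Translation (D.gens j 4 F.isNullRoot.lt) i ^ q).prod).1 x =
      eichler (D.nform o) (Pi.single o 1 + f4Vec i₁ i₂ i₃ i₄ ν 2 3 2 1)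
        ((q : ℝ) • ∑ i ∈ Finset.range k, shift i₁ i₂ i₃ i₄ ν i) x := by
  refine F.isNullRoot.eichler_prod (fun i _ => ?_)
    (fun i hi => F.realAct_f4Translation (by omega)) q x
  unfold shift
  split <;> exact F.f4Vec_mem _ _ _ _

end IsF4String

namespace IsHexagonalString

theorem of_endLabels (hj : j + 2 < n) {A B : ℝ}
    (hD : D.SingleString j 2 (endLabels 2 A A B)) {μ ν : ℤ}
    (hμ : (μ = 3 ∧ ν = 1) ∨ (μ = 1 ∧ ν = 3)) (h : μ * A = ν * B) :
    IsHexagonalString D j ⟨j, by omega⟩ ⟨j + 1, by omega⟩ ⟨j + 2, by omega⟩ μ ν := by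
  have hl : ∀ i (hi : i ≤ 2), D.label ⟨j + i, by omega⟩ = endLabels 2 A A B i := by
    intro i hi
    rw [hD.1 _ (by simp) (by simp; omega)]
    simp
  have hA : A ≠ 0 := by
    have := hl 0 (by omega)
    simp only [endLabels, if_true] at this
    exact this ▸ (D.label_pos _).ne'
  have hB : B / A = μ / ν := by
    have : (ν : ℝ) ≠ 0 := by rcases hμ with ⟨-, rfl⟩ | ⟨-, rfl⟩ <;> norm_num
    rw [div_eq_div_iff hA this]
    linarith
  have h0 := hD.cartan_eq hj (i := 0) (x := 1) (y := 1) (by omega) one_pos one_pos (Or.inl rfl)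
    (by simp [endLabels])
  have h1 := hD.cartan_eq hj (i := 1) (x := μ) (y := ν) (by omega) (by omega) (by omega) (by omega)
    (by simpa [endLabels] using h)
  refine ⟨rfl, rfl, rfl, hμ, ?_, ?_, ?_, ?_, ?_, ?_⟩
  · rw [← cartanRight_eq rfl]; exact h0.1
  · rw [← cartanLeft_eq rfl]; exact h0.2
  · rw [← cartanRight_eq rfl]; exact h1.1
  · rw [← cartanLeft_eq rfl]; exact h1.2
  · rw [hl 1 (by omega)]; exact (congrArg _ (hl 0 (by omega))).trans (by simp [endLabels, hA])
  · rw [hl 2 (by omega)]; exact (congrArg _ (hl 0 (by omega))).trans (by simpa [endLabels] using hB)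

theorem realAct_prod (F : IsHexagonalString D j o i₁ i₂ μ ν) {k : ℕ} (hk : k ≤ 2) (q : ℕ)
    (x : Fin n → ℝ) :
    realAct (((List.range k).map fun i =>
      hexagonalTranslation (D.gens j 2 F.isNullRoot.lt) i ^ q).prod).1 x =
      eichler (D.nform o) (Pi.single o 1 + hexVec i₁ i₂ ν 2 1)
        ((q : ℝ) • ∑ i ∈ Finset.range k, shift i₁ i₂ ν i) x := by
  refine F.isNullRoot.eichler_prod (fun i _ => ?_)
    (fun i hi => F.realAct_hexagonalTranslation (by omega)) q x
  unfold shift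
  split <;> exact F.hexVec_mem _ _

end IsHexagonalString


/-- The diagram `2a, a, …, a, 2a`. -/
theorem IsCubicString.of_two_two (hm : 2 ≤ m) (hjm : j + m < n) {a : ℝ}
    (hD : D.SingleString j m (endLabels m (2 * a) a (2 * a))) :
    IsCubicString D j m ⟨j, by omega⟩ ⟨j + m, hjm⟩ 2 2 ∧ Odd (D.cartanRight j) ∧
      Odd (D.cartanLeft (j + m)) := by
  have C := IsCubicString.of_endLabels hm hjm hD (k := 2) (u := 1) (k' := 2) (u' := 1)
    (by simp) (by simp) (by simp) (by push_cast; ring) (by push_cast; ring)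
  have h1 := C.right_first hm
  have h2 := C.left_last hm
  norm_num at C h1 h2
  exact ⟨C, by simp [h1], by simp [h2]⟩

/-- The diagram `a, 2a, …, 2a, a`. -/
theorem IsCubicString.of_one_one (hm : 2 ≤ m) (hjm : j + m < n) {a : ℝ}
    (hD : D.SingleString j m (endLabels m a (2 * a) a)) :
    IsCubicString D j m ⟨j, by omega⟩ ⟨j + m, hjm⟩ 1 1 ∧ Even (D.cartanRight j) ∧
      Even (D.cartanLeft (j + m)) := by
  have C := IsCubicString.of_endLabels hm hjm hD (k := 1) (u := 2) (k' := 1) (u' := 2)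
    (by simp) (by simp) (by simp) (by push_cast; ring) (by push_cast; ring)
  have h1 := C.right_first hm
  have h2 := C.left_last hm
  norm_num at C h1 h2
  norm_cast at h1 h2
  exact ⟨C, by simp [h1], by simp [h2]⟩

/-- The diagram `4a, 2a, …, 2a, a`. -/
theorem IsCubicString.of_two_one (hm : 2 ≤ m) (hjm : j + m < n) {a : ℝ}
    (hD : D.SingleString j m (endLabels m (4 * a) (2 * a) a)) :
    IsCubicString D j m ⟨j, by omega⟩ ⟨j + m, hjm⟩ 2 1 ∧ Even (D.cartanLeft (j + m)) := by
  have C := IsCubicString.of_endLabels hm hjm hD (k := 2) (u := 1) (k' := 1) (u' := 2)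
    (by simp) (by simp) (by simp) (by push_cast; ring) (by push_cast; ring)
  have h2 := C.left_last hm
  norm_num at C h2
  norm_cast at h2
  exact ⟨C, by simp [h2]⟩

end StringBasicSystem

theorem lemma2 {n : ℕ} (D : StringBasicSystem n) (s j m : ℕ) (hs : 2 ≤ s) (hjm : j + m < n)
    (X : EuclideanFamily) (q k : ℕ) (hX : ToroidEntry D s j m X q k) :
    -- `E = T ⋊ H`
    ((D.translations j (j + m)).subgroupOf (D.parabolic j (j + m))).Normal ∧
    Subgroup.IsComplement'
      ((D.translations j (j + m)).subgroupOf (D.parabolic j (j + m)))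
      ((D.parabolic (j + 1) (j + m)).subgroupOf (D.parabolic j (j + m))) ∧
    -- `H ≃ H^s`
    Set.InjOn (changeRing n (ZMod s)) (D.parabolic (j + 1) (j + m)) ∧
    -- (a)
    (D.modReduction j m s).ker ≤
      (D.translations j (j + m)).subgroupOf (D.parabolic j (j + m)) ∧
    -- (b)
    IsStringCGroup (fun i => D.modReduction j m s (D.gens j m hjm i)) ∧
    (toroidKernel X (D.gens j m hjm) q k ≠ ⊥ ∧
      toroidKernel X (D.gens j m hjm) q k ≤
        (D.translations j (j + m)).subgroupOf (D.parabolic j (j + m)) ∧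
      (D.modReduction j m s).ker = toroidKernel X (D.gens j m hjm) q k ∧
      ∃ Φ : (D.parabolic j (j + m)).map (changeRing n (ZMod s)) ≃*
          QuotientAut (D.gens j m hjm) (toroidKernel X (D.gens j m hjm) q k),
        ∀ (g : D.parabolic j (j + m)) (F : Face (D.gens j m hjm)),
          Φ (D.modReduction j m s g) (QuotientFace.mk _ _ F) = QuotientFace.mk _ _ (g • F)) ∧
    -- (c)
    ((∀ t ∈ (D.translations j (j + m)).map (changeRing n (ZMod s)),
        (∀ x ∈ rootSpan n (ZMod s) j (j + m), t.val *ᵥ x = x) → t = 1) →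
      ∀ l : ℕ, m ≤ l → j + l < n →
        (D.translations j (j + m)).map (changeRing n (ZMod s)) ⊓
          (D.parabolic (j + 1) (j + l)).map (changeRing n (ZMod s)) = ⊥) := by
  -- The labels fix the Cartan integers inside the string. So the types of the end nodes amount to
  -- the parities of `m_{j,j-1}` and `m_{j+m,j+m+1}`, which decide the solution of the congruences
  -- in each entry.
  open StringBasicSystem in
  cases hX with
  | cubicA_odd a hm hD hs ho =>
    obtain ⟨C, -, -⟩ := IsCubicString.of_two_two hm hjm hD
    exact toroid_of_isToroidModulus C.isNullRoot
      (C.isToroidModulus_two_two (by omega) (Or.inl hs) (Or.inl ho))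
      _ _ _ (C.realAct_prod C.one_le _)
  | cubicA_even_oo a hm hD hs he hmo hN =>
    obtain ⟨C, -, -⟩ := IsCubicString.of_two_two hm hjm hD
    exact toroid_of_isToroidModulus C.isNullRoot
      (C.isToroidModulus_two_two (by omega) (Or.inl (by omega))
        (Or.inr ⟨hmo, hN.imp And.left And.right⟩)) _ _ _ (C.realAct_prod C.one_le _)
  | cubicA_even_oe a hm hD hs he hmo hN =>
    obtain ⟨C, hR, hL⟩ := IsCubicString.of_two_two hm hjm hD
    exact toroid_of_isToroidModulus C.isNullRoot
      (C.isToroidModulus_two_two_half hs he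
        (Or.inr ⟨hN.1.even_cartanLeft hR, hN.2.even_cartanRight hL⟩))
      _ _ _ (C.realAct_prod le_rfl _)
  | cubicA_even_even a hm hD hs he hme =>
    obtain ⟨C, -, -⟩ := IsCubicString.of_two_two hm hjm hD
    exact toroid_of_isToroidModulus C.isNullRoot
      (C.isToroidModulus_two_two_half hs he (Or.inl hme)) _ _ _ (C.realAct_prod le_rfl _)
  | cubicA_two a hm hD hs2 hmo hN =>
    subst hs2
    obtain ⟨C, -, -⟩ := IsCubicString.of_two_two hm hjm hD
    exact toroid_of_isToroidModulus C.isNullRoot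
      (C.isToroidModulus_two_two le_rfl (Or.inr ⟨hm, hmo, hN.1.1, hN.2.2⟩)
        (Or.inr ⟨hmo, Or.inl hN.1.1⟩)) _ _ _ (C.realAct_prod C.one_le _)
  | cubicB_odd a hm hD hs ho =>
    obtain ⟨C, -, -⟩ := IsCubicString.of_one_one hm hjm hD
    exact toroid_of_isToroidModulus C.isNullRoot
      (C.isToroidModulus_one_one (by omega) (Or.inl hs) (Or.inl ho))
      _ _ _ (C.realAct_prod C.one_le _)
  | cubicB_even_oe a hm hD hs he hN =>
    obtain ⟨C, hR, hL⟩ := IsCubicString.of_one_one hm hjm hD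
    exact toroid_of_isToroidModulus C.isNullRoot
      (C.isToroidModulus_one_one (by omega) (Or.inl (by omega))
        (Or.inr (hN.imp (·.odd_cartanLeft hR) (·.odd_cartanRight hL))))
      _ _ _ (C.realAct_prod C.one_le _)
  | cubicB_even_ee a hm hD hs he hN =>
    obtain ⟨C, -, -⟩ := IsCubicString.of_one_one hm hjm hD
    exact toroid_of_isToroidModulus C.isNullRoot
      (C.isToroidModulus_one_one_half hs he hN.1.1 hN.2.2) _ _ _ (C.realAct_prod C.one_le _)
  | cubicB_two a hm hD hs2 hN =>
    subst hs2
    obtain ⟨C, hR, hL⟩ := IsCubicString.of_one_one hm hjm hD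
    exact toroid_of_isToroidModulus C.isNullRoot
      (C.isToroidModulus_one_one le_rfl
        (Or.inr ⟨hN.1.odd_cartanLeft hR, hN.2.odd_cartanRight hL⟩)
        (Or.inr (Or.inl (hN.1.odd_cartanLeft hR)))) _ _ _ (C.realAct_prod C.one_le _)
  | cubicC_odd a hm hD hs ho =>
    obtain ⟨C, -⟩ := IsCubicString.of_two_one hm hjm hD
    exact toroid_of_isToroidModulus C.isNullRoot
      (C.isToroidModulus_two_one hs (Or.inl ho)) _ _ _ (C.realAct_prod C.one_le _)
  | cubicC_even_ee a hm hD hs he hN =>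
    obtain ⟨C, -⟩ := IsCubicString.of_two_one hm hjm hD
    exact toroid_of_isToroidModulus C.isNullRoot
      (C.isToroidModulus_two_one (by omega) (Or.inr hN.2)) _ _ _ (C.realAct_prod C.one_le _)
  | cubicC_even_oe a hm hD hs he hN =>
    obtain ⟨C, hL⟩ := IsCubicString.of_two_one hm hjm hD
    exact toroid_of_isToroidModulus C.isNullRoot
      (C.isToroidModulus_two_one_pair hm hs he (hN.odd_cartanRight hL)) _ _ _ (C.realAct_prod hm _)
  | f4A_odd a hm hD hs ho =>
    subst hm
    have F := IsF4String.of_labels hjm hD (μ := 2) (ν := 1) (by simp) (by push_cast; ring)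
    exact toroid_of_isToroidModulus F.isNullRoot
      (F.isToroidModulus_full hs (Or.inr (Or.inl ho))) _ _ _ (F.realAct_prod one_le_two _)
  | f4A_even_oo a hm hD hs he hN =>
    subst hm
    have F := IsF4String.of_labels hjm hD (μ := 2) (ν := 1) (by simp) (by push_cast; ring)
    exact toroid_of_isToroidModulus F.isNullRoot
      (F.isToroidModulus_full (by omega) (Or.inr (Or.inr hN.1))) _ _ _ (F.realAct_prod one_le_two _)
  | f4A_even_oe a hm hD hs he hN =>
    subst hm
    have F := IsF4String.of_labels hjm hD (μ := 2) (ν := 1) (by simp) (by push_cast; ring)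
    have hR : Odd (D.cartanRight j) := by
      rw [show D.cartanRight j = 1 from (cartanRight_eq rfl).trans F.cartan₀₁]
      exact odd_one
    exact toroid_of_isToroidModulus F.isNullRoot
      (F.isToroidModulus_half hs he (hN.even_cartanLeft hR)) _ _ _ (F.realAct_prod le_rfl _)
  | f4B a hm hD hs =>
    subst hm
    have F := IsF4String.of_labels hjm hD (μ := 1) (ν := 2) (by simp) (by push_cast; ring)
    exact toroid_of_isToroidModulus F.isNullRoot
      (F.isToroidModulus_full hs (Or.inl rfl)) _ _ _ (F.realAct_prod one_le_two _)
  | hexA_coprime a hm hD hs h3 =>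
    subst hm
    have F := IsHexagonalString.of_endLabels hjm hD (μ := 3) (ν := 1) (by simp)
      (by push_cast; ring)
    exact toroid_of_isToroidModulus F.isNullRoot
      (F.isToroidModulus_full hs (Or.inr (Or.inl h3))) _ _ _ (F.realAct_prod one_le_two _)
  | hexA_unit a hm hD hs h3 hN =>
    subst hm
    have F := IsHexagonalString.of_endLabels hjm hD (μ := 3) (ν := 1) (by simp)
      (by push_cast; ring)
    exact toroid_of_isToroidModulus F.isNullRoot
      (F.isToroidModulus_full hs (Or.inr (Or.inr hN))) _ _ _ (F.realAct_prod one_le_two _)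
  | hexA_zero a hm hD hs h3 hN =>
    subst hm
    have F := IsHexagonalString.of_endLabels hjm hD (μ := 3) (ν := 1) (by simp)
      (by push_cast; ring)
    exact toroid_of_isToroidModulus F.isNullRoot
      (F.isToroidModulus_third hs h3 hN) _ _ _ (F.realAct_prod le_rfl _)
  | hexB a hm hD hs =>
    subst hm
    have F := IsHexagonalString.of_endLabels hjm hD (μ := 1) (ν := 3) (by simp)
      (by push_cast; ring)
    exact toroid_of_isToroidModulus F.isNullRoot
      (F.isToroidModulus_full hs (Or.inl rfl)) _ _ _ (F.realAct_prod one_le_two _)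
  | dihA_odd hm hD hs ho =>
    subst hm
    have C := IsCubicString.of_doubleBranch hjm hD
    exact toroid_of_isToroidModulus C.isNullRoot
      (C.isToroidModulus_one_one (by omega) (Or.inl hs) (Or.inl ho)) _ _ _ (C.realAct_prod le_rfl _)
  | dihA_even_oe hm hD hs he hN =>
    subst hm
    have C := IsCubicString.of_doubleBranch hjm hD
    obtain ⟨hR, hL⟩ := hD.even
    exact toroid_of_isToroidModulus C.isNullRoot
      (C.isToroidModulus_one_one (by omega) (Or.inl (by omega))
        (Or.inr (hN.imp (·.odd_cartanLeft hR) (·.odd_cartanRight hL))))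
      _ _ _ (C.realAct_prod le_rfl _)
  | dihA_even_ee hm hD hs he hN =>
    subst hm
    have C := IsCubicString.of_doubleBranch hjm hD
    exact toroid_of_isToroidModulus C.isNullRoot
      (C.isToroidModulus_one_one_half hs he hN.1.1 hN.2.2) _ _ _ (C.realAct_prod le_rfl _)
  | dihA_two hm hD hs2 hN =>
    subst hs2
    subst hm
    have C := IsCubicString.of_doubleBranch hjm hD
    obtain ⟨hR, hL⟩ := hD.even
    exact toroid_of_isToroidModulus C.isNullRoot
      (C.isToroidModulus_one_one le_rfl
        (Or.inr ⟨hN.1.odd_cartanLeft hR, hN.2.odd_cartanRight hL⟩)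
        (Or.inr (Or.inl (hN.1.odd_cartanLeft hR)))) _ _ _ (C.realAct_prod le_rfl _)
  | dihB_odd a hm hD hs ho =>
    subst hm
    obtain ⟨C, -⟩ := IsCubicString.of_single_branch hjm hD
    exact toroid_of_isToroidModulus C.isNullRoot
      (C.isToroidModulus_two_one hs (Or.inl ho)) _ _ _ (C.realAct_prod le_rfl _)
  | dihB_even_ee a hm hD hs he hN =>
    subst hm
    obtain ⟨C, -⟩ := IsCubicString.of_single_branch hjm hD
    exact toroid_of_isToroidModulus C.isNullRoot
      (C.isToroidModulus_two_one (by omega) (Or.inr hN.2)) _ _ _ (C.realAct_prod le_rfl _)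
  | dihB_even_oe a hm hD hs he hN =>
    subst hm
    obtain ⟨C, hL⟩ := IsCubicString.of_single_branch hjm hD
    exact toroid_of_isToroidModulus C.isNullRoot
      (C.isToroidModulus_two_one_double hs he (hN.odd_cartanRight hL))
      _ _ _ (C.realAct_prod le_rfl _)

end
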